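/- **Setting.** Let $\mathsf T$ be the topos of sheaves on a small site. A *braided crossed module* $\mathsf G=(\partial\colon G\to\Pi,\{-,-\})$ of $\mathsf T$ consists of sheaves of groups $G,\Pi$, a homomorphism $\partial$, a right action $(g,x)\mapsto g^x$ of $\Pi$ on $G$ by automorphisms with $\partial(g^x)=x^{-1}\partial(g)x$ and $g^{\partial h}=h^{-1}gh$, and a map $\{-,-\}\colon\Pi\times\Pi\to G$ with $\partial\{x,y\}=y^{-1}x^{-1}yx$, $\{x,yz\}=\{x,y\}^z\{x,z\}$, $\{xy,z\}=\{y,z\}\{x,z\}^y$, $\{x,\partial h\}=h^{-1}h^x$, $\{\partial g,y\}=g^{-y}g$. It is *symmetric* if $\{y,x\}=\{x,y\}^{-1}$ for all $x,y$. A *$(G,\Pi)$-torsor* is a right $G$-torsor $P$ with a map $\jmath\colon P\to\Pi$ such that $\jmath(pg)=\jmath(p)\,\partial g$; then $G$ also acts on the left by $gp=p\,g^{\jmath(p)}$. The contracted product $P\wedge^G Q$ (quotient of $P\times Q$ by $(pg,q)\sim(p,gq)$, with $\jmath(p\wedge q)=\jmath(p)\jmath(q)$) and the braiding $c(p\wedge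 q)=(q\wedge p)\{\jmath(p),\jmath(q)\}^{-1}$ make the stack $\mathcal G$ of $(G,\Pi)$-torsors a braided group-like stack. Write $\hat c\colon (XY)(ZW)\to(XZ)(YW)$ for the morphism exchanging $Y$ and $Z$ by means of $c$ and the associativity isomorphisms. Let $H,K$ be sheaves of groups. A *biextension* of $(H,K)$ by $(G,\Pi)$ is a $(G,\Pi)$-torsor $E$ over $H\times K$ with morphisms of $(G,\Pi)$-torsors $\gamma^1\colon E_{h,k}\wedge^G E_{h',k}\to E_{hh',k}$ and $\gamma^2\colon E_{h,k}\wedge^G E_{h,k'}\to E_{h,kk'}$, compatible with restriction, each associative, such that the two morphisms $$(E_{h,k}\wedge^G E_{h',k})\wedge^G(E_{h,k'}\wedge^G E_{h',k'})\to E_{hh',kk'},\qquad \gamma^2(\gamma^1\wedge\gamma^1)\quad\text{and}\quad \gamma^1(\gamma^2\wedge\gamma^2)\,\hat c,$$ coincide. Morphisms of biextensions are morphisms of $(G,\Pi)$-torsors compatible with $\gamma^1,\gamma^2$. A *biadditive morphism* $F\colon H\times K\to\mathcal G$ consists of torsors $F(h,k)$, functorial under restriction, with functorial associative $\lambda^1\colon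 F(h,k)F(h',k)\to F(hh',k)$, $\lambda^2\colon F(h,k)F(h,k')\to F(h,kk')$ satisfying the analogous interchange condition and inducing the same isomorphism between $F(1,1)$ and the unit. The groupoids of these are $\mathrm{Biext}(H,K;\mathsf G)$ and $\mathrm{Biadd}(H,K;\mathcal G)$; letting the base vary, one gets stacks $\mathcal{B}iext(H,K;\mathsf G)$ and $\mathcal{B}iadd(H,K;\mathcal G)$. The functor $u$ sends $E$ to $(h,k)\mapsto E_{h,k}$. For biextensions $(E,\gamma)$, $(F,\mu)$ of $(H,K)$, equip the torsor $E\wedge^GF$ with the partial laws $$(E_{h,k}\wedge^G F_{h,k})\wedge^G(E_{h',k}\wedge^G F_{h',k})\xrightarrow{\ \hat c\ }(E_{h,k}\wedge^G E_{h',k})\wedge^G(F_{h,k}\wedge^G F_{h',k})\xrightarrow{\gamma^1\wedge\mu^1}E_{hh',k}\wedge^G F_{hh',k}$$ and, in the same way, the one built from $\gamma^2,\mu^2$. **Proposition.** Let $\mathsf G$ be a braided crossed module of $\mathsf T$. 1. $\mathsf G$ is symmetric if and only if the braiding of $\mathcal G$ is symmetric, i.e. $c_{Q,P}\,c_{P,Q}=\mathrm{id}$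 for all $(G,\Pi)$-torsors $P,Q$ (over all objects of the site). 2. For given $H$, $K$, $E$, $F$ (over any base), $E\wedge^GF$ with the above laws is a biextension if and only if $c_{F_y,E_x}\,c_{E_x,F_y}=\mathrm{id}$ for all points $x,y$ of $H\times K$ over a common point of the base. 3. The product $E\wedge^G F$ with the above laws is a biextension for all $H,K$ and all biextensions $E,F$ of $(H,K)$ by $(G,\Pi)$ if and only if $\mathsf G$ is symmetric. 4. The contracted product (with the above partial laws and with the associativity, unit and commutativity isomorphisms of the contracted product of torsors) makes $\mathrm{Biext}(H,K;\mathsf G)$ a symmetric group-like groupoid for all $H,K$ if and only if $\mathsf G$ is symmetric; likewise it makes $\mathcal{B}iext(H,K;\mathsf G)$ a symmetric group-like stack for all $H,K$ if and only if $\mathsf G$ is symmetric. The same two statements hold for $\mathrm{Biadd}(H,K;\mathcal G)$ and $\mathcal{B}iadd(H,K;\mathcal G)$ with the pointwise product $(F_1F_2)(h,k)=F_1(h,k)F_2(h,k)$. 5. If $\mathsf G$ is symmetric, then for all $H,K$ the functor $u\colon\mathrm{Biext}(H,K;\mathsf G)\to\mathrm{Biadd}(H,K;\mathcal G)$, with the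 canonical isomorphisms $E_{h,k}\wedge^GF_{h,k}\cong(E\wedge^GF)_{h,k}$, is an equivalence of symmetric group-like groupoids, and $u\colon\mathcal{B}iext(H,K;\mathsf G)\to\mathcal{B}iadd(H,K;\mathcal G)$ is an equivalence of symmetric group-like stacks. -/

import Mathlib

open CategoryTheory Opposite
universe u

namespace Biext4

section Base
variable {C : Type u} [SmallCategory C]

/-- Restriction of a section of a presheaf. -/
abbrev rs (X : Cᵒᵖ ⥤ Type u) {U V : C} (f : V ⟶ U) (x : X.obj (op U)) : X.obj (op V) :=
  X.map f.op x

theorem rs_id (X : Cᵒᵖ ⥤ Type u) {U : C} (x : X.obj (op U)) : rs X (𝟙 U) x = x := by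
  simp [rs]

theorem rs_comp (X : Cᵒᵖ ⥤ Type u) {U V W : C} (f : V ⟶ U) (g : W ⟶ V) (x : X.obj (op U)) :
    rs X (g ≫ f) x = rs X g (rs X f x) := by
  simp [rs]

variable {J : GrothendieckTopology C}

/-- Sections of a sheaf of groups. -/
abbrev Sec (F : Sheaf J GrpCat.{u}) (U : C) : Type u := F.obj.obj (op U)

/-- Restriction homomorphisms of a sheaf of groups. -/
abbrev gres (F : Sheaf J GrpCat.{u}) {U V : C} (f : V ⟶ U) : Sec F U →* Sec F V :=
  (F.obj.map f.op).hom

theorem gres_id (F : Sheaf J GrpCat.{u}) {U : C} (x : Sec F U) : gres F (𝟙 U) x = x := by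
  simp [gres]

theorem gres_comp (F : Sheaf J GrpCat.{u}) {U V W : C} (f : V ⟶ U) (g : W ⟶ V) (x : Sec F U) :
    gres F (g ≫ f) x = gres F g (gres F f x) := by
  simp [gres]

theorem gsep (F : Sheaf J GrpCat.{u}) {U : C} {R : Sieve U} (hR : R ∈ J U) (a b : Sec F U)
    (h : ∀ {V : C} (f : V ⟶ U), R f → gres F f a = gres F f b) : a = b := by
  have := (isSheaf_iff_isSheaf_of_type J _).1 ((sheafCompose J (forget GrpCat.{u})).obj F).2
  exact (this R hR).isSeparatedFor.ext (fun V f hf => h f hf)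

theorem gglue (F : Sheaf J GrpCat.{u}) {U : C} {R : Sieve U} (hR : R ∈ J U)
    (t : ∀ {V : C} (f : V ⟶ U), R f → Sec F V)
    (ht : ∀ {V W : C} (f : V ⟶ U) (hf : R f) (g : W ⟶ V),
      gres F g (t f hf) = t (g ≫ f) (R.downward_closed hf g)) :
    ∃ a : Sec F U, ∀ {V : C} (f : V ⟶ U) (hf : R f), gres F f a = t f hf := by
  have := (isSheaf_iff_isSheaf_of_type J _).1 ((sheafCompose J (forget GrpCat.{u})).obj F).2
  let fam : Presieve.FamilyOfElements ((sheafCompose J (forget GrpCat.{u})).obj F).obj R.arrows :=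
    fun V f hf => t f hf
  have hc : fam.Compatible := by
    rw [Presieve.compatible_iff_sieveCompatible]
    intro V W f g hf
    exact (ht f hf g).symm
  obtain ⟨a, ha, -⟩ := this R hR fam hc
  exact ⟨a, fun f hf => ha f hf⟩

/-- A sheaf of sets on the localized topos over a presheaf `X`: a family of sets of sections
indexed by the sections of `X`, with restriction maps and the gluing property. -/
structure RelSheaf (J : GrothendieckTopology C) (X : Cᵒᵖ ⥤ Type u) where
  carrier : ∀ {U : C}, X.obj (op U) → Type u
  res : ∀ {U V : C} (f : V ⟶ U) {x : X.obj (op U)} {y : X.obj (op V)},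
    rs X f x = y → carrier x → carrier y
  res_id : ∀ {U : C} {x : X.obj (op U)} (h : rs X (𝟙 U) x = x) (p : carrier x), res (𝟙 U) h p = p
  res_res : ∀ {U V W : C} (f : V ⟶ U) (g : W ⟶ V) {x : X.obj (op U)} {y : X.obj (op V)}
    {z : X.obj (op W)} (hf : rs X f x = y) (hg : rs X g y = z) (h : rs X (g ≫ f) x = z)
    (p : carrier x), res g hg (res f hf p) = res (g ≫ f) h p
  sep : ∀ {U : C} {x : X.obj (op U)} (R : Sieve U), R ∈ J U → ∀ p q : carrier x,
    (∀ {V : C} (f : V ⟶ U), R f → res f rfl p = res f rfl q) → p = q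
  glue : ∀ {U : C} {x : X.obj (op U)} (R : Sieve U), R ∈ J U →
    ∀ t : (∀ {V : C} (f : V ⟶ U), R f → carrier (rs X f x)),
    (∀ {V W : C} (f : V ⟶ U) (hf : R f) (g : W ⟶ V),
      res g (rs_comp X f g x).symm (t f hf) = t (g ≫ f) (R.downward_closed hf g)) →
    ∃ p : carrier x, ∀ {V : C} (f : V ⟶ U) (hf : R f), res f rfl p = t f hf

/-- A braided crossed module of sheaves of groups; `act g x` is `g ^ x`. -/
structure BraidedCrossedModule (J : GrothendieckTopology C) where
  G : Sheaf J GrpCat.{u}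
  Pi : Sheaf J GrpCat.{u}
  /-- The homomorphism `∂ : G ⟶ Π`. -/
  d : ∀ {U : C}, Sec G U →* Sec Pi U
  d_res : ∀ {U V : C} (f : V ⟶ U) (g : Sec G U), d (gres G f g) = gres Pi f (d g)
  /-- The right action of `Π` on `G`. -/
  act : ∀ {U : C}, Sec G U → Sec Pi U → Sec G U
  act_res : ∀ {U V : C} (f : V ⟶ U) (g : Sec G U) (x : Sec Pi U),
    gres G f (act g x) = act (gres G f g) (gres Pi f x)
  act_one : ∀ {U : C} (g : Sec G U), act g 1 = g
  act_mul : ∀ {U : C} (g : Sec G U) (x y : Sec Pi U), act g (x * y) = act (act g x) y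
  mul_act : ∀ {U : C} (g h : Sec G U) (x : Sec Pi U), act (g * h) x = act g x * act h x
  d_act : ∀ {U : C} (g : Sec G U) (x : Sec Pi U), d (act g x) = x⁻¹ * d g * x
  act_d : ∀ {U : C} (g h : Sec G U), act g (d h) = h⁻¹ * g * h
  /-- The bracket `{x, y}`. -/
  br : ∀ {U : C}, Sec Pi U → Sec Pi U → Sec G U
  br_res : ∀ {U V : C} (f : V ⟶ U) (x y : Sec Pi U),
    gres G f (br x y) = br (gres Pi f x) (gres Pi f y)
  d_br : ∀ {U : C} (x y : Sec Pi U), d (br x y) = y⁻¹ * x⁻¹ * y * x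
  br_mul : ∀ {U : C} (x y z : Sec Pi U), br x (y * z) = act (br x y) z * br x z
  mul_br : ∀ {U : C} (x y z : Sec Pi U), br (x * y) z = br y z * act (br x z) y
  br_d : ∀ {U : C} (x : Sec Pi U) (h : Sec G U), br x (d h) = h⁻¹ * act h x
  d_br_left : ∀ {U : C} (g : Sec G U) (y : Sec Pi U), br (d g) y = (act g y)⁻¹ * g

/-- The braiding is symmetric. -/
def BraidedCrossedModule.IsSymmetric (M : BraidedCrossedModule J) : Prop :=
  ∀ (U : C) (x y : Sec M.Pi U), M.br y x = (M.br x y)⁻¹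

namespace BraidedCrossedModule
variable (M : BraidedCrossedModule J)

theorem one_act {U : C} (x : Sec M.Pi U) : M.act (1 : Sec M.G U) x = 1 := by
  have := M.mul_act (1 : Sec M.G U) 1 x
  simpa using this

theorem inv_act {U : C} (g : Sec M.G U) (x : Sec M.Pi U) : M.act g⁻¹ x = (M.act g x)⁻¹ := by
  rw [eq_inv_iff_mul_eq_one, ← M.mul_act, inv_mul_cancel, one_act]

theorem br_one {U : C} (x : Sec M.Pi U) : M.br x 1 = 1 := by
  simpa [M.act_one] using M.br_mul x 1 1

theorem one_br {U : C} (x : Sec M.Pi U) : M.br 1 x = 1 := by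
  simpa [M.act_one] using M.mul_br 1 1 x

end BraidedCrossedModule

/-- A `(G, Π)`-torsor over `X`: a right `G`-torsor `P` over `X` with a `G`-equivariant map
`j : P ⟶ Π`, where `G` acts on `Π` by right multiplication through `∂`. -/
structure Torsor (M : BraidedCrossedModule J) (X : Cᵒᵖ ⥤ Type u) extends RelSheaf J X where
  act : ∀ {U : C} {x : X.obj (op U)}, carrier x → Sec M.G U → carrier x
  act_res : ∀ {U V : C} (f : V ⟶ U) {x : X.obj (op U)} {y : X.obj (op V)} (h : rs X f x = y)
    (p : carrier x) (g : Sec M.G U), res f h (act p g) = act (res f h p) (gres M.G f g)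
  act_one : ∀ {U : C} {x : X.obj (op U)} (p : carrier x), act p 1 = p
  act_mul : ∀ {U : C} {x : X.obj (op U)} (p : carrier x) (g h : Sec M.G U),
    act p (g * h) = act (act p g) h
  trans : ∀ {U : C} {x : X.obj (op U)} (p q : carrier x), ∃! g : Sec M.G U, act p g = q
  inhab : ∀ {U : C} (x : X.obj (op U)), ∃ R ∈ J U, ∀ {V : C} (f : V ⟶ U), R f →
    Nonempty (carrier (rs X f x))
  j : ∀ {U : C} {x : X.obj (op U)}, carrier x → Sec M.Pi U
  j_res : ∀ {U V : C} (f : V ⟶ U) {x : X.obj (op U)} {y : X.obj (op V)} (h : rs X f x = y)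
    (p : carrier x), j (res f h p) = gres M.Pi f (j p)
  j_act : ∀ {U : C} {x : X.obj (op U)} (p : carrier x) (g : Sec M.G U),
    j (act p g) = j p * M.d g

namespace Torsor
variable {M : BraidedCrossedModule J} {X : Cᵒᵖ ⥤ Type u}

/-- Morphisms of `(G, Π)`-torsors. -/
@[ext] structure Hom (P Q : Torsor M X) where
  app : ∀ {U : C} {x : X.obj (op U)}, P.carrier x → Q.carrier x
  app_res : ∀ {U V : C} (f : V ⟶ U) {x : X.obj (op U)} {y : X.obj (op V)} (h : rs X f x = y)
    (p : P.carrier x), app (P.res f h p) = Q.res f h (app p)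
  app_act : ∀ {U : C} {x : X.obj (op U)} (p : P.carrier x) (g : Sec M.G U),
    app (P.act p g) = Q.act (app p) g
  j_app : ∀ {U : C} {x : X.obj (op U)} (p : P.carrier x), Q.j (app p) = P.j p

instance : Category.{u} (Torsor M X) where
  Hom := Hom
  id P := ⟨fun p => p, fun _ _ _ _ _ => rfl, fun _ _ => rfl, fun _ => rfl⟩
  comp φ ψ := ⟨fun p => ψ.app (φ.app p), fun f _ _ h p => by rw [φ.app_res, ψ.app_res],
    fun p g => by rw [φ.app_act, ψ.app_act], fun p => by rw [ψ.j_app, φ.j_app]⟩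

variable {P Q R T : Torsor M X}

theorem hom_ext {φ ψ : P ⟶ Q} (h : ∀ {U : C} {x : X.obj (op U)} (p : P.carrier x),
    Hom.app φ p = Hom.app ψ p) : φ = ψ :=
  Hom.ext (by funext U x p; exact h p)

@[simp] theorem id_app {U : C} {x : X.obj (op U)} (p : P.carrier x) : Hom.app (𝟙 P) p = p := rfl
@[simp] theorem comp_app (φ : P ⟶ Q) (ψ : Q ⟶ R) {U : C} {x : X.obj (op U)} (p : P.carrier x) :
    Hom.app (φ ≫ ψ) p = Hom.app ψ (Hom.app φ p) := rfl

theorem act_inj {U : C} {x : X.obj (op U)} {p : P.carrier x} {g h : Sec M.G U}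
    (e : P.act p g = P.act p h) : g = h :=
  (P.trans p (P.act p h)).unique e rfl

theorem app_inj (φ : P ⟶ Q) {U : C} {x : X.obj (op U)} {p q : P.carrier x}
    (e : Hom.app φ p = Hom.app φ q) : p = q := by
  obtain ⟨g, rfl, -⟩ := P.trans p q
  rw [φ.app_act] at e
  have : (1 : Sec M.G U) = g := act_inj (P := Q) (p := Hom.app φ p) (by rw [Q.act_one]; exact e)
  rw [← this, P.act_one]

theorem app_surj (φ : P ⟶ Q) {U : C} {x : X.obj (op U)} (q : Q.carrier x) :
    ∃ p, Hom.app φ p = q := by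
  obtain ⟨S, hS, hS'⟩ := P.inhab x
  have key : ∀ {V : C} (f : V ⟶ U), S f → ∃ p : P.carrier (rs X f x),
      Hom.app φ p = Q.res f rfl q := by
    intro V f hf
    obtain ⟨p⟩ := hS' f hf
    obtain ⟨g, hg, -⟩ := Q.trans (Hom.app φ p) (Q.res f rfl q)
    exact ⟨P.act p g, by rw [φ.app_act, hg]⟩
  obtain ⟨p, hp⟩ := P.glue S hS (fun f hf => (key f hf).choose) (fun {V W} f hf g => by
    apply app_inj φ
    rw [φ.app_res, (key f hf).choose_spec, (key (g ≫ f) (S.downward_closed hf g)).choose_spec]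
    exact Q.res_res _ _ _ _ _ _)
  refine ⟨p, Q.sep S hS _ _ fun f hf => ?_⟩
  rw [← φ.app_res, hp f hf, (key f hf).choose_spec]

theorem app_bij (φ : P ⟶ Q) {U : C} (x : X.obj (op U)) :
    Function.Bijective (fun p : P.carrier x => Hom.app φ p) :=
  ⟨fun _ _ e => app_inj φ e, fun q => app_surj φ q⟩

/-- Every morphism of torsors is invertible. -/
noncomputable def inverse (φ : P ⟶ Q) : Q ⟶ P where
  app q := (app_surj φ q).choose
  app_res f _ _ h q := app_inj φ (by
    rw [(app_surj φ _).choose_spec, φ.app_res, (app_surj φ q).choose_spec])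
  app_act q g := app_inj φ (by
    rw [(app_surj φ _).choose_spec, φ.app_act, (app_surj φ q).choose_spec])
  j_app q := by rw [← φ.j_app, (app_surj φ q).choose_spec]

theorem app_inverse (φ : P ⟶ Q) {U : C} {x : X.obj (op U)} (q : Q.carrier x) :
    Hom.app φ (Hom.app (inverse φ) q) = q := (app_surj φ q).choose_spec

/-- A morphism of torsors, as an isomorphism. -/
@[simps] noncomputable def isoOf (φ : P ⟶ Q) : P ≅ Q where
  hom := φ
  inv := inverse φ
  hom_inv_id := hom_ext fun _ => app_inj φ (app_inverse φ _)
  inv_hom_id := hom_ext fun q => app_inverse φ q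

instance (φ : P ⟶ Q) : IsIso φ := (isoOf φ).isIso_hom

/-- The left action `g p = p g ^ j(p)`. -/
def lact {U : C} {x : X.obj (op U)} (P : Torsor M X) (g : Sec M.G U) (p : P.carrier x) :
    P.carrier x := P.act p (M.act g (P.j p))

theorem lact_one {U : C} {x : X.obj (op U)} (p : P.carrier x) : P.lact 1 p = p := by
  rw [lact, M.one_act, P.act_one]

theorem j_lact {U : C} {x : X.obj (op U)} (g : Sec M.G U) (p : P.carrier x) :
    P.j (P.lact g p) = M.d g * P.j p := by
  rw [lact, P.j_act, M.d_act]; group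

theorem lact_mul {U : C} {x : X.obj (op U)} (g h : Sec M.G U) (p : P.carrier x) :
    P.lact (g * h) p = P.lact g (P.lact h p) := by
  have : M.act g (P.j (P.lact h p)) = M.act (M.act g (M.d h)) (P.j p) := by
    rw [j_lact, M.act_mul]
  rw [lact, lact, this, lact, ← P.act_mul, ← M.mul_act, M.act_d]
  congr 2; group

theorem lact_act {U : C} {x : X.obj (op U)} (g h : Sec M.G U) (p : P.carrier x) :
    P.lact g (P.act p h) = P.act (P.lact g p) h := by
  rw [lact, lact, P.j_act, M.act_mul, M.act_d, ← P.act_mul, ← P.act_mul]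
  congr 1; group

theorem lact_res {U V : C} (f : V ⟶ U) {x : X.obj (op U)} {y : X.obj (op V)} (h : rs X f x = y)
    (g : Sec M.G U) (p : P.carrier x) :
    P.res f h (P.lact g p) = P.lact (gres M.G f g) (P.res f h p) := by
  rw [lact, lact, P.act_res, M.act_res, P.j_res]

theorem app_lact (φ : P ⟶ Q) {U : C} {x : X.obj (op U)} (g : Sec M.G U) (p : P.carrier x) :
    Hom.app φ (P.lact g p) = Q.lact g (Hom.app φ p) := by
  rw [lact, lact, φ.app_act, φ.j_app]

/-- The orbit relation of the action `(p, q) ↦ (p g, g⁻¹ q)`. -/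
def Orb (P Q : Torsor M X) {U : C} {x : X.obj (op U)} (p : P.carrier x) (q : Q.carrier x)
    (p' : P.carrier x) (q' : Q.carrier x) : Prop :=
  ∃ g : Sec M.G U, p' = P.act p g ∧ q = Q.lact g q'

theorem Orb.refl {U : C} {x : X.obj (op U)} (p : P.carrier x) (q : Q.carrier x) :
    Orb P Q p q p q := ⟨1, (P.act_one p).symm, (lact_one q).symm⟩

theorem Orb.symm {U : C} {x : X.obj (op U)} {p p' : P.carrier x} {q q' : Q.carrier x}
    (h : Orb P Q p q p' q') : Orb P Q p' q' p q := by
  obtain ⟨g, rfl, rfl⟩ := h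
  exact ⟨g⁻¹, by rw [← P.act_mul, mul_inv_cancel, P.act_one],
    by rw [← lact_mul, inv_mul_cancel, lact_one]⟩

theorem Orb.trans {U : C} {x : X.obj (op U)} {p p' p'' : P.carrier x} {q q' q'' : Q.carrier x}
    (h : Orb P Q p q p' q') (h' : Orb P Q p' q' p'' q'') : Orb P Q p q p'' q'' := by
  obtain ⟨g, rfl, rfl⟩ := h
  obtain ⟨g', rfl, rfl⟩ := h'
  exact ⟨g * g', by rw [P.act_mul], by rw [lact_mul]⟩

theorem Orb.res {U V : C} (f : V ⟶ U) {x : X.obj (op U)} {y : X.obj (op V)} (e : rs X f x = y)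
    {p p' : P.carrier x} {q q' : Q.carrier x} (h : Orb P Q p q p' q') :
    Orb P Q (P.res f e p) (Q.res f e q) (P.res f e p') (Q.res f e q') := by
  obtain ⟨g, rfl, rfl⟩ := h
  exact ⟨gres M.G f g, P.act_res _ _ _ _, lact_res _ _ _ _⟩

/-- The relation `Orb` is local. -/
theorem Orb.of_local {U : C} {x : X.obj (op U)} (S : Sieve U) (hS : S ∈ J U)
    {p p' : P.carrier x} {q q' : Q.carrier x}
    (h : ∀ {V : C} (f : V ⟶ U), S f →
      Orb P Q (P.res f rfl p) (Q.res f rfl q) (P.res f rfl p') (Q.res f rfl q')) :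
    Orb P Q p q p' q' := by
  obtain ⟨g, hg, -⟩ := P.trans p p'
  refine ⟨g, hg.symm, Q.sep S hS _ _ fun f hf => ?_⟩
  obtain ⟨g', h1, h2⟩ := h f hf
  rw [← hg, P.act_res] at h1
  rw [lact_res, act_inj h1, h2]

end Torsor

namespace Torsor
variable {M : BraidedCrossedModule J} {X : Cᵒᵖ ⥤ Type u} {P Q R T : Torsor M X}

/-- A section over `x` of the sheaf quotient of `P × Q` by the action `(p, q) ↦ (p g, g⁻¹ q)`
of `G`: an orbit, that is, a subsheaf of the restriction of `P × Q` to `x` which is locally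
nonempty and on which `G` acts transitively. -/
@[ext] structure TensorSec (P Q : Torsor M X) {U : C} (x : X.obj (op U)) where
  mem : ∀ {V : C} (f : V ⟶ U) {y : X.obj (op V)}, rs X f x = y →
    P.carrier y → Q.carrier y → Prop
  mem_res : ∀ {V W : C} (f : V ⟶ U) (g : W ⟶ V) {y : X.obj (op V)} {z : X.obj (op W)}
    (hf : rs X f x = y) (hg : rs X g y = z) (h : rs X (g ≫ f) x = z) (p : P.carrier y)
    (q : Q.carrier y), mem f hf p q → mem (g ≫ f) h (P.res g hg p) (Q.res g hg q)
  mem_orb : ∀ {V : C} (f : V ⟶ U) {y : X.obj (op V)} (hf : rs X f x = y) (p p' : P.carrier y)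
    (q q' : Q.carrier y), mem f hf p q → (mem f hf p' q' ↔ Orb P Q p q p' q')
  mem_local : ∀ {V : C} (f : V ⟶ U) {y : X.obj (op V)} (hf : rs X f x = y) (p : P.carrier y)
    (q : Q.carrier y) (S : Sieve V), S ∈ J V →
    (∀ {W : C} (g : W ⟶ V) {z : X.obj (op W)} (hg : rs X g y = z) (h : rs X (g ≫ f) x = z), S g →
      mem (g ≫ f) h (P.res g hg p) (Q.res g hg q)) →
    mem f hf p q
  inhab : ∃ S ∈ J U, ∀ {V : C} (f : V ⟶ U) {y : X.obj (op V)} (hf : rs X f x = y), S f →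
    ∃ p q, mem f hf p q

namespace TensorSec

theorem mem_congr {U V : C} {x : X.obj (op U)} (O : TensorSec P Q x) {f f' : V ⟶ U}
    {y : X.obj (op V)} (e : f = f') {h : rs X f x = y} {p : P.carrier y} {q : Q.carrier y}
    (hm : O.mem f h p q) : O.mem f' (e ▸ h) p q := by
  subst e; exact hm

/-- Two orbits that meet locally are equal. -/
theorem eq_of_mem {U : C} {x : X.obj (op U)} {O O' : TensorSec P Q x} (S : Sieve U) (hS : S ∈ J U)
    (h : ∀ {V : C} (f : V ⟶ U) {y : X.obj (op V)} (hf : rs X f x = y), S f →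
      ∃ p q, O.mem f hf p q ∧ O'.mem f hf p q) : O = O' := by
  have aux : ∀ {O O' : TensorSec P Q x} (_ : ∀ {V : C} (f : V ⟶ U) {y : X.obj (op V)}
      (hf : rs X f x = y), S f → ∃ p q, O.mem f hf p q ∧ O'.mem f hf p q) {V : C} (f : V ⟶ U)
      {y : X.obj (op V)} (hf : rs X f x = y) (p : P.carrier y) (q : Q.carrier y),
      O.mem f hf p q → O'.mem f hf p q := by
    intro O O' h V f y hf p q hm
    refine O'.mem_local f hf p q (S.pullback f) (J.pullback_stable f hS) fun {W} g z hg e hS => ?_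
    obtain ⟨a, b, h1, h2⟩ := h (g ≫ f) e hS
    exact (O'.mem_orb _ e _ _ _ _ h2).2
      ((O.mem_orb _ e _ _ _ _ h1).1 (O.mem_res f g hf hg e p q hm))
  ext V f y hf p q
  exact ⟨aux h f hf p q, aux (fun f _ hf hS => by
    obtain ⟨p, q, h1, h2⟩ := h f hf hS; exact ⟨p, q, h2, h1⟩) f hf p q⟩

/-- Restriction of orbits. -/
def res {U V : C} (f : V ⟶ U) {x : X.obj (op U)} {y : X.obj (op V)} (hf : rs X f x = y)
    (O : TensorSec P Q x) : TensorSec P Q y where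
  mem g _ h p q := O.mem (g ≫ f) (by rw [rs_comp, hf, h]) p q
  mem_res g k _ z hg hk h p q hm := by
    have h' : rs X (k ≫ g ≫ f) x = z := by rw [← Category.assoc, rs_comp, hf, h]
    exact O.mem_congr (Category.assoc k g f).symm
      (O.mem_res (g ≫ f) k (by rw [rs_comp, hf, hg]) hk h' p q hm)
  mem_orb g _ h p p' q q' hm := O.mem_orb _ _ _ _ _ _ hm
  mem_local g _ h p q S hS H := by
    refine O.mem_local _ _ p q S hS fun k z hk e hS => ?_
    have e' : rs X (k ≫ g) y = z := by rw [rs_comp, h, hk]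
    exact O.mem_congr (Category.assoc k g f) (H k hk e' hS)
  inhab := by
    obtain ⟨S, hS, h⟩ := O.inhab
    exact ⟨S.pullback f, J.pullback_stable f hS, fun g _ hg hS =>
      h (g ≫ f) (by rw [rs_comp, hf, hg]) hS⟩

theorem glue {U : C} {x : X.obj (op U)} (S : Sieve U) (hS : S ∈ J U)
    (t : ∀ {V : C} (f : V ⟶ U), S f → TensorSec P Q (rs X f x))
    (ht : ∀ {V W : C} (f : V ⟶ U) (hf : S f) (g : W ⟶ V),
      res g (rs_comp X f g x).symm (t f hf) = t (g ≫ f) (S.downward_closed hf g)) :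
    ∃ O : TensorSec P Q x, ∀ {V : C} (f : V ⟶ U) (hf : S f), res f rfl O = t f hf := by
  have key : ∀ {V W : C} (f : V ⟶ U) (hf : S f) (g : W ⟶ V) {z : X.obj (op W)}
      (h : rs X g (rs X f x) = z) (h' : rs X (𝟙 W) (rs X (g ≫ f) x) = z)
      (p : P.carrier z) (q : Q.carrier z),
      (t f hf).mem g h p q ↔ (t (g ≫ f) (S.downward_closed hf g)).mem (𝟙 W) h' p q := by
    intro V W f hf g z h h' p q
    rw [← ht f hf g]
    exact ⟨fun hm => (t f hf).mem_congr (Category.id_comp g).symm hm,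
      fun hm => (t f hf).mem_congr (Category.id_comp g) hm⟩
  have tc : ∀ {V W : C} {f f' : V ⟶ U} (e : f = f') (hf : S f) (g : W ⟶ V) {z : X.obj (op W)}
      (h : rs X g (rs X f x) = z) (p : P.carrier z) (q : Q.carrier z),
      (t f hf).mem g h p q → (t f' (e ▸ hf)).mem g (e ▸ h) p q := by
    intro V W f f' e hf g z h p q hm; subst e; exact hm
  refine ⟨{
    mem := fun {V} f {y} hf p q => ∀ {W : C} (g : W ⟶ V) {z : X.obj (op W)} (hg : rs X g y = z)
      (hS : S (g ≫ f)), (t (g ≫ f) hS).mem (𝟙 W) (by rw [rs_id, rs_comp, hf, hg])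
        (P.res g hg p) (Q.res g hg q)
    mem_res := ?_
    mem_orb := ?_
    mem_local := ?_
    inhab := ?_ }, ?_⟩
  · intro V W f g y z hf hg h p q hm W' k z' hk hS'
    have e : rs X (k ≫ g) y = z' := by rw [rs_comp, hg, hk]
    rw [P.res_res g k hg hk e, Q.res_res g k hg hk e]
    exact tc (Category.assoc k g f) (by simpa using hS') _ _ _ _ (hm (k ≫ g) e (by simpa using hS'))
  · intro V f y hf p p' q q' hm
    constructor
    · intro hm'
      refine Orb.of_local (S.pullback f) (J.pullback_stable f hS) fun {W} g hg => ?_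
      exact ((t (g ≫ f) hg).mem_orb _ _ _ _ _ _ (hm g rfl hg)).1 (hm' g rfl hg)
    · intro ho W g z hg hS'
      exact ((t (g ≫ f) hS').mem_orb _ _ _ _ _ _ (hm g hg hS')).2 (ho.res g hg)
  · intro V f y hf p q S' hS' H W g z hg hSg
    refine (t (g ≫ f) hSg).mem_local _ _ _ _ (S'.pullback g) (J.pullback_stable g hS')
      fun {W'} k z' hk e hk' => ?_
    have e1 : rs X (k ≫ g) y = z' := by rw [rs_comp, hg, hk]
    have e2 : rs X ((k ≫ g) ≫ f) x = z' := by rw [rs_comp, hf, e1]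
    have hS2 : S (k ≫ g ≫ f) := S.downward_closed hSg k
    have e3 : rs X (𝟙 W') z' = z' := rs_id X z'
    have := H (k ≫ g) e1 e2 hk' (𝟙 W') e3 (by simpa using hS2)
    rw [P.res_id, Q.res_id] at this
    rw [P.res_res g k hg hk e1, Q.res_res g k hg hk e1]
    have h5 := tc (f' := k ≫ g ≫ f) (by simp) _ _ _ _ _ this
    have e6 : rs X k (rs X (g ≫ f) x) = z' := by rw [← rs_comp, ← Category.assoc, e2]
    exact (t (g ≫ f) hSg).mem_congr (Category.comp_id k).symm
      ((key (g ≫ f) hSg k e6 _ _ _).2 h5)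
  · refine ⟨Sieve.bind S.arrows (fun V f hf => (t f hf).inhab.choose), J.bind_covering hS
      (fun V f hf => (t f hf).inhab.choose_spec.1), ?_⟩
    intro V f y hf hb
    obtain ⟨W, g, k, hk, hg, rfl⟩ := hb
    have e0 : rs X g (rs X k x) = y := by rw [← hf, rs_comp]
    obtain ⟨p, q, hm⟩ := (t k hk).inhab.choose_spec.2 g e0 hg
    refine ⟨p, q, fun {W'} l z hl hS' => ?_⟩
    have e : rs X (l ≫ g) (rs X k x) = z := by rw [← rs_comp, Category.assoc, rs_comp, hf, hl]
    have h1 := (t k hk).mem_res g l e0 hl e p q hm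
    exact tc (Category.assoc l g k) _ _ _ _ _ ((key k hk (l ≫ g) e
      (by rw [rs_id, rs_comp, e]) _ _).1 h1)
  · intro V f hf
    obtain ⟨S', hS', h⟩ := (t f hf).inhab
    refine eq_of_mem S' hS' fun {W} g y hg hSg => ?_
    obtain ⟨p, q, hm⟩ := h g hg hSg
    refine ⟨p, q, ?_, hm⟩
    intro W' k z hk hSk
    have e : rs X (k ≫ g) (rs X f x) = z := by rw [rs_comp, hg, hk]
    have h1 := (t f hf).mem_res g k hg hk e p q hm
    exact tc (Category.assoc k g f) _ _ _ _ _ ((key f hf (k ≫ g) e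
      (by rw [rs_id, rs_comp, e]) _ _).1 h1)

/-- The class `p ∧ q`. -/
def wedge {U : C} {x : X.obj (op U)} (p : P.carrier x) (q : Q.carrier x) : TensorSec P Q x where
  mem f _ hf p' q' := Orb P Q (P.res f hf p) (Q.res f hf q) p' q'
  mem_res f g _ _ hf hg h p' q' hm := by
    rw [← P.res_res f g hf hg h, ← Q.res_res f g hf hg h]
    exact hm.res g hg
  mem_orb f _ hf _ _ _ _ hm := ⟨fun h => hm.symm.trans h, fun h => hm.trans h⟩
  mem_local f y hf p' q' S hS H := by
    refine Orb.of_local S hS fun g hg => ?_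
    have e : rs X (g ≫ f) x = rs X g y := by rw [rs_comp, hf]
    have := H g rfl e hg
    rwa [← P.res_res f g hf rfl e, ← Q.res_res f g hf rfl e] at this
  inhab := ⟨⊤, J.top_mem U, fun _ _ _ _ => ⟨_, _, Orb.refl _ _⟩⟩

theorem wedge_eq_wedge {U : C} {x : X.obj (op U)} {p p' : P.carrier x} {q q' : Q.carrier x} :
    wedge p q = wedge p' q' ↔ Orb P Q p q p' q' := by
  have hid := rs_id X x
  constructor
  · intro h
    have h1 : (wedge p' q').mem (𝟙 U) hid (P.res (𝟙 U) hid p') (Q.res (𝟙 U) hid q') := Orb.refl _ _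
    rw [← h, P.res_id, Q.res_id] at h1
    change Orb P Q _ _ _ _ at h1
    rwa [P.res_id, Q.res_id] at h1
  · intro h
    exact eq_of_mem ⊤ (J.top_mem U) fun f _ hf _ => ⟨_, _, Orb.refl _ _, (h.res f hf).symm⟩

theorem res_wedge {U V : C} (f : V ⟶ U) {x : X.obj (op U)} {y : X.obj (op V)} (hf : rs X f x = y)
    (p : P.carrier x) (q : Q.carrier x) : res f hf (wedge p q) = wedge (P.res f hf p) (Q.res f hf q) :=
  eq_of_mem ⊤ (J.top_mem V) fun g z hg _ => by
    have e : rs X (g ≫ f) x = z := by rw [rs_comp, hf, hg]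
    refine ⟨_, _, Orb.refl _ _, ?_⟩
    change Orb P Q _ _ _ _
    rw [P.res_res f g hf hg e, Q.res_res f g hf hg e]
    exact Orb.refl _ _

theorem eq_wedge {U : C} {x : X.obj (op U)} (O : TensorSec P Q x) (h : rs X (𝟙 U) x = x)
    {p : P.carrier x} {q : Q.carrier x} (hm : O.mem (𝟙 U) h p q) : O = wedge p q :=
  eq_of_mem ⊤ (J.top_mem U) fun f y hf _ => by
    have e : rs X (f ≫ 𝟙 U) x = y := by simpa using hf
    exact ⟨P.res f hf p, Q.res f hf q,
      O.mem_congr (Category.comp_id f) (O.mem_res (𝟙 U) f h hf e p q hm), Orb.refl _ _⟩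

/-- Locally, every section of the contracted product has the form `p ∧ q`. -/
theorem locally_wedge {U : C} {x : X.obj (op U)} (O : TensorSec P Q x) :
    ∃ S ∈ J U, ∀ {V : C} (f : V ⟶ U), S f → ∃ p q, res f rfl O = wedge p q := by
  obtain ⟨S, hS, h⟩ := O.inhab
  refine ⟨S, hS, fun {V} f hf => ?_⟩
  obtain ⟨p, q, hm⟩ := h f rfl hf
  exact ⟨p, q, eq_wedge _ (rs_id X _) (O.mem_congr (Category.id_comp f).symm hm)⟩

end TensorSec
end Torsor

/-- A sheaf of groups, viewed over `X`. -/
abbrev RelSheaf.ofGrp (F : Sheaf J GrpCat.{u}) (X : Cᵒᵖ ⥤ Type u) : RelSheaf J X where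
  carrier {U} _ := Sec F U
  res f _ _ _ p := gres F f p
  res_id _ p := gres_id F p
  res_res f g _ _ _ _ _ _ p := (gres_comp F f g p).symm
  sep _ hS p q h := gsep F hS p q h
  glue _ hS t ht := gglue F hS t ht

namespace Torsor
variable {M : BraidedCrossedModule J} {X : Cᵒᵖ ⥤ Type u} {P Q R T : Torsor M X}

namespace TensorSec

/-- Functions out of the contracted product. -/
theorem exists_lift {U : C} {x : X.obj (op U)} (O : TensorSec P Q x) (T : RelSheaf J X)
    (φ : ∀ {V : C} (f : V ⟶ U) {y : X.obj (op V)}, rs X f x = y → P.carrier y → Q.carrier y →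
      T.carrier y)
    (hn : ∀ {V W : C} (f : V ⟶ U) (g : W ⟶ V) {y : X.obj (op V)} {z : X.obj (op W)}
      (hf : rs X f x = y) (hg : rs X g y = z) (h : rs X (g ≫ f) x = z) (p : P.carrier y)
      (q : Q.carrier y), T.res g hg (φ f hf p q) = φ (g ≫ f) h (P.res g hg p) (Q.res g hg q))
    (ho : ∀ {V : C} (f : V ⟶ U) {y : X.obj (op V)} (hf : rs X f x = y) (p p' : P.carrier y)
      (q q' : Q.carrier y), Orb P Q p q p' q' → φ f hf p q = φ f hf p' q') :
    ∃ r : T.carrier x, ∀ {V : C} (f : V ⟶ U) {y : X.obj (op V)} (hf : rs X f x = y)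
      (p : P.carrier y) (q : Q.carrier y), O.mem f hf p q → T.res f hf r = φ f hf p q := by
  obtain ⟨S, hS, h⟩ := O.inhab
  obtain ⟨r, hr⟩ := T.glue S hS (fun f hf => φ f rfl (h f rfl hf).choose
    (h f rfl hf).choose_spec.choose) (fun {V W} f hf g => by
      rw [hn f g rfl _ rfl]
      exact ho _ _ _ _ _ _ ((O.mem_orb _ _ _ _ _ _ (O.mem_res f g rfl _ rfl _ _
        (h f rfl hf).choose_spec.choose_spec)).1
          (h (g ≫ f) rfl (S.downward_closed hf g)).choose_spec.choose_spec))
  refine ⟨r, fun {V} f y hf p q hm => ?_⟩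
  refine T.sep (S.pullback f) (J.pullback_stable f hS) _ _ fun {W} g hg => ?_
  have e : rs X (g ≫ f) x = rs X g y := by rw [rs_comp, hf]
  rw [T.res_res f g hf rfl e, hn f g hf rfl e]
  have h1 := O.mem_res f g hf rfl e p q hm
  have key : ∀ {z : X.obj (op W)} (e : rs X (g ≫ f) x = z) (p : P.carrier z) (q : Q.carrier z),
      O.mem (g ≫ f) e p q → T.res (g ≫ f) e r = φ (g ≫ f) e p q := by
    intro z e p q hm
    subst e
    rw [hr (g ≫ f) hg]
    exact ho _ _ _ _ _ _ ((O.mem_orb _ _ _ _ _ _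
      (h (g ≫ f) rfl hg).choose_spec.choose_spec).1 hm)
  exact key e _ _ h1

theorem act_inv_orb {U : C} {x : X.obj (op U)} (g : Sec M.G U) {p p' : P.carrier x}
    {q q' : Q.carrier x} :
    Orb P Q p (Q.act q g) p' (Q.act q' g) ↔ Orb P Q p q p' q' := by
  constructor
  · rintro ⟨a, h1, h2⟩
    refine ⟨a, h1, ?_⟩
    rw [lact_act] at h2
    have := congrArg (fun t => Q.act t g⁻¹) h2
    simpa only [← Q.act_mul, mul_inv_cancel, Q.act_one] using this
  · rintro ⟨a, h1, rfl⟩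
    exact ⟨a, h1, (lact_act _ _ _).symm⟩

/-- The right action of `G` on the contracted product: `(p ∧ q) g = p ∧ q g`. -/
def act {U : C} {x : X.obj (op U)} (O : TensorSec P Q x) (a : Sec M.G U) : TensorSec P Q x where
  mem f _ hf p q := O.mem f hf p (Q.act q (gres M.G f a)⁻¹)
  mem_res f g _ _ hf hg h p q hm := by
    have := O.mem_res f g hf hg h _ _ hm
    rwa [Q.act_res, map_inv, ← gres_comp] at this
  mem_orb f _ hf p p' q q' hm := by rw [O.mem_orb f hf _ _ _ _ hm, act_inv_orb]
  mem_local f _ hf p q S hS H := by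
    refine O.mem_local f hf _ _ S hS fun g _ hg h hS' => ?_
    rw [Q.act_res, map_inv, ← gres_comp]
    exact H g hg h hS'
  inhab := by
    obtain ⟨S, hS, h⟩ := O.inhab
    refine ⟨S, hS, fun f _ hf hS' => ?_⟩
    obtain ⟨p, q, hm⟩ := h f hf hS'
    refine ⟨p, Q.act q (gres M.G f a), ?_⟩
    rwa [← Q.act_mul, mul_inv_cancel, Q.act_one]

theorem act_wedge {U : C} {x : X.obj (op U)} (p : P.carrier x) (q : Q.carrier x) (a : Sec M.G U) :
    act (wedge p q) a = wedge p (Q.act q a) :=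
  eq_of_mem ⊤ (J.top_mem U) fun f y hf _ => by
    refine ⟨P.res f hf p, Q.res f hf (Q.act q a), ?_, Orb.refl _ _⟩
    change Orb P Q _ _ _ _
    rw [Q.act_res, ← Q.act_mul, mul_inv_cancel, Q.act_one]
    exact Orb.refl _ _

theorem res_act {U V : C} (f : V ⟶ U) {x : X.obj (op U)} {y : X.obj (op V)} (hf : rs X f x = y)
    (O : TensorSec P Q x) (a : Sec M.G U) :
    res f hf (act O a) = act (res f hf O) (gres M.G f a) := by
  ext W g z hg p q
  change O.mem (g ≫ f) _ _ _ ↔ O.mem (g ≫ f) _ _ _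
  rw [gres_comp]

theorem res_id {U : C} {x : X.obj (op U)} (h : rs X (𝟙 U) x = x) (O : TensorSec P Q x) :
    res (𝟙 U) h O = O := by
  ext W g z hg p q
  exact ⟨fun hm => O.mem_congr (Category.comp_id g) hm,
    fun hm => O.mem_congr (Category.comp_id g).symm hm⟩

theorem res_res {U V W : C} (f : V ⟶ U) (g : W ⟶ V) {x : X.obj (op U)} {y : X.obj (op V)}
    {z : X.obj (op W)} (hf : rs X f x = y) (hg : rs X g y = z) (h : rs X (g ≫ f) x = z)
    (O : TensorSec P Q x) : res g hg (res f hf O) = res (g ≫ f) h O := by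
  ext W k z hk p q
  exact ⟨fun hm => O.mem_congr (Category.assoc k g f) hm,
    fun hm => O.mem_congr (Category.assoc k g f).symm hm⟩

theorem sep {U : C} {x : X.obj (op U)} (S : Sieve U) (hS : S ∈ J U) (O O' : TensorSec P Q x)
    (h : ∀ {V : C} (f : V ⟶ U), S f → res f rfl O = res f rfl O') : O = O' := by
  obtain ⟨S', hS', h'⟩ := O.inhab
  refine eq_of_mem (S ⊓ S') (J.intersection_covering hS hS') fun f y hf hm => ?_
  obtain ⟨p, q, hp⟩ := h' f hf hm.2
  refine ⟨p, q, hp, ?_⟩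
  subst hf
  have h1 : (res f rfl O).mem (𝟙 _) (rs_id X _) p q := O.mem_congr (Category.id_comp f).symm hp
  rw [h f hm.1] at h1
  exact O'.mem_congr (Category.id_comp f) h1

/-- To prove an equality of sections depending on a section of a contracted product, one may
assume that the latter is of the form `p ∧ q`. -/
theorem local_rec {U : C} {x : X.obj (op U)} (O : TensorSec P Q x) (F : RelSheaf J X)
    (a b : F.carrier x) (h : ∀ {V : C} (f : V ⟶ U) (p : P.carrier (rs X f x))
      (q : Q.carrier (rs X f x)), res f rfl O = wedge p q → F.res f rfl a = F.res f rfl b) :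
    a = b := by
  obtain ⟨S, hS, h'⟩ := O.locally_wedge
  refine F.sep S hS _ _ fun f hf => ?_
  obtain ⟨p, q, e⟩ := h' f hf
  exact h f p q e

theorem j_orb {U : C} {x : X.obj (op U)} {p p' : P.carrier x} {q q' : Q.carrier x}
    (h : Orb P Q p q p' q') : P.j p * Q.j q = P.j p' * Q.j q' := by
  obtain ⟨g, rfl, rfl⟩ := h
  rw [j_lact, P.j_act, mul_assoc]

theorem exists_j {U : C} {x : X.obj (op U)} (O : TensorSec P Q x) :
    ∃ r : Sec M.Pi U, ∀ {V : C} (f : V ⟶ U) {y : X.obj (op V)} (hf : rs X f x = y)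
      (p : P.carrier y) (q : Q.carrier y), O.mem f hf p q →
      gres M.Pi f r = P.j p * Q.j q :=
  O.exists_lift (RelSheaf.ofGrp M.Pi X) (fun _ _ _ p q => P.j p * Q.j q)
    (fun f g _ _ hf hg h p q => by
      change gres M.Pi g _ = _
      rw [map_mul, P.j_res, Q.j_res]) (fun _ _ _ _ _ _ _ h => j_orb h)

/-- The structural map of the contracted product: `j(p ∧ q) = j(p) j(q)`. -/
noncomputable def j {U : C} {x : X.obj (op U)} (O : TensorSec P Q x) : Sec M.Pi U :=
  O.exists_j.choose

theorem j_wedge {U : C} {x : X.obj (op U)} (p : P.carrier x) (q : Q.carrier x) :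
    j (wedge p q) = P.j p * Q.j q := by
  have := (wedge p q).exists_j.choose_spec (𝟙 U) (rs_id X x) _ _ (Orb.refl _ _)
  rw [gres_id, P.res_id, Q.res_id] at this
  exact this

theorem j_res {U V : C} (f : V ⟶ U) {x : X.obj (op U)} {y : X.obj (op V)} (hf : rs X f x = y)
    (O : TensorSec P Q x) : j (res f hf O) = gres M.Pi f (j O) := by
  obtain ⟨S, hS, h⟩ := (res f hf O).inhab
  refine gsep M.Pi hS _ _ fun g hg => ?_
  obtain ⟨p, q, hm⟩ := h g rfl hg
  have h1 := (res f hf O).exists_j.choose_spec g rfl p q hm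
  have h2 := O.exists_j.choose_spec (g ≫ f) (by rw [rs_comp, hf]) p q hm
  rw [← gres_comp]
  exact h1.trans h2.symm

theorem local_rec' {U : C} {x : X.obj (op U)} (O : TensorSec P Q x)
    (a b : TensorSec R T x) (h : ∀ {V : C} (f : V ⟶ U) (p : P.carrier (rs X f x))
      (q : Q.carrier (rs X f x)), res f rfl O = wedge p q → res f rfl a = res f rfl b) :
    a = b := by
  obtain ⟨S, hS, h'⟩ := O.locally_wedge
  refine sep S hS _ _ fun f hf => ?_
  obtain ⟨p, q, e⟩ := h' f hf
  exact h f p q e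

end TensorSec

open TensorSec

/-- The contracted product `P ∧ Q` of `(G, Π)`-torsors. -/
noncomputable def tensor (P Q : Torsor M X) : Torsor M X where
  carrier x := TensorSec P Q x
  res f _ _ h O := TensorSec.res f h O
  res_id h O := TensorSec.res_id h O
  res_res f g _ _ _ hf hg h O := TensorSec.res_res f g hf hg h O
  sep S hS O O' h := TensorSec.sep S hS O O' h
  glue S hS t ht := TensorSec.glue S hS t ht
  act O g := TensorSec.act O g
  act_res f _ _ h O g := TensorSec.res_act f h O g
  act_one O := local_rec' O _ _ fun f p q e => by
    rw [TensorSec.res_act, e, map_one, act_wedge, Q.act_one]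
  act_mul O g h := local_rec' O _ _ fun f p q e => by
    rw [TensorSec.res_act, TensorSec.res_act, TensorSec.res_act, e, map_mul, act_wedge, act_wedge,
      act_wedge, Q.act_mul]
  trans {U x} O O' := by
    have loc : ∀ {V : C} {y : X.obj (op V)} (p p' : P.carrier y) (q q' : Q.carrier y),
        ∃! g : Sec M.G V, TensorSec.act (wedge p q) g = wedge p' q' := by
      intro V y p p' q q'
      obtain ⟨a, rfl, -⟩ := P.trans p p'
      obtain ⟨b, hb, hb'⟩ := Q.trans q (Q.lact a q')
      refine ⟨b, ?_, fun c hc => hb' c ?_⟩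
      · change TensorSec.act _ _ = _
        rw [act_wedge, hb, wedge_eq_wedge]
        exact ⟨a, rfl, rfl⟩
      · change TensorSec.act _ _ = _ at hc
        rw [act_wedge, wedge_eq_wedge] at hc
        obtain ⟨a', h1, h2⟩ := hc
        rw [h2, act_inj h1]
    obtain ⟨S, hS, h⟩ := O.locally_wedge
    obtain ⟨S', hS', h'⟩ := O'.locally_wedge
    have loc' : ∀ {V : C} (f : V ⟶ U), (S ⊓ S') f → ∃! g : Sec M.G V,
        TensorSec.act (TensorSec.res f rfl O) g = TensorSec.res f rfl O' := by
      intro V f hf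
      obtain ⟨p, q, e⟩ := h f hf.1
      obtain ⟨p', q', e'⟩ := h' f hf.2
      rw [e, e']
      exact loc p p' q q'
    have hcov := J.intersection_covering hS hS'
    obtain ⟨g, hg⟩ := gglue M.G hcov (fun f hf => (loc' f hf).choose) (fun {V W} f hf k => by
      refine (loc' (k ≫ f) ((S ⊓ S').downward_closed hf k)).choose_spec.2 _ ?_
      have := congrArg (TensorSec.res k (rs_comp X f k x).symm) (loc' f hf).choose_spec.1
      dsimp only at this ⊢
      rwa [TensorSec.res_act, TensorSec.res_res f k rfl _ rfl,
        TensorSec.res_res f k rfl _ rfl] at this)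
    refine ⟨g, TensorSec.sep _ hcov _ _ fun f hf => ?_, fun g' hg' => gsep M.G hcov _ _
      fun f hf => ?_⟩
    · rw [TensorSec.res_act, hg f hf]
      exact (loc' f hf).choose_spec.1
    · rw [hg f hf]
      refine (loc' f hf).choose_spec.2 _ ?_
      dsimp only at hg' ⊢
      rw [← hg', TensorSec.res_act]
  inhab {U} x := by
    obtain ⟨S, hS, h⟩ := P.inhab x
    obtain ⟨S', hS', h'⟩ := Q.inhab x
    exact ⟨S ⊓ S', J.intersection_covering hS hS', fun f hf =>
      ⟨wedge (h f hf.1).some (h' f hf.2).some⟩⟩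
  j O := TensorSec.j O
  j_res f _ _ h O := TensorSec.j_res f h O
  j_act {U x} O g := by
    obtain ⟨S, hS, h⟩ := O.locally_wedge
    refine gsep M.Pi hS _ _ fun f hf => ?_
    obtain ⟨p, q, e⟩ := h f hf
    rw [← TensorSec.j_res f rfl, TensorSec.res_act, map_mul, ← TensorSec.j_res f rfl, e, act_wedge,
      j_wedge, j_wedge, Q.j_act, M.d_res, mul_assoc]

/-- The canonical map `P × Q ⟶ P ∧ Q`. -/
def wdg {U : C} {x : X.obj (op U)} (p : P.carrier x) (q : Q.carrier x) :
    (tensor P Q).carrier x := TensorSec.wedge p q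

theorem wdg_res {U V : C} (f : V ⟶ U) {x : X.obj (op U)} {y : X.obj (op V)} (hf : rs X f x = y)
    (p : P.carrier x) (q : Q.carrier x) :
    (tensor P Q).res f hf (wdg p q) = wdg (P.res f hf p) (Q.res f hf q) := res_wedge f hf p q

theorem wdg_act {U : C} {x : X.obj (op U)} (p : P.carrier x) (q : Q.carrier x) (g : Sec M.G U) :
    (tensor P Q).act (wdg p q) g = wdg p (Q.act q g) := act_wedge p q g

theorem wdg_j {U : C} {x : X.obj (op U)} (p : P.carrier x) (q : Q.carrier x) :
    (tensor P Q).j (wdg p q) = P.j p * Q.j q := j_wedge p q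

theorem wdg_bal {U : C} {x : X.obj (op U)} (p : P.carrier x) (q : Q.carrier x) (g : Sec M.G U) :
    wdg (P.act p g) q = wdg p (Q.lact g q) :=
  (wedge_eq_wedge.2 ⟨g, rfl, rfl⟩ : wedge p (Q.lact g q) = wedge (P.act p g) q).symm

theorem wdg_lact {U : C} {x : X.obj (op U)} (p : P.carrier x) (q : Q.carrier x) (g : Sec M.G U) :
    (tensor P Q).lact g (wdg p q) = wdg (P.lact g p) q := by
  rw [lact, wdg_j, wdg_act, M.act_mul, ← lact, ← wdg_bal, ← lact]

/-- An equality of sections of a sheaf may be checked locally, where a given section of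
a contracted product has the form `p ∧ q`. -/
theorem tensor_rec {U : C} {x : X.obj (op U)} (O : (tensor P Q).carrier x) (F : RelSheaf J X)
    (a b : F.carrier x) (h : ∀ {V : C} (f : V ⟶ U) (p : P.carrier (rs X f x))
      (q : Q.carrier (rs X f x)), (tensor P Q).res f rfl O = wdg p q →
      F.res f rfl a = F.res f rfl b) : a = b :=
  local_rec O F a b h

theorem tensor_ext {φ ψ : tensor P Q ⟶ R} (h : ∀ {U : C} {x : X.obj (op U)} (p : P.carrier x)
    (q : Q.carrier x), Hom.app φ (wdg p q) = Hom.app ψ (wdg p q)) : φ = ψ :=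
  hom_ext fun O => tensor_rec O R.toRelSheaf _ _ fun f p q e => by
    rw [← φ.app_res, ← ψ.app_res, e, h]

/-- The universal property of the contracted product. -/
noncomputable def desc (β : ∀ {U : C} {x : X.obj (op U)}, P.carrier x → Q.carrier x → R.carrier x)
    (hr : ∀ {U V : C} (f : V ⟶ U) {x : X.obj (op U)} {y : X.obj (op V)} (h : rs X f x = y)
      (p : P.carrier x) (q : Q.carrier x), R.res f h (β p q) = β (P.res f h p) (Q.res f h q))
    (hb : ∀ {U : C} {x : X.obj (op U)} (p : P.carrier x) (q : Q.carrier x) (g : Sec M.G U),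
      β (P.act p g) q = β p (Q.lact g q))
    (ha : ∀ {U : C} {x : X.obj (op U)} (p : P.carrier x) (q : Q.carrier x) (g : Sec M.G U),
      β p (Q.act q g) = R.act (β p q) g)
    (hj : ∀ {U : C} {x : X.obj (op U)} (p : P.carrier x) (q : Q.carrier x),
      R.j (β p q) = P.j p * Q.j q) : {φ : tensor P Q ⟶ R // ∀ {U : C} {x : X.obj (op U)}
        (p : P.carrier x) (q : Q.carrier x), Hom.app φ (wdg p q) = β p q} := by
  have ex : ∀ {U : C} {x : X.obj (op U)} (O : TensorSec P Q x), ∃ r : R.carrier x,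
      ∀ {V : C} (f : V ⟶ U) {y : X.obj (op V)} (hf : rs X f x = y)
      (p : P.carrier y) (q : Q.carrier y), O.mem f hf p q → R.res f hf r = β p q :=
    fun O => O.exists_lift R.toRelSheaf (fun _ _ _ p q => β p q)
      (fun f g _ _ hf hg h p q => hr g hg p q)
      (fun f _ hf p p' q q' h => by obtain ⟨g, rfl, rfl⟩ := h; exact (hb _ _ _).symm)
  have hw : ∀ {U : C} {x : X.obj (op U)} (p : P.carrier x) (q : Q.carrier x),
      (ex (wedge p q)).choose = β p q := by
    intro U x p q
    have := (ex (wedge p q)).choose_spec (𝟙 U) (rs_id X x) _ _ (Orb.refl _ _)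
    rwa [R.res_id, P.res_id, Q.res_id] at this
  have hres : ∀ {U V : C} (f : V ⟶ U) {x : X.obj (op U)} {y : X.obj (op V)} (h : rs X f x = y)
      (O : TensorSec P Q x), (ex (TensorSec.res f h O)).choose = R.res f h (ex O).choose := by
    intro U V f x y h O
    obtain ⟨S, hS, h'⟩ := (TensorSec.res f h O).inhab
    refine R.sep S hS _ _ fun {W} g hg => ?_
    obtain ⟨p, q, hm⟩ := h' g rfl hg
    have e : rs X (g ≫ f) x = rs X g y := by rw [rs_comp, h]
    rw [(ex (TensorSec.res f h O)).choose_spec g rfl p q hm, R.res_res f g h rfl e,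
      (ex O).choose_spec (g ≫ f) e p q hm]
  have hact : ∀ {U : C} {x : X.obj (op U)} (O : TensorSec P Q x) (g : Sec M.G U),
      (ex (TensorSec.act O g)).choose = R.act (ex O).choose g := by
    intro U x O g
    refine local_rec O R.toRelSheaf _ _ fun f p q e => ?_
    rw [← hres f rfl, TensorSec.res_act, R.act_res, ← hres f rfl, e, act_wedge, hw, hw, ha]
  have hjj : ∀ {U : C} {x : X.obj (op U)} (O : TensorSec P Q x),
      R.j (ex O).choose = TensorSec.j O := by
    intro U x O
    obtain ⟨S, hS, h⟩ := O.locally_wedge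
    refine gsep M.Pi hS _ _ fun f hf => ?_
    obtain ⟨p, q, e⟩ := h f hf
    rw [← R.j_res f rfl, ← hres f rfl, ← TensorSec.j_res f rfl, e, hw, hj, j_wedge]
  exact ⟨⟨fun O => (ex O).choose, fun f _ _ h O => hres f h O, fun O g => hact O g,
    fun O => hjj O⟩, fun p q => hw p q⟩

end Torsor

namespace Torsor
variable {M : BraidedCrossedModule J} {X : Cᵒᵖ ⥤ Type u}

/-- The unit `(G, e)`: the trivial torsor with structural map `∂`. -/
def unit (M : BraidedCrossedModule J) (X : Cᵒᵖ ⥤ Type u) : Torsor M X where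
  toRelSheaf := RelSheaf.ofGrp M.G X
  act {U _} (a : Sec M.G U) g := (a * g : Sec M.G U)
  act_res f _ _ _ a g := map_mul (gres M.G f) a g
  act_one {U _} a := mul_one (a : Sec M.G U)
  act_mul {U _} a g h := (mul_assoc (a : Sec M.G U) g h).symm
  trans {U _} (a : Sec M.G U) (b : Sec M.G U) :=
    ⟨a⁻¹ * b, mul_inv_cancel_left a b, fun _ hc => eq_inv_mul_of_mul_eq hc⟩
  inhab _ := ⟨⊤, J.top_mem _, fun {V} _ _ => ⟨(1 : Sec M.G V)⟩⟩
  j {U _} (a : Sec M.G U) := M.d a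
  j_res f _ _ _ a := M.d_res f a
  j_act {U _} (a : Sec M.G U) g := map_mul M.d a g

theorem unit_lact {U : C} {x : X.obj (op U)} (g : Sec M.G U) (a : (unit M X).carrier x) :
    (unit M X).lact g a = HMul.hMul (α := Sec M.G U) (β := Sec M.G U) g a := by
  have : ∀ b : Sec M.G U, b * M.act g (M.d b) = g * b := fun b => by rw [M.act_d]; group
  exact this a

variable {P Q R T P' Q' : Torsor M X}

/-- The contracted product of morphisms. -/
noncomputable def tensorMap (φ : P ⟶ P') (ψ : Q ⟶ Q') : tensor P Q ⟶ tensor P' Q' :=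
  (desc (R := tensor P' Q') (fun p q => wdg (Hom.app φ p) (Hom.app ψ q))
    (fun f _ _ h p q => by rw [wdg_res, φ.app_res, ψ.app_res])
    (fun p q g => by rw [φ.app_act, wdg_bal, app_lact])
    (fun p q g => by rw [ψ.app_act, wdg_act])
    (fun p q => by rw [wdg_j, φ.j_app, ψ.j_app])).1

theorem tensorMap_wdg (φ : P ⟶ P') (ψ : Q ⟶ Q') {U : C} {x : X.obj (op U)} (p : P.carrier x)
    (q : Q.carrier x) :
    Hom.app (tensorMap φ ψ) (wdg p q) = wdg (Hom.app φ p) (Hom.app ψ q) :=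
  (desc (R := tensor P' Q') (fun p q => wdg (Hom.app φ p) (Hom.app ψ q)) _ _ _ _).2 p q

/-- For a section `r` of `R` over `x`, the map `p ∧ q ↦ p ∧ (q ∧ r)`. -/
theorem exists_assoc {U : C} {x : X.obj (op U)} (O : (tensor P Q).carrier x) (r : R.carrier x) :
    ∃ t : (tensor P (tensor Q R)).carrier x, ∀ {V : C} (f : V ⟶ U) {y : X.obj (op V)}
      (hf : rs X f x = y) (p : P.carrier y) (q : Q.carrier y),
      (tensor P Q).res f hf O = wdg p q →
      (tensor P (tensor Q R)).res f hf t = wdg p (wdg q (R.res f hf r)) := by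
  obtain ⟨t, ht⟩ := TensorSec.exists_lift (P := P) (Q := Q) O (tensor P (tensor Q R)).toRelSheaf
    (fun f _ hf p q => wdg p (wdg q (R.res f hf r)))
    (fun f g _ _ hf hg h p q => by rw [wdg_res, wdg_res, R.res_res f g hf hg h])
    (fun f _ hf p p' q q' h => by
      obtain ⟨g, rfl, rfl⟩ := h
      rw [wdg_bal, wdg_lact])
  refine ⟨t, fun {V} f y hf p q e => ht f hf p q ?_⟩
  have h1 : (TensorSec.wedge p q).mem (𝟙 V) (rs_id X y) p q := by
    change Orb P Q _ _ _ _
    rw [P.res_id, Q.res_id]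
    exact Orb.refl _ _
  have e' : TensorSec.res f hf (show TensorSec P Q x from O) = TensorSec.wedge p q := e
  rw [← e'] at h1
  exact TensorSec.mem_congr _ (Category.id_comp f) h1

/-- The map `(p ∧ q, r) ↦ p ∧ (q ∧ r)`. -/
noncomputable def assocFun {U : C} {x : X.obj (op U)} (O : (tensor P Q).carrier x)
    (r : R.carrier x) : (tensor P (tensor Q R)).carrier x := (exists_assoc O r).choose

theorem assocFun_wdg {U : C} {x : X.obj (op U)} (p : P.carrier x) (q : Q.carrier x)
    (r : R.carrier x) : assocFun (wdg p q) r = wdg p (wdg q r) := by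
  have := (exists_assoc (wdg p q) r).choose_spec (𝟙 U) (rs_id X x) p q
    ((tensor P Q).res_id _ _)
  rwa [(tensor P (tensor Q R)).res_id, R.res_id] at this

theorem assocFun_res {U V : C} (f : V ⟶ U) {x : X.obj (op U)} {y : X.obj (op V)}
    (h : rs X f x = y) (O : (tensor P Q).carrier x) (r : R.carrier x) :
    (tensor P (tensor Q R)).res f h (assocFun O r) =
      assocFun ((tensor P Q).res f h O) (R.res f h r) := by
  refine tensor_rec ((tensor P Q).res f h O) (tensor P (tensor Q R)).toRelSheaf _ _
    fun {W} g p q e => ?_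
  have e1 : rs X (g ≫ f) x = rs X g y := by rw [rs_comp, h]
  have e2 : (tensor P Q).res (g ≫ f) e1 O = wdg p q := by
    rw [← (tensor P Q).res_res f g h rfl e1, e]
  unfold assocFun
  rw [(exists_assoc ((tensor P Q).res f h O) (R.res f h r)).choose_spec g rfl p q e,
    (tensor P (tensor Q R)).res_res f g h rfl e1,
    (exists_assoc O r).choose_spec (g ≫ f) e1 p q e2, R.res_res f g h rfl e1]

/-- The associativity morphism `(p ∧ q) ∧ r ↦ p ∧ (q ∧ r)`. -/
noncomputable def assocSub (P Q R : Torsor M X) :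
    {φ : tensor (tensor P Q) R ⟶ tensor P (tensor Q R) // ∀ {U : C} {x : X.obj (op U)}
        (O : (tensor P Q).carrier x) (r : R.carrier x), Hom.app φ (wdg O r) = assocFun O r} :=
  desc (P := tensor P Q) (Q := R) (R := tensor P (tensor Q R)) (fun O r => assocFun O r)
    (fun f _ _ h O r => assocFun_res f h O r)
    (fun O r g => tensor_rec O (tensor P (tensor Q R)).toRelSheaf _ _ fun f p q e => by
      rw [assocFun_res, assocFun_res, (tensor P Q).act_res, e, wdg_act, assocFun_wdg, lact_res,
        assocFun_wdg, wdg_bal])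
    (fun O r g => tensor_rec O (tensor P (tensor Q R)).toRelSheaf _ _ fun f p q e => by
      rw [assocFun_res, (tensor P (tensor Q R)).act_res, assocFun_res, e, R.act_res, assocFun_wdg,
        assocFun_wdg, wdg_act, wdg_act])
    (fun O r => tensor_rec O (RelSheaf.ofGrp M.Pi X) _ _ fun f p q e => by
      change gres M.Pi f _ = gres M.Pi f _
      rw [← (tensor P (tensor Q R)).j_res f rfl, map_mul, ← (tensor P Q).j_res f rfl,
        ← R.j_res f rfl, assocFun_res, e, assocFun_wdg, wdg_j, wdg_j, wdg_j, mul_assoc])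

noncomputable def assoc (P Q R : Torsor M X) :
    tensor (tensor P Q) R ⟶ tensor P (tensor Q R) := (assocSub P Q R).1

theorem assoc_wdg {U : C} {x : X.obj (op U)} (p : P.carrier x) (q : Q.carrier x)
    (r : R.carrier x) : Hom.app (assoc P Q R) (wdg (wdg p q) r) = wdg p (wdg q r) :=
  ((assocSub P Q R).2 _ _).trans (assocFun_wdg p q r)

/-- The map `(g, p) ↦ g p`. -/
noncomputable def leftUnit (P : Torsor M X) : tensor (unit M X) P ⟶ P :=
  (desc (P := unit M X) (Q := P) (R := P) (fun {U _} (a : Sec M.G U) p => P.lact a p)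
    (fun f _ _ h a p => lact_res f h a p)
    (fun _ _ _ => lact_mul _ _ _)
    (fun _ _ _ => lact_act _ _ _)
    (fun _ _ => j_lact _ _)).1

theorem leftUnit_wdg {U : C} {x : X.obj (op U)} (a : Sec M.G U) (p : P.carrier x) :
    Hom.app (leftUnit P) (wdg (P := unit M X) a p) = P.lact a p :=
  (desc (P := unit M X) (Q := P) (R := P) (fun {U _} (a : Sec M.G U) p => P.lact a p) _ _ _ _).2 a p

/-- The map `(p, g) ↦ p g`. -/
noncomputable def rightUnit (P : Torsor M X) : tensor P (unit M X) ⟶ P :=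
  (desc (P := P) (Q := unit M X) (R := P) (fun {U _} p (a : Sec M.G U) => P.act p a)
    (fun f _ _ h p a => P.act_res f h p a)
    (fun {U _} p a g => by
      rw [unit_lact]; exact (P.act_mul p g a).symm)
    (fun _ _ _ => P.act_mul _ _ _)
    (fun _ _ => P.j_act _ _)).1

theorem rightUnit_wdg {U : C} {x : X.obj (op U)} (a : Sec M.G U) (p : P.carrier x) :
    Hom.app (rightUnit P) (wdg (Q := unit M X) p a) = P.act p a :=
  (desc (P := P) (Q := unit M X) (R := P) (fun {U _} p (a : Sec M.G U) => P.act p a) _ _ _ _).2 p a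

/-- The braiding `p ∧ q ↦ (q ∧ p) {j(p), j(q)}⁻¹`. -/
noncomputable def braid (P Q : Torsor M X) : tensor P Q ⟶ tensor Q P :=
  (desc (P := P) (Q := Q) (R := tensor Q P)
    (fun p q => (tensor Q P).act (wdg q p) (M.br (P.j p) (Q.j q))⁻¹)
    (fun f _ _ h p q => by
      rw [(tensor Q P).act_res, wdg_res, map_inv, M.br_res, P.j_res, Q.j_res])
    (fun p q g => by
      have hl : Q.lact g q = Q.act q (M.act g (Q.j q)) := rfl
      rw [P.j_act, wdg_act, wdg_act, M.mul_br, M.d_br_left, M.act_d, hl, Q.j_act, wdg_bal,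
        lact_act, lact, ← P.act_mul, ← P.act_mul, M.br_mul, M.br_d, M.act_d]
      congr 2; group)
    (fun p q g => by
      rw [wdg_act, wdg_act, wdg_act, wdg_bal, Q.j_act, lact_act, lact, ← P.act_mul, ← P.act_mul,
        M.br_mul, M.br_d, M.act_d]
      congr 2; group)
    (fun p q => by
      rw [(tensor Q P).j_act, wdg_j, map_inv, M.d_br]; group)).1

theorem braid_wdg {U : C} {x : X.obj (op U)} (p : P.carrier x) (q : Q.carrier x) :
    Hom.app (braid P Q) (wdg p q) = (tensor Q P).act (wdg q p) (M.br (P.j p) (Q.j q))⁻¹ :=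
  (desc (P := P) (Q := Q) (R := tensor Q P)
    (fun p q => (tensor Q P).act (wdg q p) (M.br (P.j p) (Q.j q))⁻¹) _ _ _ _).2 p q

theorem tensor_ext₃ {φ ψ : tensor (tensor P Q) R ⟶ T} (h : ∀ {U : C} {x : X.obj (op U)}
    (p : P.carrier x) (q : Q.carrier x) (r : R.carrier x),
    Hom.app φ (wdg (wdg p q) r) = Hom.app ψ (wdg (wdg p q) r)) : φ = ψ :=
  tensor_ext fun O r => tensor_rec O T.toRelSheaf _ _ fun f p q e => by
    rw [← φ.app_res, ← ψ.app_res, wdg_res, e, h]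

theorem tensor_ext₃' {φ ψ : tensor P (tensor Q R) ⟶ T} (h : ∀ {U : C} {x : X.obj (op U)}
    (p : P.carrier x) (q : Q.carrier x) (r : R.carrier x),
    Hom.app φ (wdg p (wdg q r)) = Hom.app ψ (wdg p (wdg q r))) : φ = ψ :=
  tensor_ext fun p O => tensor_rec O T.toRelSheaf _ _ fun f q r e => by
    rw [← φ.app_res, ← ψ.app_res, wdg_res, e, h]

theorem tensor_ext₄ {φ ψ : tensor (tensor (tensor P Q) R) P' ⟶ T} (h : ∀ {U : C} {x : X.obj (op U)}
    (p : P.carrier x) (q : Q.carrier x) (r : R.carrier x) (s : P'.carrier x),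
    Hom.app φ (wdg (wdg (wdg p q) r) s) = Hom.app ψ (wdg (wdg (wdg p q) r) s)) : φ = ψ :=
  tensor_ext₃ fun O r s => tensor_rec O T.toRelSheaf _ _ fun f p q e => by
    rw [← φ.app_res, ← ψ.app_res, wdg_res, wdg_res, e, h]

noncomputable instance : MonoidalCategoryStruct (Torsor M X) where
  tensorObj P Q := tensor P Q
  tensorHom φ ψ := tensorMap φ ψ
  whiskerLeft P _ _ ψ := tensorMap (𝟙 P) ψ
  whiskerRight φ Q := tensorMap φ (𝟙 Q)
  tensorUnit := unit M X
  associator P Q R := isoOf (assoc P Q R)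
  leftUnitor P := isoOf (leftUnit P)
  rightUnitor P := isoOf (rightUnit P)

open MonoidalCategory

theorem tensorHom_wdg (φ : P ⟶ P') (ψ : Q ⟶ Q') {U : C} {x : X.obj (op U)} (p : P.carrier x)
    (q : Q.carrier x) : Hom.app (φ ⊗ₘ ψ) (wdg p q) = wdg (Hom.app φ p) (Hom.app ψ q) :=
  tensorMap_wdg φ ψ p q

theorem whiskerLeft_wdg (P : Torsor M X) (ψ : Q ⟶ Q') {U : C} {x : X.obj (op U)} (p : P.carrier x)
    (q : Q.carrier x) : Hom.app (P ◁ ψ) (wdg p q) = wdg p (Hom.app ψ q) :=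
  tensorMap_wdg (𝟙 P) ψ p q

theorem whiskerRight_wdg (φ : P ⟶ P') (Q : Torsor M X) {U : C} {x : X.obj (op U)}
    (p : P.carrier x) (q : Q.carrier x) : Hom.app (φ ▷ Q) (wdg p q) = wdg (Hom.app φ p) q :=
  tensorMap_wdg φ (𝟙 Q) p q

theorem associator_wdg {U : C} {x : X.obj (op U)} (p : P.carrier x) (q : Q.carrier x)
    (r : R.carrier x) : Hom.app (α_ P Q R).hom (wdg (wdg p q) r) = wdg p (wdg q r) :=
  assoc_wdg p q r

theorem associator_inv_wdg {U : C} {x : X.obj (op U)} (p : P.carrier x) (q : Q.carrier x)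
    (r : R.carrier x) : Hom.app (α_ P Q R).inv (wdg p (wdg q r)) = wdg (wdg p q) r :=
  app_inj (α_ P Q R).hom (by
    rw [associator_wdg, ← comp_app, Iso.inv_hom_id]; rfl)

theorem leftUnitor_wdg {U : C} {x : X.obj (op U)} (a : (unit M X).carrier x) (p : P.carrier x) :
    Hom.app (λ_ P).hom (wdg (P := unit M X) a p) = P.lact (U := U) a p := leftUnit_wdg a p

theorem rightUnitor_wdg {U : C} {x : X.obj (op U)} (p : P.carrier x) (a : (unit M X).carrier x) :
    Hom.app (ρ_ P).hom (wdg (Q := unit M X) p a) = P.act (U := U) p a := rightUnit_wdg a p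

noncomputable instance : MonoidalCategory (Torsor M X) := .ofTensorHom
  (id_tensorHom_id := fun P Q => tensor_ext fun p q => by
    rw [tensorHom_wdg]; rfl)
  (id_tensorHom := fun _ _ _ _ => rfl)
  (tensorHom_id := fun _ _ => rfl)
  (tensorHom_comp_tensorHom := fun f g h k => tensor_ext fun p q => by
    rw [comp_app, tensorHom_wdg, tensorHom_wdg, tensorHom_wdg]; rfl)
  (associator_naturality := fun f g h => tensor_ext₃ fun p q r => by
    rw [comp_app, comp_app, tensorHom_wdg, tensorHom_wdg, associator_wdg, associator_wdg,
      tensorHom_wdg, tensorHom_wdg])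
  (leftUnitor_naturality := fun f => tensor_ext fun a p => by
    rw [comp_app, comp_app, tensorHom_wdg, leftUnitor_wdg, leftUnitor_wdg]
    exact (app_lact f a p).symm)
  (rightUnitor_naturality := fun f => tensor_ext fun p a => by
    rw [comp_app, comp_app, tensorHom_wdg, rightUnitor_wdg, rightUnitor_wdg]
    exact (Hom.app_act f p a).symm)
  (pentagon := fun P Q R T => tensor_ext₄ fun p q r s => by
    rw [comp_app, comp_app, comp_app, tensorHom_wdg, associator_wdg, associator_wdg,
      associator_wdg, associator_wdg, tensorHom_wdg, associator_wdg]; rfl)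
  (triangle := fun P Q => tensor_ext₃ fun p a q => by
    rw [comp_app, associator_wdg, tensorHom_wdg, tensorHom_wdg, leftUnitor_wdg, rightUnitor_wdg]
    exact (wdg_bal p q a).symm)

theorem tensor_act {U : C} {x : X.obj (op U)} (p : P.carrier x) (q : Q.carrier x)
    (g : Sec M.G U) : wdg (P.act p g) q = (tensor P Q).act (wdg p q) (M.act g (Q.j q)) := by
  rw [wdg_bal, lact, wdg_act]

noncomputable instance : BraidedCategory (Torsor M X) where
  braiding P Q := isoOf (braid P Q)
  braiding_naturality_right P Q R f := tensor_ext fun p q => by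
    rw [comp_app, comp_app, whiskerLeft_wdg]
    change Hom.app (braid P R) _ = Hom.app _ (Hom.app (braid P Q) _)
    rw [braid_wdg, braid_wdg, Hom.app_act, whiskerRight_wdg, f.j_app]
  braiding_naturality_left {P Q} f R := tensor_ext fun p q => by
    rw [comp_app, comp_app, whiskerRight_wdg]
    change Hom.app (braid Q R) _ = Hom.app _ (Hom.app (braid P R) _)
    rw [braid_wdg, braid_wdg, Hom.app_act, whiskerLeft_wdg, f.j_app]
  hexagon_forward P Q R := tensor_ext₃ fun p q r => by
    rw [comp_app, comp_app, comp_app, comp_app, associator_wdg, whiskerRight_wdg]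
    change Hom.app _ (Hom.app (braid P (tensor Q R)) _) =
      Hom.app (Q ◁ braid P R) (Hom.app _ (wdg (Hom.app (braid P Q) _) _))
    rw [braid_wdg, braid_wdg, Hom.app_act, associator_wdg, tensor_act, Hom.app_act, associator_wdg,
      Hom.app_act, whiskerLeft_wdg, braid_wdg, wdg_j, ← wdg_act, M.br_mul, mul_inv_rev, M.inv_act]
    exact Torsor.act_mul _ _ _ _
  hexagon_reverse P Q R := tensor_ext₃' fun p q r => by
    rw [comp_app, comp_app, comp_app, comp_app, associator_inv_wdg, whiskerLeft_wdg]
    change Hom.app _ (Hom.app (braid (tensor P Q) R) _) =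
      Hom.app (braid P R ▷ Q) (Hom.app _ (wdg _ (Hom.app (braid Q R) _)))
    rw [braid_wdg, braid_wdg, Hom.app_act, associator_inv_wdg, ← wdg_act, Hom.app_act,
      associator_inv_wdg, Hom.app_act, whiskerRight_wdg, braid_wdg, wdg_j, tensor_act,
      M.mul_br, mul_inv_rev, M.inv_act]
    exact Torsor.act_mul _ _ _ _

theorem braiding_wdg {U : C} {x : X.obj (op U)} (p : P.carrier x) (q : Q.carrier x) :
    Hom.app (β_ P Q).hom (wdg p q) = (tensor Q P).act (wdg q p) (M.br (P.j p) (Q.j q))⁻¹ :=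
  braid_wdg p q

end Torsor

namespace Torsor
variable {M : BraidedCrossedModule J} {X Y Z : Cᵒᵖ ⥤ Type u}

theorem nat_app (φ : X ⟶ Y) {U V : C} (f : V ⟶ U) {x : X.obj (op U)} {y : X.obj (op V)}
    (h : rs X f x = y) : rs Y f (φ.app _ x) = φ.app _ y := by
  rw [← h]; exact (NatTrans.naturality_apply φ f.op x).symm

/-- The pullback of a torsor along a morphism of presheaves. -/
def pullObj (φ : X ⟶ Y) (P : Torsor M Y) : Torsor M X where
  carrier x := P.carrier (φ.app _ x)
  res f _ _ h p := P.res f (nat_app φ f h) p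
  res_id _ p := P.res_id _ p
  res_res f g _ _ _ _ _ _ p := P.res_res f g _ _ _ p
  sep {U x} S hS p q h := P.sep S hS p q fun {V} f hf => by
    have h1 := h f hf
    have key : ∀ {y : Y.obj (op V)} (e : rs Y f (φ.app _ x) = y), P.res f e p = P.res f e q →
        P.res f rfl p = P.res f rfl q := by
      intro y e he; subst e; exact he
    exact key _ h1
  glue {U x} S hS t ht := by
    have e1 : ∀ {V : C} (f : V ⟶ U), rs Y f (φ.app _ x) = φ.app _ (rs X f x) :=
      fun f => nat_app φ f rfl
    have e2 : ∀ {V : C} (f : V ⟶ U), rs Y (𝟙 V) (φ.app _ (rs X f x)) = rs Y f (φ.app _ x) :=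
      fun f => by rw [rs_id, e1]
    obtain ⟨p, hp⟩ := P.glue (x := φ.app _ x) S hS (fun f hf => P.res (𝟙 _) (e2 f) (t f hf))
      (fun {V W} f hf g => by
        have h1 := ht f hf g
        rw [← h1, P.res_res (𝟙 V) g (e2 f) _ (by rw [Category.comp_id, rs_comp, e1]),
          P.res_res g (𝟙 W) _ _ (by rw [Category.id_comp, ← e1, ← rs_comp])]
        congr 1
        simp)
    refine ⟨p, fun {V} f hf => ?_⟩
    have h2 : P.res (𝟙 V) (by rw [rs_id, e1]) (P.res f rfl p) = t f hf := by
      rw [hp f hf, P.res_res (𝟙 V) (𝟙 V) _ _ (by simp [rs_id])]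
      have : ∀ (k : V ⟶ V) (hk : k = 𝟙 V) (hh : rs Y k (φ.app _ (rs X f x)) = _),
        P.res k hh (t f hf) = t f hf := by
        intro k hk hh; subst hk; exact P.res_id _ _
      exact this _ (Category.comp_id _) _
    rw [← h2, P.res_res f (𝟙 V) rfl _ (by rw [Category.id_comp, e1])]
    congr 1
    simp
  act p g := P.act p g
  act_res f _ _ _ p g := P.act_res f _ p g
  act_one p := P.act_one p
  act_mul p g h := P.act_mul p g h
  trans p q := P.trans p q
  inhab {U} x := by
    obtain ⟨S, hS, h⟩ := P.inhab (φ.app _ x)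
    refine ⟨S, hS, fun {V} f hf => ?_⟩
    obtain ⟨p⟩ := h f hf
    have e : rs Y (𝟙 V) (rs Y f (φ.app _ x)) = φ.app _ (rs X f x) := by
      rw [rs_id]; exact nat_app φ f rfl
    exact ⟨P.res (𝟙 V) e p⟩
  j p := P.j p
  j_res f _ _ _ p := P.j_res f _ p
  j_act p g := P.j_act p g

/-- The pullback functor on torsors. -/
def pull (φ : X ⟶ Y) : Torsor M Y ⥤ Torsor M X where
  obj P := pullObj φ P
  map {P Q} u := show Hom (pullObj φ P) (pullObj φ Q) from
    { app := fun p => Hom.app u p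
      app_res := fun f _ _ _ p => Hom.app_res u f _ p
      app_act := fun p g => Hom.app_act u p g
      j_app := fun p => Hom.j_app u p }

/-- The canonical isomorphism between pullbacks along equal morphisms. -/
def pullCongr {φ ψ : X ⟶ Y} (h : φ = ψ) (P : Torsor M Y) : (pull φ).obj P ⟶ (pull ψ).obj P :=
  eqToHom (by rw [h])

theorem pull_id : pull (M := M) (𝟙 X) = 𝟭 _ := rfl
theorem pull_comp (φ : X ⟶ Y) (ψ : Y ⟶ Z) : pull (M := M) (φ ≫ ψ) = pull ψ ⋙ pull φ := rfl
end Torsor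

open MonoidalCategory

namespace Torsor
variable {M : BraidedCrossedModule J} {X Y : Cᵒᵖ ⥤ Type u}

/-- The canonical morphism `φ^* P ∧ φ^* Q ⟶ φ^* (P ∧ Q)`, `p ∧ q ↦ p ∧ q`. -/
noncomputable def pullTensorSub (φ : X ⟶ Y) (P Q : Torsor M Y) :
    {u : (pull φ).obj P ⊗ (pull φ).obj Q ⟶ (pull φ).obj (P ⊗ Q) //
      ∀ {U : C} {x : X.obj (op U)} (p : P.carrier (φ.app _ x)) (q : Q.carrier (φ.app _ x)),
        Hom.app u (wdg (P := pullObj φ P) (Q := pullObj φ Q) (x := x) p q) =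
          wdg (P := P) (Q := Q) p q} :=
  desc (P := pullObj φ P) (Q := pullObj φ Q) (R := pullObj φ (tensor P Q))
    (fun p q => wdg (P := P) (Q := Q) p q) (fun f _ _ _ p q => wdg_res (P := P) (Q := Q) f _ p q)
    (fun p q g => wdg_bal (P := P) (Q := Q) p q g)
    (fun p q g => (wdg_act (P := P) (Q := Q) p q g).symm) (fun p q => wdg_j (P := P) (Q := Q) p q)

noncomputable def pullTensor (φ : X ⟶ Y) (P Q : Torsor M Y) :
    (pull φ).obj P ⊗ (pull φ).obj Q ⟶ (pull φ).obj (P ⊗ Q) := (pullTensorSub φ P Q).1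

theorem pullTensor_wdg (φ : X ⟶ Y) (P Q : Torsor M Y) {U : C} {x : X.obj (op U)}
    (p : P.carrier (φ.app _ x)) (q : Q.carrier (φ.app _ x)) :
    Hom.app (pullTensor φ P Q) (wdg (P := pullObj φ P) (Q := pullObj φ Q) (x := x) p q) =
      wdg (P := P) (Q := Q) p q := (pullTensorSub φ P Q).2 p q

theorem pull_map_app (φ : X ⟶ Y) {P Q : Torsor M Y} (u : P ⟶ Q) {U : C} {x : X.obj (op U)}
    (p : P.carrier (φ.app _ x)) :
    Hom.app ((pull φ).map u) (x := x) p = Hom.app u p := rfl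

/-- The canonical morphism from the unit to its pullback. -/
def pullUnit (φ : X ⟶ Y) : 𝟙_ (Torsor M X) ⟶ (pull φ).obj (𝟙_ (Torsor M Y)) :=
  show Hom (unit M X) (pullObj φ (unit M Y)) from
    { app := fun a => a
      app_res := fun _ _ _ _ _ => rfl
      app_act := fun _ _ => rfl
      j_app := fun _ => rfl }

noncomputable instance (φ : X ⟶ Y) : (pull (M := M) φ).Monoidal :=
  Functor.CoreMonoidal.toMonoidal
    { εIso := isoOf (pullUnit φ)
      μIso := fun P Q => isoOf (pullTensor φ P Q)
      μIso_hom_natural_left := fun {P P'} f Q => tensor_ext fun p q => by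
        rw [comp_app, comp_app, isoOf_hom, isoOf_hom, whiskerRight_wdg]
        erw [pullTensor_wdg, pullTensor_wdg]
        exact (whiskerRight_wdg (P := P) (P' := P') f Q p q).symm
      μIso_hom_natural_right := fun {P P'} Q f => tensor_ext fun p q => by
        rw [comp_app, comp_app, isoOf_hom, isoOf_hom, whiskerLeft_wdg]
        erw [pullTensor_wdg, pullTensor_wdg]
        exact (whiskerLeft_wdg (Q := P) (Q' := P') Q f p q).symm
      associativity := fun P Q R => tensor_ext₃ fun p q r => by
        rw [comp_app, comp_app, comp_app, comp_app, isoOf_hom, isoOf_hom, isoOf_hom, isoOf_hom,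
          whiskerRight_wdg, associator_wdg, whiskerLeft_wdg]
        erw [pullTensor_wdg, pullTensor_wdg, pullTensor_wdg, pullTensor_wdg]
        exact associator_wdg (P := P) (Q := Q) (R := R) p q r
      left_unitality := fun P => tensor_ext fun a p => by
        rw [comp_app, comp_app, isoOf_hom, isoOf_hom, whiskerRight_wdg, leftUnitor_wdg]
        erw [pullTensor_wdg]
        exact (leftUnitor_wdg (P := P) a p).symm
      right_unitality := fun P => tensor_ext fun p a => by
        rw [comp_app, comp_app, isoOf_hom, isoOf_hom, whiskerLeft_wdg, rightUnitor_wdg]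
        erw [pullTensor_wdg]
        exact (rightUnitor_wdg (P := P) p a).symm }

end Torsor

/-- The presheaf `S × H × K`. -/
def base (S : Cᵒᵖ ⥤ Type u) (H K : Sheaf J GrpCat.{u}) : Cᵒᵖ ⥤ Type u where
  obj U := S.obj U × H.obj.obj U × K.obj.obj U
  map f := TypeCat.ofHom fun x => (S.map f x.1, (H.obj.map f).hom x.2.1, (K.obj.map f).hom x.2.2)

/-- The morphism `S' × H × K ⟶ S × H × K` induced by `S' ⟶ S`. -/
def baseMap {S' S : Cᵒᵖ ⥤ Type u} (a : S' ⟶ S) (H K : Sheaf J GrpCat.{u}) :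
    base S' H K ⟶ base S H K where
  app U := TypeCat.ofHom fun x => (a.app U x.1, x.2)
  naturality U V f := by
    ext x
    have := NatTrans.naturality_apply a f x.1
    exact Prod.ext this rfl

/-- A point of `S × H × K` with values in `U`. -/
@[ext] structure Pt (S : Cᵒᵖ ⥤ Type u) (H K : Sheaf J GrpCat.{u}) (U : C) where
  s : yoneda.obj U ⟶ S
  h : Sec H U
  k : Sec K U

namespace Pt
variable {S' S : Cᵒᵖ ⥤ Type u} {H K : Sheaf J GrpCat.{u}} {U V W : C}

/-- The restriction of a point along `f : V ⟶ U`. -/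
def restrict (x : Pt S H K U) (f : V ⟶ U) : Pt S H K V where
  s := yoneda.map f ≫ x.s
  h := gres H f x.h
  k := gres K f x.k

/-- The image of a point under `S' ⟶ S`. -/
def push (a : S' ⟶ S) (x : Pt S' H K U) : Pt S H K U where
  s := x.s ≫ a
  h := x.h
  k := x.k

/-- The morphism `U ⟶ S × H × K` classifying a point. -/
def map (x : Pt S H K U) : yoneda.obj U ⟶ base S H K where
  app V := TypeCat.ofHom fun w => (x.s.app V w, (H.obj.map w.op).hom x.h, (K.obj.map w.op).hom x.k)
  naturality V W f := by
    ext w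
    have := NatTrans.naturality_apply x.s f w
    refine Prod.ext this (Prod.ext ?_ ?_)
    · exact gres_comp H w f.unop x.h
    · exact gres_comp K w f.unop x.k

theorem map_restrict {x : Pt S H K U} {y : Pt S H K V} {f : V ⟶ U} (h : x.restrict f = y) :
    yoneda.map f ≫ x.map = y.map := by
  subst h
  ext W w
  refine Prod.ext rfl (Prod.ext ?_ ?_)
  · exact gres_comp H f w x.h
  · exact gres_comp K f w x.k

theorem map_push (a : S' ⟶ S) (x : Pt S' H K U) : x.map ≫ baseMap a H K = (push a x).map := rfl

theorem push_restrict {a : S' ⟶ S} {x : Pt S' H K U} {y : Pt S' H K V} {f : V ⟶ U}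
    (h : x.restrict f = y) : (push a x).restrict f = push a y := by
  subst h; rfl

/-- The relation `z = x y` for points `x = (s, h, k)`, `y = (s, h', k)`, `z = (s, h h', k)`. -/
structure Mul₁ (x y z : Pt S H K U) : Prop where
  s : y.s = x.s
  s' : z.s = x.s
  h : z.h = x.h * y.h
  k : y.k = x.k
  k' : z.k = x.k

/-- The relation `z = x y` for points `x = (s, h, k)`, `y = (s, h, k')`, `z = (s, h, k k')`. -/
structure Mul₂ (x y z : Pt S H K U) : Prop where
  s : y.s = x.s
  s' : z.s = x.s
  h : y.h = x.h
  h' : z.h = x.h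
  k : z.k = x.k * y.k

theorem Mul₁.push {x y z : Pt S' H K U} (m : Mul₁ x y z) (a : S' ⟶ S) :
    Mul₁ (x.push a) (y.push a) (z.push a) :=
  ⟨by simp [Pt.push, m.s], by simp [Pt.push, m.s'], m.h, m.k, m.k'⟩

theorem Mul₂.push {x y z : Pt S' H K U} (m : Mul₂ x y z) (a : S' ⟶ S) :
    Mul₂ (x.push a) (y.push a) (z.push a) :=
  ⟨by simp [Pt.push, m.s], by simp [Pt.push, m.s'], m.h, m.h', m.k⟩

end Pt

open Biext4.Torsor

/-- The restriction functor `𝒢(U) ⥤ 𝒢(V)` of the stack `𝒢` of `(G, Π)`-torsors. -/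
abbrev rst {M : BraidedCrossedModule J} {U V : C} (f : V ⟶ U) :
    Torsor M (yoneda.obj U) ⥤ Torsor M (yoneda.obj V) := pull (yoneda.map f)

/-- The canonical isomorphism between restriction along an identity and the identity. -/
def rstId {M : BraidedCrossedModule J} {U : C} (P : Torsor M (yoneda.obj U)) :
    (rst (𝟙 U)).obj P ⟶ P := pullCongr (yoneda.map_id U) P

/-- The canonical isomorphism between restriction along a composite and the composite of the
restrictions. -/
def rstComp {M : BraidedCrossedModule J} {U V W : C} (f : V ⟶ U) (g : W ⟶ V)
    (P : Torsor M (yoneda.obj U)) : (rst (g ≫ f)).obj P ⟶ (rst g).obj ((rst f).obj P) :=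
  pullCongr (yoneda.map_comp g f) P

/-- The data of a biadditive morphism `S × H × K ⟶ 𝒢`: the torsors `F(h, k)`, their restriction
isomorphisms, and the two families
`F(h, k) F(h', k) ⟶ F(h h', k)` and `F(h, k) F(h, k') ⟶ F(h, k k')`. -/
structure BiData (M : BraidedCrossedModule J) (H K : Sheaf J GrpCat.{u}) (S : Cᵒᵖ ⥤ Type u) where
  obj : ∀ {U : C}, Pt S H K U → Torsor M (yoneda.obj U)
  res : ∀ {U V : C} (f : V ⟶ U) {x : Pt S H K U} {y : Pt S H K V}, x.restrict f = y →
    ((rst f).obj (obj x) ⟶ obj y)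
  mul₁ : ∀ {U : C} {x y z : Pt S H K U}, Pt.Mul₁ x y z → (obj x ⊗ obj y ⟶ obj z)
  mul₂ : ∀ {U : C} {x y z : Pt S H K U}, Pt.Mul₂ x y z → (obj x ⊗ obj y ⟶ obj z)

namespace BiData
variable {M : BraidedCrossedModule J} {H K : Sheaf J GrpCat.{u}} {S' S : Cᵒᵖ ⥤ Type u}

/-- The two laws are functorial, associative and satisfy the interchange law, in which
`tensorμ : (X Y) (Z W) ⟶ (X Z) (Y W)` is built from the braiding of `𝒢`. -/
structure IsLaw (D : BiData M H K S) : Prop where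
  natural₁ : ∀ {U V : C} (f : V ⟶ U) {x y z : Pt S H K U} {x' y' z' : Pt S H K V}
    (hx : x.restrict f = x') (hy : y.restrict f = y') (hz : z.restrict f = z')
    (m : Pt.Mul₁ x y z) (m' : Pt.Mul₁ x' y' z'),
    Functor.LaxMonoidal.μ (rst f) (D.obj x) (D.obj y) ≫ (rst f).map (D.mul₁ m) ≫ D.res f hz =
      (D.res f hx ⊗ₘ D.res f hy) ≫ D.mul₁ m'
  natural₂ : ∀ {U V : C} (f : V ⟶ U) {x y z : Pt S H K U} {x' y' z' : Pt S H K V}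
    (hx : x.restrict f = x') (hy : y.restrict f = y') (hz : z.restrict f = z')
    (m : Pt.Mul₂ x y z) (m' : Pt.Mul₂ x' y' z'),
    Functor.LaxMonoidal.μ (rst f) (D.obj x) (D.obj y) ≫ (rst f).map (D.mul₂ m) ≫ D.res f hz =
      (D.res f hx ⊗ₘ D.res f hy) ≫ D.mul₂ m'
  assoc₁ : ∀ {U : C} {x y z xy yz xyz : Pt S H K U} (m : Pt.Mul₁ x y xy) (n : Pt.Mul₁ xy z xyz)
    (m' : Pt.Mul₁ y z yz) (n' : Pt.Mul₁ x yz xyz),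
    (D.mul₁ m ▷ D.obj z) ≫ D.mul₁ n =
      (α_ (D.obj x) (D.obj y) (D.obj z)).hom ≫ (D.obj x ◁ D.mul₁ m') ≫ D.mul₁ n'
  assoc₂ : ∀ {U : C} {x y z xy yz xyz : Pt S H K U} (m : Pt.Mul₂ x y xy) (n : Pt.Mul₂ xy z xyz)
    (m' : Pt.Mul₂ y z yz) (n' : Pt.Mul₂ x yz xyz),
    (D.mul₂ m ▷ D.obj z) ≫ D.mul₂ n =
      (α_ (D.obj x) (D.obj y) (D.obj z)).hom ≫ (D.obj x ◁ D.mul₂ m') ≫ D.mul₂ n'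
  interchange : ∀ {U : C} {x y z w xy zw xz yw t : Pt S H K U}
    (m : Pt.Mul₁ x y xy) (n : Pt.Mul₁ z w zw) (p : Pt.Mul₂ xy zw t)
    (m' : Pt.Mul₂ x z xz) (n' : Pt.Mul₂ y w yw) (p' : Pt.Mul₁ xz yw t),
    (D.mul₁ m ⊗ₘ D.mul₁ n) ≫ D.mul₂ p =
      tensorμ (D.obj x) (D.obj y) (D.obj z) (D.obj w) ≫ (D.mul₂ m' ⊗ₘ D.mul₂ n') ≫ D.mul₁ p'

/-- The conditions for a biadditive morphism. -/
structure IsBiadd (D : BiData M H K S) : Prop extends IsLaw D where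
  res_id : ∀ {U : C} {x : Pt S H K U} (h : x.restrict (𝟙 U) = x),
    D.res (𝟙 U) h = rstId (D.obj x)
  res_comp : ∀ {U V W : C} (f : V ⟶ U) (g : W ⟶ V) {x : Pt S H K U} {y : Pt S H K V}
    {z : Pt S H K W} (hf : x.restrict f = y) (hg : y.restrict g = z)
    (h : x.restrict (g ≫ f) = z),
    D.res (g ≫ f) h = rstComp f g (D.obj x) ≫ (rst g).map (D.res f hf) ≫ D.res g hg
  /-- The two isomorphisms between the unit and `F(1, 1)` coincide: `e₁` and `e₂` are the units
  of the two multiplications of `F(1, 1)`. -/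
  unit : ∀ {U : C} {x : Pt S H K U}, x.h = 1 → x.k = 1 →
    ∀ (m : Pt.Mul₁ x x x) (n : Pt.Mul₂ x x x) (e₁ e₂ : 𝟙_ _ ⟶ D.obj x),
    (e₁ ▷ D.obj x) ≫ D.mul₁ m = (λ_ (D.obj x)).hom →
    (e₂ ▷ D.obj x) ≫ D.mul₂ n = (λ_ (D.obj x)).hom → e₁ = e₂

/-- The unit section of the unit torsor. -/
def oneSec {X : Cᵒᵖ ⥤ Type u} {U : C} (x : X.obj (op U)) : (unit M X).carrier x :=
  (1 : Sec M.G U)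

theorem mul_unit {X : Cᵒᵖ ⥤ Type u} {P : Torsor M X} (m : P ⊗ P ⟶ P)
    (ha : (m ▷ P) ≫ m = (α_ P P P).hom ≫ (P ◁ m) ≫ m)
    {U : C} {x : X.obj (op U)} (e : P.carrier x)
    (h : ∀ p : P.carrier x, Hom.app m (wdg e p) = p) (p : P.carrier x) :
    Hom.app m (wdg p e) = p := by
  have h1 : Hom.app m (wdg (Hom.app m (wdg p e)) e) = Hom.app m (wdg p (Hom.app m (wdg e e))) := by
    have := congrArg (fun φ => Hom.app φ (wdg (wdg p e) e)) ha
    simp only [comp_app] at this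
    rw [whiskerRight_wdg, associator_wdg, whiskerLeft_wdg] at this
    exact this
  rw [h e] at h1
  have h2 := app_inj m h1
  obtain ⟨g, hg, -⟩ := P.trans p (Hom.app m (wdg p e))
  rw [← hg, tensor_act] at h2
  have h3 : M.act g (P.j e) = 1 :=
    act_inj (P := tensor P P) (p := wdg p e) (h2.trans ((tensor P P).act_one _).symm)
  have h4 : g = 1 := by
    have := congrArg (fun t => M.act t (P.j e)⁻¹) h3
    simp only [← M.act_mul, mul_inv_cancel, M.act_one, M.one_act] at this
    exact this
  rw [← hg, h4, P.act_one]

theorem IsLaw.unit_aux {D : BiData M H K S} (hD : D.IsLaw) {U : C} {x : Pt S H K U}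
    (m : Pt.Mul₁ x x x) (n : Pt.Mul₂ x x x) (e₁ e₂ : 𝟙_ _ ⟶ D.obj x)
    (h₁ : (e₁ ▷ D.obj x) ≫ D.mul₁ m = (λ_ (D.obj x)).hom)
    (h₂ : (e₂ ▷ D.obj x) ≫ D.mul₂ n = (λ_ (D.obj x)).hom) : e₁ = e₂ := by
  apply hom_ext
  intro V w a
  have key : ∀ (e : 𝟙_ (Torsor M (yoneda.obj U)) ⟶ D.obj x) (mm : D.obj x ⊗ D.obj x ⟶ D.obj x),
      (e ▷ D.obj x) ≫ mm = (λ_ (D.obj x)).hom → ∀ p : (D.obj x).carrier w,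
      Hom.app mm (wdg (Hom.app e (oneSec w)) p) = p := by
    intro e mm h p
    have := congrArg (fun φ => Hom.app φ (wdg (P := unit M _) (oneSec w) p)) h
    simp only [comp_app] at this
    refine Eq.trans ?_ (this.trans ((leftUnitor_wdg (oneSec w) p).trans (lact_one p)))
    exact congrArg (Hom.app mm) (whiskerRight_wdg e _ _ _).symm
  have j1 : ∀ e : 𝟙_ (Torsor M (yoneda.obj U)) ⟶ D.obj x,
      (D.obj x).j (Hom.app e (oneSec w)) = 1 := by
    intro e
    rw [Hom.j_app]
    exact map_one M.d
  have l1 := key e₁ _ h₁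
  have l2 := key e₂ _ h₂
  have r1 := mul_unit _ (hD.assoc₁ m m m m) _ l1
  have r2 := mul_unit _ (hD.assoc₂ n n n n) _ l2
  set p := Hom.app e₁ (oneSec w) with hp
  set q := Hom.app e₂ (oneSec w) with hq
  have hi := congrArg (fun φ => Hom.app φ (wdg (wdg q p) (wdg p q))) (hD.interchange m m n n n m)
  simp only [tensorμ, comp_app] at hi
  rw [tensorHom_wdg, r1, l1, l2, associator_wdg, whiskerLeft_wdg, associator_inv_wdg,
    whiskerLeft_wdg, whiskerRight_wdg, braiding_wdg, j1 e₁, M.br_one, inv_one] at hi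
  erw [(tensor _ _).act_one] at hi
  rw [whiskerLeft_wdg, associator_wdg, associator_inv_wdg, tensorHom_wdg, l2, r2, l1] at hi
  have ha : a = (unit M (yoneda.obj U)).act (oneSec w) a :=
    (one_mul (M := Sec M.G V) a).symm
  have e1 : Hom.app e₁ a = (D.obj x).act p a :=
    (congrArg (Hom.app e₁) ha).trans (e₁.app_act _ _)
  have e2 : Hom.app e₂ a = (D.obj x).act q a :=
    (congrArg (Hom.app e₂) ha).trans (e₂.app_act _ _)
  rw [e1, e2, hi]

end BiData

namespace BiData
variable {M : BraidedCrossedModule J} {H K : Sheaf J GrpCat.{u}} {S'' S' S : Cᵒᵖ ⥤ Type u}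

/-- A family of morphisms compatible with the restrictions and with both laws. -/
structure IsHom (D D' : BiData M H K S) (φ : ∀ {U : C} (x : Pt S H K U), D.obj x ⟶ D'.obj x) :
    Prop where
  natural : ∀ {U V : C} (f : V ⟶ U) {x : Pt S H K U} {y : Pt S H K V} (h : x.restrict f = y),
    D.res f h ≫ φ y = (rst f).map (φ x) ≫ D'.res f h
  mul₁ : ∀ {U : C} {x y z : Pt S H K U} (m : Pt.Mul₁ x y z),
    D.mul₁ m ≫ φ z = (φ x ⊗ₘ φ y) ≫ D'.mul₁ m
  mul₂ : ∀ {U : C} {x y z : Pt S H K U} (m : Pt.Mul₂ x y z),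
    D.mul₂ m ≫ φ z = (φ x ⊗ₘ φ y) ≫ D'.mul₂ m

/-- The pointwise product `(F F')(h, k) = F(h, k) F'(h, k)`. -/
noncomputable def prod (D D' : BiData M H K S) : BiData M H K S where
  obj x := D.obj x ⊗ D'.obj x
  res f x _ h := Functor.OplaxMonoidal.δ (rst f) (D.obj x) (D'.obj x) ≫ (D.res f h ⊗ₘ D'.res f h)
  mul₁ {_ x y _} m := tensorμ (D.obj x) (D'.obj x) (D.obj y) (D'.obj y) ≫
    (D.mul₁ m ⊗ₘ D'.mul₁ m)
  mul₂ {_ x y _} m := tensorμ (D.obj x) (D'.obj x) (D.obj y) (D'.obj y) ≫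
    (D.mul₂ m ⊗ₘ D'.mul₂ m)

/-- Base change along `S' ⟶ S`. -/
def baseChange (a : S' ⟶ S) (D : BiData M H K S) : BiData M H K S' where
  obj x := D.obj (x.push a)
  res f _ _ h := D.res f (Pt.push_restrict h)
  mul₁ m := D.mul₁ (m.push a)
  mul₂ m := D.mul₂ (m.push a)

theorem IsLaw.baseChange {D : BiData M H K S} (hD : D.IsLaw) (a : S' ⟶ S) :
    (D.baseChange a).IsLaw where
  natural₁ f _ _ _ _ _ _ hx hy hz m m' :=
    hD.natural₁ f (Pt.push_restrict hx) (Pt.push_restrict hy) (Pt.push_restrict hz) (m.push a)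
      (m'.push a)
  natural₂ f _ _ _ _ _ _ hx hy hz m m' :=
    hD.natural₂ f (Pt.push_restrict hx) (Pt.push_restrict hy) (Pt.push_restrict hz) (m.push a)
      (m'.push a)
  assoc₁ m n m' n' := hD.assoc₁ (m.push a) (n.push a) (m'.push a) (n'.push a)
  assoc₂ m n m' n' := hD.assoc₂ (m.push a) (n.push a) (m'.push a) (n'.push a)
  interchange m n p m' n' p' :=
    hD.interchange (m.push a) (n.push a) (p.push a) (m'.push a) (n'.push a) (p'.push a)

theorem IsBiadd.baseChange {D : BiData M H K S} (hD : D.IsBiadd) (a : S' ⟶ S) :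
    (D.baseChange a).IsBiadd where
  toIsLaw := hD.toIsLaw.baseChange a
  res_id h := hD.res_id (Pt.push_restrict h)
  res_comp f g _ _ _ hf hg h :=
    hD.res_comp f g (Pt.push_restrict hf) (Pt.push_restrict hg) (Pt.push_restrict h)
  unit hh hk m n e₁ e₂ := hD.unit (x := Pt.push a _) hh hk (m.push a) (n.push a) e₁ e₂

end BiData

/-- Biadditive morphisms `H × K ⟶ 𝒢` over the base `S`. -/
structure Biadd (M : BraidedCrossedModule J) (H K : Sheaf J GrpCat.{u}) (S : Cᵒᵖ ⥤ Type u) where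
  data : BiData M H K S
  isBiadd : data.IsBiadd

namespace Biadd
variable {M : BraidedCrossedModule J} {H K : Sheaf J GrpCat.{u}} {S'' S' S : Cᵒᵖ ⥤ Type u}

/-- Morphisms of biadditive morphisms. -/
@[ext] structure Hom (D D' : Biadd M H K S) where
  app : ∀ {U : C} (x : Pt S H K U), D.data.obj x ⟶ D'.data.obj x
  isHom : D.data.IsHom D'.data app

instance : Category.{u} (Biadd M H K S) where
  Hom := Hom
  id D := ⟨fun _ => 𝟙 _, ⟨by simp, by simp, by simp⟩⟩
  comp φ ψ := ⟨fun x => φ.app x ≫ ψ.app x,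
    ⟨fun f _ _ h => by
      rw [← Category.assoc, φ.isHom.natural, Category.assoc, ψ.isHom.natural, Functor.map_comp,
        Category.assoc],
    fun m => by
      rw [← Category.assoc, φ.isHom.mul₁, Category.assoc, ψ.isHom.mul₁, ← Category.assoc,
        tensorHom_comp_tensorHom],
    fun m => by
      rw [← Category.assoc, φ.isHom.mul₂, Category.assoc, ψ.isHom.mul₂, ← Category.assoc,
        tensorHom_comp_tensorHom]⟩⟩
  id_comp φ := Hom.ext (by funext U x; exact Category.id_comp (φ.app x))
  comp_id φ := Hom.ext (by funext U x; exact Category.comp_id (φ.app x))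
  assoc φ ψ χ := Hom.ext (by funext U x; exact Category.assoc (φ.app x) (ψ.app x) (χ.app x))

/-- Evaluation at a point. -/
def ev {U : C} (x : Pt S H K U) : Biadd M H K S ⥤ Torsor M (yoneda.obj U) where
  obj D := D.data.obj x
  map φ := Hom.app φ x

/-- Base change along `S' ⟶ S`. -/
def baseChange (a : S' ⟶ S) : Biadd M H K S ⥤ Biadd M H K S' where
  obj D := ⟨D.data.baseChange a, D.isBiadd.baseChange a⟩
  map φ := show Hom _ _ from ⟨fun x => Hom.app φ (x.push a),
    ⟨fun f _ _ h => φ.isHom.natural f (Pt.push_restrict h), fun m => φ.isHom.mul₁ (m.push a),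
      fun m => φ.isHom.mul₂ (m.push a)⟩⟩

theorem baseChange_id : baseChange (𝟙 S) = 𝟭 (Biadd M H K S) := rfl
theorem baseChange_comp (a : S'' ⟶ S') (b : S' ⟶ S) :
    baseChange (a ≫ b) = baseChange (M := M) (H := H) (K := K) b ⋙ baseChange a := rfl

end Biadd

/-- The fiber of a torsor over `S × H × K` at a point. -/
abbrev fib {M : BraidedCrossedModule J} {H K : Sheaf J GrpCat.{u}} {S : Cᵒᵖ ⥤ Type u}
    (E : Torsor M (base S H K)) {U : C} (x : Pt S H K U) : Torsor M (yoneda.obj U) :=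
  (pull x.map).obj E

/-- A `(G, Π)`-torsor `E` over `S × H × K` with two partial composition laws
`E_{h, k} ∧ E_{h', k} ⟶ E_{hh', k}` and `E_{h, k} ∧ E_{h, k'} ⟶ E_{h, kk'}`. -/
structure BiextData (M : BraidedCrossedModule J) (H K : Sheaf J GrpCat.{u})
    (S : Cᵒᵖ ⥤ Type u) where
  tor : Torsor M (base S H K)
  mul₁ : ∀ {U : C} {x y z : Pt S H K U}, Pt.Mul₁ x y z → (fib tor x ⊗ fib tor y ⟶ fib tor z)
  mul₂ : ∀ {U : C} {x y z : Pt S H K U}, Pt.Mul₂ x y z → (fib tor x ⊗ fib tor y ⟶ fib tor z)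

namespace BiextData
variable {M : BraidedCrossedModule J} {H K : Sheaf J GrpCat.{u}} {S'' S' S : Cᵒᵖ ⥤ Type u}

/-- The assignment `(h, k) ↦ E_{h, k}`, with its canonical restriction isomorphisms. -/
def toBiData (E : BiextData M H K S) : BiData M H K S where
  obj x := fib E.tor x
  res _ _ _ h := pullCongr (Pt.map_restrict h) E.tor
  mul₁ m := E.mul₁ m
  mul₂ m := E.mul₂ m

/-- The conditions for a biextension: the partial laws are morphisms over the base (compatible
with restriction), associative, and satisfy the interchange law. -/
def IsBiext (E : BiextData M H K S) : Prop := E.toBiData.IsLaw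

/-- Compatibility of a morphism of torsors with the partial laws. -/
structure IsHom (E F : BiextData M H K S) (φ : E.tor ⟶ F.tor) : Prop where
  mul₁ : ∀ {U : C} {x y z : Pt S H K U} (m : Pt.Mul₁ x y z),
    E.mul₁ m ≫ (pull z.map).map φ = ((pull x.map).map φ ⊗ₘ (pull y.map).map φ) ≫ F.mul₁ m
  mul₂ : ∀ {U : C} {x y z : Pt S H K U} (m : Pt.Mul₂ x y z),
    E.mul₂ m ≫ (pull z.map).map φ = ((pull x.map).map φ ⊗ₘ (pull y.map).map φ) ≫ F.mul₂ m

/-- The contracted product `E ∧ F` with the partial laws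
`(E_x ∧ F_x) ∧ (E_y ∧ F_y) ⟶ (E_x ∧ E_y) ∧ (F_x ∧ F_y) ⟶ E_z ∧ F_z`, the first arrow being
built from the braiding and the second being the contracted product of the laws of `E` and `F`. -/
noncomputable def prod (E F : BiextData M H K S) : BiextData M H K S where
  tor := E.tor ⊗ F.tor
  mul₁ {_ x y z} m :=
    (Functor.OplaxMonoidal.δ (pull x.map) E.tor F.tor ⊗ₘ
      Functor.OplaxMonoidal.δ (pull y.map) E.tor F.tor) ≫
    tensorμ (fib E.tor x) (fib F.tor x) (fib E.tor y) (fib F.tor y) ≫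
    (E.mul₁ m ⊗ₘ F.mul₁ m) ≫ Functor.LaxMonoidal.μ (pull z.map) E.tor F.tor
  mul₂ {_ x y z} m :=
    (Functor.OplaxMonoidal.δ (pull x.map) E.tor F.tor ⊗ₘ
      Functor.OplaxMonoidal.δ (pull y.map) E.tor F.tor) ≫
    tensorμ (fib E.tor x) (fib F.tor x) (fib E.tor y) (fib F.tor y) ≫
    (E.mul₂ m ⊗ₘ F.mul₂ m) ≫ Functor.LaxMonoidal.μ (pull z.map) E.tor F.tor

/-- Base change along `S' ⟶ S`. -/
def baseChange (a : S' ⟶ S) (E : BiextData M H K S) : BiextData M H K S' where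
  tor := (pull (baseMap a H K)).obj E.tor
  mul₁ m := E.mul₁ (m.push a)
  mul₂ m := E.mul₂ (m.push a)

theorem toBiData_baseChange (a : S' ⟶ S) (E : BiextData M H K S) :
    (E.baseChange a).toBiData = E.toBiData.baseChange a := rfl

theorem pullCongr_comp {A B D X : Cᵒᵖ ⥤ Type u} {c : A ⟶ B} {r : A ⟶ D} {s : B ⟶ D}
    {p : D ⟶ X} {q : B ⟶ X} {t : A ⟶ X} (e₀ : r = c ≫ s) (e₁ : s ≫ p = q) (e₂ : c ≫ q = t)
    (e : r ≫ p = t) (P : Torsor M X) :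
    pullCongr e P = pullCongr e₀ ((pull p).obj P) ≫
      ((pull c).map (pullCongr e₁ P) : (pull (c ≫ s)).obj ((pull p).obj P) ⟶ (pull c).obj _) ≫
      (pullCongr e₂ P : (pull c).obj _ ⟶ _) := by
  subst e₀ e₁ e₂
  rfl

theorem IsBiext.isBiadd {E : BiextData M H K S} (hE : E.IsBiext) : E.toBiData.IsBiadd where
  toIsLaw := hE
  res_id _ := rfl
  res_comp f g x y z hf hg h := by
    exact pullCongr_comp (yoneda.map_comp g f) (Pt.map_restrict hf) (Pt.map_restrict hg)
      (Pt.map_restrict h) E.tor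
  unit _ _ m n e₁ e₂ := hE.unit_aux m n e₁ e₂

end BiextData

/-- Biextensions of `H`, `K` by `(G, Π)` over the base `S`. -/
structure Biext (M : BraidedCrossedModule J) (H K : Sheaf J GrpCat.{u}) (S : Cᵒᵖ ⥤ Type u) where
  data : BiextData M H K S
  isBiext : data.IsBiext

namespace Biext
variable {M : BraidedCrossedModule J} {H K : Sheaf J GrpCat.{u}} {S'' S' S : Cᵒᵖ ⥤ Type u}

/-- Morphisms of biextensions. -/
@[ext] structure Hom (E F : Biext M H K S) where
  hom : E.data.tor ⟶ F.data.tor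
  isHom : E.data.IsHom F.data hom

instance : Category.{u} (Biext M H K S) where
  Hom := Hom
  id E := ⟨𝟙 _, ⟨by simp, by simp⟩⟩
  comp φ ψ := ⟨φ.hom ≫ ψ.hom,
    ⟨fun m => by
      rw [Functor.map_comp, ← Category.assoc, φ.isHom.mul₁, Category.assoc, ψ.isHom.mul₁,
        ← Category.assoc, tensorHom_comp_tensorHom, ← Functor.map_comp, ← Functor.map_comp],
    fun m => by
      rw [Functor.map_comp, ← Category.assoc, φ.isHom.mul₂, Category.assoc, ψ.isHom.mul₂,
        ← Category.assoc, tensorHom_comp_tensorHom, ← Functor.map_comp, ← Functor.map_comp]⟩⟩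
  id_comp φ := Hom.ext (Category.id_comp φ.hom)
  comp_id φ := Hom.ext (Category.comp_id φ.hom)
  assoc φ ψ χ := Hom.ext (Category.assoc φ.hom ψ.hom χ.hom)

/-- The underlying torsor. -/
def toTorsor : Biext M H K S ⥤ Torsor M (base S H K) where
  obj E := E.data.tor
  map φ := Hom.hom φ

/-- Base change along `S' ⟶ S`. -/
def baseChange (a : S' ⟶ S) : Biext M H K S ⥤ Biext M H K S' where
  obj E := ⟨E.data.baseChange a, BiData.IsLaw.baseChange E.isBiext a⟩
  map φ := show Hom _ _ from ⟨(pull (baseMap a H K)).map (Hom.hom φ),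
    ⟨fun m => φ.isHom.mul₁ (m.push a), fun m => φ.isHom.mul₂ (m.push a)⟩⟩

theorem baseChange_id : baseChange (𝟙 S) = 𝟭 (Biext M H K S) := rfl
theorem baseChange_comp (a : S'' ⟶ S') (b : S' ⟶ S) :
    baseChange (a ≫ b) = baseChange (M := M) (H := H) (K := K) b ⋙ baseChange a := rfl

/-- The functor `u` sending a biextension `E` to the biadditive morphism `(h, k) ↦ E_{h, k}`. -/
def u (M : BraidedCrossedModule J) (H K : Sheaf J GrpCat.{u}) (S : Cᵒᵖ ⥤ Type u) :
    Biext M H K S ⥤ Biadd M H K S where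
  obj E := ⟨E.data.toBiData, E.isBiext.isBiadd⟩
  map {E F} φ := show Biadd.Hom _ _ from
    ⟨fun x => (pull x.map).map (Hom.hom φ),
    ⟨fun {U V} f x y h => by
      have key : ∀ {A : Cᵒᵖ ⥤ Type u} {a b : A ⟶ base S H K} (e : a = b),
          pullCongr e E.data.tor ≫ (pull b).map (Hom.hom φ) =
            (pull a).map (Hom.hom φ) ≫ pullCongr e F.data.tor := by
        intro A a b e
        subst e
        exact (Category.id_comp _).trans (Category.comp_id _).symm
      exact key (Pt.map_restrict h),
    fun m => φ.isHom.mul₁ m, fun m => φ.isHom.mul₂ m⟩⟩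

theorem u_baseChange (a : S' ⟶ S) :
    baseChange a ⋙ u M H K S' = u M H K S ⋙ Biadd.baseChange a := rfl

end Biext

universe v w v' w'

/-- A braided monoidal structure on a category. -/
structure BrStr (A : Type w) [Category.{v} A] where
  mon : MonoidalCategory A
  br : BraidedCategory A

/-- A symmetric group-like structure on a category: the category is a groupoid, it has a symmetric
monoidal structure, and the left and right multiplications by every object are equivalences. -/
structure SymGr (A : Type w) [Category.{v} A] extends BrStr A where
  symmetric : ∀ X Y : A, (br.braiding X Y).hom ≫ (br.braiding Y X).hom = 𝟙 _
  groupoid : IsGroupoid A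
  left : ∀ X : A, (tensorLeft X).IsEquivalence
  right : ∀ X : A, (tensorRight X).IsEquivalence

namespace BrStr
variable {A : Type w} [Category.{v} A] {B : Type w'} [Category.{v'} B]

/-- The structure of a braided monoidal functor on `F`. -/
def Fun (s : BrStr A) (t : BrStr B) (F : A ⥤ B) :=
  letI := s.mon
  letI := s.br
  letI := t.mon
  letI := t.br
  F.Braided

/-- The product of two objects. -/
def mul (s : BrStr A) (X Y : A) : A := s.mon.tensorObj X Y

/-- The isomorphism `F(X) F(Y) ⟶ F(X Y)` of a braided monoidal functor. -/
def Fun.mu {s : BrStr A} {t : BrStr B} {F : A ⥤ B} (b : Fun s t F) (X Y : A) :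
    t.mul (F.obj X) (F.obj Y) ⟶ F.obj (s.mul X Y) :=
  letI := s.mon
  letI := s.br
  letI := t.mon
  letI := t.br
  letI : F.Braided := b
  Functor.LaxMonoidal.μ F X Y

end BrStr

/-- The braided structure on torsors given by the contracted product. -/
noncomputable def torsorBr (M : BraidedCrossedModule J) (X : Cᵒᵖ ⥤ Type u) : BrStr (Torsor M X) :=
  ⟨inferInstance, inferInstance⟩

/-- A symmetric group-like structure on a presheaf of categories that is a stack: symmetric
group-like structures on the fibers, braided structures on the restriction functors, compatible
with identities and composition. -/
structure SymGrStack (J : GrothendieckTopology C) (Φ : Cᵒᵖ ⥤ Cat.{v, w}) where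
  stack : Φ.toPseudofunctor'.IsStack J
  fiber : ∀ U : Cᵒᵖ, SymGr (Φ.obj U)
  res : ∀ {U V : Cᵒᵖ} (f : U ⟶ V),
    (fiber U).Fun (fiber V).toBrStr (Φ.map f).toFunctor
  res_id : ∀ {U : Cᵒᵖ} (X Y : Φ.obj U), (res (𝟙 U)).mu X Y = eqToHom (by simp)
  res_comp : ∀ {U V W : Cᵒᵖ} (f : U ⟶ V) (g : V ⟶ W) (X Y : Φ.obj U),
    (res (f ≫ g)).mu X Y = eqToHom (by simp) ≫
      (res g).mu ((Φ.map f).toFunctor.obj X) ((Φ.map f).toFunctor.obj Y) ≫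
      (Φ.map g).toFunctor.map ((res f).mu X Y) ≫ eqToHom (by simp)

theorem nat_obj {Φ Ψ : Cᵒᵖ ⥤ Cat.{v, w}} (α : Φ ⟶ Ψ) {U V : Cᵒᵖ} (f : U ⟶ V) (X : Φ.obj U) :
    (α.app V).toFunctor.obj ((Φ.map f).toFunctor.obj X) =
      (Ψ.map f).toFunctor.obj ((α.app U).toFunctor.obj X) :=
  congrArg (fun F : Φ.obj U ⟶ Ψ.obj V => F.toFunctor.obj X) (α.naturality f)

/-- The structure of an equivalence of symmetric group-like stacks on a morphism: it is an
equivalence on the fibers, with braided structures compatible with restriction. -/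
structure SymGrStack.Equivalence {Φ Ψ : Cᵒᵖ ⥤ Cat.{v, w}} (s : SymGrStack J Φ)
    (t : SymGrStack J Ψ) (α : Φ ⟶ Ψ) where
  equiv : ∀ U : Cᵒᵖ, (α.app U).toFunctor.IsEquivalence
  braided : ∀ U : Cᵒᵖ, (s.fiber U).Fun (t.fiber U).toBrStr (α.app U).toFunctor
  comm : ∀ {U V : Cᵒᵖ} (f : U ⟶ V) (X Y : Φ.obj U),
    (braided V).mu ((Φ.map f).toFunctor.obj X) ((Φ.map f).toFunctor.obj Y) ≫
        (α.app V).toFunctor.map ((s.res f).mu X Y) =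
      eqToHom (by rw [nat_obj, nat_obj]) ≫
        (t.res f).mu ((α.app U).toFunctor.obj X) ((α.app U).toFunctor.obj Y) ≫
        (Ψ.map f).toFunctor.map ((braided U).mu X Y) ≫ eqToHom (nat_obj α f _).symm

section Biextensions
variable (M : BraidedCrossedModule J) (H K : Sheaf J GrpCat.{u})

/-- The groupoids of biextensions over a variable base. -/
def biextOver : (Cᵒᵖ ⥤ Type u)ᵒᵖ ⥤ Cat.{u, u + 1} where
  obj S := Cat.of (Biext M H K S.unop)
  map a := (Biext.baseChange a.unop).toCatHom
  map_id _ := rfl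
  map_comp _ _ := rfl

/-- The groupoids of biadditive morphisms over a variable base. -/
def biaddOver : (Cᵒᵖ ⥤ Type u)ᵒᵖ ⥤ Cat.{u, u + 1} where
  obj S := Cat.of (Biadd M H K S.unop)
  map a := (Biadd.baseChange a.unop).toCatHom
  map_id _ := rfl
  map_comp _ _ := rfl

/-- The functor `u` over a variable base. -/
def uOver : biextOver M H K ⟶ biaddOver M H K where
  app S := (Biext.u M H K S.unop).toCatHom
  naturality _ _ _ := rfl

/-- The stack of biextensions. -/
def biextStack : Cᵒᵖ ⥤ Cat.{u, u + 1} := yoneda.op ⋙ biextOver M H K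

/-- The stack of biadditive morphisms. -/
def biaddStack : Cᵒᵖ ⥤ Cat.{u, u + 1} := yoneda.op ⋙ biaddOver M H K

/-- The morphism of stacks `u`. -/
def uStack : biextStack M H K ⟶ biaddStack M H K := Functor.whiskerLeft yoneda.op (uOver M H K)

end Biextensions

/-- The final presheaf. -/
abbrev final (C : Type u) [SmallCategory C] : Cᵒᵖ ⥤ Type u := (Functor.const _).obj PUnit

section Structures
variable {M : BraidedCrossedModule J} {H K : Sheaf J GrpCat.{u}} {S : Cᵒᵖ ⥤ Type u}

/-- The symmetric group-like structure `s` on biextensions is given by the contracted product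
with its partial laws, and by the associativity, unit and commutativity isomorphisms of the
contracted product of torsors. -/
structure IsContracted (s : SymGr (Biext M H K S)) where
  toTorsor : s.Fun (torsorBr M (base S H K)) Biext.toTorsor
  laws : ∀ E F : Biext M H K S,
    (E.data.prod F.data).IsHom (s.mul E F).data (toTorsor.mu E F)

/-- The symmetric group-like structure `s` on biadditive morphisms is given by the pointwise
product. -/
structure IsPointwise (s : SymGr (Biadd M H K S)) where
  ev : ∀ {U : C} (x : Pt S H K U), s.Fun (torsorBr M (yoneda.obj U)) (Biadd.ev x)
  laws : ∀ D D' : Biadd M H K S,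
    (D.data.prod D'.data).IsHom (s.mul D D').data (fun x => (ev x).mu D D')

/-- The isomorphisms `u(E) u(F) ⟶ u(E ∧ F)` are at each point `(h, k)` the canonical ones
`E_{h, k} ∧ F_{h, k} ⟶ (E ∧ F)_{h, k}`. -/
def IsCanonical {s : SymGr (Biext M H K S)} {t : SymGr (Biadd M H K S)} (c : IsContracted s)
    (p : IsPointwise t) (b : s.Fun t.toBrStr (Biext.u M H K S)) : Prop :=
  ∀ (E F : Biext M H K S) (U : C) (x : Pt S H K U),
    (p.ev x).mu ((Biext.u M H K S).obj E) ((Biext.u M H K S).obj F) ≫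
        (Biadd.ev x).map (b.mu E F) =
      Functor.LaxMonoidal.μ (pull x.map) E.data.tor F.data.tor ≫
        (pull x.map).map (c.toTorsor.mu E F)

end Structures

section Stacks
variable (M : BraidedCrossedModule J) (H K : Sheaf J GrpCat.{u})

/-- A symmetric group-like structure on the stack of biextensions given by the contracted
product. -/
structure ContractedStack extends SymGrStack J (biextStack M H K) where
  contracted : ∀ U : C, IsContracted (M := M) (H := H) (K := K) (S := yoneda.obj U) (fiber (op U))
  res_contracted : ∀ {U V : C} (f : V ⟶ U) (E F : Biext M H K (yoneda.obj U)),
    (contracted V).toTorsor.mu ((Biext.baseChange (yoneda.map f)).obj E)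
        ((Biext.baseChange (yoneda.map f)).obj F) ≫ Biext.toTorsor.map ((res f.op).mu E F) =
      Functor.LaxMonoidal.μ (pull (baseMap (yoneda.map f) H K)) E.data.tor F.data.tor ≫
        (pull (baseMap (yoneda.map f) H K)).map ((contracted U).toTorsor.mu E F)

/-- A symmetric group-like structure on the stack of biadditive morphisms given by the pointwise
product. -/
structure PointwiseStack extends SymGrStack J (biaddStack M H K) where
  pointwise : ∀ U : C, IsPointwise (M := M) (H := H) (K := K) (S := yoneda.obj U) (fiber (op U))
  res_pointwise : ∀ {U V : C} (f : V ⟶ U) (D D' : Biadd M H K (yoneda.obj U)) {W : C}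
    (x : Pt (yoneda.obj V) H K W),
    ((pointwise V).ev x).mu ((Biadd.baseChange (yoneda.map f)).obj D)
        ((Biadd.baseChange (yoneda.map f)).obj D') ≫ (Biadd.ev x).map ((res f.op).mu D D') =
      ((pointwise U).ev (x.push (yoneda.map f))).mu D D'

end Stacks
end Base
end Biext4

open Biext4 MonoidalCategory

namespace Biext4

section Invertible
universe v w
variable {A : Type w} [Category.{v} A] [MonoidalCategory A] [BraidedCategory A]

/-- The multiplication by an invertible object is an equivalence. -/
theorem isEquivalence_tensorLeft {X Y : A} (e : X ⊗ Y ≅ 𝟙_ A) : (tensorLeft X).IsEquivalence := by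
  have e' : Y ⊗ X ≅ 𝟙_ A := β_ Y X ≪≫ e
  exact (CategoryTheory.Equivalence.mk (tensorLeft X) (tensorLeft Y)
    (NatIso.ofComponents (fun Z => (λ_ Z).symm ≪≫ whiskerRightIso e'.symm Z ≪≫ α_ Y X Z)
      (fun f => by
        have h1 : Y ◁ X ◁ f = (α_ _ _ _).inv ≫ (Y ⊗ X) ◁ f ≫ (α_ _ _ _).hom := by simp
        simp only [Functor.id_map, Functor.comp_map, curriedTensor_obj_map, Iso.trans_hom,
          Iso.symm_hom, whiskerRightIso_hom, Category.assoc, h1, Iso.hom_inv_id_assoc]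
        rw [← whisker_exchange_assoc]
        simp))
    (NatIso.ofComponents (fun Z => (α_ X Y Z).symm ≪≫ whiskerRightIso e Z ≪≫ λ_ Z)
      (fun f => by
        have h1 : X ◁ Y ◁ f = (α_ _ _ _).inv ≫ (X ⊗ Y) ◁ f ≫ (α_ _ _ _).hom := by simp
        simp only [Functor.id_map, Functor.comp_map, curriedTensor_obj_map, Iso.trans_hom,
          Iso.symm_hom, whiskerRightIso_hom, Category.assoc, h1, Iso.hom_inv_id_assoc]
        rw [whisker_exchange_assoc]
        simp))).isEquivalence_functor

theorem isEquivalence_tensorRight {X Y : A} (e : X ⊗ Y ≅ 𝟙_ A) :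
    (tensorRight X).IsEquivalence := by
  have := isEquivalence_tensorLeft e
  exact Functor.isEquivalence_of_iso (BraidedCategory.tensorLeftIsoTensorRight X)

end Invertible

section
variable {C : Type u} [SmallCategory C] {J : GrothendieckTopology C}

namespace BraidedCrossedModule
variable (M : BraidedCrossedModule J) {U : C}

theorem br_mul_act (x y : Sec M.Pi U) (v : Sec M.G U) :
    M.br x y * M.act v (y * x) = M.act v (x * y) * M.br x y := by
  have h : y * x = x * y * M.d (M.br x y) := by rw [M.d_br]; group
  rw [h, M.act_mul, M.act_d]; group

theorem act_of_d_eq_one {s : Sec M.G U} (hs : M.d s = 1) (x : Sec M.Pi U) : M.act s x = s := by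
  have h := M.br_d x s
  rw [hs, M.br_one] at h
  exact (inv_mul_eq_one.1 h.symm).symm

theorem commute_of_d_eq_one {s : Sec M.G U} (hs : M.d s = 1) (g : Sec M.G U) :
    s * g = g * s := by
  have h := M.act_d g s
  rw [hs, M.act_one] at h
  conv_lhs => rw [h]
  group

theorem d_br_mul_br (x y : Sec M.Pi U) : M.d (M.br x y * M.br y x) = 1 := by
  rw [map_mul, M.d_br, M.d_br]; group

/-- The Yang–Baxter relation. -/
theorem br_yang_baxter (x y z : Sec M.Pi U) :
    M.br x (y * z) * M.act (M.br y z) x = M.br y z * M.br x (z * y) := by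
  have h : z * y = y * z * M.d (M.br y z) := by rw [M.d_br]; group
  rw [h, M.br_mul x (y * z), M.br_d, M.act_d]; group


end BraidedCrossedModule

namespace Torsor
variable {M : BraidedCrossedModule J} {X Y : Cᵒᵖ ⥤ Type u} {P Q R T P' Q' : Torsor M X}

theorem pullCongr_app {φ ψ : X ⟶ Y} (h : φ = ψ) (P : Torsor M Y) {U : C} {x : X.obj (op U)}
    (p : P.carrier (φ.app _ x)) (e : rs Y (𝟙 U) (φ.app _ x) = ψ.app _ x) :
    Hom.app (pullCongr h P) (x := x) p = P.res (𝟙 U) e p := by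
  subst h
  exact (P.res_id _ p).symm

theorem wdg_act_act {U : C} {x : X.obj (op U)} (p : P.carrier x) (q : Q.carrier x)
    (g h : Sec M.G U) : wdg (P.act p g) (Q.act q h) =
      (tensor P Q).act (wdg p q) (M.act g (Q.j q) * h) := by
  rw [wdg_act, ← wdg_act, tensor_act, ← Torsor.act_mul, wdg_act]

theorem wdg_cancel_left {U : C} {x : X.obj (op U)} {p : P.carrier x} {q q' : Q.carrier x}
    (h : wdg p q = wdg p q') : q = q' := by
  obtain ⟨g, rfl, -⟩ := Q.trans q q'
  rw [← wdg_act] at h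
  have : (1 : Sec M.G U) = g := act_inj (P := tensor P Q) (p := wdg p q)
    (by rw [(tensor P Q).act_one]; exact h)
  rw [← this, Q.act_one]

/-- The contracted product is faithful in its second argument. -/
theorem tensorHom_cancel_left (φ : P ⟶ P') {ψ ψ' : Q ⟶ Q'} (h : φ ⊗ₘ ψ = φ ⊗ₘ ψ') : ψ = ψ' := by
  apply hom_ext
  intro U x q
  obtain ⟨S, hS, hP⟩ := P.inhab x
  refine Q'.sep S hS _ _ fun f hf => ?_
  obtain ⟨p⟩ := hP f hf
  rw [← ψ.app_res, ← ψ'.app_res]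
  have := congrArg (fun χ => Hom.app χ (wdg p (Q.res f rfl q))) h
  simp only [tensorHom_wdg] at this
  exact wdg_cancel_left this

theorem lact_inj {U : C} {x : X.obj (op U)} {p : P.carrier x} {g h : Sec M.G U}
    (e : P.lact g p = P.lact h p) : g = h := by
  have h1 := congrArg (fun a => M.act a (P.j p)⁻¹) (act_inj e)
  simpa only [← M.act_mul, mul_inv_cancel, M.act_one] using h1

theorem exists_lact {U : C} {x : X.obj (op U)} (p q : P.carrier x) :
    ∃ g : Sec M.G U, P.lact g p = q := by
  obtain ⟨h, rfl, -⟩ := P.trans p q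
  exact ⟨M.act h (P.j p)⁻¹, by rw [lact, ← M.act_mul, inv_mul_cancel, M.act_one]⟩

/-- The inverse of a torsor: the same sheaf, with `j` and the action inverted. -/
def inv (P : Torsor M X) : Torsor M X where
  toRelSheaf := P.toRelSheaf
  act p g := P.lact g⁻¹ p
  act_res f _ _ h p g := by rw [lact_res, map_inv]
  act_one p := by rw [inv_one, lact_one]
  act_mul p g h := by rw [mul_inv_rev, lact_mul]
  trans p q := by
    obtain ⟨g, hg⟩ := exists_lact p q
    exact ⟨g⁻¹, by dsimp only; rw [inv_inv, hg], fun h hh =>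
      inv_injective (lact_inj (hh.trans (by rw [inv_inv, hg])))⟩
  inhab := P.inhab
  j p := (P.j p)⁻¹
  j_res f _ _ h p := by rw [P.j_res, map_inv]
  j_act p g := by rw [j_lact, mul_inv_rev, map_inv, inv_inv]

theorem inv_lact {U : C} {x : X.obj (op U)} (g : Sec M.G U) (p : P.carrier x) :
    (inv P).lact g p = P.act p g⁻¹ := by
  change P.act p (M.act (M.act g (P.j p)⁻¹)⁻¹ (P.j p)) = _
  rw [← M.inv_act, ← M.act_mul, inv_mul_cancel, M.act_one]

/-- The quotient `p / q` of two sections: the section `g` such that `p = g q`. -/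
noncomputable def quot {U : C} {x : X.obj (op U)} (p q : P.carrier x) : Sec M.G U :=
  (exists_lact q p).choose

theorem quot_lact {U : C} {x : X.obj (op U)} (p q : P.carrier x) : P.lact (quot p q) q = p :=
  (exists_lact q p).choose_spec

theorem quot_eq {U : C} {x : X.obj (op U)} {p q : P.carrier x} {g : Sec M.G U}
    (h : P.lact g q = p) : quot p q = g := lact_inj ((quot_lact p q).trans h.symm)

theorem quot_res {U V : C} (f : V ⟶ U) {x : X.obj (op U)} {y : X.obj (op V)} (h : rs X f x = y)
    (p q : P.carrier x) : gres M.G f (quot p q) = quot (P.res f h p) (P.res f h q) :=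
  (quot_eq (by rw [← lact_res, quot_lact])).symm

theorem quot_act {U : C} {x : X.obj (op U)} (p q : P.carrier x) (g : Sec M.G U) :
    quot (P.act p g) q = quot p (P.act q g⁻¹) :=
  quot_eq (by
    have h := congrArg (fun t => P.act t g) (quot_lact p (P.act q g⁻¹))
    simpa only [← lact_act, ← P.act_mul, inv_mul_cancel, P.act_one] using h)

theorem quot_lact_inv {U : C} {x : X.obj (op U)} (p q : P.carrier x) (g : Sec M.G U) :
    quot p (P.lact g⁻¹ q) = quot p q * g :=
  quot_eq (by rw [← lact_mul, mul_inv_cancel_right, quot_lact])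

theorem d_quot {U : C} {x : X.obj (op U)} (p q : P.carrier x) :
    M.d (quot p q) = P.j p * (P.j q)⁻¹ := by
  have h := congrArg P.j (quot_lact p q)
  rw [j_lact] at h
  rw [← h, mul_inv_cancel_right]

/-- The pairing `P ∧ P⁻¹ ⟶ G`. -/
noncomputable def tensorInv (P : Torsor M X) : P ⊗ inv P ⟶ 𝟙_ (Torsor M X) :=
  (desc (P := P) (Q := inv P) (R := unit M X) (fun p q => quot (P := P) p q)
    (fun f _ _ h p q => quot_res (P := P) f h p q)
    (fun p q g => (quot_act (P := P) p q g).trans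
      (congrArg (quot (P := P) p) (inv_lact (P := P) g q).symm))
    (fun p q g => quot_lact_inv (P := P) p q g)
    (fun p q => d_quot (P := P) p q)).1

instance (P : Torsor M X) : (tensorLeft P).IsEquivalence :=
  isEquivalence_tensorLeft (isoOf (tensorInv P))

/-- The contracted product with a fixed morphism is full in its second argument. -/
theorem exists_tensorHom_eq (φ : P ⟶ P') (χ : P ⊗ Q ⟶ P' ⊗ Q') : ∃ ψ : Q ⟶ Q', φ ⊗ₘ ψ = χ := by
  obtain ⟨ψ, hψ⟩ := (tensorLeft P).map_surjective (χ ≫ (inverse φ ▷ Q'))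
  have h2 : inverse φ ≫ φ = 𝟙 _ := (isoOf φ).inv_hom_id
  refine ⟨ψ, ?_⟩
  rw [tensorHom_def']
  have h1 : P ◁ ψ = χ ≫ (inverse φ ▷ Q') := hψ
  rw [h1, Category.assoc, ← comp_whiskerRight, h2, id_whiskerRight, Category.comp_id]

theorem app_act_tensor (φ : P ⊗ Q ⟶ R) {U : C} {x : X.obj (op U)} (o : (tensor P Q).carrier x)
    (g : Sec M.G U) : Hom.app φ ((tensor P Q).act o g) = R.act (Hom.app φ o) g := φ.app_act o g

theorem app_act_tensor_tensor (φ : P ⊗ Q ⟶ P' ⊗ Q') {U : C} {x : X.obj (op U)}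
    (o : (tensor P Q).carrier x) (g : Sec M.G U) :
    Hom.app φ ((tensor P Q).act o g) = (tensor P' Q').act (Hom.app φ o) g := φ.app_act o g

theorem tensorμ_wdg {U : C} {x : X.obj (op U)} (p : P.carrier x) (q : Q.carrier x)
    (r : R.carrier x) (t : T.carrier x) :
    Hom.app (tensorμ P Q R T) (wdg (wdg p q) (wdg r t)) =
      (tensor (tensor P R) (tensor Q T)).act (wdg (wdg p r) (wdg q t))
        (M.act (M.br (Q.j q) (R.j r))⁻¹ (T.j t)) := by
  simp only [tensorμ, comp_app]
  rw [associator_wdg, whiskerLeft_wdg, associator_inv_wdg, whiskerLeft_wdg, whiskerRight_wdg,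
    braiding_wdg]
  erw [tensor_act]
  rw [whiskerLeft_wdg]
  erw [app_act_tensor_tensor]
  rw [associator_wdg]
  erw [← wdg_act, app_act_tensor_tensor]
  rw [associator_inv_wdg]
  rfl

theorem tensor_ext₂₂ {φ ψ : tensor (tensor P Q) (tensor R T) ⟶ P'} (h : ∀ {U : C}
    {x : X.obj (op U)} (p : P.carrier x) (q : Q.carrier x) (r : R.carrier x) (t : T.carrier x),
    Hom.app φ (wdg (wdg p q) (wdg r t)) = Hom.app ψ (wdg (wdg p q) (wdg r t))) : φ = ψ :=
  tensor_ext₃ fun p q O => tensor_rec O P'.toRelSheaf _ _ fun f r t e => by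
    rw [← φ.app_res, ← ψ.app_res, wdg_res, wdg_res, e, h]

theorem braiding_braiding_wdg {U : C} {x : X.obj (op U)} (p : P.carrier x) (q : Q.carrier x) :
    Hom.app ((β_ P Q).hom ≫ (β_ Q P).hom) (wdg p q) =
      (tensor P Q).act (wdg p q) (M.br (P.j p) (Q.j q) * M.br (Q.j q) (P.j p))⁻¹ := by
  rw [comp_app, braiding_wdg, app_act_tensor_tensor, braiding_wdg, ← Torsor.act_mul, mul_inv_rev]

theorem braiding_braiding_eq_id_iff : (β_ P Q).hom ≫ (β_ Q P).hom = 𝟙 (P ⊗ Q) ↔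
    ∀ {U : C} {x : X.obj (op U)} (p : P.carrier x) (q : Q.carrier x),
      M.br (P.j p) (Q.j q) * M.br (Q.j q) (P.j p) = 1 := by
  constructor
  · intro h U x p q
    have h1 := congrArg (fun φ => Hom.app φ (wdg p q)) h
    simp only [braiding_braiding_wdg] at h1
    exact inv_eq_one.1 (act_inj (P := tensor P Q) (h1.trans ((tensor P Q).act_one _).symm))
  · intro h
    refine tensor_ext fun p q => ?_
    rw [braiding_braiding_wdg, h, inv_one]
    exact (tensor P Q).act_one _

theorem braiding_braiding_of_isSymmetric (hM : M.IsSymmetric) (P Q : Torsor M X) :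
    (β_ P Q).hom ≫ (β_ Q P).hom = 𝟙 (P ⊗ Q) :=
  braiding_braiding_eq_id_iff.2 fun p q => by rw [hM _ (P.j p), mul_inv_cancel]

/-- The trivial torsor over `X` with the structural map `g ↦ b g`, for `b : X ⟶ Π`. -/
def twist (b : ∀ {U : C}, X.obj (op U) → Sec M.Pi U)
    (hb : ∀ {U V : C} (f : V ⟶ U) (x : X.obj (op U)), b (rs X f x) = gres M.Pi f (b x)) :
    Torsor M X where
  toRelSheaf := RelSheaf.ofGrp M.G X
  act {U _} (a : Sec M.G U) g := (a * g : Sec M.G U)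
  act_res f _ _ _ a g := map_mul (gres M.G f) a g
  act_one {U _} a := mul_one (a : Sec M.G U)
  act_mul {U _} a g h := (mul_assoc (a : Sec M.G U) g h).symm
  trans {U _} (a : Sec M.G U) (b : Sec M.G U) :=
    ⟨a⁻¹ * b, mul_inv_cancel_left a b, fun _ hc => eq_inv_mul_of_mul_eq hc⟩
  inhab _ := ⟨⊤, J.top_mem _, fun {V} _ _ => ⟨(1 : Sec M.G V)⟩⟩
  j {U x} (a : Sec M.G U) := b x * M.d a
  j_res f _ _ h a := by subst h; rw [hb, M.d_res, map_mul]
  j_act {U _} (a : Sec M.G U) g := by rw [map_mul, mul_assoc]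

theorem isSymmetric_iff (M : BraidedCrossedModule J) :
    M.IsSymmetric ↔ ∀ (U : C) (P Q : Torsor M (yoneda.obj U)),
      (β_ P Q).hom ≫ (β_ Q P).hom = 𝟙 (P ⊗ Q) := by
  refine ⟨fun hM U P Q => braiding_braiding_of_isSymmetric hM P Q, fun h U x y => ?_⟩
  let t (z : Sec M.Pi U) : Torsor M (yoneda.obj U) :=
    twist (fun f => gres M.Pi f z) fun f g => gres_comp M.Pi g f z
  have h1 := braiding_braiding_eq_id_iff.1 (h U (t x) (t y)) (x := 𝟙 U) (1 : Sec M.G U)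
    (1 : Sec M.G U)
  have ht : ∀ z, (t z).j (x := 𝟙 U) (1 : Sec M.G U) = z := fun z => by
    change gres M.Pi (𝟙 U) z * M.d 1 = z
    rw [gres_id, map_one, mul_one]
  rw [ht, ht] at h1
  exact eq_inv_of_mul_eq_one_right h1

end Torsor
end
end Biext4

namespace Biext4
section
variable {C : Type u} [SmallCategory C] {J : GrothendieckTopology C}

namespace BraidedCrossedModule
variable (M : BraidedCrossedModule J) {U : C}

theorem act_br_mul_act (x y z : Sec M.Pi U) (v t : Sec M.G U) :
    M.act (M.br x y) z * (M.act v (y * (x * z)) * t) =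
      M.act v (x * (y * z)) * (M.act (M.br x y) z * t) := by
  rw [← mul_assoc, ← mul_assoc, ← mul_assoc x, M.act_mul v, M.act_mul v (x * y), ← M.mul_act,
    br_mul_act, M.mul_act, mul_assoc]

theorem br_mul_act_assoc (x y : Sec M.Pi U) (v t : Sec M.G U) :
    M.br x y * (M.act v (y * x) * t) = M.act v (x * y) * (M.br x y * t) := by
  rw [← mul_assoc, br_mul_act, mul_assoc]

theorem br_hexagon (x y z : Sec M.Pi U) :
    M.act (M.br x y) z * (M.br x z * M.act (M.br y z) x) =
      M.br y z * (M.act (M.br x z) y * M.br x y) := by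
  rw [← mul_assoc, ← M.br_mul, br_yang_baxter, M.br_mul]

/-- The comparison of the two ways to shuffle eight factors. -/
theorem br_interchange (b c d e f g : Sec M.Pi U) :
    M.act (M.br (c * d) (e * f)) g * (M.br d g * (M.act (M.br b e) (f * (c * (g * d))) *
        M.act (M.br (b * f) (c * g)) d)) =
      (M.br c f * M.br f c) *
      (M.br f g * (M.act (M.br b c) (d * (e * (g * f))) * (M.act (M.br (b * d) (e * g)) f *
        (M.br d f * M.act (M.br c e) (g * (b * (f * d))))))) := by
  obtain ⟨s, hs, hfc⟩ : ∃ s, M.d s = 1 ∧ M.br f c = (M.br c f)⁻¹ * s :=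
    ⟨_, M.d_br_mul_br c f, (inv_mul_cancel_left _ _).symm⟩
  have e1 : M.br c f * M.br f c = s := by rw [hfc, mul_inv_cancel_left]
  rw [e1]
  have cs : ∀ t : Sec M.G U, t * s = s * t := fun t => (M.commute_of_d_eq_one hs t).symm
  have cs' : ∀ t r : Sec M.G U, t * (s * r) = s * (t * r) := fun t r => by
    rw [← mul_assoc, cs, mul_assoc]
  simp only [M.mul_br, M.br_mul, M.mul_act, hfc, M.act_of_d_eq_one hs, ← M.act_mul, mul_assoc, cs',
    M.inv_act]
  congr 1
  have hx : ∀ t : Sec M.G U, M.act (M.br d f) g * (M.br d g * (M.act (M.br f g) d * t)) =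
      M.br f g * (M.act (M.br d g) f * (M.br d f * t)) := fun t => by
    have := congrArg (· * t) (M.br_hexagon d f g)
    simpa only [mul_assoc] using this
  have hy : ∀ t : Sec M.G U, M.act (M.br c e) (g * (f * d)) *
      (M.act (M.br b e) (c * (g * (f * d))) * (M.act (M.br b c) (g * (f * d)) * t)) =
      M.act (M.br b c) (e * (g * (f * d))) * (M.act (M.br b e) (g * (f * d)) *
        (M.act (M.br c e) (b * (g * (f * d))) * t)) := fun t => by
    have := congrArg (fun r => M.act r (g * (f * d)) * t) (M.br_hexagon b c e)
    simpa only [M.mul_act, mul_assoc, ← M.act_mul] using this.symm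
  rw [← M.br_mul_act_assoc d g (M.br c f), M.act_br_mul_act c f (g * d), mul_inv_cancel_left,
    M.act_mul (M.br c e) f, ← M.br_mul_act_assoc d g, ← M.act_mul,
    M.act_mul (M.br b e) c, ← M.act_br_mul_act f g d, ← M.act_br_mul_act f g d, ← M.act_mul,
    hx, ← M.br_mul_act_assoc f g, hy]
  rw [← M.act_br_mul_act d e (g * f), M.act_mul (M.br b c) e (d * _),
    ← M.act_br_mul_act d g f, ← M.act_mul]
  have h1 : ∀ v t : Sec M.G U, M.act v (d * f) * (M.br d f * t) =
      M.br d f * (M.act v (f * d) * t) := fun v t => (M.br_mul_act_assoc d f v t).symm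
  have h2 : ∀ (v : Sec M.G U) w t, M.act v (w * (d * f)) * (M.br d f * t) =
      M.br d f * (M.act v (w * (f * d)) * t) := fun v w t => by
    rw [M.act_mul v w, M.act_mul v w, h1]
  have h3 := M.act_br_mul_act b g (f * d) (M.br c e) 1
  rw [mul_one, mul_one] at h3
  rw [h1 (M.br b g), h2, M.act_mul (M.br b c) e (g * (d * f)), h2, h3, ← M.act_mul]

end BraidedCrossedModule

namespace Torsor
variable {M : BraidedCrossedModule J} {X Y : Cᵒᵖ ⥤ Type u} {A B C' D E F G H : Torsor M X}

theorem tensor_ext₈ {T : Torsor M X}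
    {φ ψ : tensor (tensor (tensor A B) (tensor C' D)) (tensor (tensor E F) (tensor G H)) ⟶ T}
    (h : ∀ {U : C} {x : X.obj (op U)} (a : A.carrier x) (b : B.carrier x) (c : C'.carrier x)
      (d : D.carrier x) (e : E.carrier x) (f : F.carrier x) (g : G.carrier x) (h : H.carrier x),
      Hom.app φ (wdg (wdg (wdg a b) (wdg c d)) (wdg (wdg e f) (wdg g h))) =
        Hom.app ψ (wdg (wdg (wdg a b) (wdg c d)) (wdg (wdg e f) (wdg g h)))) : φ = ψ :=
  tensor_ext₂₂ fun p q r s => tensor_rec p T.toRelSheaf _ _ fun f₁ a b e₁ => by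
    rw [← φ.app_res, ← ψ.app_res, wdg_res, wdg_res, wdg_res, e₁]
    refine tensor_rec ((tensor C' D).res f₁ rfl q) T.toRelSheaf _ _ fun f₂ c d e₂ => ?_
    rw [← φ.app_res, ← ψ.app_res]
    simp only [wdg_res]
    rw [e₂]
    refine tensor_rec ((tensor E F).res f₂ rfl ((tensor E F).res f₁ rfl r)) T.toRelSheaf _ _
      fun f₃ e f e₃ => ?_
    rw [← φ.app_res, ← ψ.app_res]
    simp only [wdg_res]
    rw [e₃]
    refine tensor_rec ((tensor G H).res f₃ rfl ((tensor G H).res f₂ rfl ((tensor G H).res f₁ rfl s)))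
      T.toRelSheaf _ _ fun f₄ g k e₄ => ?_
    rw [← φ.app_res, ← ψ.app_res]
    simp only [wdg_res]
    rw [e₄]
    exact h _ _ _ _ _ _ _ _

theorem tensorHom_wdg_act {φ : A ⟶ C'} {ψ : B ⟶ D} {U : C} {x : X.obj (op U)} {a : A.carrier x}
    {b : B.carrier x} {c : C'.carrier x} {d : D.carrier x} {r s : Sec M.G U}
    (h : Hom.app φ a = C'.act c r) (k : Hom.app ψ b = D.act d s) (g : Sec M.G U) :
    Hom.app (φ ⊗ₘ ψ) ((tensor A B).act (wdg a b) g) =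
      (tensor C' D).act (wdg c d) (M.act r (D.j d) * s * g) := by
  rw [app_act_tensor_tensor, tensorHom_wdg, h, k, wdg_act_act, ← Torsor.act_mul]

theorem tensorμ_wdg_act {U : C} {x : X.obj (op U)} (a : A.carrier x) (b : B.carrier x)
    (c : C'.carrier x) (d : D.carrier x) (g : Sec M.G U) :
    Hom.app (tensorμ A B C' D) ((tensor (tensor A B) (tensor C' D)).act
      (wdg (wdg a b) (wdg c d)) g) =
      (tensor (tensor A C') (tensor B D)).act (wdg (wdg a c) (wdg b d))
        (M.act (M.br (B.j b) (C'.j c))⁻¹ (D.j d) * g) :=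
  (Hom.app_act (tensorμ A B C' D) _ g).trans (by
    rw [tensorμ_wdg]; exact (Torsor.act_mul _ _ _ _).symm)

theorem interchange_lhs_wdg {U : C} {x : X.obj (op U)}
    (a : A.carrier x) (b : B.carrier x) (c : C'.carrier x) (d : D.carrier x) (e : E.carrier x)
    (f : F.carrier x) (g : G.carrier x) (h : H.carrier x) :
    Hom.app ((tensorμ A B C' D ⊗ₘ tensorμ E F G H) ≫ tensorμ (A ⊗ C') (B ⊗ D) (E ⊗ G) (F ⊗ H) ≫
      (tensorμ A C' E G ⊗ₘ tensorμ B D F H))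
      (wdg (wdg (wdg a b) (wdg c d)) (wdg (wdg e f) (wdg g h))) =
      Torsor.act _ (wdg (wdg (wdg a e) (wdg c g)) (wdg (wdg b f) (wdg d h)))
        (M.act (M.br (F.j f) (G.j g) * (M.act (M.br (B.j b) (C'.j c)) (D.j d * (E.j e * (G.j g * F.j f)))
          * (M.act (M.br (B.j b * D.j d) (E.j e * G.j g)) (F.j f) * (M.br (D.j d) (F.j f) *
            M.act (M.br (C'.j c) (E.j e)) (G.j g * (B.j b * (F.j f * D.j d))))))) (H.j h))⁻¹ := by
  rw [comp_app, comp_app, tensorHom_wdg, tensorμ_wdg, tensorμ_wdg]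
  erw [wdg_act_act]
  rw [app_act_tensor_tensor]
  erw [app_act_tensor_tensor]
  erw [tensorμ_wdg]
  erw [app_act_tensor_tensor]
  erw [tensorHom_wdg]
  rw [tensorμ_wdg, tensorμ_wdg]
  erw [wdg_act_act]
  rw [← Torsor.act_mul, ← Torsor.act_mul]
  congr 1
  erw [wdg_j, wdg_j, wdg_j, wdg_j, wdg_j, wdg_j, wdg_j, wdg_j, wdg_j]
  simp only [M.mul_act, M.inv_act, mul_inv_rev, ← M.act_mul, mul_assoc]

theorem interchange_rhs_wdg {U : C} {x : X.obj (op U)}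
    (a : A.carrier x) (b : B.carrier x) (c : C'.carrier x) (d : D.carrier x) (e : E.carrier x)
    (f : F.carrier x) (g : G.carrier x) (h : H.carrier x) :
    Hom.app (tensorμ (A ⊗ B) (C' ⊗ D) (E ⊗ F) (G ⊗ H) ≫ (tensorμ A B E F ⊗ₘ tensorμ C' D G H) ≫
      tensorμ (A ⊗ E) (B ⊗ F) (C' ⊗ G) (D ⊗ H))
      (wdg (wdg (wdg a b) (wdg c d)) (wdg (wdg e f) (wdg g h))) =
      Torsor.act _ (wdg (wdg (wdg a e) (wdg c g)) (wdg (wdg b f) (wdg d h)))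
        (M.act (M.act (M.br (C'.j c * D.j d) (E.j e * F.j f)) (G.j g) * (M.br (D.j d) (G.j g) *
          (M.act (M.br (B.j b) (E.j e)) (F.j f * (C'.j c * (G.j g * D.j d))) *
            M.act (M.br (B.j b * F.j f) (C'.j c * G.j g)) (D.j d)))) (H.j h))⁻¹ := by
  have h1 := tensorμ_wdg (P := A ⊗ B) (Q := C' ⊗ D) (R := E ⊗ F) (T := G ⊗ H) (wdg a b) (wdg c d)
    (wdg e f) (wdg g h)
  have h2 := tensorHom_wdg_act (tensorμ_wdg a b e f) (tensorμ_wdg c d g h)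
    (M.act (M.br ((C' ⊗ D).j (wdg c d)) ((E ⊗ F).j (wdg e f)))⁻¹ ((G ⊗ H).j (wdg g h)))
  have h3 := fun r => tensorμ_wdg_act (A := A ⊗ E) (B := B ⊗ F) (C' := C' ⊗ G) (D := D ⊗ H) (wdg a e)
    (wdg b f) (wdg c g) (wdg d h) r
  refine (congrArg (fun o => Hom.app (tensorμ (A ⊗ E) (B ⊗ F) (C' ⊗ G) (D ⊗ H))
    (Hom.app (tensorμ A B E F ⊗ₘ tensorμ C' D G H) o)) h1).trans
    ((congrArg (Hom.app (tensorμ (A ⊗ E) (B ⊗ F) (C' ⊗ G) (D ⊗ H))) h2).trans ((h3 _).trans ?_))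
  congr 1
  erw [wdg_j, wdg_j, wdg_j, wdg_j, wdg_j, wdg_j, wdg_j, wdg_j, wdg_j]
  simp only [M.mul_act, M.inv_act, mul_inv_rev, ← M.act_mul, mul_assoc]

/-- The two shuffles of eight torsors agree if and only if the third and the sixth of them
commute. -/
theorem interchange_tensorμ_iff :
    (tensorμ A B C' D ⊗ₘ tensorμ E F G H) ≫ tensorμ (A ⊗ C') (B ⊗ D) (E ⊗ G) (F ⊗ H) ≫
      (tensorμ A C' E G ⊗ₘ tensorμ B D F H) =
    tensorμ (A ⊗ B) (C' ⊗ D) (E ⊗ F) (G ⊗ H) ≫ (tensorμ A B E F ⊗ₘ tensorμ C' D G H) ≫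
      tensorμ (A ⊗ E) (B ⊗ F) (C' ⊗ G) (D ⊗ H) ↔
    (β_ C' F).hom ≫ (β_ F C').hom = 𝟙 (C' ⊗ F) := by
  rw [braiding_braiding_eq_id_iff]
  constructor
  · intro h U x c f
    obtain ⟨SA, hA, kA⟩ := A.inhab x
    obtain ⟨SB, hB, kB⟩ := B.inhab x
    obtain ⟨SD, hD, kD⟩ := D.inhab x
    obtain ⟨SE, hE, kE⟩ := E.inhab x
    obtain ⟨SG, hG, kG⟩ := G.inhab x
    obtain ⟨SH, hH, kH⟩ := H.inhab x
    refine gsep M.G (J.intersection_covering hA (J.intersection_covering hB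
      (J.intersection_covering hD (J.intersection_covering hE (J.intersection_covering hG hH)))))
      _ _ fun k hk => ?_
    obtain ⟨⟨a⟩, ⟨b⟩, ⟨d⟩, ⟨e⟩, ⟨g⟩, ⟨l⟩⟩ : Nonempty (A.carrier _) ∧ Nonempty (B.carrier _) ∧
      Nonempty (D.carrier _) ∧ Nonempty (E.carrier _) ∧ Nonempty (G.carrier _) ∧
      Nonempty (H.carrier _) := ⟨kA k hk.1, kB k hk.2.1, kD k hk.2.2.1, kE k hk.2.2.2.1,
        kG k hk.2.2.2.2.1, kH k hk.2.2.2.2.2⟩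
    have h1 := congrArg (fun χ => Hom.app χ (wdg (wdg (wdg a b) (wdg (C'.res k rfl c) d))
      (wdg (wdg e (F.res k rfl f)) (wdg g l)))) h
    simp only [interchange_lhs_wdg, interchange_rhs_wdg] at h1
    have h2 := inv_injective (act_inj h1)
    have h3 := congrArg (fun t => M.act t (H.j l)⁻¹) h2
    simp only [← M.act_mul, mul_inv_cancel, M.act_one] at h3
    rw [M.br_interchange] at h3
    have h4 := (mul_eq_right.1 h3.symm)
    rw [C'.j_res, F.j_res, ← M.br_res, ← M.br_res, ← map_mul] at h4
    rw [h4, map_one]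
  · intro h
    refine tensor_ext₈ fun a b c d e f g k => ?_
    rw [interchange_lhs_wdg, interchange_rhs_wdg, M.br_interchange, h, one_mul]

end Torsor
end
end Biext4

namespace Biext4

section Braided
universe v w v' w'
variable {A : Type w} [Category.{v} A] [MonoidalCategory A] [BraidedCategory A]

theorem prod_assoc_left {X X' Y Y' Z Z' V V' W W' : A} (m : X ⊗ Y ⟶ V) (m' : X' ⊗ Y' ⟶ V')
    (n : V ⊗ Z ⟶ W) (n' : V' ⊗ Z' ⟶ W') :
    ((tensorμ X X' Y Y' ≫ (m ⊗ₘ m')) ▷ (Z ⊗ Z')) ≫ tensorμ V V' Z Z' ≫ (n ⊗ₘ n') =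
      (tensorμ X X' Y Y' ▷ (Z ⊗ Z') ≫ tensorμ (X ⊗ Y) (X' ⊗ Y') Z Z') ≫
        ((m ▷ Z ≫ n) ⊗ₘ (m' ▷ Z' ≫ n')) := by
  rw [comp_whiskerRight, Category.assoc, tensorμ_natural_left_assoc, tensorHom_comp_tensorHom,
    Category.assoc]

theorem prod_assoc_right {X X' Y Y' Z Z' V V' W W' : A} (m : Y ⊗ Z ⟶ V) (m' : Y' ⊗ Z' ⟶ V')
    (n : X ⊗ V ⟶ W) (n' : X' ⊗ V' ⟶ W') :
    (α_ (X ⊗ X') (Y ⊗ Y') (Z ⊗ Z')).hom ≫ ((X ⊗ X') ◁ (tensorμ Y Y' Z Z' ≫ (m ⊗ₘ m'))) ≫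
        tensorμ X X' V V' ≫ (n ⊗ₘ n') =
      (tensorμ X X' Y Y' ▷ (Z ⊗ Z') ≫ tensorμ (X ⊗ Y) (X' ⊗ Y') Z Z') ≫
        (((α_ X Y Z).hom ≫ X ◁ m ≫ n) ⊗ₘ ((α_ X' Y' Z').hom ≫ X' ◁ m' ≫ n')) := by
  rw [whiskerLeft_comp, Category.assoc, tensorμ_natural_right_assoc, tensorHom_comp_tensorHom,
    ← tensorHom_comp_tensorHom (α_ X Y Z).hom, Category.assoc, tensor_associativity_assoc]

theorem prod_interchange_left {A₁ B₁ A₂ B₂ A₃ B₃ A₄ B₄ A₁₂ B₁₂ A₃₄ B₃₄ W W' : A}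
    (m : A₁ ⊗ A₂ ⟶ A₁₂) (m' : B₁ ⊗ B₂ ⟶ B₁₂) (n : A₃ ⊗ A₄ ⟶ A₃₄) (n' : B₃ ⊗ B₄ ⟶ B₃₄)
    (p : A₁₂ ⊗ A₃₄ ⟶ W) (p' : B₁₂ ⊗ B₃₄ ⟶ W') :
    ((tensorμ A₁ B₁ A₂ B₂ ≫ (m ⊗ₘ m')) ⊗ₘ (tensorμ A₃ B₃ A₄ B₄ ≫ (n ⊗ₘ n'))) ≫
        tensorμ A₁₂ B₁₂ A₃₄ B₃₄ ≫ (p ⊗ₘ p') =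
      (tensorμ A₁ B₁ A₂ B₂ ⊗ₘ tensorμ A₃ B₃ A₄ B₄) ≫
        tensorμ (A₁ ⊗ A₂) (B₁ ⊗ B₂) (A₃ ⊗ A₄) (B₃ ⊗ B₄) ≫
        (((m ⊗ₘ n) ≫ p) ⊗ₘ ((m' ⊗ₘ n') ≫ p')) := by
  rw [← tensorHom_comp_tensorHom, Category.assoc, tensorμ_natural_assoc, tensorHom_comp_tensorHom]

theorem tensorμ_isHom_assoc {X X' X'' Y Y' Y'' Z Z' Z'' : A} (m : X ⊗ Y ⟶ Z) (m' : X' ⊗ Y' ⟶ Z')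
    (m'' : X'' ⊗ Y'' ⟶ Z'') :
    (tensorμ (X ⊗ X') X'' (Y ⊗ Y') Y'' ≫ ((tensorμ X X' Y Y' ≫ (m ⊗ₘ m')) ⊗ₘ m'')) ≫
        (α_ Z Z' Z'').hom =
      ((α_ X X' X'').hom ⊗ₘ (α_ Y Y' Y'').hom) ≫ tensorμ X (X' ⊗ X'') Y (Y' ⊗ Y'') ≫
        (m ⊗ₘ (tensorμ X' X'' Y' Y'' ≫ (m' ⊗ₘ m''))) := by
  have h1 : (tensorμ X X' Y Y' ≫ (m ⊗ₘ m')) ⊗ₘ m'' =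
      (tensorμ X X' Y Y' ▷ (X'' ⊗ Y'')) ≫ ((m ⊗ₘ m') ⊗ₘ m'') := by
    rw [← tensorHom_id, tensorHom_comp_tensorHom, Category.id_comp]
  have h2 : m ⊗ₘ (tensorμ X' X'' Y' Y'' ≫ (m' ⊗ₘ m'')) =
      ((X ⊗ Y) ◁ tensorμ X' X'' Y' Y'') ≫ (m ⊗ₘ (m' ⊗ₘ m'')) := by
    rw [← id_tensorHom, tensorHom_comp_tensorHom, Category.id_comp]
  rw [h1, h2, Category.assoc, Category.assoc, associator_naturality, associator_monoidal_assoc]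

variable {B : Type w'} [Category.{v'} B] [MonoidalCategory B] [BraidedCategory B]
open Functor.LaxMonoidal Functor.OplaxMonoidal

theorem prod_natural_left (F : A ⥤ B) [F.Braided] {X X' Y Y' Z Z' : A} {T T' : B}
    (m : X ⊗ Y ⟶ Z) (m' : X' ⊗ Y' ⟶ Z') (r : F.obj Z ⟶ T) (r' : F.obj Z' ⟶ T') :
    μ F (X ⊗ X') (Y ⊗ Y') ≫ F.map (tensorμ X X' Y Y' ≫ (m ⊗ₘ m')) ≫ δ F Z Z' ≫ (r ⊗ₘ r') =
      ((δ F X X' ⊗ₘ δ F Y Y') ≫ tensorμ (F.obj X) (F.obj X') (F.obj Y) (F.obj Y')) ≫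
        ((μ F X Y ≫ F.map m ≫ r) ⊗ₘ (μ F X' Y' ≫ F.map m' ≫ r')) := by
  have h1 := tensorμ_comp_μ_tensorHom_μ_comp_μ F X X' Y Y'
  have h2 : (δ F X X' ⊗ₘ δ F Y Y') ≫ (μ F X X' ⊗ₘ μ F Y Y') = 𝟙 _ := by
    rw [tensorHom_comp_tensorHom, Functor.Monoidal.δ_μ, Functor.Monoidal.δ_μ, id_tensorHom_id]
  have h3 : μ F (X ⊗ X') (Y ⊗ Y') ≫ F.map (tensorμ X X' Y Y') =
      (δ F X X' ⊗ₘ δ F Y Y') ≫ tensorμ (F.obj X) (F.obj X') (F.obj Y) (F.obj Y') ≫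
        (μ F X Y ⊗ₘ μ F X' Y') ≫ μ F (X ⊗ Y) (X' ⊗ Y') := by
    rw [h1, reassoc_of% h2]
  rw [Functor.map_comp, Category.assoc, reassoc_of% h3, ← μ_natural_assoc,
    Functor.Monoidal.μ_δ_assoc]
  simp only [tensorHom_comp_tensorHom, Category.assoc]

theorem prod_natural_right (F : A ⥤ B) [F.Braided] {X X' Y Y' : A} {S S' T T' W W' : B}
    (r : F.obj X ⟶ S) (r' : F.obj X' ⟶ S') (t : F.obj Y ⟶ T) (t' : F.obj Y' ⟶ T')
    (m : S ⊗ T ⟶ W) (m' : S' ⊗ T' ⟶ W') :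
    ((δ F X X' ≫ (r ⊗ₘ r')) ⊗ₘ (δ F Y Y' ≫ (t ⊗ₘ t'))) ≫ tensorμ S S' T T' ≫ (m ⊗ₘ m') =
      ((δ F X X' ⊗ₘ δ F Y Y') ≫ tensorμ (F.obj X) (F.obj X') (F.obj Y) (F.obj Y')) ≫
        (((r ⊗ₘ t) ≫ m) ⊗ₘ ((r' ⊗ₘ t') ≫ m')) := by
  rw [← tensorHom_comp_tensorHom, Category.assoc, tensorμ_natural_assoc, tensorHom_comp_tensorHom,
    Category.assoc]

end Braided

section
variable {C : Type u} [SmallCategory C] {J : GrothendieckTopology C}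

namespace Torsor
variable {M : BraidedCrossedModule J} {X Y : Cᵒᵖ ⥤ Type u}

theorem pull_μ (φ : X ⟶ Y) (P Q : Torsor M Y) :
    Functor.LaxMonoidal.μ (pull φ) P Q = pullTensor φ P Q := rfl

noncomputable instance (φ : X ⟶ Y) : (pull (M := M) φ).Braided where
  braided P Q := tensor_ext fun p q => by
    rw [comp_app, comp_app, pull_μ, pull_μ, braiding_wdg, app_act_tensor]
    erw [pullTensor_wdg, pullTensor_wdg]
    exact braiding_wdg (P := P) (Q := Q) p q

theorem tensorμ_isHom_braiding (hM : M.IsSymmetric) (A B C' D : Torsor M X) :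
    tensorμ A B C' D ≫ (β_ (A ⊗ C') (B ⊗ D)).hom =
      ((β_ A B).hom ⊗ₘ (β_ C' D).hom) ≫ tensorμ B A D C' := by
  let _ : SymmetricCategory (Torsor M X) :=
    { symmetry := braiding_braiding_of_isSymmetric hM }
  simp [tensorμ, SymmetricCategory.braiding_swap_eq_inv_braiding B C', MonoidalCategory.tensorHom_def]

end Torsor

end
end Biext4

namespace Biext4
section
variable {C : Type u} [SmallCategory C] {J : GrothendieckTopology C}
open Biext4.Torsor Functor.LaxMonoidal Functor.OplaxMonoidal

namespace Torsor
variable {M : BraidedCrossedModule J} {X : Cᵒᵖ ⥤ Type u} {A B C' D E F G H : Torsor M X}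

theorem interchange_tensorHom_iff {W W' : Torsor M X} (q : (A ⊗ E) ⊗ (C' ⊗ G) ⟶ W)
    (q' : (B ⊗ F) ⊗ (D ⊗ H) ⟶ W') :
    ((tensorμ A B C' D ⊗ₘ tensorμ E F G H) ≫ tensorμ (A ⊗ C') (B ⊗ D) (E ⊗ G) (F ⊗ H)) ≫
      ((tensorμ A C' E G ≫ q) ⊗ₘ (tensorμ B D F H ≫ q')) =
    (tensorμ (A ⊗ B) (C' ⊗ D) (E ⊗ F) (G ⊗ H) ≫ (tensorμ A B E F ⊗ₘ tensorμ C' D G H) ≫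
      tensorμ (A ⊗ E) (B ⊗ F) (C' ⊗ G) (D ⊗ H)) ≫ (q ⊗ₘ q') ↔
    (β_ C' F).hom ≫ (β_ F C').hom = 𝟙 (C' ⊗ F) := by
  rw [← tensorHom_comp_tensorHom, ← Category.assoc, cancel_mono, Category.assoc,
    interchange_tensorμ_iff]

theorem cancel_interchange (hM : M.IsSymmetric) {W W' : Torsor M X}
    {p : (A ⊗ C') ⊗ (E ⊗ G) ⟶ W} {p' : (B ⊗ D) ⊗ (F ⊗ H) ⟶ W'}
    {q : (A ⊗ E) ⊗ (C' ⊗ G) ⟶ W} {q' : (B ⊗ F) ⊗ (D ⊗ H) ⟶ W'}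
    (h : ((tensorμ A B C' D ⊗ₘ tensorμ E F G H) ≫ tensorμ (A ⊗ C') (B ⊗ D) (E ⊗ G) (F ⊗ H)) ≫
      (p ⊗ₘ p') =
    (tensorμ (A ⊗ B) (C' ⊗ D) (E ⊗ F) (G ⊗ H) ≫ (tensorμ A B E F ⊗ₘ tensorμ C' D G H) ≫
      tensorμ (A ⊗ E) (B ⊗ F) (C' ⊗ G) (D ⊗ H)) ≫ (q ⊗ₘ q')) (hp : p = tensorμ A C' E G ≫ q) :
    p' = tensorμ B D F H ≫ q' := by
  rw [← (interchange_tensorHom_iff q q').2 (braiding_braiding_of_isSymmetric hM _ _), cancel_epi,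
    hp] at h
  exact tensorHom_cancel_left _ h

end Torsor

namespace BiData
variable {M : BraidedCrossedModule J} {H K : Sheaf J GrpCat.{u}} {S : Cᵒᵖ ⥤ Type u}
  {D D' D'' D''' : BiData M H K S}

theorem IsHom.id (D : BiData M H K S) : D.IsHom D (fun _ => 𝟙 _) :=
  ⟨by simp, by simp, by simp⟩

theorem IsHom.comp {φ : ∀ {U : C} (x : Pt S H K U), D.obj x ⟶ D'.obj x}
    {ψ : ∀ {U : C} (x : Pt S H K U), D'.obj x ⟶ D''.obj x} (hφ : D.IsHom D' φ)
    (hψ : D'.IsHom D'' ψ) : D.IsHom D'' (fun x => φ x ≫ ψ x) where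
  natural f _ _ h := by
    rw [← Category.assoc, hφ.natural, Category.assoc, hψ.natural, Functor.map_comp, Category.assoc]
  mul₁ m := by
    rw [← Category.assoc, hφ.mul₁, Category.assoc, hψ.mul₁, ← Category.assoc,
      tensorHom_comp_tensorHom]
  mul₂ m := by
    rw [← Category.assoc, hφ.mul₂, Category.assoc, hψ.mul₂, ← Category.assoc,
      tensorHom_comp_tensorHom]

theorem IsHom.inv {φ : ∀ {U : C} (x : Pt S H K U), D.obj x ⟶ D'.obj x}
    {ψ : ∀ {U : C} (x : Pt S H K U), D'.obj x ⟶ D.obj x} (hφ : D.IsHom D' φ)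
    (h : ∀ {U : C} (x : Pt S H K U), φ x ≫ ψ x = 𝟙 _) : D'.IsHom D ψ where
  natural f x y e := by
    rw [← cancel_epi ((rst f).map (φ x)), ← Category.assoc, ← hφ.natural, Category.assoc, h,
      ← Category.assoc, ← Functor.map_comp, h, CategoryTheory.Functor.map_id, Category.comp_id, Category.id_comp]
  mul₁ {_ x y _} m := by
    rw [← cancel_epi (φ x ⊗ₘ φ y), ← Category.assoc, ← hφ.mul₁, Category.assoc, h,
      ← Category.assoc, tensorHom_comp_tensorHom, h, h, id_tensorHom_id, Category.comp_id,
      Category.id_comp]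
  mul₂ {_ x y _} m := by
    rw [← cancel_epi (φ x ⊗ₘ φ y), ← Category.assoc, ← hφ.mul₂, Category.assoc, h,
      ← Category.assoc, tensorHom_comp_tensorHom, h, h, id_tensorHom_id, Category.comp_id,
      Category.id_comp]

theorem IsHom.prod {φ : ∀ {U : C} (x : Pt S H K U), D.obj x ⟶ D'.obj x}
    {ψ : ∀ {U : C} (x : Pt S H K U), D''.obj x ⟶ D'''.obj x} (hφ : D.IsHom D' φ)
    (hψ : D''.IsHom D''' ψ) : (D.prod D'').IsHom (D'.prod D''') (fun x => φ x ⊗ₘ ψ x) where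
  natural f x y h := by
    change (δ _ _ _ ≫ (_ ⊗ₘ _)) ≫ (_ ⊗ₘ _) = (rst f).map _ ≫ δ _ _ _ ≫ (_ ⊗ₘ _)
    rw [Category.assoc, tensorHom_comp_tensorHom, hφ.natural, hψ.natural,
      ← tensorHom_comp_tensorHom, δ_natural_assoc]
  mul₁ {_ x y z} m := by
    change (tensorμ _ _ _ _ ≫ (_ ⊗ₘ _)) ≫ (_ ⊗ₘ _) = (_ ⊗ₘ _) ≫ tensorμ _ _ _ _ ≫ (_ ⊗ₘ _)
    rw [Category.assoc, tensorHom_comp_tensorHom, hφ.mul₁, hψ.mul₁, ← tensorHom_comp_tensorHom,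
      tensorμ_natural_assoc]
  mul₂ {_ x y z} m := by
    change (tensorμ _ _ _ _ ≫ (_ ⊗ₘ _)) ≫ (_ ⊗ₘ _) = (_ ⊗ₘ _) ≫ tensorμ _ _ _ _ ≫ (_ ⊗ₘ _)
    rw [Category.assoc, tensorHom_comp_tensorHom, hφ.mul₂, hψ.mul₂, ← tensorHom_comp_tensorHom,
      tensorμ_natural_assoc]

/-- Laws can be transported along isomorphisms. -/
theorem IsLaw.of_isHom (hD : D.IsLaw) {φ : ∀ {U : C} (x : Pt S H K U), D.obj x ⟶ D'.obj x}
    (hφ : D.IsHom D' φ) : D'.IsLaw where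
  natural₁ f x y z x' y' z' hx hy hz m m' := by
    rw [← cancel_epi ((rst f).map (φ x) ⊗ₘ (rst f).map (φ y)), μ_natural_assoc,
      ← Functor.map_comp_assoc, ← hφ.mul₁, Functor.map_comp_assoc, ← hφ.natural,
      tensorHom_comp_tensorHom_assoc, ← hφ.natural, ← hφ.natural, ← tensorHom_comp_tensorHom_assoc,
      ← hφ.mul₁]
    simpa only [Category.assoc] using congrArg (· ≫ φ z') (hD.natural₁ f hx hy hz m m')
  natural₂ f x y z x' y' z' hx hy hz m m' := by
    rw [← cancel_epi ((rst f).map (φ x) ⊗ₘ (rst f).map (φ y)), μ_natural_assoc,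
      ← Functor.map_comp_assoc, ← hφ.mul₂, Functor.map_comp_assoc, ← hφ.natural,
      tensorHom_comp_tensorHom_assoc, ← hφ.natural, ← hφ.natural, ← tensorHom_comp_tensorHom_assoc,
      ← hφ.mul₂]
    simpa only [Category.assoc] using congrArg (· ≫ φ z') (hD.natural₂ f hx hy hz m m')
  assoc₁ {U x y z xy yz xyz} m n m' n' := by
    rw [← cancel_epi ((φ x ⊗ₘ φ y) ⊗ₘ φ z), associator_naturality_assoc, ← tensorHom_id,
      ← id_tensorHom, tensorHom_comp_tensorHom_assoc, tensorHom_comp_tensorHom_assoc, ← hφ.mul₁,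
      ← hφ.mul₁, Category.comp_id, Category.comp_id, ← Category.id_comp (φ z),
      ← tensorHom_comp_tensorHom_assoc, ← hφ.mul₁, ← Category.id_comp (φ x),
      ← tensorHom_comp_tensorHom_assoc, ← hφ.mul₁, tensorHom_id, id_tensorHom]
    simpa only [Category.assoc] using congrArg (· ≫ φ xyz) (hD.assoc₁ m n m' n')
  assoc₂ {U x y z xy yz xyz} m n m' n' := by
    rw [← cancel_epi ((φ x ⊗ₘ φ y) ⊗ₘ φ z), associator_naturality_assoc, ← tensorHom_id,
      ← id_tensorHom, tensorHom_comp_tensorHom_assoc, tensorHom_comp_tensorHom_assoc, ← hφ.mul₂,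
      ← hφ.mul₂, Category.comp_id, Category.comp_id, ← Category.id_comp (φ z),
      ← tensorHom_comp_tensorHom_assoc, ← hφ.mul₂, ← Category.id_comp (φ x),
      ← tensorHom_comp_tensorHom_assoc, ← hφ.mul₂, tensorHom_id, id_tensorHom]
    simpa only [Category.assoc] using congrArg (· ≫ φ xyz) (hD.assoc₂ m n m' n')
  interchange {U x y z w xy zw xz yw t} m n p m' n' p' := by
    rw [← cancel_epi ((φ x ⊗ₘ φ y) ⊗ₘ (φ z ⊗ₘ φ w)), tensorμ_natural_assoc,
      tensorHom_comp_tensorHom_assoc, tensorHom_comp_tensorHom_assoc, ← hφ.mul₁, ← hφ.mul₁,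
      ← hφ.mul₂, ← hφ.mul₂, ← tensorHom_comp_tensorHom_assoc, ← tensorHom_comp_tensorHom_assoc,
      ← hφ.mul₂, ← hφ.mul₁]
    simpa only [Category.assoc] using congrArg (· ≫ φ t) (hD.interchange m n p m' n' p')

theorem prod_natural₁_iff {U V : C} (f : V ⟶ U) {x y z : Pt S H K U} {x' y' z' : Pt S H K V}
    (hx : x.restrict f = x') (hy : y.restrict f = y') (hz : z.restrict f = z')
    (m : Pt.Mul₁ x y z) (m' : Pt.Mul₁ x' y' z') :
    (μ (rst f) ((D.prod D').obj x) ((D.prod D').obj y) ≫ (rst f).map ((D.prod D').mul₁ m) ≫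
        (D.prod D').res f hz =
      ((D.prod D').res f hx ⊗ₘ (D.prod D').res f hy) ≫ (D.prod D').mul₁ m') ↔
    (μ (rst f) (D.obj x) (D.obj y) ≫ (rst f).map (D.mul₁ m) ≫ D.res f hz) ⊗ₘ
        (μ (rst f) (D'.obj x) (D'.obj y) ≫ (rst f).map (D'.mul₁ m) ≫ D'.res f hz) =
      ((D.res f hx ⊗ₘ D.res f hy) ≫ D.mul₁ m') ⊗ₘ ((D'.res f hx ⊗ₘ D'.res f hy) ≫ D'.mul₁ m') := by
  refine Iff.trans ?_ (cancel_epi ((δ (rst f) (D.obj x) (D'.obj x) ⊗ₘ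
    δ (rst f) (D.obj y) (D'.obj y)) ≫ tensorμ _ _ _ _))
  exact Eq.congr (prod_natural_left (rst f) (D.mul₁ m) (D'.mul₁ m) (D.res f hz) (D'.res f hz))
    (prod_natural_right (rst f) (D.res f hx) (D'.res f hx) (D.res f hy) (D'.res f hy) (D.mul₁ m')
      (D'.mul₁ m'))

theorem prod_natural₂_iff {U V : C} (f : V ⟶ U) {x y z : Pt S H K U} {x' y' z' : Pt S H K V}
    (hx : x.restrict f = x') (hy : y.restrict f = y') (hz : z.restrict f = z')
    (m : Pt.Mul₂ x y z) (m' : Pt.Mul₂ x' y' z') :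
    (μ (rst f) ((D.prod D').obj x) ((D.prod D').obj y) ≫ (rst f).map ((D.prod D').mul₂ m) ≫
        (D.prod D').res f hz =
      ((D.prod D').res f hx ⊗ₘ (D.prod D').res f hy) ≫ (D.prod D').mul₂ m') ↔
    (μ (rst f) (D.obj x) (D.obj y) ≫ (rst f).map (D.mul₂ m) ≫ D.res f hz) ⊗ₘ
        (μ (rst f) (D'.obj x) (D'.obj y) ≫ (rst f).map (D'.mul₂ m) ≫ D'.res f hz) =
      ((D.res f hx ⊗ₘ D.res f hy) ≫ D.mul₂ m') ⊗ₘ ((D'.res f hx ⊗ₘ D'.res f hy) ≫ D'.mul₂ m') := by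
  refine Iff.trans ?_ (cancel_epi ((δ (rst f) (D.obj x) (D'.obj x) ⊗ₘ
    δ (rst f) (D.obj y) (D'.obj y)) ≫ tensorμ _ _ _ _))
  exact Eq.congr (prod_natural_left (rst f) (D.mul₂ m) (D'.mul₂ m) (D.res f hz) (D'.res f hz))
    (prod_natural_right (rst f) (D.res f hx) (D'.res f hx) (D.res f hy) (D'.res f hy) (D.mul₂ m')
      (D'.mul₂ m'))

theorem prod_assoc₁_iff {U : C} {x y z xy yz xyz : Pt S H K U} (m : Pt.Mul₁ x y xy)
    (n : Pt.Mul₁ xy z xyz) (m' : Pt.Mul₁ y z yz) (n' : Pt.Mul₁ x yz xyz) :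
    (((D.prod D').mul₁ m ▷ (D.prod D').obj z) ≫ (D.prod D').mul₁ n =
      (α_ ((D.prod D').obj x) ((D.prod D').obj y) ((D.prod D').obj z)).hom ≫
        ((D.prod D').obj x ◁ (D.prod D').mul₁ m') ≫ (D.prod D').mul₁ n') ↔
    ((D.mul₁ m ▷ D.obj z) ≫ D.mul₁ n) ⊗ₘ ((D'.mul₁ m ▷ D'.obj z) ≫ D'.mul₁ n) =
      ((α_ (D.obj x) (D.obj y) (D.obj z)).hom ≫ (D.obj x ◁ D.mul₁ m') ≫ D.mul₁ n') ⊗ₘ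
      ((α_ (D'.obj x) (D'.obj y) (D'.obj z)).hom ≫ (D'.obj x ◁ D'.mul₁ m') ≫ D'.mul₁ n') := by
  refine Iff.trans ?_ (cancel_epi (tensorμ (D.obj x) (D'.obj x) (D.obj y) (D'.obj y) ▷
    (D.obj z ⊗ D'.obj z) ≫ tensorμ _ _ _ _))
  exact Eq.congr (prod_assoc_left (D.mul₁ m) (D'.mul₁ m) (D.mul₁ n) (D'.mul₁ n))
    (prod_assoc_right (D.mul₁ m') (D'.mul₁ m') (D.mul₁ n') (D'.mul₁ n'))

theorem prod_assoc₂_iff {U : C} {x y z xy yz xyz : Pt S H K U} (m : Pt.Mul₂ x y xy)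
    (n : Pt.Mul₂ xy z xyz) (m' : Pt.Mul₂ y z yz) (n' : Pt.Mul₂ x yz xyz) :
    (((D.prod D').mul₂ m ▷ (D.prod D').obj z) ≫ (D.prod D').mul₂ n =
      (α_ ((D.prod D').obj x) ((D.prod D').obj y) ((D.prod D').obj z)).hom ≫
        ((D.prod D').obj x ◁ (D.prod D').mul₂ m') ≫ (D.prod D').mul₂ n') ↔
    ((D.mul₂ m ▷ D.obj z) ≫ D.mul₂ n) ⊗ₘ ((D'.mul₂ m ▷ D'.obj z) ≫ D'.mul₂ n) =
      ((α_ (D.obj x) (D.obj y) (D.obj z)).hom ≫ (D.obj x ◁ D.mul₂ m') ≫ D.mul₂ n') ⊗ₘ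
      ((α_ (D'.obj x) (D'.obj y) (D'.obj z)).hom ≫ (D'.obj x ◁ D'.mul₂ m') ≫ D'.mul₂ n') := by
  refine Iff.trans ?_ (cancel_epi (tensorμ (D.obj x) (D'.obj x) (D.obj y) (D'.obj y) ▷
    (D.obj z ⊗ D'.obj z) ≫ tensorμ _ _ _ _))
  exact Eq.congr (prod_assoc_left (D.mul₂ m) (D'.mul₂ m) (D.mul₂ n) (D'.mul₂ n))
    (prod_assoc_right (D.mul₂ m') (D'.mul₂ m') (D.mul₂ n') (D'.mul₂ n'))

section
variable {U : C} {x y z w xy zw xz yw t : Pt S H K U}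
    (m : Pt.Mul₁ x y xy) (n : Pt.Mul₁ z w zw) (p : Pt.Mul₂ xy zw t)
    (m' : Pt.Mul₂ x z xz) (n' : Pt.Mul₂ y w yw) (p' : Pt.Mul₁ xz yw t)

theorem prod_interchange_lhs : ((D.prod D').mul₁ m ⊗ₘ (D.prod D').mul₁ n) ≫ (D.prod D').mul₂ p =
    ((tensorμ (D.obj x) (D'.obj x) (D.obj y) (D'.obj y) ⊗ₘ
      tensorμ (D.obj z) (D'.obj z) (D.obj w) (D'.obj w)) ≫ tensorμ _ _ _ _) ≫
      (((D.mul₁ m ⊗ₘ D.mul₁ n) ≫ D.mul₂ p) ⊗ₘ ((D'.mul₁ m ⊗ₘ D'.mul₁ n) ≫ D'.mul₂ p)) :=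
  (prod_interchange_left (D.mul₁ m) (D'.mul₁ m) (D.mul₁ n) (D'.mul₁ n) (D.mul₂ p)
    (D'.mul₂ p)).trans (Category.assoc _ _ _).symm

theorem prod_interchange_rhs : tensorμ ((D.prod D').obj x) ((D.prod D').obj y)
      ((D.prod D').obj z) ((D.prod D').obj w) ≫
      ((D.prod D').mul₂ m' ⊗ₘ (D.prod D').mul₂ n') ≫ (D.prod D').mul₁ p' =
    (tensorμ (D.obj x ⊗ D'.obj x) (D.obj y ⊗ D'.obj y) (D.obj z ⊗ D'.obj z) (D.obj w ⊗ D'.obj w) ≫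
      (tensorμ (D.obj x) (D'.obj x) (D.obj z) (D'.obj z) ⊗ₘ
        tensorμ (D.obj y) (D'.obj y) (D.obj w) (D'.obj w)) ≫ tensorμ _ _ _ _) ≫
      (((D.mul₂ m' ⊗ₘ D.mul₂ n') ≫ D.mul₁ p') ⊗ₘ ((D'.mul₂ m' ⊗ₘ D'.mul₂ n') ≫ D'.mul₁ p')) :=
  (congrArg (tensorμ (D.obj x ⊗ D'.obj x) (D.obj y ⊗ D'.obj y) (D.obj z ⊗ D'.obj z)
    (D.obj w ⊗ D'.obj w) ≫ ·) (prod_interchange_left (D.mul₂ m') (D'.mul₂ m') (D.mul₂ n')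
      (D'.mul₂ n') (D.mul₁ p') (D'.mul₁ p'))).trans (by simp only [Category.assoc])

theorem prod_interchange_iff (hD : D.IsLaw) (hD' : D'.IsLaw) :
    (((D.prod D').mul₁ m ⊗ₘ (D.prod D').mul₁ n) ≫ (D.prod D').mul₂ p =
      tensorμ ((D.prod D').obj x) ((D.prod D').obj y) ((D.prod D').obj z) ((D.prod D').obj w) ≫
        ((D.prod D').mul₂ m' ⊗ₘ (D.prod D').mul₂ n') ≫ (D.prod D').mul₁ p') ↔
    (β_ (D.obj y) (D'.obj z)).hom ≫ (β_ (D'.obj z) (D.obj y)).hom = 𝟙 _ := by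
  refine (Eq.congr (prod_interchange_lhs m n p) (prod_interchange_rhs m' n' p')).trans ?_
  rw [hD.interchange m n p m' n' p', hD'.interchange m n p m' n' p']
  exact interchange_tensorHom_iff _ _

theorem interchange_of_prod (hM : M.IsSymmetric) (hD : D.IsLaw)
    (h : ((D.prod D').mul₁ m ⊗ₘ (D.prod D').mul₁ n) ≫ (D.prod D').mul₂ p =
      tensorμ ((D.prod D').obj x) ((D.prod D').obj y) ((D.prod D').obj z) ((D.prod D').obj w) ≫
        ((D.prod D').mul₂ m' ⊗ₘ (D.prod D').mul₂ n') ≫ (D.prod D').mul₁ p') :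
    (D'.mul₁ m ⊗ₘ D'.mul₁ n) ≫ D'.mul₂ p =
      tensorμ (D'.obj x) (D'.obj y) (D'.obj z) (D'.obj w) ≫ (D'.mul₂ m' ⊗ₘ D'.mul₂ n') ≫
        D'.mul₁ p' := by
  exact cancel_interchange hM ((prod_interchange_lhs m n p).symm.trans
    (h.trans (prod_interchange_rhs m' n' p'))) (hD.interchange m n p m' n' p')

end

/-- The product of two laws is a law if and only if the values of the two factors at points over
the same point of the base commute. -/
theorem prod_isLaw_iff (hD : D.IsLaw) (hD' : D'.IsLaw) : (D.prod D').IsLaw ↔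
    ∀ (U : C) (x y : Pt S H K U), x.s = y.s →
      (β_ (D.obj x) (D'.obj y)).hom ≫ (β_ (D'.obj y) (D.obj x)).hom = 𝟙 (D.obj x ⊗ D'.obj y) := by
  constructor
  · intro h U x y e
    exact (prod_interchange_iff (x := ⟨x.s, y.h, x.k⟩) (y := x) (z := y) (w := ⟨x.s, x.h, y.k⟩)
      (xy := ⟨x.s, y.h * x.h, x.k⟩) (zw := ⟨x.s, y.h * x.h, y.k⟩) (xz := ⟨x.s, y.h, x.k * y.k⟩)
      (yw := ⟨x.s, x.h, x.k * y.k⟩) (t := ⟨x.s, y.h * x.h, x.k * y.k⟩)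
      ⟨rfl, rfl, rfl, rfl, rfl⟩ ⟨e, e, rfl, rfl, rfl⟩ ⟨rfl, rfl, rfl, rfl, rfl⟩
      ⟨e.symm, rfl, rfl, rfl, rfl⟩ ⟨rfl, rfl, rfl, rfl, rfl⟩ ⟨rfl, rfl, rfl, rfl, rfl⟩ hD hD').1
      (h.interchange _ _ _ _ _ _)
  · intro h
    refine ⟨?_, ?_, ?_, ?_, ?_⟩
    · intro U V f x y z x' y' z' hx hy hz m m'
      rw [prod_natural₁_iff, hD.natural₁ f hx hy hz m m', hD'.natural₁ f hx hy hz m m']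
    · intro U V f x y z x' y' z' hx hy hz m m'
      rw [prod_natural₂_iff, hD.natural₂ f hx hy hz m m', hD'.natural₂ f hx hy hz m m']
    · intro U x y z xy yz xyz m n m' n'
      rw [prod_assoc₁_iff, hD.assoc₁ m n m' n', hD'.assoc₁ m n m' n']
    · intro U x y z xy yz xyz m n m' n'
      rw [prod_assoc₂_iff, hD.assoc₂ m n m' n', hD'.assoc₂ m n m' n']
    · intro U x y z w xy zw xz yw t m n p m' n' p'
      rw [prod_interchange_iff _ _ _ _ _ _ hD hD']
      exact h U y z (m.s.trans m'.s.symm)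

theorem IsLaw.prod (hM : M.IsSymmetric) (hD : D.IsLaw) (hD' : D'.IsLaw) : (D.prod D').IsLaw :=
  (prod_isLaw_iff hD hD').2 fun _ _ _ _ => braiding_braiding_of_isSymmetric hM _ _

/-- A factor of a product of laws is a law if the other one is. -/
theorem isLaw_of_prod (hM : M.IsSymmetric) (hD : D.IsLaw) (h : (D.prod D').IsLaw) :
    D'.IsLaw where
  natural₁ f _ _ _ _ _ _ hx hy hz m m' := by
    have h1 := (prod_natural₁_iff f hx hy hz m m').1 (h.natural₁ f hx hy hz m m')
    rw [hD.natural₁ f hx hy hz m m'] at h1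
    exact tensorHom_cancel_left _ h1
  natural₂ f _ _ _ _ _ _ hx hy hz m m' := by
    have h1 := (prod_natural₂_iff f hx hy hz m m').1 (h.natural₂ f hx hy hz m m')
    rw [hD.natural₂ f hx hy hz m m'] at h1
    exact tensorHom_cancel_left _ h1
  assoc₁ m n m' n' := by
    have h1 := (prod_assoc₁_iff m n m' n').1 (h.assoc₁ m n m' n')
    rw [hD.assoc₁ m n m' n'] at h1
    exact tensorHom_cancel_left _ h1
  assoc₂ m n m' n' := by
    have h1 := (prod_assoc₂_iff m n m' n').1 (h.assoc₂ m n m' n')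
    rw [hD.assoc₂ m n m' n'] at h1
    exact tensorHom_cancel_left _ h1
  interchange m n p m' n' p' := interchange_of_prod m n p m' n' p' hM hD
    (h.interchange m n p m' n' p')

end BiData
end
end Biext4

namespace Biext4
section
variable {C : Type u} [SmallCategory C] {J : GrothendieckTopology C}
open Biext4.Torsor Functor.LaxMonoidal Functor.OplaxMonoidal

namespace Torsor
variable {M : BraidedCrossedModule J} {X Y Z : Cᵒᵖ ⥤ Type u}

theorem μ_pull_id (P Q : Torsor M X) :
    μ (pull (𝟙 X)) P Q = 𝟙 (P ⊗ Q) :=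
  tensor_ext fun p q => pullTensor_wdg (𝟙 X) P Q p q

theorem δ_pull_id (P Q : Torsor M X) : δ (pull (𝟙 X)) P Q = 𝟙 (P ⊗ Q) :=
  (cancel_epi (μ (pull (𝟙 X)) P Q)).1 ((Functor.Monoidal.μ_δ (pull (𝟙 X)) P Q).trans
    ((μ_pull_id P Q).symm.trans (Category.comp_id _).symm))

theorem μ_pull_comp (φ : X ⟶ Y) (ψ : Y ⟶ Z) (P Q : Torsor M Z) :
    μ (pull (φ ≫ ψ)) P Q =
      μ (pull φ) ((pull ψ).obj P) ((pull ψ).obj Q) ≫ (pull φ).map (μ (pull ψ) P Q) :=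
  tensor_ext fun p q => by
    refine (pullTensor_wdg (φ ≫ ψ) P Q p q).trans (Eq.symm ?_)
    exact (congrArg (Hom.app ((pull φ).map (μ (pull ψ) P Q)))
      (pullTensor_wdg φ ((pull ψ).obj P) ((pull ψ).obj Q) p q)).trans (pullTensor_wdg ψ P Q p q)

theorem δ_pull_comp (φ : X ⟶ Y) (ψ : Y ⟶ Z) (P Q : Torsor M Z) :
    δ (pull (φ ≫ ψ)) P Q =
      (pull φ).map (δ (pull ψ) P Q) ≫ δ (pull φ) ((pull ψ).obj P) ((pull ψ).obj Q) := by
  refine (cancel_epi (μ (pull (φ ≫ ψ)) P Q)).1 ((Functor.Monoidal.μ_δ (pull (φ ≫ ψ)) P Q).trans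
    (Eq.symm ?_))
  refine (congrArg (· ≫ (pull φ).map (δ (pull ψ) P Q) ≫
    δ (pull φ) ((pull ψ).obj P) ((pull ψ).obj Q)) (μ_pull_comp φ ψ P Q)).trans ?_
  have h : (μ (pull φ) ((pull ψ).obj P) ((pull ψ).obj Q) ≫ (pull φ).map (μ (pull ψ) P Q)) ≫
      (pull φ).map (δ (pull ψ) P Q) ≫ δ (pull φ) ((pull ψ).obj P) ((pull ψ).obj Q) = 𝟙 _ := by
    rw [Category.assoc, ← Functor.map_comp_assoc, Functor.Monoidal.μ_δ,
      CategoryTheory.Functor.map_id, Category.id_comp, Functor.Monoidal.μ_δ]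
  exact h

theorem pullCongr_δ {φ ψ : X ⟶ Y} (h : φ = ψ) (P Q : Torsor M Y) :
    pullCongr h (P ⊗ Q) ≫ δ (pull ψ) P Q =
      δ (pull φ) P Q ≫ (pullCongr h P ⊗ₘ pullCongr h Q) := by
  subst h
  simp [pullCongr]

theorem pullCongr_comp_δ {φ : X ⟶ Y} {ψ : Y ⟶ Z} {χ : X ⟶ Z} (h : φ ≫ ψ = χ) (P Q : Torsor M Z) :
    (pullCongr h (P ⊗ Q) : (pull φ).obj ((pull ψ).obj (P ⊗ Q)) ⟶ _) ≫ δ (pull χ) P Q =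
      (pull φ).map (δ (pull ψ) P Q) ≫ δ (pull φ) ((pull ψ).obj P) ((pull ψ).obj Q) ≫
        (pullCongr h P ⊗ₘ pullCongr h Q) := by
  refine (pullCongr_δ h P Q).trans ?_
  rw [δ_pull_comp]
  exact Category.assoc _ _ _

end Torsor

theorem rstComp_δ {M : BraidedCrossedModule J} {U V W : C} (f : V ⟶ U) (g : W ⟶ V)
    (P Q : Torsor M (yoneda.obj U)) :
    rstComp f g (P ⊗ Q) ≫ (rst g).map (δ (rst f) P Q) ≫
        δ (rst g) ((rst f).obj P) ((rst f).obj Q) =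
      δ (rst (g ≫ f)) P Q ≫ (rstComp f g P ⊗ₘ rstComp f g Q) :=
  (congrArg (rstComp f g (P ⊗ Q) ≫ ·) (δ_pull_comp (yoneda.map g) (yoneda.map f) P Q).symm).trans
    (pullCongr_δ (yoneda.map_comp g f) P Q)

namespace BiData
variable {M : BraidedCrossedModule J} {H K : Sheaf J GrpCat.{u}} {S : Cᵒᵖ ⥤ Type u}
  {D D' : BiData M H K S}

theorem IsBiadd.prod (hM : M.IsSymmetric) (hD : D.IsBiadd) (hD' : D'.IsBiadd) :
    (D.prod D').IsBiadd where
  toIsLaw := hD.toIsLaw.prod hM hD'.toIsLaw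
  res_id {U x} h := by
    change δ (rst (𝟙 U)) _ _ ≫ (D.res (𝟙 U) h ⊗ₘ D'.res (𝟙 U) h) = rstId (D.obj x ⊗ D'.obj x)
    rw [hD.res_id, hD'.res_id]
    refine (pullCongr_δ (yoneda.map_id U) (D.obj x) (D'.obj x)).symm.trans ?_
    rw [δ_pull_id]
    exact Category.comp_id _
  res_comp {U V W} f g x y z hf hg h := by
    change δ (rst (g ≫ f)) _ _ ≫ (D.res (g ≫ f) h ⊗ₘ D'.res (g ≫ f) h) =
      rstComp f g (D.obj x ⊗ D'.obj x) ≫ (rst g).map (δ (rst f) _ _ ≫ (_ ⊗ₘ _)) ≫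
        δ (rst g) _ _ ≫ (_ ⊗ₘ _)
    rw [hD.res_comp f g hf hg h, hD'.res_comp f g hf hg h, ← tensorHom_comp_tensorHom,
      ← tensorHom_comp_tensorHom, (rst g).map_comp, Category.assoc, ← δ_natural_assoc,
      reassoc_of% rstComp_δ f g (D.obj x) (D'.obj x)]
  unit _ _ m n e₁ e₂ h₁ h₂ := (hD.toIsLaw.prod hM hD'.toIsLaw).unit_aux m n e₁ e₂ h₁ h₂

end BiData

theorem comp_μ_δ {A B : Type*} [Category* A] [MonoidalCategory A] [Category* B]
    [MonoidalCategory B] (F : A ⥤ B) [F.Monoidal] {P Q : A} {X Y Z : B} (a : X ⟶ Y)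
    (b : Y ⟶ Z) (c : Z ⟶ F.obj P ⊗ F.obj Q) :
    (a ≫ b ≫ c ≫ μ F P Q) ≫ δ F P Q = a ≫ b ≫ c := by simp

namespace BiextData
variable {M : BraidedCrossedModule J} {H K : Sheaf J GrpCat.{u}} {S : Cᵒᵖ ⥤ Type u}
  {E F : BiextData M H K S}

theorem IsHom.toBiData {φ : E.tor ⟶ F.tor} (h : E.IsHom F φ) :
    E.toBiData.IsHom F.toBiData (fun x => (pull x.map).map φ) where
  natural {U V} f x y h := by
    have key : ∀ {A : Cᵒᵖ ⥤ Type u} {a b : A ⟶ base S H K} (e : a = b),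
        pullCongr e E.tor ≫ (pull b).map φ = (pull a).map φ ≫ pullCongr e F.tor := by
      intro A a b e
      subst e
      exact (Category.id_comp _).trans (Category.comp_id _).symm
    exact key (Pt.map_restrict h)
  mul₁ m := h.mul₁ m
  mul₂ m := h.mul₂ m

theorem isHom_of_toBiData {φ : E.tor ⟶ F.tor}
    (h : E.toBiData.IsHom F.toBiData (fun x => (pull x.map).map φ)) : E.IsHom F φ :=
  ⟨fun m => h.mul₁ m, fun m => h.mul₂ m⟩

/-- The fibers of a contracted product are the contracted products of the fibers. -/
theorem isHom_δ (E F : BiextData M H K S) :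
    (E.prod F).toBiData.IsHom (E.toBiData.prod F.toBiData)
      (fun x => δ (pull x.map) E.tor F.tor) where
  natural _ _ _ h := pullCongr_comp_δ (Pt.map_restrict h) E.tor F.tor
  mul₁ {_ _ _ z} _ := comp_μ_δ (pull z.map) _ _ _
  mul₂ {_ _ _ z} _ := comp_μ_δ (pull z.map) _ _ _

theorem isHom_μ (E F : BiextData M H K S) :
    (E.toBiData.prod F.toBiData).IsHom (E.prod F).toBiData
      (fun x => μ (pull x.map) E.tor F.tor) :=
  (isHom_δ E F).inv fun x => Functor.Monoidal.δ_μ (pull x.map) E.tor F.tor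

theorem prod_isBiext_iff : (E.prod F).IsBiext ↔ (E.toBiData.prod F.toBiData).IsLaw :=
  ⟨fun h => BiData.IsLaw.of_isHom h (isHom_δ E F),
    fun h => BiData.IsLaw.of_isHom h (isHom_μ E F)⟩

theorem IsBiext.of_isHom (h : E.IsBiext) {φ : E.tor ⟶ F.tor} (hφ : E.IsHom F φ) : F.IsBiext :=
  BiData.IsLaw.of_isHom h hφ.toBiData

theorem IsBiext.prod (hM : M.IsSymmetric) (hE : E.IsBiext) (hF : F.IsBiext) :
    (E.prod F).IsBiext :=
  prod_isBiext_iff.2 (BiData.IsLaw.prod hM hE hF)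

end BiextData

theorem Biext.prod_isBiext_iff {M : BraidedCrossedModule J} {H K : Sheaf J GrpCat.{u}}
    {S : Cᵒᵖ ⥤ Type u} (E F : Biext M H K S) :
    (E.data.prod F.data).IsBiext ↔ ∀ (U : C) (x y : Pt S H K U), x.s = y.s →
      (β_ (fib E.data.tor x) (fib F.data.tor y)).hom ≫
        (β_ (fib F.data.tor y) (fib E.data.tor x)).hom =
          𝟙 (fib E.data.tor x ⊗ fib F.data.tor y) :=
  BiextData.prod_isBiext_iff.trans (BiData.prod_isLaw_iff E.isBiext F.isBiext)

end
end Biext4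

namespace Biext4
section
variable {C : Type u} [SmallCategory C] {J : GrothendieckTopology C}
open Biext4.Torsor Functor.LaxMonoidal Functor.OplaxMonoidal

/-- A partial composition law `E_x × E_y ⟶ E_z` on a torsor, defined for `r x y z`. -/
structure PartialLaw {M : BraidedCrossedModule J} {X : Cᵒᵖ ⥤ Type u} (E : Torsor M X)
    (r : ∀ {U : C}, X.obj (op U) → X.obj (op U) → X.obj (op U) → Prop) where
  mul : ∀ {U : C} {x y z : X.obj (op U)}, r x y z → E.carrier x → E.carrier y → E.carrier z
  res : ∀ {U V : C} (f : V ⟶ U) {x y z : X.obj (op U)} {x' y' z' : X.obj (op V)}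
    (hx : rs X f x = x') (hy : rs X f y = y') (hz : rs X f z = z') (m : r x y z) (m' : r x' y' z')
    (p : E.carrier x) (q : E.carrier y),
    E.res f hz (mul m p q) = mul m' (E.res f hx p) (E.res f hy q)
  bal : ∀ {U : C} {x y z : X.obj (op U)} (m : r x y z) (p : E.carrier x) (q : E.carrier y)
    (g : Sec M.G U), mul m (E.act p g) q = mul m p (E.lact g q)
  act : ∀ {U : C} {x y z : X.obj (op U)} (m : r x y z) (p : E.carrier x) (q : E.carrier y)
    (g : Sec M.G U), mul m p (E.act q g) = E.act (mul m p q) g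
  j : ∀ {U : C} {x y z : X.obj (op U)} (m : r x y z) (p : E.carrier x) (q : E.carrier y),
    E.j (mul m p q) = E.j p * E.j q

namespace PartialLaw
variable {M : BraidedCrossedModule J} {X A : Cᵒᵖ ⥤ Type u} {E : Torsor M X}
    {r : ∀ {U : C}, X.obj (op U) → X.obj (op U) → X.obj (op U) → Prop}

/-- The morphism `a^* E ∧ b^* E ⟶ c^* E` defined by a partial law. -/
noncomputable def homSub (L : PartialLaw E r) {a b c : A ⟶ X}
    (h : ∀ {U : C} (w : A.obj (op U)), r (a.app _ w) (b.app _ w) (c.app _ w)) :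
    {φ : (pull a).obj E ⊗ (pull b).obj E ⟶ (pull c).obj E // ∀ {U : C} {w : A.obj (op U)}
      (p : E.carrier (a.app _ w)) (q : E.carrier (b.app _ w)),
      Hom.app φ (wdg (P := pullObj a E) (Q := pullObj b E) p q) = L.mul (h w) p q} :=
  desc (P := pullObj a E) (Q := pullObj b E) (R := pullObj c E) (fun {_ w} p q => L.mul (h w) p q)
    (fun f _ _ _ p q => L.res f _ _ _ _ _ p q) (fun p q g => L.bal _ p q g)
    (fun p q g => L.act _ p q g) (fun p q => L.j _ p q)

noncomputable def hom (L : PartialLaw E r) {a b c : A ⟶ X}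
    (h : ∀ {U : C} (w : A.obj (op U)), r (a.app _ w) (b.app _ w) (c.app _ w)) :
    (pull a).obj E ⊗ (pull b).obj E ⟶ (pull c).obj E := (L.homSub h).1

theorem hom_wdg (L : PartialLaw E r) {a b c : A ⟶ X}
    (h : ∀ {U : C} (w : A.obj (op U)), r (a.app _ w) (b.app _ w) (c.app _ w)) {U : C}
    {w : A.obj (op U)} (p : E.carrier (a.app _ w)) (q : E.carrier (b.app _ w)) :
    Hom.app (L.hom h) (wdg (P := pullObj a E) (Q := pullObj b E) p q) = L.mul (h w) p q :=
  (L.homSub h).2 p q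

end PartialLaw

variable {S : Cᵒᵖ ⥤ Type u} {H K : Sheaf J GrpCat.{u}}

/-- The relation `z = x y` for sections `x = (s, h, k)`, `y = (s, h', k)`, `z = (s, h h', k)`. -/
structure BaseMul₁ {U : C} (x y z : (base S H K).obj (op U)) : Prop where
  s : y.1 = x.1
  s' : z.1 = x.1
  h : z.2.1 = x.2.1 * y.2.1
  k : y.2.2 = x.2.2
  k' : z.2.2 = x.2.2

/-- The relation `z = x y` for sections `x = (s, h, k)`, `y = (s, h, k')`, `z = (s, h, k k')`. -/
structure BaseMul₂ {U : C} (x y z : (base S H K).obj (op U)) : Prop where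
  s : y.1 = x.1
  s' : z.1 = x.1
  h : y.2.1 = x.2.1
  h' : z.2.1 = x.2.1
  k : z.2.2 = x.2.2 * y.2.2

theorem BaseMul₁.rs {U V : C} {x y z : (base S H K).obj (op U)} (m : BaseMul₁ x y z) (f : V ⟶ U) :
    BaseMul₁ (rs _ f x) (rs _ f y) (rs _ f z) :=
  ⟨congrArg (S.map f.op) m.s, congrArg (S.map f.op) m.s',
    (congrArg (gres H f) m.h).trans (map_mul _ _ _), congrArg (gres K f) m.k,
    congrArg (gres K f) m.k'⟩

theorem BaseMul₂.rs {U V : C} {x y z : (base S H K).obj (op U)} (m : BaseMul₂ x y z) (f : V ⟶ U) :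
    BaseMul₂ (rs _ f x) (rs _ f y) (rs _ f z) :=
  ⟨congrArg (S.map f.op) m.s, congrArg (S.map f.op) m.s',
    congrArg (gres H f) m.h, congrArg (gres H f) m.h',
    (congrArg (gres K f) m.k).trans (map_mul _ _ _)⟩

namespace Pt
variable {U V : C}

theorem Mul₁.base {x y z : Pt S H K U} (m : Mul₁ x y z) {V : C} (w : V ⟶ U) :
    BaseMul₁ (x.map.app _ w) (y.map.app _ w) (z.map.app _ w) :=
  ⟨congrArg (fun s => s.app _ w) m.s, congrArg (fun s => s.app _ w) m.s',
    (congrArg (gres H w) m.h).trans (map_mul _ _ _), congrArg (gres K w) m.k,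
    congrArg (gres K w) m.k'⟩

theorem Mul₂.base {x y z : Pt S H K U} (m : Mul₂ x y z) {V : C} (w : V ⟶ U) :
    BaseMul₂ (x.map.app _ w) (y.map.app _ w) (z.map.app _ w) :=
  ⟨congrArg (fun s => s.app _ w) m.s, congrArg (fun s => s.app _ w) m.s',
    congrArg (gres H w) m.h, congrArg (gres H w) m.h',
    (congrArg (gres K w) m.k).trans (map_mul _ _ _)⟩

/-- The point defined by a section. -/
def ofBase (x : (base S H K).obj (op U)) : Pt S H K U := ⟨yonedaEquiv.symm x.1, x.2.1, x.2.2⟩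

theorem rs_eq_ofBase (x : (base S H K).obj (op U)) (f : V ⟶ U) :
    rs _ f x = (ofBase x).map.app _ f := rfl

theorem ofBase_map_app_id (x : (base S H K).obj (op U)) : (ofBase x).map.app _ (𝟙 U) = x :=
  rs_id _ x

theorem rs_ofBase (x : (base S H K).obj (op U)) :
    rs _ (𝟙 U) ((ofBase x).map.app _ (𝟙 U)) = x := by rw [ofBase_map_app_id, rs_id]

theorem ofBase_restrict {x : (base S H K).obj (op U)} {y : (base S H K).obj (op V)} {f : V ⟶ U}
    (h : rs _ f x = y) : (ofBase x).restrict f = ofBase y := by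
  subst h
  refine Pt.ext ?_ rfl rfl
  ext W w
  exact rs_comp S f w x.1

theorem restrict_eq_ofBase (x : Pt S H K U) (f : V ⟶ U) :
    x.restrict f = ofBase (x.map.app _ f) := by
  refine Pt.ext ?_ rfl rfl
  ext W w
  exact (NatTrans.naturality_apply x.s w.op f)

theorem _root_.Biext4.BaseMul₁.pt {x y z : (base S H K).obj (op U)} (m : BaseMul₁ x y z) :
    Mul₁ (ofBase x) (ofBase y) (ofBase z) :=
  ⟨congrArg yonedaEquiv.symm m.s, congrArg yonedaEquiv.symm m.s', m.h, m.k, m.k'⟩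

theorem _root_.Biext4.BaseMul₂.pt {x y z : (base S H K).obj (op U)} (m : BaseMul₂ x y z) :
    Mul₂ (ofBase x) (ofBase y) (ofBase z) :=
  ⟨congrArg yonedaEquiv.symm m.s, congrArg yonedaEquiv.symm m.s', m.h, m.h', m.k⟩

end Pt

/-- The structure of a biextension on a torsor over `S × H × K`, in terms of sections. -/
structure SecLaws {M : BraidedCrossedModule J} (E : Torsor M (base S H K)) where
  law₁ : PartialLaw E BaseMul₁
  law₂ : PartialLaw E BaseMul₂
  assoc₁ : ∀ {U : C} {x y z xy yz xyz : (base S H K).obj (op U)} (m : BaseMul₁ x y xy)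
    (n : BaseMul₁ xy z xyz) (m' : BaseMul₁ y z yz) (n' : BaseMul₁ x yz xyz) (p : E.carrier x)
    (q : E.carrier y) (r : E.carrier z),
    law₁.mul n (law₁.mul m p q) r = law₁.mul n' p (law₁.mul m' q r)
  assoc₂ : ∀ {U : C} {x y z xy yz xyz : (base S H K).obj (op U)} (m : BaseMul₂ x y xy)
    (n : BaseMul₂ xy z xyz) (m' : BaseMul₂ y z yz) (n' : BaseMul₂ x yz xyz) (p : E.carrier x)
    (q : E.carrier y) (r : E.carrier z),
    law₂.mul n (law₂.mul m p q) r = law₂.mul n' p (law₂.mul m' q r)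
  interchange : ∀ {U : C} {x y z w xy zw xz yw t : (base S H K).obj (op U)}
    (m : BaseMul₁ x y xy) (n : BaseMul₁ z w zw) (p : BaseMul₂ xy zw t)
    (m' : BaseMul₂ x z xz) (n' : BaseMul₂ y w yw) (p' : BaseMul₁ xz yw t)
    (a : E.carrier x) (b : E.carrier y) (c : E.carrier z) (d : E.carrier w),
    law₂.mul p (law₁.mul m a b) (law₁.mul n c d) =
      E.act (law₁.mul p' (law₂.mul m' a c) (law₂.mul n' b d))
        (M.act (M.br (E.j b) (E.j c))⁻¹ (E.j d))

theorem RelSheaf.res_eq_res {X : Cᵒᵖ ⥤ Type u} (E : RelSheaf J X) {U V W : C} {f : V ⟶ U}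
    {g : W ⟶ V} {k : W ⟶ U} {x : X.obj (op U)} {y : X.obj (op V)} {z : X.obj (op W)}
    {hf : rs X f x = y} {hg : rs X g y = z} {h : rs X k x = z} (e : g ≫ f = k)
    (p : E.carrier x) : E.res g hg (E.res f hf p) = E.res k h p := by
  subst e
  exact E.res_res f g hf hg h p

namespace Torsor
variable {M : BraidedCrossedModule J} {X Y : Cᵒᵖ ⥤ Type u}

theorem map_pullTensor_pullCongr_wdg {A : Cᵒᵖ ⥤ Type u} {E : Torsor M Y} {c : A ⟶ X}
    {a b d : X ⟶ Y} {d' : A ⟶ Y} (φ : (pull a).obj E ⊗ (pull b).obj E ⟶ (pull d).obj E)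
    (h : c ≫ d = d') {U : C} {x : A.obj (op U)} (p : E.carrier (a.app _ (c.app _ x)))
    (q : E.carrier (b.app _ (c.app _ x))) (e : rs Y (𝟙 U) (d.app _ (c.app _ x)) = d'.app _ x) :
    Hom.app (μ (pull c) ((pull a).obj E) ((pull b).obj E) ≫ (pull c).map φ ≫
      (pullCongr h E : (pull c).obj ((pull d).obj E) ⟶ (pull d').obj E))
      (wdg (P := pullObj c (pullObj a E)) (Q := pullObj c (pullObj b E)) (x := x) p q) =
      E.res (𝟙 U) e (Hom.app φ (wdg (P := pullObj a E) (Q := pullObj b E) (x := c.app _ x) p q)) := by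
  have h1 := pullTensor_wdg c (pullObj a E) (pullObj b E) (x := x) p q
  refine (congrArg (fun o => Hom.app ((pull c).map φ ≫
    (pullCongr h E : (pull c).obj ((pull d).obj E) ⟶ (pull d').obj E)) o) h1).trans ?_
  exact pullCongr_app h E (x := x)
    (Hom.app φ (wdg (P := pullObj a E) (Q := pullObj b E) (x := c.app _ x) p q)) e

theorem pullCongr_tensor_wdg {E : Torsor M Y} {a b a' b' d : X ⟶ Y}
    (φ : (pull a').obj E ⊗ (pull b').obj E ⟶ (pull d).obj E) (ha : a = a') (hb : b = b')
    {U : C} {x : X.obj (op U)} (p : E.carrier (a.app _ x)) (q : E.carrier (b.app _ x))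
    (ea : rs Y (𝟙 U) (a.app _ x) = a'.app _ x) (eb : rs Y (𝟙 U) (b.app _ x) = b'.app _ x) :
    Hom.app ((pullCongr ha E ⊗ₘ pullCongr hb E) ≫ φ)
      (wdg (P := pullObj a E) (Q := pullObj b E) (x := x) p q) =
      Hom.app φ (wdg (P := pullObj a' E) (Q := pullObj b' E) (x := x) (E.res (𝟙 U) ea p)
        (E.res (𝟙 U) eb q)) := by
  subst ha hb
  have h1 : pullCongr (rfl : a = a) E ⊗ₘ pullCongr (rfl : b = b) E = 𝟙 _ :=
    id_tensorHom_id _ _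
  rw [h1, Category.id_comp]
  exact congrArg₂ (fun p q => Hom.app φ (wdg (P := pullObj a E) (Q := pullObj b E) (x := x) p q))
    (E.res_id _ p).symm (E.res_id _ q).symm

variable {P Q R T PQ QR RT PR QT Z P' Q' : Torsor M X}

theorem comp_eq_tensorHom_comp_iff {a : P ⊗ Q ⟶ R} {φ : R ⟶ T} {ψ : P ⟶ P'} {χ : Q ⟶ Q'}
    {b : P' ⊗ Q' ⟶ T} : a ≫ φ = (ψ ⊗ₘ χ) ≫ b ↔
    ∀ {U : C} {x : X.obj (op U)} (p : P.carrier x) (q : Q.carrier x),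
      Hom.app φ (Hom.app a (wdg p q)) = Hom.app b (wdg (Hom.app ψ p) (Hom.app χ q)) := by
  refine ⟨fun h U x p q => ?_, fun h => tensor_ext fun p q => ?_⟩
  · have h1 := congrArg (fun t => Hom.app t (wdg p q)) h
    simp only [comp_app, tensorHom_wdg] at h1
    exact h1
  · rw [comp_app, comp_app, tensorHom_wdg, h]

theorem assoc_iff {a : P ⊗ Q ⟶ PQ} {b : PQ ⊗ R ⟶ T} {a' : Q ⊗ R ⟶ QR} {b' : P ⊗ QR ⟶ T} :
    (a ▷ R) ≫ b = (α_ P Q R).hom ≫ (P ◁ a') ≫ b' ↔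
    ∀ {U : C} {x : X.obj (op U)} (p : P.carrier x) (q : Q.carrier x) (r : R.carrier x),
      Hom.app b (wdg (Hom.app a (wdg p q)) r) = Hom.app b' (wdg p (Hom.app a' (wdg q r))) := by
  refine ⟨fun h U x p q r => ?_, fun h => tensor_ext₃ fun p q r => ?_⟩
  · have h1 := congrArg (fun t => Hom.app t (wdg (wdg p q) r)) h
    simp only [comp_app] at h1
    rw [whiskerRight_wdg, associator_wdg, whiskerLeft_wdg] at h1
    exact h1
  · rw [comp_app, comp_app, comp_app, whiskerRight_wdg, associator_wdg, whiskerLeft_wdg, h]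

theorem tensorHom_comp_tensorμ_wdg {m : P ⊗ R ⟶ PR} {n : Q ⊗ T ⟶ QT} {b : PR ⊗ QT ⟶ Z} {U : C}
    {x : X.obj (op U)} (p : P.carrier x) (q : Q.carrier x) (r : R.carrier x) (t : T.carrier x) :
    Hom.app (tensorμ P Q R T ≫ (m ⊗ₘ n) ≫ b) (wdg (wdg p q) (wdg r t)) =
      Z.act (Hom.app b (wdg (Hom.app m (wdg p r)) (Hom.app n (wdg q t))))
        (M.act (M.br (Q.j q) (R.j r))⁻¹ (T.j t)) := by
  rw [comp_app, tensorμ_wdg]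
  refine (app_act_tensor_tensor (m ⊗ₘ n) _ _ |> congrArg (Hom.app b)).trans ?_
  rw [tensorHom_wdg, app_act_tensor]

theorem interchange_iff {m : P ⊗ Q ⟶ PQ} {n : R ⊗ T ⟶ RT} {a : PQ ⊗ RT ⟶ Z} {m' : P ⊗ R ⟶ PR}
    {n' : Q ⊗ T ⟶ QT} {a' : PR ⊗ QT ⟶ Z} :
    (m ⊗ₘ n) ≫ a = tensorμ P Q R T ≫ (m' ⊗ₘ n') ≫ a' ↔
    ∀ {U : C} {x : X.obj (op U)} (p : P.carrier x) (q : Q.carrier x) (r : R.carrier x)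
      (t : T.carrier x), Hom.app a (wdg (Hom.app m (wdg p q)) (Hom.app n (wdg r t))) =
        Z.act (Hom.app a' (wdg (Hom.app m' (wdg p r)) (Hom.app n' (wdg q t))))
          (M.act (M.br (Q.j q) (R.j r))⁻¹ (T.j t)) := by
  refine ⟨fun h U x p q r t => ?_, fun h => tensor_ext₂₂ fun p q r t => ?_⟩
  · have h1 := congrArg (fun k => Hom.app k (wdg (wdg p q) (wdg r t))) h
    rw [tensorHom_comp_tensorμ_wdg, comp_app, tensorHom_wdg] at h1
    exact h1
  · rw [tensorHom_comp_tensorμ_wdg, comp_app, tensorHom_wdg, h]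

end Torsor

namespace SecLaws
variable {M : BraidedCrossedModule J} {E : Torsor M (base S H K)}

/-- The partial laws as morphisms on fibers. -/
noncomputable def data (L : SecLaws E) : BiextData M H K S where
  tor := E
  mul₁ m := L.law₁.hom fun w => m.base w
  mul₂ m := L.law₂.hom fun w => m.base w

variable {U V : C} {x y z : Pt S H K U} {w : V ⟶ U}

theorem data_mul₁_wdg (L : SecLaws E) (m : Pt.Mul₁ x y z) (p : E.carrier (x.map.app _ w))
    (q : E.carrier (y.map.app _ w)) :
    Hom.app (L.data.mul₁ m) (wdg (P := fib E x) (Q := fib E y) (x := w) p q) =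
      L.law₁.mul (m.base w) p q := L.law₁.hom_wdg (a := x.map) (b := y.map) (c := z.map) (fun w => m.base w) (w := w) p q

theorem data_mul₂_wdg (L : SecLaws E) (m : Pt.Mul₂ x y z) (p : E.carrier (x.map.app _ w))
    (q : E.carrier (y.map.app _ w)) :
    Hom.app (L.data.mul₂ m) (wdg (P := fib E x) (Q := fib E y) (x := w) p q) =
      L.law₂.mul (m.base w) p q := L.law₂.hom_wdg (a := x.map) (b := y.map) (c := z.map) (fun w => m.base w) (w := w) p q

theorem isBiext (L : SecLaws E) : L.data.IsBiext where
  natural₁ f x y z x' y' z' hx hy hz m m' := tensor_ext fun {V w} p q => by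
    have e : ∀ {t : Pt S H K _} {t' : Pt S H K _}, t.restrict f = t' →
        rs (base S H K) (𝟙 V) (t.map.app _ ((yoneda.map f).app _ w)) = t'.map.app _ w :=
      fun h => by rw [rs_id, ← Pt.map_restrict h]; rfl
    refine (map_pullTensor_pullCongr_wdg (L.data.mul₁ m) (Pt.map_restrict hz) (x := w) p q
      (e hz)).trans (Eq.trans ?_ (pullCongr_tensor_wdg (L.data.mul₁ m') (Pt.map_restrict hx)
        (Pt.map_restrict hy) (x := w) p q (e hx) (e hy)).symm)
    refine (congrArg (E.res _ _) (L.data_mul₁_wdg m p q)).trans (Eq.trans ?_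
      (L.data_mul₁_wdg m' (w := w) _ _).symm)
    exact L.law₁.res _ _ _ _ _ _ _ _
  natural₂ f x y z x' y' z' hx hy hz m m' := tensor_ext fun {V w} p q => by
    have e : ∀ {t : Pt S H K _} {t' : Pt S H K _}, t.restrict f = t' →
        rs (base S H K) (𝟙 V) (t.map.app _ ((yoneda.map f).app _ w)) = t'.map.app _ w :=
      fun h => by rw [rs_id, ← Pt.map_restrict h]; rfl
    refine (map_pullTensor_pullCongr_wdg (L.data.mul₂ m) (Pt.map_restrict hz) (x := w) p q
      (e hz)).trans (Eq.trans ?_ (pullCongr_tensor_wdg (L.data.mul₂ m') (Pt.map_restrict hx)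
        (Pt.map_restrict hy) (x := w) p q (e hx) (e hy)).symm)
    refine (congrArg (E.res _ _) (L.data_mul₂_wdg m p q)).trans (Eq.trans ?_
      (L.data_mul₂_wdg m' (w := w) _ _).symm)
    exact L.law₂.res _ _ _ _ _ _ _ _
  assoc₁ m n m' n' := assoc_iff.2 fun {V w} p q r => by
    refine (congrArg (fun o => Hom.app (L.data.mul₁ n) (wdg o r)) (L.data_mul₁_wdg m p q)).trans
      (Eq.trans ?_ (congrArg (fun o => Hom.app (L.data.mul₁ n') (wdg p o))
        (L.data_mul₁_wdg m' q r)).symm)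
    exact (L.data_mul₁_wdg n _ _).trans ((L.assoc₁ _ _ (m'.base w) (n'.base w) p q r).trans
      (L.data_mul₁_wdg n' _ _).symm)
  assoc₂ m n m' n' := assoc_iff.2 fun {V w} p q r => by
    refine (congrArg (fun o => Hom.app (L.data.mul₂ n) (wdg o r)) (L.data_mul₂_wdg m p q)).trans
      (Eq.trans ?_ (congrArg (fun o => Hom.app (L.data.mul₂ n') (wdg p o))
        (L.data_mul₂_wdg m' q r)).symm)
    exact (L.data_mul₂_wdg n _ _).trans ((L.assoc₂ _ _ (m'.base w) (n'.base w) p q r).trans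
      (L.data_mul₂_wdg n' _ _).symm)
  interchange m n p m' n' p' := interchange_iff.2 fun {V w} a b c d => by
    refine (congrArg₂ (fun o o' => Hom.app (L.data.mul₂ p) (wdg o o')) (L.data_mul₁_wdg m a b)
      (L.data_mul₁_wdg n c d)).trans (Eq.trans ?_ (congrArg₂ (fun o o' => E.act
        (Hom.app (L.data.mul₁ p') (wdg o o')) (M.act (M.br (E.j b) (E.j c))⁻¹ (E.j d)))
        (L.data_mul₂_wdg m' a c) (L.data_mul₂_wdg n' b d)).symm)
    exact (L.data_mul₂_wdg p _ _).trans ((L.interchange _ _ _ (m'.base w) (n'.base w)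
      (p'.base w) a b c d).trans (congrArg (fun o => E.act o _) (L.data_mul₁_wdg p' _ _)).symm)

/-- The biextension defined by laws on sections. -/
noncomputable def toBiext (L : SecLaws E) : Biext M H K S := ⟨L.data, L.isBiext⟩

end SecLaws

end
end Biext4

namespace Biext4
section
variable {C : Type u} [SmallCategory C] {J : GrothendieckTopology C}
open Biext4.Torsor Functor.LaxMonoidal Functor.OplaxMonoidal

variable {S : Cᵒᵖ ⥤ Type u} {H K : Sheaf J GrpCat.{u}} {M : BraidedCrossedModule J}

/-- The value of a morphism `E_x ∧ E_y ⟶ E_z` on a pair of sections. -/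
def fibMul {E : Torsor M (base S H K)} {U V : C} {x y z : Pt S H K U}
    (φ : fib E x ⊗ fib E y ⟶ fib E z) (w : V ⟶ U) (p : E.carrier (x.map.app _ w))
    (q : E.carrier (y.map.app _ w)) : E.carrier (z.map.app _ w) :=
  Hom.app φ (wdg (P := fib E x) (Q := fib E y) (x := w) p q)

section fibMul
variable {E : Torsor M (base S H K)} {U V W : C} {x y z : Pt S H K U}
  (φ : fib E x ⊗ fib E y ⟶ fib E z)

theorem fibMul_res {w : V ⟶ U} {w' : W ⟶ U} (f : W ⟶ V) (e : f ≫ w = w')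
    (p : E.carrier (x.map.app _ w)) (q : E.carrier (y.map.app _ w))
    (hx : rs (base S H K) f (x.map.app _ w) = x.map.app _ w')
    (hy : rs (base S H K) f (y.map.app _ w) = y.map.app _ w')
    (hz : rs (base S H K) f (z.map.app _ w) = z.map.app _ w') :
    E.res f hz (fibMul φ w p q) = fibMul φ w' (E.res f hx p) (E.res f hy q) :=
  (Hom.app_res φ f (x := w) (y := w') e _).symm.trans
    (congrArg (Hom.app φ) (wdg_res (P := fib E x) (Q := fib E y) f e p q))

theorem fibMul_bal {w : V ⟶ U} (p : E.carrier (x.map.app _ w)) (q : E.carrier (y.map.app _ w))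
    (g : Sec M.G V) : fibMul φ w (E.act p g) q = fibMul φ w p (E.lact g q) :=
  congrArg (Hom.app φ) (wdg_bal (P := fib E x) (Q := fib E y) (x := w) p q g)

theorem fibMul_act {w : V ⟶ U} (p : E.carrier (x.map.app _ w)) (q : E.carrier (y.map.app _ w))
    (g : Sec M.G V) : fibMul φ w p (E.act q g) = E.act (fibMul φ w p q) g :=
  (congrArg (Hom.app φ) (wdg_act (P := fib E x) (Q := fib E y) (x := w) p q g).symm).trans
    (app_act_tensor φ _ _)

theorem fibMul_j {w : V ⟶ U} (p : E.carrier (x.map.app _ w)) (q : E.carrier (y.map.app _ w)) :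
    E.j (fibMul φ w p q) = E.j p * E.j q :=
  (Hom.j_app φ _).trans (wdg_j (P := fib E x) (Q := fib E y) (x := w) p q)

theorem fibMul_natural {f : V ⟶ U} {x' y' z' : Pt S H K V} (hx : x.restrict f = x')
    (hy : y.restrict f = y') (hz : z.restrict f = z') {ψ : fib E x' ⊗ fib E y' ⟶ fib E z'}
    (nat : μ (rst f) (fib E x) (fib E y) ≫ (rst f).map φ ≫
        (pullCongr (Pt.map_restrict hz) E : (rst f).obj (fib E z) ⟶ fib E z') =
      ((pullCongr (Pt.map_restrict hx) E : (rst f).obj (fib E x) ⟶ fib E x') ⊗ₘ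
        (pullCongr (Pt.map_restrict hy) E : (rst f).obj (fib E y) ⟶ fib E y')) ≫ ψ)
    (w : W ⟶ V) (p : E.carrier (x.map.app _ ((yoneda.map f).app _ w)))
    (q : E.carrier (y.map.app _ ((yoneda.map f).app _ w)))
    (ex : rs (base S H K) (𝟙 W) (x.map.app _ ((yoneda.map f).app _ w)) = x'.map.app _ w)
    (ey : rs (base S H K) (𝟙 W) (y.map.app _ ((yoneda.map f).app _ w)) = y'.map.app _ w)
    (ez : rs (base S H K) (𝟙 W) (z.map.app _ ((yoneda.map f).app _ w)) = z'.map.app _ w) :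
    E.res (𝟙 W) ez (fibMul φ ((yoneda.map f).app _ w) p q) =
      fibMul ψ w (E.res (𝟙 W) ex p) (E.res (𝟙 W) ey q) :=
  (map_pullTensor_pullCongr_wdg φ (Pt.map_restrict hz) (x := w) p q ez).symm.trans
    ((congrArg (fun φ => Hom.app φ (wdg (P := (rst f).obj (fib E x)) (Q := (rst f).obj (fib E y))
      (x := w) p q)) nat).trans (pullCongr_tensor_wdg ψ (Pt.map_restrict hx) (Pt.map_restrict hy)
        (x := w) p q ex ey))

end fibMul

namespace PartialLaw
variable {E : Torsor M (base S H K)}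
  {r : ∀ {U : C}, (base S H K).obj (op U) → (base S H K).obj (op U) →
    (base S H K).obj (op U) → Prop}
  {R : ∀ {U : C}, Pt S H K U → Pt S H K U → Pt S H K U → Prop}
  (hr : ∀ {U : C} {x y z : (base S H K).obj (op U)}, r x y z →
    R (Pt.ofBase x) (Pt.ofBase y) (Pt.ofBase z))
  (mul : ∀ {U : C} {x y z : Pt S H K U}, R x y z → (fib E x ⊗ fib E y ⟶ fib E z))

/-- The value on sections of a law defined on fibers. -/
def secMul {U : C} {x y z : (base S H K).obj (op U)} (m : r x y z) (p : E.carrier x)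
    (q : E.carrier y) : E.carrier z :=
  E.res (𝟙 U) (Pt.rs_ofBase z) (fibMul (mul (hr m)) (𝟙 U)
    (E.res (𝟙 U) (Pt.rs_eq_ofBase x (𝟙 U)) p) (E.res (𝟙 U) (Pt.rs_eq_ofBase y (𝟙 U)) q))

variable (nat : ∀ {U V : C} (f : V ⟶ U) {x y z : Pt S H K U} {x' y' z' : Pt S H K V}
    (hx : x.restrict f = x') (hy : y.restrict f = y') (hz : z.restrict f = z')
    (m : R x y z) (m' : R x' y' z'),
    μ (rst f) (fib E x) (fib E y) ≫ (rst f).map (mul m) ≫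
        (pullCongr (Pt.map_restrict hz) E : (rst f).obj (fib E z) ⟶ fib E z') =
      ((pullCongr (Pt.map_restrict hx) E : (rst f).obj (fib E x) ⟶ fib E x') ⊗ₘ
        (pullCongr (Pt.map_restrict hy) E : (rst f).obj (fib E y) ⟶ fib E y')) ≫ mul m')

include nat in
theorem fibMul_eq_secMul {U V : C} {x y z : Pt S H K U} (m : R x y z) {w : V ⟶ U}
    (m' : r (x.map.app _ w) (y.map.app _ w) (z.map.app _ w)) (p : E.carrier (x.map.app _ w))
    (q : E.carrier (y.map.app _ w)) : fibMul (mul m) w p q = secMul hr mul m' p q := by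
  have hw : (yoneda.map w).app _ (𝟙 V) = w := Category.id_comp w
  have e : ∀ t : Pt S H K U, rs (base S H K) (𝟙 V) (t.map.app _ w) =
      t.map.app _ ((yoneda.map w).app _ (𝟙 V)) := fun t => by rw [hw, rs_id]
  have e' : ∀ t : Pt S H K U, rs (base S H K) (𝟙 V) (t.map.app _ ((yoneda.map w).app _ (𝟙 V))) =
      (Pt.ofBase (t.map.app _ w)).map.app _ (𝟙 V) := fun t => by rw [hw]; rfl
  have h2 := fibMul_natural _ (Pt.restrict_eq_ofBase x w) (Pt.restrict_eq_ofBase y w)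
    (Pt.restrict_eq_ofBase z w) (nat w (Pt.restrict_eq_ofBase x w) (Pt.restrict_eq_ofBase y w)
    (Pt.restrict_eq_ofBase z w) m (hr m')) (𝟙 V) (E.res (𝟙 V) (e x) p) (E.res (𝟙 V) (e y) q)
    (e' x) (e' y) (e' z)
  rw [← fibMul_res (mul m) (w' := (yoneda.map w).app _ (𝟙 V)) (𝟙 V) rfl p q (e x) (e y) (e z)] at h2
  unfold secMul
  have h3 : ∀ (t : Pt S H K U) (p : E.carrier (t.map.app _ w)), E.res (𝟙 V) (e' t)
      (E.res (𝟙 V) (e t) p) = E.res (𝟙 V) (Pt.rs_eq_ofBase _ (𝟙 V)) p := fun t p => E.res_eq_res (Category.id_comp _) p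
  rw [h3 x, h3 y, h3 z] at h2
  rw [← h2, E.res_eq_res (Category.id_comp _), E.res_id]
  exact rs_id _ _

/-- A law on fibers defines a law on sections. -/
def ofHoms : PartialLaw E r where
  mul m p q := secMul hr mul m p q
  res {U V} f x y z x' y' z' hx hy hz m m' p q := by
    subst hx hy hz
    have h0 : f ≫ 𝟙 U = f := Category.comp_id f
    have e : ∀ t : (base S H K).obj (op U), rs (base S H K) f ((Pt.ofBase t).map.app _ (𝟙 U)) =
      (Pt.ofBase t).map.app _ f := fun t => congrArg (rs _ f) (rs_id _ t)
    have e' : ∀ (t : (base S H K).obj (op U)) (p : E.carrier t),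
      E.res f (e t) (E.res (𝟙 U) (Pt.rs_eq_ofBase t (𝟙 U)) p) = E.res f (Pt.rs_eq_ofBase t f) p := fun t p => E.res_eq_res h0 p
    refine Eq.trans ?_ (fibMul_eq_secMul hr mul nat (x := Pt.ofBase x) (y := Pt.ofBase y)
      (z := Pt.ofBase z) (hr m) (w := f) m' _ _)
    have h1 := fibMul_res (mul (hr m)) (w := 𝟙 U) f h0 (E.res (𝟙 U) (Pt.rs_eq_ofBase x (𝟙 U)) p)
      (E.res (𝟙 U) (Pt.rs_eq_ofBase y (𝟙 U)) q) (e x) (e y) (e z)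
    rw [e' x, e' y] at h1
    exact (E.res_eq_res h0 _).trans h1
  bal {U x y z} m p q g := by
    unfold secMul
    have h := fibMul_bal (mul (hr m)) (w := 𝟙 U) (E.res (𝟙 U) (Pt.rs_eq_ofBase x (𝟙 U)) p)
      (E.res (𝟙 U) (Pt.rs_eq_ofBase y (𝟙 U)) q) g
    rw [E.act_res, lact_res, gres_id]
    exact congrArg (E.res _ _) h
  act {U x y z} m p q g := by
    unfold secMul
    have h := fibMul_act (mul (hr m)) (w := 𝟙 U) (E.res (𝟙 U) (Pt.rs_eq_ofBase x (𝟙 U)) p)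
      (E.res (𝟙 U) (Pt.rs_eq_ofBase y (𝟙 U)) q) g
    rw [E.act_res, gres_id]
    refine (congrArg (E.res _ _) h).trans ((E.act_res _ _ _ _).trans ?_)
    rw [gres_id]
  j {U x y z} m p q := by
    refine (E.j_res _ _ _).trans ((gres_id _ _).trans ((fibMul_j _ _ _).trans ?_))
    rw [E.j_res, E.j_res, gres_id, gres_id]

end PartialLaw

namespace Biext
variable (B : Biext M H K S)

/-- The laws of a biextension, on sections. -/
def secLaw₁ : PartialLaw B.data.tor BaseMul₁ :=
  PartialLaw.ofHoms (R := Pt.Mul₁) BaseMul₁.pt B.data.mul₁ B.isBiext.natural₁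

def secLaw₂ : PartialLaw B.data.tor BaseMul₂ :=
  PartialLaw.ofHoms (R := Pt.Mul₂) BaseMul₂.pt B.data.mul₂ B.isBiext.natural₂

variable {B} {U V : C} {x y z : Pt S H K U}

theorem fibMul_mul₁ (m : Pt.Mul₁ x y z) (w : V ⟶ U) (p : B.data.tor.carrier (x.map.app _ w))
    (q : B.data.tor.carrier (y.map.app _ w)) :
    fibMul (B.data.mul₁ m) w p q = B.secLaw₁.mul (m.base w) p q :=
  PartialLaw.fibMul_eq_secMul (R := Pt.Mul₁) BaseMul₁.pt B.data.mul₁ B.isBiext.natural₁ m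
    (m.base w) p q

theorem fibMul_mul₂ (m : Pt.Mul₂ x y z) (w : V ⟶ U) (p : B.data.tor.carrier (x.map.app _ w))
    (q : B.data.tor.carrier (y.map.app _ w)) :
    fibMul (B.data.mul₂ m) w p q = B.secLaw₂.mul (m.base w) p q :=
  PartialLaw.fibMul_eq_secMul (R := Pt.Mul₂) BaseMul₂.pt B.data.mul₂ B.isBiext.natural₂ m
    (m.base w) p q

theorem sec_assoc₁ {x y z xy yz xyz : (base S H K).obj (op U)} (m : BaseMul₁ x y xy)
    (n : BaseMul₁ xy z xyz) (m' : BaseMul₁ y z yz) (n' : BaseMul₁ x yz xyz)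
    (p : B.data.tor.carrier x) (q : B.data.tor.carrier y) (r : B.data.tor.carrier z) :
    B.secLaw₁.mul n (B.secLaw₁.mul m p q) r = B.secLaw₁.mul n' p (B.secLaw₁.mul m' q r) := by
  let A : ∀ _ _ _ _ _ _ : (base S H K).obj (op U), Prop := fun x y z xy yz xyz =>
    ∀ (m : BaseMul₁ x y xy) (n : BaseMul₁ xy z xyz) (m' : BaseMul₁ y z yz) (n' : BaseMul₁ x yz xyz)
    (p : B.data.tor.carrier x) (q : B.data.tor.carrier y) (r : B.data.tor.carrier z),
    B.secLaw₁.mul n (B.secLaw₁.mul m p q) r = B.secLaw₁.mul n' p (B.secLaw₁.mul m' q r)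
  have h : A ((Pt.ofBase x).map.app _ (𝟙 U)) ((Pt.ofBase y).map.app _ (𝟙 U)) ((Pt.ofBase z).map.app _ (𝟙 U)) ((Pt.ofBase xy).map.app _ (𝟙 U)) ((Pt.ofBase yz).map.app _ (𝟙 U))
      ((Pt.ofBase xyz).map.app _ (𝟙 U)) := fun _ _ _ _ p q r => by
    have h1 : fibMul (B.data.mul₁ n.pt) (𝟙 U) (fibMul (B.data.mul₁ m.pt) (𝟙 U) p q) r =
        fibMul (B.data.mul₁ n'.pt) (𝟙 U) p (fibMul (B.data.mul₁ m'.pt) (𝟙 U) q r) :=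
      assoc_iff.1 (B.isBiext.assoc₁ m.pt n.pt m'.pt n'.pt) (x := 𝟙 U) p q r
    rw [fibMul_mul₁, fibMul_mul₁, fibMul_mul₁, fibMul_mul₁] at h1
    exact h1
  simp only [Pt.ofBase_map_app_id] at h
  exact h m n m' n' p q r

theorem sec_assoc₂ {x y z xy yz xyz : (base S H K).obj (op U)} (m : BaseMul₂ x y xy)
    (n : BaseMul₂ xy z xyz) (m' : BaseMul₂ y z yz) (n' : BaseMul₂ x yz xyz)
    (p : B.data.tor.carrier x) (q : B.data.tor.carrier y) (r : B.data.tor.carrier z) :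
    B.secLaw₂.mul n (B.secLaw₂.mul m p q) r = B.secLaw₂.mul n' p (B.secLaw₂.mul m' q r) := by
  let A : ∀ _ _ _ _ _ _ : (base S H K).obj (op U), Prop := fun x y z xy yz xyz =>
    ∀ (m : BaseMul₂ x y xy) (n : BaseMul₂ xy z xyz) (m' : BaseMul₂ y z yz) (n' : BaseMul₂ x yz xyz)
    (p : B.data.tor.carrier x) (q : B.data.tor.carrier y) (r : B.data.tor.carrier z),
    B.secLaw₂.mul n (B.secLaw₂.mul m p q) r = B.secLaw₂.mul n' p (B.secLaw₂.mul m' q r)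
  have h : A ((Pt.ofBase x).map.app _ (𝟙 U)) ((Pt.ofBase y).map.app _ (𝟙 U)) ((Pt.ofBase z).map.app _ (𝟙 U)) ((Pt.ofBase xy).map.app _ (𝟙 U)) ((Pt.ofBase yz).map.app _ (𝟙 U))
      ((Pt.ofBase xyz).map.app _ (𝟙 U)) := fun _ _ _ _ p q r => by
    have h1 : fibMul (B.data.mul₂ n.pt) (𝟙 U) (fibMul (B.data.mul₂ m.pt) (𝟙 U) p q) r =
        fibMul (B.data.mul₂ n'.pt) (𝟙 U) p (fibMul (B.data.mul₂ m'.pt) (𝟙 U) q r) :=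
      assoc_iff.1 (B.isBiext.assoc₂ m.pt n.pt m'.pt n'.pt) (x := 𝟙 U) p q r
    rw [fibMul_mul₂, fibMul_mul₂, fibMul_mul₂, fibMul_mul₂] at h1
    exact h1
  simp only [Pt.ofBase_map_app_id] at h
  exact h m n m' n' p q r

theorem sec_interchange {x y z w xy zw xz yw t : (base S H K).obj (op U)}
    (m : BaseMul₁ x y xy) (n : BaseMul₁ z w zw) (p : BaseMul₂ xy zw t)
    (m' : BaseMul₂ x z xz) (n' : BaseMul₂ y w yw) (p' : BaseMul₁ xz yw t)
    (a : B.data.tor.carrier x) (b : B.data.tor.carrier y) (c : B.data.tor.carrier z)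
    (d : B.data.tor.carrier w) :
    B.secLaw₂.mul p (B.secLaw₁.mul m a b) (B.secLaw₁.mul n c d) =
      B.data.tor.act (B.secLaw₁.mul p' (B.secLaw₂.mul m' a c) (B.secLaw₂.mul n' b d))
        (M.act (M.br (B.data.tor.j b) (B.data.tor.j c))⁻¹ (B.data.tor.j d)) := by
  let A : ∀ _ _ _ _ _ _ _ _ _ : (base S H K).obj (op U), Prop := fun x y z w xy zw xz yw t =>
    ∀ (m : BaseMul₁ x y xy) (n : BaseMul₁ z w zw) (p : BaseMul₂ xy zw t)
    (m' : BaseMul₂ x z xz) (n' : BaseMul₂ y w yw) (p' : BaseMul₁ xz yw t)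
    (a : B.data.tor.carrier x) (b : B.data.tor.carrier y) (c : B.data.tor.carrier z)
    (d : B.data.tor.carrier w),
    B.secLaw₂.mul p (B.secLaw₁.mul m a b) (B.secLaw₁.mul n c d) =
      B.data.tor.act (B.secLaw₁.mul p' (B.secLaw₂.mul m' a c) (B.secLaw₂.mul n' b d))
        (M.act (M.br (B.data.tor.j b) (B.data.tor.j c))⁻¹ (B.data.tor.j d))
  have h : A ((Pt.ofBase x).map.app _ (𝟙 U)) ((Pt.ofBase y).map.app _ (𝟙 U)) ((Pt.ofBase z).map.app _ (𝟙 U)) ((Pt.ofBase w).map.app _ (𝟙 U)) ((Pt.ofBase xy).map.app _ (𝟙 U))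
      ((Pt.ofBase zw).map.app _ (𝟙 U)) ((Pt.ofBase xz).map.app _ (𝟙 U)) ((Pt.ofBase yw).map.app _ (𝟙 U)) ((Pt.ofBase t).map.app _ (𝟙 U)) :=
    fun _ _ _ _ _ _ a b c d => by
    have h1 : fibMul (B.data.mul₂ p.pt) (𝟙 U) (fibMul (B.data.mul₁ m.pt) (𝟙 U) a b)
          (fibMul (B.data.mul₁ n.pt) (𝟙 U) c d) =
        B.data.tor.act (fibMul (B.data.mul₁ p'.pt) (𝟙 U) (fibMul (B.data.mul₂ m'.pt) (𝟙 U) a c)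
          (fibMul (B.data.mul₂ n'.pt) (𝟙 U) b d))
          (M.act (M.br (B.data.tor.j b) (B.data.tor.j c))⁻¹ (B.data.tor.j d)) :=
      interchange_iff.1 (B.isBiext.interchange m.pt n.pt p.pt m'.pt n'.pt p'.pt) (x := 𝟙 U) a b c d
    rw [fibMul_mul₁, fibMul_mul₁, fibMul_mul₁, fibMul_mul₂, fibMul_mul₂, fibMul_mul₂] at h1
    exact h1
  simp only [Pt.ofBase_map_app_id] at h
  exact h m n p m' n' p' a b c d

variable {B' : Biext M H K S} {φ : B.data.tor ⟶ B'.data.tor}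

theorem isHom_of_sec
    (h₁ : ∀ {U : C} {x y z : (base S H K).obj (op U)} (m : BaseMul₁ x y z)
      (p : B.data.tor.carrier x) (q : B.data.tor.carrier y),
      Hom.app φ (B.secLaw₁.mul m p q) = B'.secLaw₁.mul m (Hom.app φ p) (Hom.app φ q))
    (h₂ : ∀ {U : C} {x y z : (base S H K).obj (op U)} (m : BaseMul₂ x y z)
      (p : B.data.tor.carrier x) (q : B.data.tor.carrier y),
      Hom.app φ (B.secLaw₂.mul m p q) = B'.secLaw₂.mul m (Hom.app φ p) (Hom.app φ q)) :
    B.data.IsHom B'.data φ where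
  mul₁ m := comp_eq_tensorHom_comp_iff.2 fun {_ w} p q =>
    (congrArg (Hom.app φ) (fibMul_mul₁ m w p q)).trans ((h₁ (m.base w) p q).trans
      (fibMul_mul₁ m w (Hom.app φ p) (Hom.app φ q)).symm)
  mul₂ m := comp_eq_tensorHom_comp_iff.2 fun {_ w} p q =>
    (congrArg (Hom.app φ) (fibMul_mul₂ m w p q)).trans ((h₂ (m.base w) p q).trans
      (fibMul_mul₂ m w (Hom.app φ p) (Hom.app φ q)).symm)

theorem app_secLaw₁ (hφ : B.data.IsHom B'.data φ) {x y z : (base S H K).obj (op U)}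
    (m : BaseMul₁ x y z) (p : B.data.tor.carrier x) (q : B.data.tor.carrier y) :
    Hom.app φ (B.secLaw₁.mul m p q) = B'.secLaw₁.mul m (Hom.app φ p) (Hom.app φ q) := by
  let A : ∀ _ _ _ : (base S H K).obj (op U), Prop := fun x y z => ∀ (m : BaseMul₁ x y z)
    (p : B.data.tor.carrier x) (q : B.data.tor.carrier y),
    Hom.app φ (B.secLaw₁.mul m p q) = B'.secLaw₁.mul m (Hom.app φ p) (Hom.app φ q)
  have h : A ((Pt.ofBase x).map.app _ (𝟙 U)) ((Pt.ofBase y).map.app _ (𝟙 U)) ((Pt.ofBase z).map.app _ (𝟙 U)) := fun _ p q => by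
    have h1 : Hom.app φ (fibMul (B.data.mul₁ m.pt) (𝟙 U) p q) =
        fibMul (B'.data.mul₁ m.pt) (𝟙 U) (Hom.app φ p) (Hom.app φ q) :=
      comp_eq_tensorHom_comp_iff.1 (hφ.mul₁ m.pt) (x := 𝟙 U) p q
    rw [fibMul_mul₁, fibMul_mul₁] at h1
    exact h1
  simp only [Pt.ofBase_map_app_id] at h
  exact h m p q

theorem app_secLaw₂ (hφ : B.data.IsHom B'.data φ) {x y z : (base S H K).obj (op U)}
    (m : BaseMul₂ x y z) (p : B.data.tor.carrier x) (q : B.data.tor.carrier y) :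
    Hom.app φ (B.secLaw₂.mul m p q) = B'.secLaw₂.mul m (Hom.app φ p) (Hom.app φ q) := by
  let A : ∀ _ _ _ : (base S H K).obj (op U), Prop := fun x y z => ∀ (m : BaseMul₂ x y z)
    (p : B.data.tor.carrier x) (q : B.data.tor.carrier y),
    Hom.app φ (B.secLaw₂.mul m p q) = B'.secLaw₂.mul m (Hom.app φ p) (Hom.app φ q)
  have h : A ((Pt.ofBase x).map.app _ (𝟙 U)) ((Pt.ofBase y).map.app _ (𝟙 U)) ((Pt.ofBase z).map.app _ (𝟙 U)) := fun _ p q => by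
    have h1 : Hom.app φ (fibMul (B.data.mul₂ m.pt) (𝟙 U) p q) =
        fibMul (B'.data.mul₂ m.pt) (𝟙 U) (Hom.app φ p) (Hom.app φ q) :=
      comp_eq_tensorHom_comp_iff.1 (hφ.mul₂ m.pt) (x := 𝟙 U) p q
    rw [fibMul_mul₂, fibMul_mul₂] at h1
    exact h1
  simp only [Pt.ofBase_map_app_id] at h
  exact h m p q

end Biext

namespace SecLaws
variable {E : Torsor M (base S H K)} (L : SecLaws E) {U : C} {x y z : (base S H K).obj (op U)}

theorem toBiext_secLaw₁ (m : BaseMul₁ x y z) (p : E.carrier x) (q : E.carrier y) :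
    L.toBiext.secLaw₁.mul m p q = L.law₁.mul m p q :=
  (congrArg (E.res (𝟙 U) (Pt.rs_ofBase z)) (L.data_mul₁_wdg m.pt (w := 𝟙 U)
    (E.res (𝟙 U) (Pt.rs_eq_ofBase x (𝟙 U)) p) (E.res (𝟙 U) (Pt.rs_eq_ofBase y (𝟙 U)) q))).trans (by
    refine (L.law₁.res (𝟙 U) (Pt.rs_ofBase x) (Pt.rs_ofBase y) _ (m.pt.base (𝟙 U)) m _ _).trans ?_
    rw [E.res_eq_res (h := rs_id _ x) (Category.id_comp _),
      E.res_eq_res (h := rs_id _ y) (Category.id_comp _), E.res_id, E.res_id])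

theorem toBiext_secLaw₂ (m : BaseMul₂ x y z) (p : E.carrier x) (q : E.carrier y) :
    L.toBiext.secLaw₂.mul m p q = L.law₂.mul m p q :=
  (congrArg (E.res (𝟙 U) (Pt.rs_ofBase z)) (L.data_mul₂_wdg m.pt (w := 𝟙 U)
    (E.res (𝟙 U) (Pt.rs_eq_ofBase x (𝟙 U)) p) (E.res (𝟙 U) (Pt.rs_eq_ofBase y (𝟙 U)) q))).trans (by
    refine (L.law₂.res (𝟙 U) (Pt.rs_ofBase x) (Pt.rs_ofBase y) _ (m.pt.base (𝟙 U)) m _ _).trans ?_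
    rw [E.res_eq_res (h := rs_id _ x) (Category.id_comp _),
      E.res_eq_res (h := rs_id _ y) (Category.id_comp _), E.res_id, E.res_id])

end SecLaws

end
end Biext4

namespace Biext4
section
variable {C : Type u} [SmallCategory C] {J : GrothendieckTopology C}

namespace BraidedCrossedModule
variable (M : BraidedCrossedModule J) {U : C}

theorem mul_act_of_eq {x y : Sec M.Pi U} {u : Sec M.G U} (h : x * M.d u = y) (v : Sec M.G U) :
    u * M.act v y = M.act v x * u := by
  rw [← h, M.act_mul, M.act_d]; group

theorem mul_br_of_eq {x y : Sec M.Pi U} {u : Sec M.G U} (h : x * M.d u = y) (z : Sec M.Pi U) :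
    M.br x z * u = M.act u z * M.br y z := by
  rw [← h, M.mul_br, M.d_br_left, M.act_d]; group

theorem br_mul_of_eq {x y : Sec M.Pi U} {u : Sec M.G U} (h : x * M.d u = y) (z : Sec M.Pi U) :
    M.br z x * M.act u z = u * M.br z y := by
  rw [← h, M.br_mul, M.br_d, M.act_d]; group

theorem cocycle_left {a' a'' b b' b'' b₁₂ b₁₂₃ : Sec M.Pi U} {g₁₂ g₁₂_₃ u₁₂ u₁₂_₃ : Sec M.G U}
    (h₁ : b₁₂ * M.d u₁₂ = b * b') (h₂ : b₁₂₃ * M.d u₁₂_₃ = b₁₂ * b'') :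
    (M.act g₁₂_₃ b₁₂₃ * u₁₂_₃ * M.act (M.br a'' b₁₂) b'') *
        M.act (M.act g₁₂ b₁₂ * u₁₂ * M.act (M.br a' b) b') (a'' * b'') =
      M.act (g₁₂_₃ * M.act g₁₂ a'') b₁₂₃ * (u₁₂_₃ * M.act u₁₂ b'') *
        M.act (M.br a'' (b * b') * M.act (M.br a' b) (b' * a'')) b'' := by
  have e₁ : M.act (M.br a'' b₁₂) b'' * M.act (M.act (M.act g₁₂ b₁₂) a'') b'' =
      M.act (M.act g₁₂ a'') (b₁₂ * b'') * M.act (M.br a'' b₁₂) b'' := by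
    rw [← M.mul_act, ← M.act_mul, M.br_mul_act, M.mul_act, M.act_mul _ a'', M.act_mul _ b₁₂]
  have e₂ : M.act (M.br a'' b₁₂) b'' * M.act (M.act u₁₂ a'') b'' =
      M.act u₁₂ b'' * M.act (M.br a'' (b * b')) b'' := by
    rw [← M.mul_act, M.br_mul_of_eq h₁, M.mul_act]
  simp only [M.mul_act, M.act_mul _ a'' b'', mul_assoc]
  rw [← mul_assoc (M.act (M.br a'' b₁₂) b''), e₁, mul_assoc, ← mul_assoc (M.act (M.br a'' b₁₂) b''),
    e₂, ← mul_assoc u₁₂_₃ (M.act _ (b₁₂ * b'')), M.mul_act_of_eq h₂]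
  simp only [mul_assoc, M.act_mul]

theorem cocycle_right {a' a'' b b' b'' a₂₃ b₂₃ b₁₂₃ : Sec M.Pi U}
    {g₂₃ g₁_₂₃ u₂₃ u₁_₂₃ : Sec M.G U} (h₁ : a₂₃ * M.d g₂₃ = a' * a'')
    (h₂ : b₂₃ * M.d u₂₃ = b' * b'') (h₃ : b₁₂₃ * M.d u₁_₂₃ = b * b₂₃) :
    (M.act g₁_₂₃ b₁₂₃ * u₁_₂₃ * M.act (M.br a₂₃ b) b₂₃) *
        (M.act g₂₃ b₂₃ * u₂₃ * M.act (M.br a'' b') b'') =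
      M.act (g₁_₂₃ * g₂₃) b₁₂₃ * (u₁_₂₃ * u₂₃) *
        M.act (M.act (M.br (a' * a'') b) b' * M.br a'' b') b'' := by
  have e₁ : M.act (M.br a₂₃ b) b₂₃ * M.act g₂₃ b₂₃ =
      M.act g₂₃ (b * b₂₃) * M.act (M.br (a' * a'') b) b₂₃ := by
    rw [← M.mul_act, M.mul_br_of_eq h₁, M.mul_act, M.act_mul]
  simp only [M.mul_act, mul_assoc]
  rw [← mul_assoc (M.act (M.br a₂₃ b) b₂₃), e₁, mul_assoc, ← mul_assoc u₁_₂₃ (M.act _ (b * b₂₃)),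
    M.mul_act_of_eq h₃, mul_assoc, ← mul_assoc _ u₂₃, ← M.mul_act_of_eq h₂, M.act_mul _ b',
    mul_assoc]

theorem br_cocycle (a' a'' b b' : Sec M.Pi U) :
    M.br a'' (b * b') * M.act (M.br a' b) (b' * a'') =
      M.act (M.br (a' * a'') b) b' * M.br a'' b' := by
  rw [M.br_mul, M.mul_br, M.mul_act, mul_assoc, M.br_mul_act, mul_assoc, M.act_mul]

theorem br_mul_br (a b c y : Sec M.Pi U) :
    M.act (M.br a b) (c * y) * M.br (a * c) y = M.br c y * M.act (M.br a (b * y)) c := by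
  rw [M.br_mul, M.mul_br, M.mul_act, ← mul_assoc, ← mul_assoc, ← M.br_mul_act, M.act_mul]

end BraidedCrossedModule

/-- A family of pairs `(φ, g)` of maps `φ : Π ⟶ Π` and `g : Π × Π ⟶ G` over `V` such that
`φ(h) φ(h') = φ(h h') ∂ g(h, h')` and `g` is a cocycle: a weak endomorphism of `Π`. -/
@[ext] structure Cochain (M : BraidedCrossedModule J) (V : C) where
  φ : ∀ {W : C}, (W ⟶ V) → Sec M.Pi W → Sec M.Pi W
  g : ∀ {W : C}, (W ⟶ V) → Sec M.Pi W → Sec M.Pi W → Sec M.G W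
  φ_res : ∀ {W W' : C} (f : W ⟶ V) (k : W' ⟶ W) (h : Sec M.Pi W),
    gres M.Pi k (φ f h) = φ (k ≫ f) (gres M.Pi k h)
  g_res : ∀ {W W' : C} (f : W ⟶ V) (k : W' ⟶ W) (h h' : Sec M.Pi W),
    gres M.G k (g f h h') = g (k ≫ f) (gres M.Pi k h) (gres M.Pi k h')
  d_g : ∀ {W : C} (f : W ⟶ V) (h h' : Sec M.Pi W),
    φ f (h * h') * M.d (g f h h') = φ f h * φ f h'
  cocycle : ∀ {W : C} (f : W ⟶ V) (h h' h'' : Sec M.Pi W),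
    g f (h * h') h'' * M.act (g f h h') (φ f h'') = g f h (h' * h'') * g f h' h''

namespace Cochain
variable {V' V'' V : C} {M : BraidedCrossedModule J}

/-- The composition law `(φ, g)(ψ, u) = (φ ψ, g^ψ u {φ, ψ})`. -/
instance : Mul (Cochain M V) where
  mul k l :=
    { φ := fun f h => k.φ f h * l.φ f h
      g := fun f h h' => M.act (k.g f h h') (l.φ f (h * h')) * l.g f h h' *
        M.act (M.br (k.φ f h') (l.φ f h)) (l.φ f h')
      φ_res := fun f t h => by rw [map_mul, k.φ_res, l.φ_res]
      g_res := fun f t h h' => by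
        simp only [map_mul, M.act_res, M.br_res, k.φ_res, l.φ_res, k.g_res, l.g_res]
      d_g := fun f h h' => by
        have h₁ := k.d_g f h h'
        have h₂ := l.d_g f h h'
        have e : k.φ f (h * h') = k.φ f h * k.φ f h' * (M.d (k.g f h h'))⁻¹ := by rw [← h₁]; group
        have e' : M.d (l.g f h h') = (l.φ f (h * h'))⁻¹ * (l.φ f h * l.φ f h') := by
          rw [← h₂]; group
        simp only [map_mul, M.d_act, M.d_br, e, e']
        group
      cocycle := fun f h h' h'' => by
        rw [M.cocycle_left (l.d_g f h h') (l.d_g f (h * h') h''), mul_assoc h h' h'',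
          M.cocycle_right (k.d_g f h' h'') (l.d_g f h' h'') (l.d_g f h (h' * h'')),
          M.br_cocycle, k.cocycle, l.cocycle] }

instance : One (Cochain M V) where
  one :=
    { φ := fun _ _ => 1
      g := fun _ _ _ => 1
      φ_res := fun _ _ _ => map_one _
      g_res := fun _ _ _ _ => map_one _
      d_g := fun _ _ _ => by rw [map_one]
      cocycle := fun _ _ _ _ => by rw [M.one_act] }

theorem mul_φ (k l : Cochain M V) {W : C} (f : W ⟶ V) (h : Sec M.Pi W) :
    (k * l).φ f h = k.φ f h * l.φ f h := rfl

theorem mul_g (k l : Cochain M V) {W : C} (f : W ⟶ V) (h h' : Sec M.Pi W) :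
    (k * l).g f h h' = M.act (k.g f h h') (l.φ f (h * h')) * l.g f h h' *
        M.act (M.br (k.φ f h') (l.φ f h)) (l.φ f h') := rfl

theorem one_φ {W : C} (f : W ⟶ V) (h : Sec M.Pi W) : (1 : Cochain M V).φ f h = 1 := rfl
theorem one_g {W : C} (f : W ⟶ V) (h h' : Sec M.Pi W) : (1 : Cochain M V).g f h h' = 1 := rfl

/-- The second component of the inverse. -/
def invG (k : Cochain M V) {W : C} (f : W ⟶ V) (h h' : Sec M.Pi W) : Sec M.G W :=
  (M.act (k.g f h h') (k.φ f (h * h'))⁻¹)⁻¹ * (M.act (M.br (k.φ f h') (k.φ f h)⁻¹) (k.φ f h')⁻¹)⁻¹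

theorem mul_invG (k : Cochain M V) {W : C} (f : W ⟶ V) (h h' : Sec M.Pi W) :
    M.act (k.g f h h') (k.φ f (h * h'))⁻¹ * k.invG f h h' *
        M.act (M.br (k.φ f h') (k.φ f h)⁻¹) (k.φ f h')⁻¹ = 1 := by
  unfold invG; group

theorem d_invG (k : Cochain M V) {W : C} (f : W ⟶ V) (h h' : Sec M.Pi W) :
    (k.φ f (h * h'))⁻¹ * M.d (k.invG f h h') = (k.φ f h)⁻¹ * (k.φ f h')⁻¹ := by
  have e : M.d (k.g f h h') = (k.φ f (h * h'))⁻¹ * (k.φ f h * k.φ f h') := by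
    rw [← k.d_g]; group
  simp only [invG, map_mul, map_inv, M.d_act, M.d_br, e]
  group

instance : Inv (Cochain M V) where
  inv k :=
    { φ := fun f h => (k.φ f h)⁻¹
      g := fun f h h' => k.invG f h h'
      φ_res := fun f t h => by rw [map_inv, k.φ_res]
      g_res := fun f t h h' => by
        simp only [invG, map_mul, map_inv, M.act_res, M.br_res, k.φ_res, k.g_res]
      d_g := fun f h h' => k.d_invG f h h'
      cocycle := fun f h h' h'' => by
        have e₁ := M.cocycle_left (a' := k.φ f h') (a'' := k.φ f h'') (g₁₂ := k.g f h h')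
          (g₁₂_₃ := k.g f (h * h') h'') (k.d_invG f h h') (k.d_invG f (h * h') h'')
        have e₂ := M.cocycle_right (k.d_g f h' h'') (k.d_invG f h' h'') (k.d_invG f h (h' * h''))
          (g₁_₂₃ := k.g f h (h' * h''))
        rw [mul_invG, mul_invG, M.one_act, mul_one, mul_assoc h h' h''] at e₁
        rw [mul_invG, mul_invG, mul_one, ← M.br_cocycle, ← k.cocycle] at e₂
        have e₃ := e₁.symm.trans e₂
        rw [mul_left_inj, mul_right_inj] at e₃
        exact e₃ }

instance : Group (Cochain M V) :=
  Group.ofRightAxioms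
    (fun k l m => by
      ext W f h
      · simp only [mul_φ, mul_assoc]
      · rename_i h'
        have e₁ := M.mul_act_of_eq (m.d_g f h h') (M.act (M.br (k.φ f h') (l.φ f h)) (l.φ f h'))
        have e₂ := congrArg (fun t => M.act t (m.φ f h'))
          (M.br_mul_br (k.φ f h') (l.φ f h) (l.φ f h') (m.φ f h))
        simp only [mul_g, mul_φ, M.mul_act, M.act_mul] at e₁ e₂ ⊢
        simp only [mul_assoc]
        rw [← mul_assoc _ (m.g f h h'), ← e₁, mul_assoc, e₂])
    (fun k => by
      ext W f h
      · rw [mul_φ, one_φ, mul_one]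
      · rw [mul_g, one_φ, one_g, one_φ, M.act_one, M.br_one, M.one_act, mul_one, mul_one])
    (fun k => by
      ext W f h
      · exact mul_inv_cancel _
      · exact k.mul_invG _ _ _)

end Cochain
end
end Biext4

namespace Biext4
section
variable {C : Type u} [SmallCategory C] {J : GrothendieckTopology C}
open Biext4.Torsor

namespace Cochain
variable {V' V'' V : C} {M : BraidedCrossedModule J}

/-- The restriction of a cochain. -/
def restrict (a : V' ⟶ V) : Cochain M V →* Cochain M V' where
  toFun k :=
    { φ := fun f h => k.φ (f ≫ a) h
      g := fun f h h' => k.g (f ≫ a) h h'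
      φ_res := fun f t h => by rw [k.φ_res, Category.assoc]
      g_res := fun f t h h' => by rw [k.g_res, Category.assoc]
      d_g := fun f h h' => k.d_g _ h h'
      cocycle := fun f h h' h'' => k.cocycle _ h h' h'' }
  map_one' := rfl
  map_mul' _ _ := rfl

theorem restrict_φ (a : V' ⟶ V) (k : Cochain M V) {W : C} (f : W ⟶ V') (h : Sec M.Pi W) :
    (restrict a k).φ f h = k.φ (f ≫ a) h := rfl

theorem restrict_g (a : V' ⟶ V) (k : Cochain M V) {W : C} (f : W ⟶ V') (h h' : Sec M.Pi W) :
    (restrict a k).g f h h' = k.g (f ≫ a) h h' := rfl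

/-- The presheaf of cochains. -/
def presheaf (M : BraidedCrossedModule J) : Cᵒᵖ ⥤ GrpCat.{u} where
  obj U := GrpCat.of (Cochain M U.unop)
  map f := GrpCat.ofHom (restrict f.unop)
  map_id U := by
    refine GrpCat.hom_ext (MonoidHom.ext fun k => Cochain.ext ?_ ?_)
    · funext W f h
      exact congrArg (fun f => k.φ f h) (Category.comp_id f)
    · funext W f h h'
      exact congrArg (fun f => k.g f h h') (Category.comp_id f)
  map_comp a b := by
    refine GrpCat.hom_ext (MonoidHom.ext fun k => Cochain.ext ?_ ?_)
    · funext W f h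
      exact congrArg (fun f => k.φ f h) (Category.assoc f _ _).symm
    · funext W f h h'
      exact congrArg (fun f => k.g f h h') (Category.assoc f _ _).symm

theorem eq_of_restrict_eq {R : Sieve V} (hR : R ∈ J V) {k l : Cochain M V}
    (e : ∀ {W : C} (f : W ⟶ V), R f → restrict f k = restrict f l) : k = l := by
  refine Cochain.ext ?_ ?_
  · funext W f h
    refine gsep M.Pi (J.pullback_stable f hR) _ _ fun t ht => ?_
    have h1 := congrArg (fun c => c.φ (𝟙 _) (gres M.Pi t h)) (e (t ≫ f) ht)
    simp only [restrict_φ, Category.id_comp] at h1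
    rw [k.φ_res, l.φ_res, h1]
  · funext W f h h'
    refine gsep M.G (J.pullback_stable f hR) _ _ fun t ht => ?_
    have h1 := congrArg (fun c => c.g (𝟙 _) (gres M.Pi t h) (gres M.Pi t h')) (e (t ≫ f) ht)
    simp only [restrict_g, Category.id_comp] at h1
    rw [k.g_res, l.g_res, h1]

theorem exists_glue {R : Sieve V} (hR : R ∈ J V) (t : ∀ {W : C} (f : W ⟶ V), R f → Cochain M W)
    (ht : ∀ {W W' : C} (f : W ⟶ V) (hf : R f) (a : W' ⟶ W),
      t (a ≫ f) (R.downward_closed hf a) = restrict a (t f hf)) :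
    ∃ k : Cochain M V, ∀ {W : C} (f : W ⟶ V) (hf : R f), restrict f k = t f hf := by
  have tc : ∀ {W : C} {f f' : W ⟶ V} (e : f = f') (hf : R f) (hf' : R f'), t f hf = t f' hf' := by
    intro W f f' e hf hf'
    subst e
    rfl
  have tφ : ∀ {W W' : C} {f : W ⟶ V} (hf : R f) {a : W' ⟶ W} {f' : W' ⟶ V} (e : a ≫ f = f')
      (hf' : R f') (h : Sec M.Pi W), gres M.Pi a ((t f hf).φ (𝟙 W) h) =
        (t f' hf').φ (𝟙 W') (gres M.Pi a h) := by
    intro W W' f hf a f' e hf' h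
    subst e
    rw [ht f hf a, restrict_φ, φ_res, Category.comp_id, Category.id_comp]
  have tg : ∀ {W W' : C} {f : W ⟶ V} (hf : R f) {a : W' ⟶ W} {f' : W' ⟶ V} (e : a ≫ f = f')
      (hf' : R f') (h h' : Sec M.Pi W), gres M.G a ((t f hf).g (𝟙 W) h h') =
        (t f' hf').g (𝟙 W') (gres M.Pi a h) (gres M.Pi a h') := by
    intro W W' f hf a f' e hf' h h'
    subst e
    rw [ht f hf a, restrict_g, g_res, Category.comp_id, Category.id_comp]
  have hφ : ∀ {W : C} (f : W ⟶ V) (h : Sec M.Pi W), ∃ y : Sec M.Pi W, ∀ {W' : C} (a : W' ⟶ W)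
      (ha : R (a ≫ f)), gres M.Pi a y = (t (a ≫ f) ha).φ (𝟙 W') (gres M.Pi a h) := fun f h =>
    gglue M.Pi (J.pullback_stable f hR) (fun a ha => (t (a ≫ f) ha).φ (𝟙 _) (gres M.Pi a h))
      fun a ha b => by
        rw [tφ ha (Category.assoc b a f).symm ((R.pullback f).downward_closed ha b), gres_comp]
  have hg : ∀ {W : C} (f : W ⟶ V) (h h' : Sec M.Pi W), ∃ y : Sec M.G W, ∀ {W' : C} (a : W' ⟶ W)
      (ha : R (a ≫ f)), gres M.G a y = (t (a ≫ f) ha).g (𝟙 W') (gres M.Pi a h) (gres M.Pi a h') :=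
    fun f h h' => gglue M.G (J.pullback_stable f hR)
      (fun a ha => (t (a ≫ f) ha).g (𝟙 _) (gres M.Pi a h) (gres M.Pi a h'))
      fun a ha b => by
        rw [tg ha (Category.assoc b a f).symm ((R.pullback f).downward_closed ha b), gres_comp, gres_comp]
  choose φ hφ using @hφ
  choose g hg using @hg
  refine ⟨⟨φ, g, fun f k h => ?_, fun f k h h' => ?_, fun f h h' => ?_, fun f h h' h'' => ?_⟩,
    fun f hf => Cochain.ext ?_ ?_⟩
  · refine gsep M.Pi (J.pullback_stable (k ≫ f) hR) _ _ fun a ha => ?_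
    have ha' : R ((a ≫ k) ≫ f) := by simpa only [Category.assoc] using (show R (a ≫ k ≫ f) from ha)
    rw [← gres_comp, hφ f h (a ≫ k) ha', hφ (k ≫ f) _ a ha, gres_comp]
    rw [tc (Category.assoc a k f) ha' ha]
  · refine gsep M.G (J.pullback_stable (k ≫ f) hR) _ _ fun a ha => ?_
    have ha' : R ((a ≫ k) ≫ f) := by simpa only [Category.assoc] using (show R (a ≫ k ≫ f) from ha)
    rw [← gres_comp, hg f h h' (a ≫ k) ha', hg (k ≫ f) _ _ a ha, gres_comp, gres_comp]
    rw [tc (Category.assoc a k f) ha' ha]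
  · refine gsep M.Pi (J.pullback_stable f hR) _ _ fun a ha => ?_
    rw [map_mul, map_mul, ← M.d_res, hφ f _ a ha, hφ f _ a ha, hφ f _ a ha, hg f _ _ a ha, map_mul,
      d_g]
  · refine gsep M.G (J.pullback_stable f hR) _ _ fun a ha => ?_
    rw [map_mul, map_mul, M.act_res, hφ f _ a ha, hg f _ _ a ha, hg f _ _ a ha, hg f _ _ a ha,
      hg f _ _ a ha, map_mul, map_mul, cocycle]
  · funext W a h
    have h1 := hφ (a ≫ f) h (𝟙 _) (by simpa using R.downward_closed hf a)
    rw [gres_id, gres_id] at h1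
    refine h1.trans ?_
    rw [tc (Category.id_comp (a ≫ f)) _ (R.downward_closed hf a), ht f hf a, restrict_φ, Category.id_comp]
  · funext W a h h'
    have h1 := hg (a ≫ f) h h' (𝟙 _) (by simpa using R.downward_closed hf a)
    rw [gres_id, gres_id, gres_id] at h1
    refine h1.trans ?_
    rw [tc (Category.id_comp (a ≫ f)) _ (R.downward_closed hf a), ht f hf a, restrict_g, Category.id_comp]

/-- The sheaf of cochains. -/
def sheaf (M : BraidedCrossedModule J) : Sheaf J GrpCat.{u} where
  obj := presheaf M
  property := by
    rw [Presheaf.isSheaf_iff_isSheaf_forget J (presheaf M) (forget GrpCat.{u}),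
      isSheaf_iff_isSheaf_of_type]
    intro V R hR x hx
    rw [Presieve.compatible_iff_sieveCompatible] at hx
    obtain ⟨k, hk⟩ := exists_glue hR (fun f hf => x f hf) (fun f hf a => hx f a hf)
    exact ⟨k, fun W f hf => hk f hf, fun l hl => eq_of_restrict_eq hR fun f hf =>
      (hl f hf).trans (hk f hf).symm⟩

/-- The identity of `Π`. -/
def idCochain (M : BraidedCrossedModule J) (V : C) : Cochain M V where
  φ _ h := h
  g _ _ _ := 1
  φ_res _ _ _ := rfl
  g_res _ _ _ _ := map_one _
  d_g _ _ _ := by rw [map_one, mul_one]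
  cocycle _ _ _ _ := by rw [M.one_act]

end Cochain

section
variable (M : BraidedCrossedModule J) (S : Cᵒᵖ ⥤ Type u)

variable {M S} in
/-- The value of the cochain of a section of `S × Π × K`. -/
def Cochain.ofBase {U : C} (x : (base S M.Pi (Cochain.sheaf M)).obj (op U)) : Cochain M U := x.2.2

theorem Cochain.ofBase_φ_rs {U V : C} (f : V ⟶ U) (x : (base S M.Pi (Cochain.sheaf M)).obj (op U))
    (h : Sec M.Pi U) : (Cochain.ofBase (rs _ f x)).φ (𝟙 V) (gres M.Pi f h) =
      gres M.Pi f ((Cochain.ofBase x).φ (𝟙 U) h) := by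
  refine Eq.trans ?_ ((Cochain.ofBase x).φ_res (𝟙 U) f h).symm
  rw [Category.comp_id]
  exact congrArg (fun f => (Cochain.ofBase x).φ f _) (Category.id_comp f)

theorem Cochain.ofBase_g_rs {U V : C} (f : V ⟶ U) (x : (base S M.Pi (Cochain.sheaf M)).obj (op U))
    (h h' : Sec M.Pi U) : (Cochain.ofBase (rs _ f x)).g (𝟙 V) (gres M.Pi f h) (gres M.Pi f h') =
      gres M.G f ((Cochain.ofBase x).g (𝟙 U) h h') := by
  refine Eq.trans ?_ ((Cochain.ofBase x).g_res (𝟙 U) f h h').symm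
  rw [Category.comp_id]
  exact congrArg (fun f => (Cochain.ofBase x).g f _ _) (Category.id_comp f)

/-- The torsor of the tautological biextension: it is trivial as a `G`-torsor, with the map to `Π`
given by the evaluation `(h, φ) ↦ φ(h)`. -/
def evalTorsor : Torsor M (base S M.Pi (Cochain.sheaf M)) :=
  twist (fun x => (Cochain.ofBase x).φ (𝟙 _) x.2.1) fun f x => Cochain.ofBase_φ_rs M S f x x.2.1

variable {M S}

theorem evalTorsor_lact {U : C} {x : (base S M.Pi (Cochain.sheaf M)).obj (op U)} (g a : Sec M.G U) :
    (evalTorsor M S).lact (x := x) g a = M.act g ((Cochain.ofBase x).φ (𝟙 U) x.2.1) * a := by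
  change a * M.act g (_ * M.d a) = _
  rw [M.act_mul, M.act_d]
  group

/-- The first law `p q = g(h, h') p^{φ(h')} q`. -/
def evalLaw₁ : PartialLaw (evalTorsor M S) BaseMul₁ where
  mul {U x y _} _ (p : Sec M.G U) (q : Sec M.G U) :=
    ((Cochain.ofBase x).g (𝟙 U) x.2.1 y.2.1 * M.act p ((Cochain.ofBase x).φ (𝟙 U) y.2.1) * q :
      Sec M.G U)
  res {U V} f x y z x' y' z' hx hy hz m m' (p : Sec M.G U) (q : Sec M.G U) := by
    subst hx hy hz
    change gres M.G f (_ * _ * _) = _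
    rw [map_mul, map_mul, M.act_res, ← Cochain.ofBase_g_rs, ← Cochain.ofBase_φ_rs]
    rfl
  bal {U x y z} m (p : Sec M.G U) (q : Sec M.G U) g := by
    refine Eq.trans ?_ (congrArg (fun v => HMul.hMul (α := Sec M.G U) _ v) (evalTorsor_lact g q).symm)
    have e : Cochain.ofBase y = Cochain.ofBase x := m.k
    rw [e]
    change _ * M.act (p * g) _ * q = _
    rw [M.mul_act]
    simp only [mul_assoc]
  act {U x y z} m p q g := (mul_assoc (G := Sec M.G U) _ _ _).symm
  j {U x y z} m (p : Sec M.G U) (q : Sec M.G U) := by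
    have e : Cochain.ofBase y = Cochain.ofBase x := m.k
    have e' : Cochain.ofBase z = Cochain.ofBase x := m.k'
    have e'' : z.2.1 = (x.2.1 * y.2.1 : Sec M.Pi U) := m.h
    change (Cochain.ofBase z).φ (𝟙 U) z.2.1 * M.d (_ * _ * _) = (_ * M.d p) * ((Cochain.ofBase y).φ (𝟙 U) y.2.1 * M.d q)
    rw [e, e', e'', map_mul, map_mul, M.d_act, ← mul_assoc, ← mul_assoc, Cochain.d_g]
    group

/-- The second law `p q = p^{φ'(h)} q`. -/
def evalLaw₂ : PartialLaw (evalTorsor M S) BaseMul₂ where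
  mul {U x y _} _ (p : Sec M.G U) (q : Sec M.G U) :=
    (M.act p ((Cochain.ofBase y).φ (𝟙 U) x.2.1) * q : Sec M.G U)
  res {U V} f x y z x' y' z' hx hy hz m m' (p : Sec M.G U) (q : Sec M.G U) := by
    subst hx hy hz
    change gres M.G f (_ * _) = _
    rw [map_mul, M.act_res, ← Cochain.ofBase_φ_rs]
    rfl
  bal {U x y z} m (p : Sec M.G U) (q : Sec M.G U) g := by
    refine Eq.trans ?_ (congrArg (fun v => HMul.hMul (α := Sec M.G U) _ v) (evalTorsor_lact g q).symm)
    rw [m.h]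
    change M.act (p * g) _ * q = _
    rw [M.mul_act]
    simp only [mul_assoc]
  act {U x y z} m p q g := (mul_assoc (G := Sec M.G U) _ _ _).symm
  j {U x y z} m (p : Sec M.G U) (q : Sec M.G U) := by
    have e : Cochain.ofBase z = Cochain.ofBase x * Cochain.ofBase y := m.k
    change (Cochain.ofBase z).φ (𝟙 U) z.2.1 * M.d (_ * _) = (_ * M.d p) * ((Cochain.ofBase y).φ (𝟙 U) y.2.1 * M.d q)
    rw [e, m.h', m.h, map_mul, M.d_act, Cochain.mul_φ]
    group

theorem eval_interchange {U : C} {a b c d : Sec M.G U} {x y y' t : Sec M.Pi U} {g u : Sec M.G U}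
    (h : t * M.d u = y * y') :
    M.act (g * M.act a x * b) t * (u * M.act c y' * d) =
      M.act g t * u * M.act (M.br x y) y' * M.act (M.act a y * c) (x * y') * (M.act b y' * d) *
        M.act (M.br (x * M.d b) (y * M.d c))⁻¹ (y' * M.d d) := by
  have e₁ := M.mul_act_of_eq h (M.act a x * b)
  have e₂ := M.br_mul_act x y a
  have e₃ := M.br_mul_of_eq (x := y) (u := c) rfl x
  have e₄ := M.mul_br_of_eq (x := x) (u := b) rfl (y * M.d c)
  have e₅ : M.act a (x * y) * M.act b y * c =
      M.br x y * M.act (M.act a y * c) x * b * (M.br (x * M.d b) (y * M.d c))⁻¹ := by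
    rw [eq_mul_inv_iff_mul_eq, M.mul_act, ← mul_assoc (M.br x y), ← M.act_mul, e₂]
    simp only [mul_assoc]
    rw [← mul_assoc (M.br x y), e₃, mul_assoc, e₄, M.act_mul b, M.act_d]
    group
  have e₆ := congrArg (fun v => M.act v y') e₅
  simp only [M.mul_act, M.inv_act, M.act_mul] at e₁ e₆ ⊢
  rw [M.act_d]
  calc _ = M.act g t * (M.act (M.act a x) t * M.act b t * u) * M.act c y' * d := by group
    _ = M.act g t * u * (M.act (M.act (M.act a x) y) y' * M.act (M.act b y) y' * M.act c y') * d := by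
      rw [← e₁]; group
    _ = _ := by rw [e₆]; group

/-- The tautological biextension. -/
noncomputable def evalBiext (M : BraidedCrossedModule J) (S : Cᵒᵖ ⥤ Type u) :
    Biext M M.Pi (Cochain.sheaf M) S :=
  SecLaws.toBiext (E := evalTorsor M S)
    { law₁ := evalLaw₁
      law₂ := evalLaw₂
      assoc₁ := fun {U x y z xy yz xyz} m n m' n' (p : Sec M.G U) (q : Sec M.G U) (r : Sec M.G U) => by
        have e : Cochain.ofBase y = Cochain.ofBase x := m.k
        have e' : Cochain.ofBase xy = Cochain.ofBase x := m.k'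
        have h₁ : xy.2.1 = (x.2.1 * y.2.1 : Sec M.Pi U) := m.h
        have h₂ : yz.2.1 = (y.2.1 * z.2.1 : Sec M.Pi U) := m'.h
        change ((Cochain.ofBase xy).g (𝟙 U) xy.2.1 z.2.1 * M.act ((Cochain.ofBase x).g (𝟙 U) x.2.1 y.2.1 * M.act p _ * q) ((Cochain.ofBase xy).φ (𝟙 U) z.2.1) * r : Sec M.G U) =
          (Cochain.ofBase x).g (𝟙 U) x.2.1 yz.2.1 * M.act p ((Cochain.ofBase x).φ (𝟙 U) yz.2.1) * ((Cochain.ofBase y).g (𝟙 U) y.2.1 z.2.1 * M.act q ((Cochain.ofBase y).φ (𝟙 U) z.2.1) * r)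
        rw [e, e', h₁, h₂]
        have e₁ := M.mul_act_of_eq ((Cochain.ofBase x).d_g (𝟙 U) y.2.1 z.2.1) p
        have e₂ := (Cochain.ofBase x).cocycle (𝟙 U) x.2.1 y.2.1 z.2.1
        simp only [M.mul_act, ← mul_assoc] at e₂ ⊢
        rw [e₂, mul_assoc ((Cochain.ofBase x).g _ _ _) (M.act p _), ← e₁, M.act_mul]
        simp only [mul_assoc]
      assoc₂ := fun {U x y z xy yz xyz} m n m' n' (p : Sec M.G U) (q : Sec M.G U) (r : Sec M.G U) => by
        have e : Cochain.ofBase yz = Cochain.ofBase y * Cochain.ofBase z := m'.k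
        change M.act (M.act p _ * q) ((Cochain.ofBase z).φ (𝟙 U) xy.2.1) * r =
          M.act p ((Cochain.ofBase yz).φ (𝟙 U) x.2.1) * (M.act q ((Cochain.ofBase z).φ (𝟙 U) y.2.1) * r)
        rw [m.h', m.h, e, Cochain.mul_φ, M.mul_act, M.act_mul, mul_assoc]
      interchange := fun {U x y z w xy zw xz yw t} m n p m' n' p' (a : Sec M.G U) (b : Sec M.G U) (c : Sec M.G U)
          (d : Sec M.G U) => by
        have e₁ : Cochain.ofBase y = Cochain.ofBase x := m.k
        have e₂ : Cochain.ofBase w = Cochain.ofBase z := n.k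
        have e₃ : Cochain.ofBase zw = Cochain.ofBase z := n.k'
        have e₄ : Cochain.ofBase xz = Cochain.ofBase x * Cochain.ofBase z := m'.k
        have h₁ : xy.2.1 = (x.2.1 * y.2.1 : Sec M.Pi U) := m.h
        have h₂ : w.2.1 = y.2.1 := n'.h
        have h₃ : yw.2.1 = y.2.1 := n'.h'
        have h₄ : z.2.1 = x.2.1 := m'.h
        have h₅ : xz.2.1 = x.2.1 := m'.h'
        refine Eq.trans ?_ ((eval_interchange ((Cochain.ofBase z).d_g (𝟙 U) x.2.1 y.2.1)
          (g := (Cochain.ofBase x).g (𝟙 U) x.2.1 y.2.1) (x := (Cochain.ofBase x).φ (𝟙 U) y.2.1)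
          (a := a) (b := b) (c := c) (d := d)).trans ?_)
        · change M.act (_ * _ * b) ((Cochain.ofBase zw).φ (𝟙 U) xy.2.1) * ((Cochain.ofBase z).g (𝟙 U) z.2.1 w.2.1 * M.act c ((Cochain.ofBase z).φ (𝟙 U) w.2.1) * d) = _
          rw [e₃, h₁, h₂, h₄]
        · change _ = ((Cochain.ofBase xz).g (𝟙 U) xz.2.1 yw.2.1 *
            M.act (M.act a ((Cochain.ofBase z).φ (𝟙 U) x.2.1) * c) ((Cochain.ofBase xz).φ (𝟙 U) yw.2.1) *
            (M.act b ((Cochain.ofBase w).φ (𝟙 U) y.2.1) * d)) *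
            M.act (M.br ((Cochain.ofBase y).φ (𝟙 U) y.2.1 * M.d b) ((Cochain.ofBase z).φ (𝟙 U) z.2.1 * M.d c))⁻¹
              ((Cochain.ofBase w).φ (𝟙 U) w.2.1 * M.d d)
          rw [e₁, e₂, e₄, h₂, h₃, h₄, h₅, Cochain.mul_g, Cochain.mul_φ] }

/-- If the square of the tautological biextension is a biextension, then the braiding is
symmetric over the points of the base. -/
theorem br_eq_inv_of_evalBiext (h : ((evalBiext M S).data.prod (evalBiext M S).data).IsBiext)
    {U : C} (s : yoneda.obj U ⟶ S) (x y : Sec M.Pi U) : M.br y x = (M.br x y)⁻¹ := by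
  let pt : Sec M.Pi U → Pt S M.Pi (Cochain.sheaf M) U := fun z => ⟨s, z, Cochain.idCochain M U⟩
  have h1 := braiding_braiding_eq_id_iff.1 ((Biext.prod_isBiext_iff _ _).1 h U (pt x) (pt y) rfl)
    (x := 𝟙 U) (1 : Sec M.G U) (1 : Sec M.G U)
  have ht : ∀ z, (fib (evalBiext M S).data.tor (pt z)).j (x := 𝟙 U) (1 : Sec M.G U) = z :=
    fun z => by
      change gres M.Pi (𝟙 U) z * M.d 1 = z
      rw [gres_id, map_one, mul_one]
  rw [ht, ht] at h1
  exact eq_inv_of_mul_eq_one_right h1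

theorem isSymmetric_of_evalBiext_final
    (h : ((evalBiext M (final C)).data.prod (evalBiext M (final C)).data).IsBiext) :
    M.IsSymmetric :=
  fun _ x y => br_eq_inv_of_evalBiext h ⟨fun _ => TypeCat.ofHom fun _ => PUnit.unit,
    fun _ _ _ => rfl⟩ x y

theorem isSymmetric_of_evalBiext_yoneda (h : ∀ U : C,
    ((evalBiext M (yoneda.obj U)).data.prod (evalBiext M (yoneda.obj U)).data).IsBiext) :
    M.IsSymmetric :=
  fun U x y => br_eq_inv_of_evalBiext (h U) (𝟙 _) x y

end

theorem isSymmetric_iff_prod_isBiext (M : BraidedCrossedModule J) :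
    (∀ (H K : Sheaf J GrpCat.{u}) (E F : Biext M H K (final C)), (E.data.prod F.data).IsBiext) ↔
      M.IsSymmetric :=
  ⟨fun h => isSymmetric_of_evalBiext_final (h _ _ _ _), fun h _ _ E F => .prod h E.isBiext F.isBiext⟩

end
end Biext4

namespace Biext4
section
variable {C : Type u} [SmallCategory C] {J : GrothendieckTopology C}
open Biext4.Torsor Functor.LaxMonoidal Functor.OplaxMonoidal

variable {S : Cᵒᵖ ⥤ Type u} {H K : Sheaf J GrpCat.{u}} {M : BraidedCrossedModule J}

theorem RelSheaf.res_res_eq_res_res {X : Cᵒᵖ ⥤ Type u} (E : RelSheaf J X) {U V V' W : C}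
    {f : V ⟶ U} {g : W ⟶ V} {f' : V' ⟶ U} {g' : W ⟶ V'} {x : X.obj (op U)} {y : X.obj (op V)}
    {y' : X.obj (op V')} {z : X.obj (op W)} {hf : rs X f x = y} {hg : rs X g y = z}
    {hf' : rs X f' x = y'} {hg' : rs X g' y' = z} (e : g ≫ f = g' ≫ f') (p : E.carrier x) :
    E.res g hg (E.res f hf p) = E.res g' hg' (E.res f' hf' p) := by
  have h : rs X (g' ≫ f') x = z := by rw [rs_comp, hf', hg']
  rw [E.res_eq_res (h := h) e, E.res_res f' g' hf' hg' h]

theorem Torsor.tensorHom_inverse_comp {X : Cᵒᵖ ⥤ Type u} {P P' Q Q' R : Torsor M X} (φ : P ⟶ P')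
    (ψ : Q ⟶ Q') (a : P ⊗ Q ⟶ R) : (φ ⊗ₘ ψ) ≫ (inverse φ ⊗ₘ inverse ψ) ≫ a = a := by
  have h := tensorHom_comp_tensorHom_assoc φ ψ (inverse φ) (inverse ψ) a
  rw [h, show φ ≫ inverse φ = 𝟙 _ from (isoOf φ).hom_inv_id,
    show ψ ≫ inverse ψ = 𝟙 _ from (isoOf ψ).hom_inv_id]
  simp

section Morphisms
variable {E F : Torsor M (base S H K)} (α : ∀ {U : C} (x : Pt S H K U), fib E x ⟶ fib F x)

/-- The value on sections of a family of morphisms of fibers. -/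
def secApp {U : C} {x : (base S H K).obj (op U)} (p : E.carrier x) : F.carrier x :=
  F.res (𝟙 U) (Pt.rs_ofBase x)
    (Hom.app (α (Pt.ofBase x)) (x := 𝟙 U) (E.res (𝟙 U) (Pt.rs_eq_ofBase x (𝟙 U)) p))

variable (nat : ∀ {U V : C} (f : V ⟶ U) {x : Pt S H K U} {y : Pt S H K V} (h : x.restrict f = y),
  (pullCongr (Pt.map_restrict h) E : (rst f).obj (fib E x) ⟶ fib E y) ≫ α y =
    (rst f).map (α x) ≫ (pullCongr (Pt.map_restrict h) F : (rst f).obj (fib F x) ⟶ fib F y))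

include nat in
theorem app_eq_secApp {U V : C} (x : Pt S H K U) (w : V ⟶ U) (p : E.carrier (x.map.app _ w)) :
    Hom.app (α x) (x := w) p = secApp α p := by
  have hw : (yoneda.map w).app _ (𝟙 V) = w := Category.id_comp w
  have e : rs (base S H K) (𝟙 V) (x.map.app _ w) = x.map.app _ ((yoneda.map w).app _ (𝟙 V)) := by
    rw [hw, rs_id]
  have e' : rs (base S H K) (𝟙 V) (x.map.app _ ((yoneda.map w).app _ (𝟙 V))) =
      (Pt.ofBase (x.map.app _ w)).map.app _ (𝟙 V) := by rw [hw]; rfl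
  have h1 := congrArg (fun φ : (rst w).obj (fib E x) ⟶ fib F (Pt.ofBase (x.map.app _ w)) =>
    Hom.app φ (x := 𝟙 V) (E.res (𝟙 V) e p))
    (nat w (Pt.restrict_eq_ofBase x w))
  have h2 : Hom.app (α (Pt.ofBase (x.map.app _ w))) (x := 𝟙 V) (E.res (𝟙 V) e' (E.res (𝟙 V) e p)) =
      F.res (𝟙 V) e' (Hom.app (α x) (x := (yoneda.map w).app _ (𝟙 V)) (E.res (𝟙 V) e p)) := by
    refine Eq.trans ?_ (h1.trans ?_)
    · exact congrArg (Hom.app (α (Pt.ofBase (x.map.app _ w))) (x := 𝟙 V))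
        (pullCongr_app (φ := yoneda.map w ≫ x.map)
          (Pt.map_restrict (Pt.restrict_eq_ofBase x w)) E (x := 𝟙 V) _ e').symm
    · exact pullCongr_app (φ := yoneda.map w ≫ x.map)
        (Pt.map_restrict (Pt.restrict_eq_ofBase x w)) F (x := 𝟙 V) _ e'
  have h3 : Hom.app (α x) (x := (yoneda.map w).app _ (𝟙 V)) (E.res (𝟙 V) e p) =
      F.res (𝟙 V) e (Hom.app (α x) (x := w) p) :=
    Hom.app_res (α x) (𝟙 V) (x := w) (y := (yoneda.map w).app _ (𝟙 V)) rfl p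
  have h4 : F.res (𝟙 V) e' (F.res (𝟙 V) e (Hom.app (α x) (x := w) p)) =
      F.res (𝟙 V) (Pt.rs_eq_ofBase _ (𝟙 V)) (Hom.app (α x) (x := w) p) :=
    F.res_eq_res (Category.id_comp _) _
  rw [h3, h4, E.res_eq_res (h := Pt.rs_eq_ofBase _ (𝟙 V)) (Category.id_comp _)] at h2
  unfold secApp
  rw [h2]
  exact ((F.res_eq_res (h := rs_id _ _) (Category.id_comp _) _).trans (F.res_id _ _)).symm

/-- The morphism of torsors defined by a natural family of morphisms of fibers. -/
def secHom : E ⟶ F :=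
  show Torsor.Hom E F from
  { app := fun p => secApp α p
    app_res := fun {U V} f x y h p => by
      subst h
      have h0 : rs (base S H K) f ((Pt.ofBase x).map.app _ (𝟙 U)) = (Pt.ofBase x).map.app _ f :=
        congrArg (rs _ f) (rs_id _ x)
      refine (app_eq_secApp α nat (Pt.ofBase x) f (E.res f rfl p)).symm.trans ?_
      have h1 := Hom.app_res (α (Pt.ofBase x)) f (x := 𝟙 U) (y := f) (Category.comp_id f)
        (E.res (𝟙 U) (Pt.rs_eq_ofBase x (𝟙 U)) p)
      refine Eq.trans ?_ (h1.trans ?_)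
      · exact congrArg (Hom.app (α (Pt.ofBase x)) (x := f))
          (E.res_eq_res (hg := h0) (Category.comp_id f) p).symm
      · exact (F.res_eq_res (Category.comp_id f) _).symm
    app_act := fun {U x} p g => by
      unfold secApp
      rw [E.act_res, gres_id]
      refine (congrArg (F.res _ _) (Hom.app_act (α (Pt.ofBase x)) (x := 𝟙 U) _ g)).trans ?_
      refine (F.act_res _ _ _ _).trans ?_
      rw [gres_id]
    j_app := fun {U x} p => by
      refine (F.j_res _ _ _).trans ((gres_id _ _).trans
        ((Hom.j_app (α (Pt.ofBase x)) (x := 𝟙 U) _).trans ?_))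
      exact (E.j_res _ _ _).trans (gres_id _ _) }

theorem pull_secHom {U : C} (x : Pt S H K U) : (pull x.map).map (secHom α nat) = α x :=
  hom_ext fun p => (app_eq_secApp α nat x _ p).symm

end Morphisms

theorem Torsor.hom_ext_fib {E F : Torsor M (base S H K)} {φ ψ : E ⟶ F}
    (h : ∀ {U : C} (x : Pt S H K U), (pull x.map).map φ = (pull x.map).map ψ) : φ = ψ := by
  refine hom_ext fun {U x} p => ?_
  have h1 : ∀ p : E.carrier ((Pt.ofBase x).map.app _ (𝟙 U)), Hom.app φ p = Hom.app ψ p :=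
    fun p => congrArg (fun χ => Hom.app χ (x := 𝟙 U) p) (h (Pt.ofBase x))
  rw [Pt.ofBase_map_app_id] at h1
  exact h1 p

instance : (Biext.u M H K S).Faithful where
  map_injective h := Biext.Hom.ext (hom_ext_fib fun x =>
    congrArg (fun χ : Biadd.Hom _ _ => χ.app x) h)

instance : (Biext.u M H K S).Full where
  map_surjective {E F} α := by
    let φ := secHom (E := E.data.tor) (F := F.data.tor) (fun x => Biadd.Hom.app α x)
      (fun f _ _ h => α.isHom.natural f h)
    have hφ : ∀ {U : C} (x : Pt S H K U), (pull x.map).map φ = Biadd.Hom.app α x := fun x =>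
      pull_secHom (E := E.data.tor) (F := F.data.tor) (fun x => Biadd.Hom.app α x) _ x
    refine ⟨(⟨φ, ⟨fun m => ?_, fun m => ?_⟩⟩ : Biext.Hom E F), Biadd.Hom.ext ?_⟩
    · rw [hφ, hφ, hφ]
      exact α.isHom.mul₁ m
    · rw [hφ, hφ, hφ]
      exact α.isHom.mul₂ m
    · funext U x
      exact hφ x

namespace Biadd
variable {W' U V W : C} (D : Biadd M H K S)

/-- The restriction morphism `D_x(w') ⟶ D_y(w)` for `y` the restriction of `x` along `f` and
`w' = f w`. -/
def resApp {f : V ⟶ U} {x : Pt S H K U} {y : Pt S H K V} (h : x.restrict f = y) {w : W ⟶ V}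
    {w' : W ⟶ U} (e : w ≫ f = w') (p : (D.data.obj x).carrier w') : (D.data.obj y).carrier w :=
  Torsor.Hom.app (D.data.res f h) (x := w) ((D.data.obj x).res (𝟙 W)
    (show rs (yoneda.obj U) (𝟙 W) w' = (yoneda.map f).app _ w from (Category.id_comp w').trans e.symm) p)

variable {D}

theorem resApp_res {f : V ⟶ U} {x : Pt S H K U} {y : Pt S H K V} (h : x.restrict f = y) {w : W ⟶ V}
    {w' : W ⟶ U} (e : w ≫ f = w') {w₂ : W' ⟶ V} {w₂' : W' ⟶ U} (e₂ : w₂ ≫ f = w₂') (k : W' ⟶ W)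
    (hk : rs (yoneda.obj V) k w = w₂) (hk' : rs (yoneda.obj U) k w' = w₂')
    (p : (D.data.obj x).carrier w') :
    (D.data.obj y).res k hk (D.resApp h e p) = D.resApp h e₂ ((D.data.obj x).res k hk' p) := by
  refine (Torsor.Hom.app_res (D.data.res f h) k (x := w) (y := w₂) hk _).symm.trans ?_
  refine congrArg (Torsor.Hom.app (D.data.res f h) (x := w₂)) ?_
  exact (D.data.obj x).res_res_eq_res_res ((Category.comp_id k).trans (Category.id_comp k).symm) p

theorem resApp_id {x : Pt S H K U} (h : x.restrict (𝟙 U) = x) {w : W ⟶ U} (e : w ≫ 𝟙 U = w)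
    (p : (D.data.obj x).carrier w) : D.resApp h e p = p := by
  unfold resApp
  rw [D.isBiadd.res_id]
  refine (pullCongr_app (yoneda.map_id U) (D.data.obj x) (x := w) _ ?_).trans
    (((D.data.obj x).res_eq_res (Category.id_comp (𝟙 W)) p).trans ((D.data.obj x).res_id ?_ p))
  · exact (Category.id_comp _).trans (Category.comp_id w)
  · exact Category.id_comp _

theorem resApp_resApp {f : V ⟶ U} {g : W ⟶ V} {k : W ⟶ U} (hk : g ≫ f = k) {x : Pt S H K U}
    {y : Pt S H K V} {z : Pt S H K W} (hf : x.restrict f = y) (hg : y.restrict g = z)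
    (h : x.restrict k = z) {w : W' ⟶ W} {w' : W' ⟶ V} {w'' : W' ⟶ U} (e : w ≫ g = w')
    (e' : w' ≫ f = w'') (e'' : w ≫ k = w'') (p : (D.data.obj x).carrier w'') :
    D.resApp hg e (D.resApp hf e' p) = D.resApp h e'' p := by
  subst hk e
  unfold resApp
  rw [D.isBiadd.res_comp f g hf hg h]
  refine congrArg (Torsor.Hom.app (D.data.res g hg) (x := w)) ?_
  refine (Torsor.Hom.app_res (D.data.res f hf) (𝟙 W') (x := w ≫ g) (y := w ≫ g)
    (Category.id_comp _) _).symm.trans ?_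
  refine congrArg (Torsor.Hom.app (D.data.res f hf) (x := w ≫ g)) ?_
  refine Eq.symm ((pullCongr_app (yoneda.map_comp g f) (D.data.obj x) (x := w) _ ?_).trans
    ((D.data.obj x).res_res_eq_res_res rfl p))
  exact (Category.id_comp _).trans (Category.assoc _ _ _).symm

theorem resApp_act {f : V ⟶ U} {x : Pt S H K U} {y : Pt S H K V} (h : x.restrict f = y) {w : W ⟶ V}
    {w' : W ⟶ U} (e : w ≫ f = w') (p : (D.data.obj x).carrier w') (g : Sec M.G W) :
    D.resApp h e ((D.data.obj x).act p g) = (D.data.obj y).act (D.resApp h e p) g := by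
  unfold resApp
  rw [(D.data.obj x).act_res, gres_id]
  exact Torsor.Hom.app_act (D.data.res f h) (x := w) _ g

theorem j_resApp {f : V ⟶ U} {x : Pt S H K U} {y : Pt S H K V} (h : x.restrict f = y) {w : W ⟶ V}
    {w' : W ⟶ U} (e : w ≫ f = w') (p : (D.data.obj x).carrier w') :
    (D.data.obj y).j (D.resApp h e p) = (D.data.obj x).j p :=
  (Torsor.Hom.j_app (D.data.res f h) (x := w) _).trans (((D.data.obj x).j_res _ _ _).trans (gres_id _ _))

theorem resApp_bijective {f : V ⟶ U} {x : Pt S H K U} {y : Pt S H K V} (h : x.restrict f = y)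
    {w : W ⟶ V} {w' : W ⟶ U} (e : w ≫ f = w') :
    Function.Bijective (D.resApp h e) := by
  subst e
  have h1 := app_bij (D.data.res f h) (x := w)
  have h2 : D.resApp h (rfl : w ≫ f = w ≫ f) = fun p => Torsor.Hom.app (D.data.res f h) (x := w) p := by
    funext p
    exact congrArg (Torsor.Hom.app (D.data.res f h) (x := w)) ((D.data.obj x).res_id (Category.id_comp _) p)
  rw [h2]
  exact h1

theorem exists_res (D : Biadd M H K S) {x : (base S H K).obj (op U)} {y : (base S H K).obj (op V)}
    (f : V ⟶ U) (h : rs _ f x = y) (q : (D.data.obj (Pt.ofBase y)).carrier (𝟙 V)) :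
    ∃ p : (D.data.obj (Pt.ofBase x)).carrier (rs (yoneda.obj U) f (𝟙 U)),
      D.resApp (Pt.ofBase_restrict h) (w' := rs (yoneda.obj U) f (𝟙 U))
        ((Category.id_comp f).trans (Category.comp_id f).symm) p = q :=
  (resApp_bijective _ _).2 q

/-- The sheaf over `S × H × K` with fibers `D_x`. -/
noncomputable def relSheaf (D : Biadd M H K S) : RelSheaf J (base S H K) where
  carrier {U} x := (D.data.obj (Pt.ofBase x)).carrier (𝟙 U)
  res {U V} f x y h p := D.resApp (Pt.ofBase_restrict h)
    (w' := rs (yoneda.obj U) f (𝟙 U)) ((Category.id_comp f).trans (Category.comp_id f).symm)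
    ((D.data.obj (Pt.ofBase x)).res f rfl p)
  res_id {U x} h p := by
    refine Eq.trans ?_ (resApp_id (Pt.ofBase_restrict h) (w := 𝟙 U) (Category.id_comp _) p)
    have e : ∀ (w' : U ⟶ U) (hw : w' = 𝟙 U) (e₁ : 𝟙 U ≫ 𝟙 U = w') (e₂ : rs (yoneda.obj U) (𝟙 U) (𝟙 U) = w')
        (e₃ : 𝟙 U ≫ 𝟙 U = 𝟙 U),
        D.resApp (Pt.ofBase_restrict h) e₁ ((D.data.obj (Pt.ofBase x)).res (𝟙 U) e₂ p) =
          D.resApp (Pt.ofBase_restrict h) e₃ p := by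
      intro w' hw e₁ e₂ e₃
      subst hw
      rw [(D.data.obj (Pt.ofBase x)).res_id]
    exact e _ (Category.id_comp _) _ _ _
  res_res {U V W} f g x y z hf hg h p := by
    rw [resApp_res (Pt.ofBase_restrict hf) (w := 𝟙 V) (w₂ := rs (yoneda.obj V) g (𝟙 V))
      (w₂' := rs (yoneda.obj U) (g ≫ f) (𝟙 U)) _ (by
        change (g ≫ 𝟙 V) ≫ f = (g ≫ f) ≫ 𝟙 U
        rw [Category.comp_id, Category.comp_id]) g rfl (rs_comp _ f g _).symm,
      (D.data.obj (Pt.ofBase x)).res_eq_res (h := rfl) rfl]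
    exact resApp_resApp rfl _ _ _ _ _ _ _
  sep {U x} R hR p q hpq := (D.data.obj (Pt.ofBase x)).sep R hR p q fun f hf =>
    (resApp_bijective (Pt.ofBase_restrict rfl) _).1 (hpq f hf)
  glue {U x} R hR t ht := by
    have key := fun {V : C} (f : V ⟶ U) (hf : R f) => D.exists_res (x := x) f rfl (t f hf)
    obtain ⟨p, hp⟩ := (D.data.obj (Pt.ofBase x)).glue R hR (fun f hf => (key f hf).choose)
      (fun {V W} f hf g => by
        refine (resApp_bijective (Pt.ofBase_restrict (f := g ≫ f) rfl)
          ((Category.id_comp _).trans (Category.comp_id _).symm)).1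
          (Eq.trans ?_ (key (g ≫ f) (R.downward_closed hf g)).choose_spec.symm)
        rw [← ht f hf g]
        conv_rhs => rw [← (key f hf).choose_spec]
        rw [resApp_res (Pt.ofBase_restrict rfl) (w := 𝟙 V) (w₂ := rs (yoneda.obj V) g (𝟙 V))
          (w₂' := rs (yoneda.obj U) (g ≫ f) (𝟙 U)) _ (by
            change (g ≫ 𝟙 V) ≫ f = (g ≫ f) ≫ 𝟙 U
            rw [Category.comp_id, Category.comp_id]) g rfl (rs_comp _ f g _).symm]
        exact (resApp_resApp rfl _ _ _ _ _ _ _).symm)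
    refine ⟨p, fun f hf => ?_⟩
    rw [hp f hf]
    exact (key f hf).choose_spec

/-- The torsor over `S × H × K` with fibers `D_x`. -/
noncomputable def torsor (D : Biadd M H K S) : Torsor M (base S H K) where
  toRelSheaf := D.relSheaf
  act {_ x} p g := (D.data.obj (Pt.ofBase x)).act p g
  act_res {U V} f x y h p g := by
    refine (congrArg (D.resApp (Pt.ofBase_restrict h) (w' := rs (yoneda.obj U) f (𝟙 U))
      ((Category.id_comp f).trans (Category.comp_id f).symm))
      ((D.data.obj (Pt.ofBase x)).act_res f rfl p g)).trans ?_
    exact resApp_act _ _ _ _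
  act_one {_ x} p := (D.data.obj (Pt.ofBase x)).act_one p
  act_mul {_ x} p g h := (D.data.obj (Pt.ofBase x)).act_mul p g h
  trans {_ x} p q := (D.data.obj (Pt.ofBase x)).trans p q
  inhab {U} x := by
    obtain ⟨R, hR, h⟩ := (D.data.obj (Pt.ofBase x)).inhab (𝟙 U)
    refine ⟨R, hR, fun {V} f hf => ?_⟩
    obtain ⟨p⟩ := h f hf
    exact ⟨D.resApp (Pt.ofBase_restrict rfl) (w' := rs (yoneda.obj U) f (𝟙 U))
      ((Category.id_comp f).trans (Category.comp_id f).symm) p⟩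
  j {_ x} p := (D.data.obj (Pt.ofBase x)).j p
  j_res {U V} f x y h p := (j_resApp _ ((Category.id_comp f).trans (Category.comp_id f).symm)
    _).trans ((D.data.obj (Pt.ofBase x)).j_res f rfl p)
  j_act {_ x} p g := (D.data.obj (Pt.ofBase x)).j_act p g

/-- The identification of `D_x` with the fiber of the torsor. -/
noncomputable def toFib (D : Biadd M H K S) (x : Pt S H K U) : D.data.obj x ⟶ fib D.torsor x :=
  show Torsor.Hom (D.data.obj x) (fib D.torsor x) from
  { app := fun {_ w} p => D.resApp (Pt.restrict_eq_ofBase x w) (Category.id_comp w) p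
    app_res := fun {V W} f w w' h p => by
      subst h
      symm
      refine (congrArg (D.resApp (Pt.ofBase_restrict (nat_app x.map f rfl))
        (w' := rs (yoneda.obj V) f (𝟙 V)) ((Category.id_comp f).trans (Category.comp_id f).symm))
        (resApp_res (Pt.restrict_eq_ofBase x w)
        (w₂ := rs (yoneda.obj V) f (𝟙 V)) (w₂' := rs (yoneda.obj U) f w) (Category.id_comp w)
        (congrArg (· ≫ w) (Category.comp_id f)) f rfl rfl p)).trans ?_
      exact resApp_resApp rfl _ _ _ _ _ _ _
    app_act := fun p g => resApp_act _ _ _ _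
    j_app := fun p => j_resApp _ _ _ }

theorem toFib_natural (D : Biadd M H K S) (f : V ⟶ U) {x : Pt S H K U} {y : Pt S H K V}
    (h : x.restrict f = y) : D.data.res f h ≫ D.toFib y =
      (rst f).map (D.toFib x) ≫ (pullCongr (Pt.map_restrict h) D.torsor : (rst f).obj _ ⟶ _) := by
  refine hom_ext fun {W} w p => ?_
  have e : rs (base S H K) (𝟙 W) (x.map.app _ ((yoneda.map f).app _ w)) = y.map.app _ w := by
    rw [rs_id, ← Pt.map_restrict h]; rfl
  refine Eq.trans ?_ (pullCongr_app (φ := yoneda.map f ≫ x.map) (Pt.map_restrict h) D.torsor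
    (x := w) _ e).symm
  have h1 : Torsor.Hom.app (D.data.res f h) (x := w) p =
      D.resApp h (w := w) (w' := w ≫ f) rfl p :=
    congrArg (Torsor.Hom.app (D.data.res f h) (x := w))
      ((D.data.obj x).res_id (Category.id_comp _) p).symm
  have h2 := resApp_resApp (D := D) (k := w ≫ f) rfl h (Pt.restrict_eq_ofBase y w)
    ((Pt.restrict_eq_ofBase x (w ≫ f)).trans (congrArg Pt.ofBase ((rs_id _ _).symm.trans e)))
    (Category.id_comp w) rfl (Category.id_comp (w ≫ f)) p
  refine (congrArg (D.resApp (Pt.restrict_eq_ofBase y w) (Category.id_comp w)) h1).trans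
    (h2.trans (Eq.symm ?_))
  refine (congrArg (D.resApp (Pt.ofBase_restrict e) (w' := rs (yoneda.obj W) (𝟙 W) (𝟙 W)) rfl)
    (resApp_res (Pt.restrict_eq_ofBase x (w ≫ f)) (w₂ := rs (yoneda.obj W) (𝟙 W) (𝟙 W))
      (w₂' := w ≫ f) (Category.id_comp _) (by
        change (𝟙 W ≫ 𝟙 W) ≫ w ≫ f = w ≫ f
        rw [Category.comp_id, Category.id_comp]) (𝟙 W) rfl (Category.id_comp _) p)).trans ?_
  refine (congrArg (fun q : (D.data.obj x).carrier (w ≫ f) => D.resApp (Pt.ofBase_restrict e)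
    (w' := rs (yoneda.obj W) (𝟙 W) (𝟙 W)) rfl (D.resApp (Pt.restrict_eq_ofBase x (w ≫ f)) _ q))
    ((D.data.obj x).res_id (Category.id_comp _) p)).trans ?_
  exact resApp_resApp (Category.id_comp _) _ _ _ _ _ _ _

/-- The biextension with fibers `D_x`. -/
noncomputable def toBiextData (D : Biadd M H K S) : BiextData M H K S where
  tor := D.torsor
  mul₁ {_ x y z} m := (inverse (D.toFib x) ⊗ₘ inverse (D.toFib y)) ≫ D.data.mul₁ m ≫ D.toFib z
  mul₂ {_ x y z} m := (inverse (D.toFib x) ⊗ₘ inverse (D.toFib y)) ≫ D.data.mul₂ m ≫ D.toFib z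

theorem isHom_toFib (D : Biadd M H K S) :
    D.data.IsHom D.toBiextData.toBiData (fun x => D.toFib x) where
  natural f _ _ h := D.toFib_natural f h
  mul₁ {_ x y z} m := (tensorHom_inverse_comp (D.toFib x) (D.toFib y) _).symm
  mul₂ {_ x y z} m := (tensorHom_inverse_comp (D.toFib x) (D.toFib y) _).symm

noncomputable def toBiext (D : Biadd M H K S) : Biext M H K S :=
  ⟨D.toBiextData, D.isBiadd.toIsLaw.of_isHom D.isHom_toFib⟩

end Biadd

instance (D D' : Biadd M H K S) (φ : D ⟶ D') : IsIso φ :=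
  ⟨(⟨fun x => inverse (Biadd.Hom.app φ x),
    φ.isHom.inv fun x => (isoOf (Biadd.Hom.app φ x)).hom_inv_id⟩ : Biadd.Hom D' D),
    Biadd.Hom.ext (by funext U x; exact (isoOf (Biadd.Hom.app φ x)).hom_inv_id),
    Biadd.Hom.ext (by funext U x; exact (isoOf (Biadd.Hom.app φ x)).inv_hom_id)⟩

instance (E F : Biext M H K S) (φ : E ⟶ F) : IsIso φ := isIso_of_reflects_iso φ (Biext.u M H K S)

instance : (Biext.u M H K S).EssSurj where
  mem_essImage D := ⟨D.toBiext, ⟨(asIso (Y := (Biext.u M H K S).obj D.toBiext)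
    (⟨fun x => D.toFib x, D.isHom_toFib⟩ : Biadd.Hom D _)).symm⟩⟩

instance Biext.u_isEquivalence : (Biext.u M H K S).IsEquivalence where

end
end Biext4

namespace Biext4
section
variable {C : Type u} [SmallCategory C] {J : GrothendieckTopology C}
open Biext4.Torsor Functor.LaxMonoidal Functor.OplaxMonoidal

section Generic
variable {A B : Type*} [Category* A] [MonoidalCategory A] [Category* B] [MonoidalCategory B]

theorem prod_natural_assoc (F : A ⥤ B) [F.Monoidal] {X Y Z : A} {X' Y' Z' : B} (r : F.obj X ⟶ X')
    (s : F.obj Y ⟶ Y') (t : F.obj Z ⟶ Z') :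
    (δ F (X ⊗ Y) Z ≫ ((δ F X Y ≫ (r ⊗ₘ s)) ⊗ₘ t)) ≫ (α_ X' Y' Z').hom =
      F.map (α_ X Y Z).hom ≫ δ F X (Y ⊗ Z) ≫ (r ⊗ₘ (δ F Y Z ≫ (s ⊗ₘ t))) := by
  have h1 : (δ F X Y ≫ (r ⊗ₘ s)) ⊗ₘ t = (δ F X Y ▷ F.obj Z) ≫ ((r ⊗ₘ s) ⊗ₘ t) := by
    rw [← tensorHom_id, tensorHom_comp_tensorHom, Category.id_comp]
  have h2 : r ⊗ₘ (δ F Y Z ≫ (s ⊗ₘ t)) = (F.obj X ◁ δ F Y Z) ≫ (r ⊗ₘ (s ⊗ₘ t)) := by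
    rw [← id_tensorHom, tensorHom_comp_tensorHom, Category.id_comp]
  rw [h1, h2, ← reassoc_of% Functor.OplaxMonoidal.associativity F X Y Z]
  simp only [Category.assoc, associator_naturality]

theorem prod_natural_leftUnitor (F : A ⥤ B) [F.Monoidal] {X : A} {X' : B} (r : F.obj X ⟶ X') :
    (δ F (𝟙_ A) X ≫ (η F ⊗ₘ r)) ≫ (λ_ X').hom = F.map (λ_ X).hom ≫ r := by
  rw [Functor.Monoidal.map_leftUnitor, MonoidalCategory.tensorHom_def]
  simp only [Category.assoc, leftUnitor_naturality]

theorem prod_natural_rightUnitor (F : A ⥤ B) [F.Monoidal] {X : A} {X' : B} (r : F.obj X ⟶ X') :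
    (δ F X (𝟙_ A) ≫ (r ⊗ₘ η F)) ≫ (ρ_ X').hom = F.map (ρ_ X).hom ≫ r := by
  rw [Functor.Monoidal.map_rightUnitor, MonoidalCategory.tensorHom_def']
  simp only [Category.assoc, rightUnitor_naturality]

theorem prod_natural_unit (F : A ⥤ B) [F.Monoidal] :
    μ F (𝟙_ A) (𝟙_ A) ≫ F.map (λ_ (𝟙_ A)).hom ≫ η F = (η F ⊗ₘ η F) ≫ (λ_ (𝟙_ B)).hom := by
  rw [← prod_natural_leftUnitor, Category.assoc, Functor.Monoidal.μ_δ_assoc]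

theorem unit_assoc : ((λ_ (𝟙_ A)).hom ▷ 𝟙_ A) ≫ (λ_ (𝟙_ A)).hom =
    (α_ (𝟙_ A) (𝟙_ A) (𝟙_ A)).hom ≫ (𝟙_ A ◁ (λ_ (𝟙_ A)).hom) ≫ (λ_ (𝟙_ A)).hom := by
  monoidal

theorem unit_interchange [BraidedCategory A] :
    ((λ_ (𝟙_ A)).hom ⊗ₘ (λ_ (𝟙_ A)).hom) ≫ (λ_ (𝟙_ A)).hom =
      tensorμ (𝟙_ A) (𝟙_ A) (𝟙_ A) (𝟙_ A) ≫ ((λ_ (𝟙_ A)).hom ⊗ₘ (λ_ (𝟙_ A)).hom) ≫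
        (λ_ (𝟙_ A)).hom := by
  conv_lhs => rw [leftUnitor_monoidal]
  simp only [Category.assoc]
  congr 1
  monoidal

theorem tensorμ_leftUnitor [BraidedCategory A] {X Y Z : A} (m : X ⊗ Y ⟶ Z) :
    (tensorμ (𝟙_ A) X (𝟙_ A) Y ≫ ((λ_ (𝟙_ A)).hom ⊗ₘ m)) ≫ (λ_ Z).hom =
      ((λ_ X).hom ⊗ₘ (λ_ Y).hom) ≫ m := by
  rw [leftUnitor_monoidal, MonoidalCategory.tensorHom_def]
  simp only [Category.assoc, leftUnitor_naturality]

theorem tensorμ_rightUnitor [BraidedCategory A] {X Y Z : A} (m : X ⊗ Y ⟶ Z) :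
    (tensorμ X (𝟙_ A) Y (𝟙_ A) ≫ (m ⊗ₘ (λ_ (𝟙_ A)).hom)) ≫ (ρ_ Z).hom =
      ((ρ_ X).hom ⊗ₘ (ρ_ Y).hom) ≫ m := by
  rw [rightUnitor_monoidal, MonoidalCategory.tensorHom_def']
  simp only [Category.assoc, rightUnitor_naturality]

theorem prod_natural_braiding [BraidedCategory A] [BraidedCategory B] (F : A ⥤ B) [F.Braided]
    {X Y : A} {X' Y' : B} (r : F.obj X ⟶ X') (s : F.obj Y ⟶ Y') :
    (δ F X Y ≫ (r ⊗ₘ s)) ≫ (β_ X' Y').hom = F.map (β_ X Y).hom ≫ δ F Y X ≫ (s ⊗ₘ r) := by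
  rw [Functor.map_braiding]
  simp

theorem tensorμ_braiding [BraidedCategory A] {X Y X' Y' Z Z' : A}
    (h : tensorμ X Y X' Y' ≫ (β_ (X ⊗ X') (Y ⊗ Y')).hom =
      ((β_ X Y).hom ⊗ₘ (β_ X' Y').hom) ≫ tensorμ Y X Y' X') (m : X ⊗ X' ⟶ Z) (n : Y ⊗ Y' ⟶ Z') :
    (tensorμ X Y X' Y' ≫ (m ⊗ₘ n)) ≫ (β_ Z Z').hom =
      ((β_ X Y).hom ⊗ₘ (β_ X' Y').hom) ≫ tensorμ Y X Y' X' ≫ (n ⊗ₘ m) := by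
  rw [Category.assoc, BraidedCategory.braiding_naturality, reassoc_of% h]

theorem comp_ε_η (F : A ⥤ B) [F.Monoidal] {X Y : B} (a : X ⟶ Y) (b : Y ⟶ 𝟙_ B) :
    (a ≫ b ≫ ε F) ≫ η F = a ≫ b := by simp

end Generic

variable {S : Cᵒᵖ ⥤ Type u} {H K : Sheaf J GrpCat.{u}} {M : BraidedCrossedModule J}

namespace Torsor
variable {X Y : Cᵒᵖ ⥤ Type u}

theorem η_pull_app (φ : X ⟶ Y) {U : C} {x : X.obj (op U)}
    (a : ((pull φ).obj (𝟙_ (Torsor M Y))).carrier x) : Hom.app (η (pull (M := M) φ)) a = a :=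
  congrArg (fun χ : 𝟙_ (Torsor M X) ⟶ 𝟙_ (Torsor M X) => Hom.app χ (x := x) a)
    (Functor.Monoidal.ε_η (pull (M := M) φ))

theorem pullCongr_unit_app {φ ψ : X ⟶ Y} (h : φ = ψ) {U : C} {x : X.obj (op U)}
    (a : ((pull φ).obj (𝟙_ (Torsor M Y))).carrier x) :
    Hom.app (pullCongr h (𝟙_ (Torsor M Y))) a = a := by
  subst h; rfl

end Torsor

namespace BiData

/-- The unit of the pointwise product. -/
noncomputable def unit (M : BraidedCrossedModule J) (H K : Sheaf J GrpCat.{u})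
    (S : Cᵒᵖ ⥤ Type u) : BiData M H K S where
  obj _ := 𝟙_ _
  res f _ _ _ := η (rst f)
  mul₁ _ := (λ_ (𝟙_ _)).hom
  mul₂ _ := (λ_ (𝟙_ _)).hom

theorem unit_isLaw : (unit M H K S).IsLaw where
  natural₁ f _ _ _ _ _ _ _ _ _ _ _ := prod_natural_unit (rst f)
  natural₂ f _ _ _ _ _ _ _ _ _ _ _ := prod_natural_unit (rst f)
  assoc₁ _ _ _ _ := unit_assoc
  assoc₂ _ _ _ _ := unit_assoc
  interchange _ _ _ _ _ _ := unit_interchange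

theorem unit_isBiadd : (unit M H K S).IsBiadd where
  toIsLaw := unit_isLaw
  res_id _ := hom_ext fun a => (η_pull_app _ a).trans (pullCongr_unit_app (yoneda.map_id _) a).symm
  res_comp f g _ _ _ _ _ _ := hom_ext fun {_ x} a => (η_pull_app _ a).trans (Eq.symm
    ((η_pull_app (yoneda.map g) _).trans ((η_pull_app (yoneda.map f) _).trans
      (pullCongr_unit_app (yoneda.map_comp g f) a))))
  unit _ _ m n e₁ e₂ := unit_isLaw.unit_aux m n e₁ e₂

variable {D D' D'' : BiData M H K S}

theorem isHom_associator : ((D.prod D').prod D'').IsHom (D.prod (D'.prod D''))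
    (fun x => (α_ (D.obj x) (D'.obj x) (D''.obj x)).hom) where
  natural f _ _ h := prod_natural_assoc (rst f) (D.res f h) (D'.res f h) (D''.res f h)
  mul₁ m := tensorμ_isHom_assoc (D.mul₁ m) (D'.mul₁ m) (D''.mul₁ m)
  mul₂ m := tensorμ_isHom_assoc (D.mul₂ m) (D'.mul₂ m) (D''.mul₂ m)

theorem isHom_leftUnitor : ((unit M H K S).prod D).IsHom D (fun x => (λ_ (D.obj x)).hom) where
  natural f _ _ h := prod_natural_leftUnitor (rst f) (D.res f h)
  mul₁ m := tensorμ_leftUnitor (D.mul₁ m)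
  mul₂ m := tensorμ_leftUnitor (D.mul₂ m)

theorem isHom_rightUnitor : (D.prod (unit M H K S)).IsHom D (fun x => (ρ_ (D.obj x)).hom) where
  natural f _ _ h := prod_natural_rightUnitor (rst f) (D.res f h)
  mul₁ m := tensorμ_rightUnitor (D.mul₁ m)
  mul₂ m := tensorμ_rightUnitor (D.mul₂ m)

theorem isHom_braiding (hM : M.IsSymmetric) :
    (D.prod D').IsHom (D'.prod D) (fun x => (β_ (D.obj x) (D'.obj x)).hom) where
  natural f _ _ h := prod_natural_braiding (rst f) (D.res f h) (D'.res f h)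
  mul₁ {_ x y _} m := tensorμ_braiding (tensorμ_isHom_braiding hM _ _ _ _) (D.mul₁ m) (D'.mul₁ m)
  mul₂ {_ x y _} m := tensorμ_braiding (tensorμ_isHom_braiding hM _ _ _ _) (D.mul₂ m) (D'.mul₂ m)

end BiData

namespace BiextData

/-- The unit of the contracted product. -/
noncomputable def unit (M : BraidedCrossedModule J) (H K : Sheaf J GrpCat.{u})
    (S : Cᵒᵖ ⥤ Type u) : BiextData M H K S where
  tor := 𝟙_ _
  mul₁ {_ x y z} _ := (η (pull x.map) ⊗ₘ η (pull y.map)) ≫ (λ_ (𝟙_ _)).hom ≫ ε (pull z.map)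
  mul₂ {_ x y z} _ := (η (pull x.map) ⊗ₘ η (pull y.map)) ≫ (λ_ (𝟙_ _)).hom ≫ ε (pull z.map)

theorem isHom_η : (unit M H K S).toBiData.IsHom (BiData.unit M H K S)
    (fun x => η (pull x.map)) where
  natural f x y h := hom_ext fun a => (η_pull_app y.map _).trans
    ((pullCongr_unit_app (Pt.map_restrict h) a).trans
      ((η_pull_app (yoneda.map f) _).trans (η_pull_app x.map a)).symm)
  mul₁ {_ _ _ z} _ := comp_ε_η (pull z.map) _ _
  mul₂ {_ _ _ z} _ := comp_ε_η (pull z.map) _ _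

theorem isHom_ε : (BiData.unit M H K S).IsHom (unit M H K S).toBiData
    (fun x => ε (pull x.map)) :=
  isHom_η.inv fun x => Functor.Monoidal.η_ε (pull x.map)

theorem unit_isBiext : (unit M H K S).IsBiext := BiData.unit_isLaw.of_isHom isHom_ε

variable {E F G E' F' : BiextData M H K S}

theorem IsHom.of_fib {φ : E.tor ⟶ F.tor} {ψ : ∀ {U : C} (x : Pt S H K U), fib E.tor x ⟶ fib F.tor x}
    (hψ : E.toBiData.IsHom F.toBiData ψ)
    (h : ∀ {U : C} (x : Pt S H K U), (pull x.map).map φ = ψ x) : E.IsHom F φ := by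
  refine isHom_of_toBiData ?_
  have : (fun {U : C} (x : Pt S H K U) => (pull x.map).map φ) = @ψ := by
    funext U x; exact h x
  rw [this]
  exact hψ

theorem IsHom.prod {φ : E.tor ⟶ E'.tor} {ψ : F.tor ⟶ F'.tor} (hφ : E.IsHom E' φ)
    (hψ : F.IsHom F' ψ) : (E.prod F).IsHom (E'.prod F') (φ ⊗ₘ ψ) :=
  .of_fib (((isHom_δ E F).comp (hφ.toBiData.prod hψ.toBiData)).comp (isHom_μ E' F')) fun x => by
    change (pull x.map).map _ = (δ _ _ _ ≫ (_ ⊗ₘ _)) ≫ μ _ _ _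
    rw [Category.assoc, μ_natural, Functor.Monoidal.δ_μ_assoc]

theorem isHom_associator : ((E.prod F).prod G).IsHom (E.prod (F.prod G))
    (α_ E.tor F.tor G.tor).hom :=
  .of_fib ((((isHom_δ (E.prod F) G).comp ((isHom_δ E F).prod (.id _))).comp
    BiData.isHom_associator).comp (((BiData.IsHom.id _).prod (isHom_μ F G)).comp
      (isHom_μ E (F.prod G)))) fun x => by
    have h := Functor.Monoidal.map_associator (pull x.map) E.tor F.tor G.tor
    rw [← tensorHom_id, ← id_tensorHom] at h
    exact h.trans ((Category.assoc _ _ _).trans (Category.assoc _ _ _)).symm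

theorem isHom_leftUnitor : ((unit M H K S).prod E).IsHom E (λ_ E.tor).hom :=
  .of_fib (((isHom_δ (unit M H K S) E).comp (isHom_η.prod (.id _))).comp
    BiData.isHom_leftUnitor) fun x => by
    have h := Functor.Monoidal.map_leftUnitor (pull x.map) E.tor
    rw [← tensorHom_id] at h
    exact h.trans (Category.assoc _ _ _).symm

theorem isHom_rightUnitor : (E.prod (unit M H K S)).IsHom E (ρ_ E.tor).hom :=
  .of_fib (((isHom_δ E (unit M H K S)).comp ((BiData.IsHom.id _).prod isHom_η)).comp
    BiData.isHom_rightUnitor) fun x => by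
    have h := Functor.Monoidal.map_rightUnitor (pull x.map) E.tor
    rw [← id_tensorHom] at h
    exact h.trans (Category.assoc _ _ _).symm

theorem isHom_braiding (hM : M.IsSymmetric) : (E.prod F).IsHom (F.prod E) (β_ E.tor F.tor).hom :=
  .of_fib (((isHom_δ E F).comp (BiData.isHom_braiding hM)).comp (isHom_μ F E)) fun x =>
    (Functor.map_braiding (pull x.map) E.tor F.tor).trans (Category.assoc _ _ _).symm

end BiextData
end
end Biext4

namespace Biext4
section
variable {C : Type u} [SmallCategory C] {J : GrothendieckTopology C}
open Biext4.Torsor Functor.LaxMonoidal Functor.OplaxMonoidal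

variable {S' S : Cᵒᵖ ⥤ Type u} {H K : Sheaf J GrpCat.{u}} {M : BraidedCrossedModule J}

section Generic
variable {A : Type*} [Category* A] [MonoidalCategory A] {X Y Z : A}

theorem eq_id_whiskerRight_comp (f : X ⊗ Y ⟶ Z) : f = 𝟙 X ▷ Y ≫ 𝟙 _ ≫ f := by simp

theorem eq_whiskerLeft_id_comp (f : X ⊗ Y ⟶ Z) : f = X ◁ 𝟙 Y ≫ 𝟙 _ ≫ f := by simp

theorem id_whiskerRight_comp_eq {X' Y' : A} (f : X ⊗ Y ⟶ X' ⊗ Y') :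
    𝟙 X ▷ Y ≫ 𝟙 _ ≫ f = f ≫ X' ◁ 𝟙 Y' ≫ 𝟙 _ := by simp

theorem map_comp_map_eq_id {B : Type*} [Category* B] (F : A ⥤ B) {f : X ⟶ Y} {g : Y ⟶ X}
    (h : f ≫ g = 𝟙 X) : F.map f ≫ F.map g = 𝟙 (F.obj X) := by
  rw [← F.map_comp, h, F.map_id]

theorem comp_assoc₅ {P Q R T V W : A} (a : P ⟶ Q) (b : Q ⟶ R) (c : R ⟶ T) (d : T ⟶ V) (e : V ⟶ W) :
    (a ≫ b ≫ c ≫ d) ≫ e = (a ≫ b) ≫ c ≫ d ≫ e := by simp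

end Generic

namespace Biadd

/-- A morphism, as an isomorphism. -/
noncomputable def isoOf {D D' : Biadd M H K S} (φ : D ⟶ D') : D ≅ D' where
  hom := φ
  inv := (⟨fun x => inverse (Hom.app φ x),
    φ.isHom.inv fun x => (Torsor.isoOf (Hom.app φ x)).hom_inv_id⟩ : Hom D' D)
  hom_inv_id := Hom.ext (by funext U x; exact (Torsor.isoOf (Hom.app φ x)).hom_inv_id)
  inv_hom_id := Hom.ext (by funext U x; exact (Torsor.isoOf (Hom.app φ x)).inv_hom_id)

theorem hom_ext {D D' : Biadd M H K S} {φ ψ : D ⟶ D'}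
    (h : ∀ {U : C} (x : Pt S H K U), Hom.app φ x = Hom.app ψ x) : φ = ψ :=
  Hom.ext (by funext U x; exact h x)

variable [hM : Fact M.IsSymmetric]

noncomputable instance : MonoidalCategoryStruct (Biadd M H K S) where
  tensorObj D D' := ⟨D.data.prod D'.data, D.isBiadd.prod hM.1 D'.isBiadd⟩
  tensorHom φ ψ := (⟨fun x => Hom.app φ x ⊗ₘ Hom.app ψ x, φ.isHom.prod ψ.isHom⟩ : Hom _ _)
  whiskerLeft D _ _ ψ := (⟨fun x => 𝟙 _ ⊗ₘ Hom.app ψ x, (BiData.IsHom.id D.data).prod ψ.isHom⟩ :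
    Hom _ _)
  whiskerRight φ D := (⟨fun x => Hom.app φ x ⊗ₘ 𝟙 _, φ.isHom.prod (BiData.IsHom.id D.data)⟩ :
    Hom _ _)
  tensorUnit := ⟨BiData.unit M H K S, BiData.unit_isBiadd⟩
  associator _ _ _ := isoOf (⟨_, BiData.isHom_associator⟩ : Hom _ _)
  leftUnitor _ := isoOf (⟨_, BiData.isHom_leftUnitor⟩ : Hom _ _)
  rightUnitor _ := isoOf (⟨_, BiData.isHom_rightUnitor⟩ : Hom _ _)

noncomputable instance : MonoidalCategory (Biadd M H K S) := .ofTensorHom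
  (id_tensorHom_id := fun _ _ => hom_ext fun _ => id_tensorHom_id _ _)
  (id_tensorHom := fun _ _ _ _ => rfl)
  (tensorHom_id := fun _ _ => rfl)
  (tensorHom_comp_tensorHom := fun _ _ _ _ => hom_ext fun _ => tensorHom_comp_tensorHom _ _ _ _)
  (associator_naturality := fun _ _ _ => hom_ext fun _ => associator_naturality _ _ _)
  (leftUnitor_naturality := fun _ => hom_ext fun _ => by
    exact (congrArg (· ≫ _) (id_tensorHom _ _)).trans (leftUnitor_naturality _))
  (rightUnitor_naturality := fun _ => hom_ext fun _ => by
    exact (congrArg (· ≫ _) (tensorHom_id _ _)).trans (rightUnitor_naturality _))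
  (pentagon := fun _ _ _ _ => hom_ext fun _ => pentagon _ _ _ _)
  (triangle := fun _ _ => hom_ext fun _ => triangle _ _)

noncomputable instance : BraidedCategory (Biadd M H K S) where
  braiding _ _ := isoOf (⟨_, BiData.isHom_braiding hM.1⟩ : Hom _ _)
  braiding_naturality_right _ _ _ _ :=
    hom_ext fun _ => BraidedCategory.braiding_naturality_right _ _
  braiding_naturality_left _ _ := hom_ext fun _ => BraidedCategory.braiding_naturality_left _ _
  hexagon_forward _ _ _ := hom_ext fun _ => BraidedCategory.hexagon_forward _ _ _
  hexagon_reverse _ _ _ := hom_ext fun _ => BraidedCategory.hexagon_reverse _ _ _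

noncomputable instance {U : C} (x : Pt S H K U) : (ev (M := M) x).Braided where
  toMonoidal := Functor.CoreMonoidal.toMonoidal
    { εIso := Iso.refl _
      μIso := fun _ _ => Iso.refl _
      μIso_hom_natural_left := fun _ _ => (Category.comp_id _).trans (Category.id_comp _).symm
      μIso_hom_natural_right := fun _ _ => (Category.comp_id _).trans (Category.id_comp _).symm
      associativity := fun D D' D'' => id_whiskerRight_comp_eq _
      left_unitality := fun D => eq_id_whiskerRight_comp _
      right_unitality := fun D => eq_whiskerLeft_id_comp _ }
  braided _ _ := (Category.id_comp _).trans (Category.comp_id _).symm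

noncomputable instance (a : S' ⟶ S) :
    (baseChange (M := M) (H := H) (K := K) a).Braided where
  toMonoidal := Functor.CoreMonoidal.toMonoidal
    { εIso := Iso.refl _
      μIso := fun _ _ => Iso.refl _
      μIso_hom_natural_left := fun _ _ => (Category.comp_id _).trans (Category.id_comp _).symm
      μIso_hom_natural_right := fun _ _ => (Category.comp_id _).trans (Category.id_comp _).symm
      associativity := fun D D' D'' => id_whiskerRight_comp_eq
        (α_ ((baseChange a).obj D) ((baseChange a).obj D') ((baseChange a).obj D'')).hom
      left_unitality := fun D => eq_id_whiskerRight_comp _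
      right_unitality := fun D => eq_whiskerLeft_id_comp _ }
  braided _ _ := (Category.id_comp _).trans (Category.comp_id _).symm

end Biadd

namespace BiextData
variable {E F : BiextData M H K S}

theorem IsHom.inverse {φ : E.tor ⟶ F.tor} (h : E.IsHom F φ) : F.IsHom E (inverse φ) :=
  isHom_of_toBiData (h.toBiData.inv fun x =>
    map_comp_map_eq_id (pull x.map) (Torsor.isoOf φ).hom_inv_id)

end BiextData

namespace Biext

/-- A morphism, as an isomorphism. -/
noncomputable def isoOf {E F : Biext M H K S} (φ : E ⟶ F) : E ≅ F where
  hom := φ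
  inv := (⟨inverse (Hom.hom φ), φ.isHom.inverse⟩ : Hom F E)
  hom_inv_id := Hom.ext (Torsor.isoOf (Hom.hom φ)).hom_inv_id
  inv_hom_id := Hom.ext (Torsor.isoOf (Hom.hom φ)).inv_hom_id

variable [hM : Fact M.IsSymmetric]

noncomputable instance : MonoidalCategoryStruct (Biext M H K S) where
  tensorObj E F := ⟨E.data.prod F.data, .prod hM.1 E.isBiext F.isBiext⟩
  tensorHom φ ψ := (⟨Hom.hom φ ⊗ₘ Hom.hom ψ, φ.isHom.prod ψ.isHom⟩ : Hom _ _)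
  whiskerLeft E _ _ ψ := (⟨𝟙 _ ⊗ₘ Hom.hom ψ, (Hom.isHom (𝟙 E)).prod ψ.isHom⟩ : Hom _ _)
  whiskerRight φ E := (⟨Hom.hom φ ⊗ₘ 𝟙 _, φ.isHom.prod (Hom.isHom (𝟙 E))⟩ : Hom _ _)
  tensorUnit := ⟨BiextData.unit M H K S, BiextData.unit_isBiext⟩
  associator _ _ _ := isoOf (⟨_, BiextData.isHom_associator⟩ : Hom _ _)
  leftUnitor _ := isoOf (⟨_, BiextData.isHom_leftUnitor⟩ : Hom _ _)
  rightUnitor _ := isoOf (⟨_, BiextData.isHom_rightUnitor⟩ : Hom _ _)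

noncomputable instance : MonoidalCategory (Biext M H K S) := .ofTensorHom
  (id_tensorHom_id := fun _ _ => Hom.ext (id_tensorHom_id _ _))
  (id_tensorHom := fun _ _ _ _ => rfl)
  (tensorHom_id := fun _ _ => rfl)
  (tensorHom_comp_tensorHom := fun _ _ _ _ => Hom.ext (tensorHom_comp_tensorHom _ _ _ _))
  (associator_naturality := fun _ _ _ => Hom.ext (associator_naturality _ _ _))
  (leftUnitor_naturality := fun _ => Hom.ext (by
    exact (congrArg (· ≫ _) (id_tensorHom _ _)).trans (leftUnitor_naturality _)))
  (rightUnitor_naturality := fun _ => Hom.ext (by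
    exact (congrArg (· ≫ _) (tensorHom_id _ _)).trans (rightUnitor_naturality _)))
  (pentagon := fun _ _ _ _ => Hom.ext (pentagon _ _ _ _))
  (triangle := fun _ _ => Hom.ext (triangle _ _))

noncomputable instance : BraidedCategory (Biext M H K S) where
  braiding _ _ := isoOf (⟨_, BiextData.isHom_braiding hM.1⟩ : Hom _ _)
  braiding_naturality_right _ _ _ _ := Hom.ext (BraidedCategory.braiding_naturality_right _ _)
  braiding_naturality_left _ _ := Hom.ext (BraidedCategory.braiding_naturality_left _ _)
  hexagon_forward _ _ _ := Hom.ext (BraidedCategory.hexagon_forward _ _ _)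
  hexagon_reverse _ _ _ := Hom.ext (BraidedCategory.hexagon_reverse _ _ _)

noncomputable instance : (toTorsor (M := M) (H := H) (K := K) (S := S)).Braided where
  toMonoidal := Functor.CoreMonoidal.toMonoidal
    { εIso := Iso.refl _
      μIso := fun _ _ => Iso.refl _
      μIso_hom_natural_left := fun _ _ => (Category.comp_id _).trans (Category.id_comp _).symm
      μIso_hom_natural_right := fun _ _ => (Category.comp_id _).trans (Category.id_comp _).symm
      associativity := fun D D' D'' => id_whiskerRight_comp_eq _
      left_unitality := fun D => eq_id_whiskerRight_comp _
      right_unitality := fun D => eq_whiskerLeft_id_comp _ }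
  braided _ _ := (Category.id_comp _).trans (Category.comp_id _).symm

noncomputable instance : (u M H K S).Braided where
  toMonoidal := Functor.CoreMonoidal.toMonoidal
    { εIso := Biadd.isoOf (⟨_, BiextData.isHom_ε⟩ : Biadd.Hom _ _)
      μIso := fun E F => Biadd.isoOf (⟨_, BiextData.isHom_μ E.data F.data⟩ : Biadd.Hom _ _)
      μIso_hom_natural_left := fun φ F => Biadd.hom_ext fun x =>
        μ_natural_left (pull x.map) (Hom.hom φ) F.data.tor
      μIso_hom_natural_right := fun E φ => Biadd.hom_ext fun x =>
        μ_natural_right (pull x.map) E.data.tor (Hom.hom φ)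
      associativity := fun E F G => Biadd.hom_ext fun x =>
        Functor.LaxMonoidal.associativity (pull x.map) E.data.tor F.data.tor G.data.tor
      left_unitality := fun E => Biadd.hom_ext fun x =>
        Functor.LaxMonoidal.left_unitality (pull x.map) E.data.tor
      right_unitality := fun E => Biadd.hom_ext fun x =>
        Functor.LaxMonoidal.right_unitality (pull x.map) E.data.tor }
  braided E F := Biadd.hom_ext fun x =>
    Functor.LaxBraided.braided (F := pull x.map) E.data.tor F.data.tor

theorem _root_.Biext4.BiData.IsHom.baseChange {D D' : BiData M H K S}
    {φ : ∀ {U : C} (x : Pt S H K U), D.obj x ⟶ D'.obj x} (h : D.IsHom D' φ) (a : S' ⟶ S) :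
    (D.baseChange a).IsHom (D'.baseChange a) (fun x => φ (x.push a)) :=
  ⟨fun f _ _ e => h.natural f (Pt.push_restrict e), fun m => h.mul₁ (m.push a),
    fun m => h.mul₂ (m.push a)⟩

theorem _root_.Biext4.BiextData.isHom_baseChange_μ (E F : BiextData M H K S) (a : S' ⟶ S) :
    ((E.baseChange a).prod (F.baseChange a)).IsHom ((E.prod F).baseChange a)
      (μ (pull (baseMap a H K)) E.tor F.tor) :=
  .of_fib ((BiextData.isHom_δ (E.baseChange a) (F.baseChange a)).comp
    ((BiextData.isHom_μ E F).baseChange a)) fun x => by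
    have h := μ_pull_comp x.map (baseMap a H K) E.tor F.tor
    refine Eq.symm ((congrArg (δ (pull x.map) _ _ ≫ ·) h).trans ?_)
    exact Functor.Monoidal.δ_μ_assoc (pull x.map) _ _ _

theorem _root_.Biext4.BiextData.isHom_baseChange_ε (a : S' ⟶ S) :
    (BiextData.unit M H K S').IsHom ((BiextData.unit M H K S).baseChange a)
      (ε (pull (baseMap a H K))) :=
  .of_fib (BiextData.isHom_η.comp (BiextData.isHom_ε.baseChange a)) fun x =>
    Torsor.hom_ext fun b => (η_pull_app x.map b).symm

noncomputable instance (a : S' ⟶ S) : (baseChange (M := M) (H := H) (K := K) a).Braided where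
  toMonoidal := Functor.CoreMonoidal.toMonoidal
    { εIso := isoOf (⟨_, BiextData.isHom_baseChange_ε a⟩ : Hom _ _)
      μIso := fun E F => isoOf (⟨_, BiextData.isHom_baseChange_μ E.data F.data a⟩ : Hom _ _)
      μIso_hom_natural_left := fun φ F => Hom.ext
        (μ_natural_left (pull (baseMap a H K)) (Hom.hom φ) F.data.tor)
      μIso_hom_natural_right := fun E φ => Hom.ext
        (μ_natural_right (pull (baseMap a H K)) E.data.tor (Hom.hom φ))
      associativity := fun E F G => Hom.ext
        (Functor.LaxMonoidal.associativity (pull (baseMap a H K)) E.data.tor F.data.tor G.data.tor)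
      left_unitality := fun E => Hom.ext
        (Functor.LaxMonoidal.left_unitality (pull (baseMap a H K)) E.data.tor)
      right_unitality := fun E => Hom.ext
        (Functor.LaxMonoidal.right_unitality (pull (baseMap a H K)) E.data.tor) }
  braided E F := Hom.ext
    (Functor.LaxBraided.braided (F := pull (baseMap a H K)) E.data.tor F.data.tor)

theorem _root_.Biext4.Torsor.exists_comp_tensorHom_comp_eq {X : Cᵒᵖ ⥤ Type u}
    {P P' Q Q' T Z : Torsor M X} (a : T ⟶ P ⊗ Q) (m : P ⟶ P') (b : P' ⊗ Q' ⟶ Z) (χ : T ⟶ Z) :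
    ∃ n : Q ⟶ Q', a ≫ (m ⊗ₘ n) ≫ b = χ := by
  obtain ⟨n, hn⟩ := exists_tensorHom_eq m (CategoryTheory.inv a ≫ χ ≫ CategoryTheory.inv b)
  exact ⟨n, by simp [hn]⟩

theorem _root_.Biext4.BiextData.exists_isHom_unit (E : BiextData M H K S) :
    ∃ F : BiextData M H K S, ∃ φ, (E.prod F).IsHom (BiextData.unit M H K S) φ := by
  have key := fun {U : C} {x y z : Pt S H K U} (m : fib E.tor x ⊗ fib E.tor y ⟶ fib E.tor z) =>
    exists_comp_tensorHom_comp_eq (P := fib E.tor x ⊗ fib E.tor y)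
      (Q := fib E.tor.inv x ⊗ fib E.tor.inv y) (Q' := fib E.tor.inv z)
      ((δ (pull x.map) E.tor E.tor.inv ⊗ₘ δ (pull y.map) E.tor E.tor.inv) ≫ tensorμ _ _ _ _) m
      (μ (pull z.map) E.tor E.tor.inv ≫ (pull z.map).map (tensorInv E.tor))
      (((pull x.map).map (tensorInv E.tor) ⊗ₘ (pull y.map).map (tensorInv E.tor)) ≫
        (η (pull x.map) ⊗ₘ η (pull y.map)) ≫ (λ_ (𝟙_ _)).hom ≫ ε (pull z.map))
  refine ⟨⟨E.tor.inv, fun m => (key (E.mul₁ m)).choose, fun m => (key (E.mul₂ m)).choose⟩,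
    tensorInv E.tor, fun {U x y z} m => ?_, fun {U x y z} m => ?_⟩
  · refine Eq.trans ?_ (key (E.mul₁ m)).choose_spec
    exact (comp_assoc₅ _ _ _ _ _)
  · refine Eq.trans ?_ (key (E.mul₂ m)).choose_spec
    exact (comp_assoc₅ _ _ _ _ _)

theorem exists_tensor_iso (E : Biext M H K S) : ∃ F, Nonempty (E ⊗ F ≅ 𝟙_ (Biext M H K S)) := by
  obtain ⟨F, φ, hφ⟩ := E.data.exists_isHom_unit
  have h : (E.data.prod F).IsBiext := BiextData.unit_isBiext.of_isHom hφ.inverse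
  exact ⟨⟨F, BiData.isLaw_of_prod hM.1 E.isBiext (BiextData.prod_isBiext_iff.1 h)⟩,
    ⟨isoOf (⟨φ, hφ⟩ : Hom _ _)⟩⟩

end Biext

theorem Biadd.exists_tensor_iso [Fact M.IsSymmetric] (D : Biadd M H K S) :
    ∃ D', Nonempty (D ⊗ D' ≅ 𝟙_ (Biadd M H K S)) := by
  obtain ⟨F, ⟨e⟩⟩ := D.toBiext.exists_tensor_iso
  have e' : D ≅ (Biext.u M H K S).obj D.toBiext := isoOf ⟨fun x => D.toFib x, D.isHom_toFib⟩
  exact ⟨(Biext.u M H K S).obj F, ⟨whiskerRightIso e' _ ≪≫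
    Functor.Monoidal.μIso (Biext.u M H K S) D.toBiext F ≪≫ (Biext.u M H K S).mapIso e ≪≫
      (Functor.Monoidal.εIso (Biext.u M H K S)).symm⟩⟩

section
variable (M : BraidedCrossedModule J) (H K : Sheaf J GrpCat.{u}) (S : Cᵒᵖ ⥤ Type u)
  [hM : Fact M.IsSymmetric]

/-- The contracted product of biextensions. -/
noncomputable def biextSymGr : SymGr (Biext M H K S) where
  mon := inferInstance
  br := inferInstance
  symmetric E F := Biext.Hom.ext (braiding_braiding_of_isSymmetric hM.1 E.data.tor F.data.tor)
  groupoid := ⟨fun φ => inferInstance⟩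
  left E := by
    obtain ⟨F, ⟨e⟩⟩ := E.exists_tensor_iso
    exact isEquivalence_tensorLeft e
  right E := by
    obtain ⟨F, ⟨e⟩⟩ := E.exists_tensor_iso
    exact isEquivalence_tensorRight e

/-- The pointwise product of biadditive morphisms. -/
noncomputable def biaddSymGr : SymGr (Biadd M H K S) where
  mon := inferInstance
  br := inferInstance
  symmetric E F := Biadd.hom_ext fun _ => braiding_braiding_of_isSymmetric hM.1 _ _
  groupoid := ⟨fun φ => inferInstance⟩
  left E := by
    obtain ⟨F, ⟨e⟩⟩ := E.exists_tensor_iso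
    exact isEquivalence_tensorLeft e
  right E := by
    obtain ⟨F, ⟨e⟩⟩ := E.exists_tensor_iso
    exact isEquivalence_tensorRight e

/-- The contracted product is given by the contracted product of torsors. -/
noncomputable def biextIsContracted : IsContracted (biextSymGr M H K S) where
  toTorsor := inferInstanceAs (Biext.toTorsor (M := M) (H := H) (K := K) (S := S)).Braided
  laws E F := Biext.Hom.isHom (𝟙 (E ⊗ F))

/-- The product of biadditive morphisms is given by the contracted product at each point. -/
noncomputable def biaddIsPointwise : IsPointwise (biaddSymGr M H K S) where
  ev x := inferInstanceAs (Biadd.ev (M := M) x).Braided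
  laws D D' := BiData.IsHom.id _

/-- The functor `u` with the canonical isomorphisms. -/
noncomputable def uFun : (biextSymGr M H K S).Fun (biaddSymGr M H K S).toBrStr (Biext.u M H K S) :=
  inferInstanceAs (Biext.u M H K S).Braided

theorem uFun_isCanonical :
    IsCanonical (biextIsContracted M H K S) (biaddIsPointwise M H K S) (uFun M H K S) :=
  fun E F _ x => (Category.id_comp _).trans ((congrArg (μ (pull x.map) E.data.tor F.data.tor ≫ ·)
    ((pull x.map).map_id _)).trans (Category.comp_id _)).symm

end

end
end Biext4

namespace Biext4
section
variable {C : Type u} [SmallCategory C] {J : GrothendieckTopology C}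
open Biext4.Torsor Functor.LaxMonoidal Functor.OplaxMonoidal

section
variable {S : Cᵒᵖ ⥤ Type u} {H K : Sheaf J GrpCat.{u}} {M : BraidedCrossedModule J}

theorem Biext.eqToHom_hom {B B' : Biext M H K S} (h : B = B') (h' : B.data.tor = B'.data.tor) :
    Biext.Hom.hom (eqToHom h) = eqToHom h' := by
  subst h
  rfl

theorem IsContracted.prod_isBiext {s : SymGr (Biext M H K S)} (c : IsContracted s)
    (E F : Biext M H K S) : (E.data.prod F.data).IsBiext :=
  (s.mul E F).isBiext.of_isHom (c.laws E F).inverse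

theorem IsPointwise.prod_isBiext {s : SymGr (Biadd M H K S)} (c : IsPointwise s)
    (E F : Biext M H K S) : (E.data.prod F.data).IsBiext := by
  let D := (Biext.u M H K S).obj E
  let D' := (Biext.u M H K S).obj F
  let φ {U : C} (x : Pt S H K U) : (D.data.prod D'.data).obj x ⟶ (s.mul D D').data.obj x :=
    (c.ev x).mu D D'
  have hφ : (D.data.prod D'.data).IsHom (s.mul D D').data φ := c.laws D D'
  exact BiextData.prod_isBiext_iff.2 ((s.mul D D').isBiadd.toIsLaw.of_isHom
    (hφ.inv (ψ := fun x => inverse (φ x)) fun x => (isoOf (φ x)).hom_inv_id))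

end

section
variable (M : BraidedCrossedModule J) (H K : Sheaf J GrpCat.{u}) {S'' S' S : Cᵒᵖ ⥤ Type u}
  [hM : Fact M.IsSymmetric]

/-- Base change of biextensions, as a braided functor. -/
noncomputable def biextBaseChange (a : S' ⟶ S) :
    (biextSymGr M H K S).Fun (biextSymGr M H K S').toBrStr (Biext.baseChange a) :=
  inferInstanceAs (Biext.baseChange (M := M) (H := H) (K := K) a).Braided

/-- Base change of biadditive morphisms, as a braided functor. -/
noncomputable def biaddBaseChange (a : S' ⟶ S) :
    (biaddSymGr M H K S).Fun (biaddSymGr M H K S').toBrStr (Biadd.baseChange a) :=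
  inferInstanceAs (Biadd.baseChange (M := M) (H := H) (K := K) a).Braided

theorem biextBaseChange_id {a : S ⟶ S} (ha : a = 𝟙 S) (E F : Biext M H K S)
    (h : (biextSymGr M H K S).mul ((Biext.baseChange a).obj E) ((Biext.baseChange a).obj F) =
      (Biext.baseChange a).obj ((biextSymGr M H K S).mul E F)) :
    (biextBaseChange M H K a).mu E F = eqToHom h := by
  subst ha
  exact Biext.Hom.ext ((μ_pull_id E.data.tor F.data.tor).trans
    (Biext.eqToHom_hom h rfl).symm)

theorem biextBaseChange_comp {a : S' ⟶ S} {b : S'' ⟶ S'} {c : S'' ⟶ S} (hc : c = b ≫ a)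
    (E F : Biext M H K S)
    (h : (biextSymGr M H K S'').mul ((Biext.baseChange c).obj E) ((Biext.baseChange c).obj F) =
      (biextSymGr M H K S'').mul ((Biext.baseChange b).obj ((Biext.baseChange a).obj E))
        ((Biext.baseChange b).obj ((Biext.baseChange a).obj F)))
    (h' : (Biext.baseChange b).obj ((Biext.baseChange a).obj ((biextSymGr M H K S).mul E F)) =
      (Biext.baseChange c).obj ((biextSymGr M H K S).mul E F)) :
    (biextBaseChange M H K c).mu E F = eqToHom h ≫ (biextBaseChange M H K b).mu
      ((Biext.baseChange a).obj E) ((Biext.baseChange a).obj F) ≫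
      (Biext.baseChange b).map ((biextBaseChange M H K a).mu E F) ≫ eqToHom h' := by
  subst hc
  refine Eq.trans ?_ ((Category.id_comp _).trans (congrArg (_ ≫ ·) (Category.comp_id _))).symm
  exact Biext.Hom.ext (μ_pull_comp (baseMap b H K) (baseMap a H K) E.data.tor F.data.tor)

theorem biaddBaseChange_id {a : S ⟶ S} (ha : a = 𝟙 S) (D D' : Biadd M H K S)
    (h : (biaddSymGr M H K S).mul ((Biadd.baseChange a).obj D) ((Biadd.baseChange a).obj D') =
      (Biadd.baseChange a).obj ((biaddSymGr M H K S).mul D D')) :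
    (biaddBaseChange M H K a).mu D D' = eqToHom h := by
  subst ha
  rfl

theorem biaddBaseChange_comp {a : S' ⟶ S} {b : S'' ⟶ S'} {c : S'' ⟶ S} (hc : c = b ≫ a)
    (D D' : Biadd M H K S)
    (h : (biaddSymGr M H K S'').mul ((Biadd.baseChange c).obj D) ((Biadd.baseChange c).obj D') =
      (biaddSymGr M H K S'').mul ((Biadd.baseChange b).obj ((Biadd.baseChange a).obj D))
        ((Biadd.baseChange b).obj ((Biadd.baseChange a).obj D')))
    (h' : (Biadd.baseChange b).obj ((Biadd.baseChange a).obj ((biaddSymGr M H K S).mul D D')) =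
      (Biadd.baseChange c).obj ((biaddSymGr M H K S).mul D D')) :
    (biaddBaseChange M H K c).mu D D' = eqToHom h ≫ (biaddBaseChange M H K b).mu
      ((Biadd.baseChange a).obj D) ((Biadd.baseChange a).obj D') ≫
      (Biadd.baseChange b).map ((biaddBaseChange M H K a).mu D D') ≫ eqToHom h' := by
  subst hc
  refine Eq.trans ?_ ((Category.id_comp _).trans (congrArg (_ ≫ ·) (Category.comp_id _))).symm
  exact Biadd.hom_ext fun x => (Category.comp_id _).symm

theorem biextBaseChange_contracted (a : S' ⟶ S) (E F : Biext M H K S) :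
    (biextIsContracted M H K S').toTorsor.mu ((Biext.baseChange a).obj E)
        ((Biext.baseChange a).obj F) ≫ Biext.toTorsor.map ((biextBaseChange M H K a).mu E F) =
      μ (pull (baseMap a H K)) E.data.tor F.data.tor ≫
        (pull (baseMap a H K)).map ((biextIsContracted M H K S).toTorsor.mu E F) :=
  (Category.id_comp _).trans ((congrArg (_ ≫ ·)
    ((pull (baseMap a H K)).map_id _)).trans (Category.comp_id _)).symm

theorem biaddBaseChange_pointwise (a : S' ⟶ S) (D D' : Biadd M H K S) {W : C}
    (x : Pt S' H K W) :
    ((biaddIsPointwise M H K S').ev x).mu ((Biadd.baseChange a).obj D)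
        ((Biadd.baseChange a).obj D') ≫ (Biadd.ev x).map ((biaddBaseChange M H K a).mu D D') =
      ((biaddIsPointwise M H K S).ev (x.push a)).mu D D' :=
  Category.comp_id _

/-- The contracted product on the stack of biextensions. -/
noncomputable def contractedStack (h : (biextStack M H K).toPseudofunctor'.IsStack J) :
    ContractedStack M H K where
  stack := h
  fiber U := biextSymGr M H K (yoneda.obj U.unop)
  res f := biextBaseChange M H K (yoneda.map f.unop)
  res_id {U} E F := biextBaseChange_id M H K (yoneda.map_id U.unop) E F _
  res_comp f g E F := biextBaseChange_comp M H K (yoneda.map_comp g.unop f.unop) E F _ _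
  contracted U := biextIsContracted M H K (yoneda.obj U)
  res_contracted f E F := biextBaseChange_contracted M H K (yoneda.map f) E F

/-- The pointwise product on the stack of biadditive morphisms. -/
noncomputable def pointwiseStack (h : (biaddStack M H K).toPseudofunctor'.IsStack J) :
    PointwiseStack M H K where
  stack := h
  fiber U := biaddSymGr M H K (yoneda.obj U.unop)
  res f := biaddBaseChange M H K (yoneda.map f.unop)
  res_id {U} E F := biaddBaseChange_id M H K (yoneda.map_id U.unop) E F _
  res_comp f g E F := biaddBaseChange_comp M H K (yoneda.map_comp g.unop f.unop) E F _ _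
  pointwise U := biaddIsPointwise M H K (yoneda.obj U)
  res_pointwise f D D' _ x := biaddBaseChange_pointwise M H K (yoneda.map f) D D' x

theorem uFun_baseChange (a : S' ⟶ S) (E F : Biext M H K S) :
    (uFun M H K S').mu ((Biext.baseChange a).obj E) ((Biext.baseChange a).obj F) ≫
        (Biext.u M H K S').map ((biextBaseChange M H K a).mu E F) =
      (biaddBaseChange M H K a).mu ((Biext.u M H K S).obj E) ((Biext.u M H K S).obj F) ≫
        (Biadd.baseChange a).map ((uFun M H K S).mu E F) :=
  Biadd.hom_ext fun x => Eq.trans (μ_pull_comp x.map (baseMap a H K) E.data.tor F.data.tor).symm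
    (Category.id_comp _).symm

/-- The functor `u` is an equivalence of symmetric group-like stacks. -/
noncomputable def uStackEquivalence (h : (biextStack M H K).toPseudofunctor'.IsStack J)
    (h' : (biaddStack M H K).toPseudofunctor'.IsStack J) :
    (contractedStack M H K h).toSymGrStack.Equivalence (pointwiseStack M H K h').toSymGrStack
      (uStack M H K) where
  equiv _ := Biext.u_isEquivalence
  braided U := uFun M H K (yoneda.obj U.unop)
  comm f E F := (uFun_baseChange M H K (yoneda.map f.unop) E F).trans
    ((Category.id_comp _).trans (congrArg (_ ≫ ·) (Category.comp_id _))).symm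

end

end
end Biext4

namespace Biext4
section
variable {C : Type u} [SmallCategory C] {J : GrothendieckTopology C}
open Biext4.Torsor Functor.LaxMonoidal Functor.OplaxMonoidal

variable {X' X : Cᵒᵖ ⥤ Type u} {M : BraidedCrossedModule J}

/-- The sieve of the morphisms along which a section lifts. -/
def liftSieve (i : X' ⟶ X) {U : C} (x : X.obj (op U)) : Sieve U where
  arrows V f := ∃ y, rs X f x = i.app (op V) y
  downward_closed := by
    rintro V W f ⟨y, hy⟩ g
    exact ⟨rs X' g y, by rw [rs_comp, hy, nat_app i g rfl]⟩

/-- A monomorphism of presheaves that is locally surjective. -/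
structure IsDense (J : GrothendieckTopology C) (i : X' ⟶ X) : Prop where
  inj : ∀ {U : C} {y y' : X'.obj (op U)}, i.app (op U) y = i.app (op U) y' → y = y'
  cover : ∀ {U : C} (x : X.obj (op U)), liftSieve i x ∈ J U

namespace IsDense
variable {i : X' ⟶ X} (hi : IsDense J i)
include hi

theorem rs_eq {U V W : C} {f : V ⟶ U} {g : W ⟶ V} {k : W ⟶ U} (e : g ≫ f = k)
    {x : X.obj (op U)} {y : X'.obj (op V)} {z : X'.obj (op W)} (hy : rs X f x = i.app (op V) y)
    (hz : rs X k x = i.app (op W) z) : rs X' g y = z := by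
  subst e
  exact hi.inj (by rw [← hz, rs_comp, hy, nat_app i g rfl])

theorem relSheaf_sep (P : RelSheaf J X) {U : C} {x : X.obj (op U)} {p q : P.carrier x}
    (h : ∀ {V : C} (f : V ⟶ U) (y : X'.obj (op V)) (hy : rs X f x = i.app (op V) y),
      P.res f hy p = P.res f hy q) : p = q := by
  refine P.sep _ (hi.cover x) p q fun {V} f ⟨y, hy⟩ => ?_
  have key : ∀ {z : X.obj (op V)} (e : rs X f x = z), P.res f e p = P.res f e q →
      P.res f rfl p = P.res f rfl q := by
    intro z e he; subst e; exact he
  exact key hy (h f y hy)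

theorem relSheaf_glue (P : RelSheaf J X) {U : C} {x : X.obj (op U)}
    (t : ∀ {V : C} (f : V ⟶ U) (y : X'.obj (op V)), rs X f x = i.app (op V) y →
      P.carrier (i.app (op V) y))
    (ht : ∀ {V W : C} (f : V ⟶ U) (g : W ⟶ V) {y : X'.obj (op V)} {z : X'.obj (op W)}
      (hy : rs X f x = i.app (op V) y) (hg : rs X' g y = z)
      (hz : rs X (g ≫ f) x = i.app (op W) z),
      P.res g (nat_app i g hg) (t f y hy) = t (g ≫ f) z hz) :
    ∃ p : P.carrier x, ∀ {V : C} (f : V ⟶ U) (y : X'.obj (op V))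
      (hy : rs X f x = i.app (op V) y), P.res f hy p = t f y hy := by
  have e : ∀ {V : C} (f : V ⟶ U) (hf : liftSieve i x f),
      rs X (𝟙 V) (i.app (op V) hf.choose) = rs X f x :=
    fun f hf => (rs_id X _).trans hf.choose_spec.symm
  obtain ⟨p, hp⟩ := P.glue _ (hi.cover x)
    (fun f hf => P.res (𝟙 _) (e f hf) (t f hf.choose hf.choose_spec)) (fun {V W} f hf g => by
      have h1 := (liftSieve i x).downward_closed hf g
      rw [← ht f g hf.choose_spec (hi.rs_eq rfl hf.choose_spec h1.choose_spec) h1.choose_spec]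
      exact P.res_res_eq_res_res ((Category.comp_id g).trans (Category.id_comp g).symm) _)
  refine ⟨p, fun {V} f y hy => ?_⟩
  have h1 := hp f ⟨y, hy⟩
  have h2 : rs X' (𝟙 V) (Exists.choose ⟨y, hy⟩ : X'.obj (op V)) = y :=
    hi.rs_eq (Category.id_comp f) (Exists.choose_spec (⟨y, hy⟩ : liftSieve i x f)) hy
  have h3 : rs X (𝟙 V) (rs X f x) = i.app (op V) y := (rs_id X _).trans hy
  rw [← P.res_eq_res (hf := rfl) (hg := h3) (Category.id_comp f), h1,
    P.res_eq_res (h := nat_app i (𝟙 V) h2) (Category.id_comp _),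
    ht f (𝟙 V) _ h2 (by rw [Category.id_comp, hy])]
  congr 1
  exact Category.id_comp f

theorem pull_faithful : (pull (M := M) i).Faithful where
  map_injective {P Q φ ψ} h := hom_ext fun {U x} p => hi.relSheaf_sep Q.toRelSheaf fun f y hy => by
    have h1 : ∀ q : P.carrier (i.app _ y), Hom.app φ q = Hom.app ψ q := fun q =>
      congrArg (fun χ : (pull i).obj P ⟶ (pull i).obj Q => Hom.app χ (x := y) q) h
    rw [← φ.app_res, ← ψ.app_res, h1]

theorem pull_full : (pull (M := M) i).Full where
  map_surjective {P Q} φ := by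
    have key : ∀ {U : C} {x : X.obj (op U)} (p : P.carrier x), ∃ q : Q.carrier x, ∀ {V : C}
        (f : V ⟶ U) (y : X'.obj (op V)) (hy : rs X f x = i.app (op V) y),
        Q.res f hy q = Hom.app φ (x := y) (P.res f hy p) := fun p =>
      hi.relSheaf_glue Q.toRelSheaf (fun f y hy => Hom.app φ (x := y) (P.res f hy p))
        (fun {V W} f g y z hy hg hz => by
          refine (Hom.app_res φ g hg (P.res f hy p)).symm.trans ?_
          exact congrArg (Hom.app φ (x := z)) (P.res_res f g hy _ hz p))
    choose F hF using @key
    refine ⟨show Hom P Q from ⟨fun p => F p, ?_, ?_, ?_⟩, ?_⟩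
    · intro U V k x z hk p
      refine hi.relSheaf_sep Q.toRelSheaf fun {W} f y hy => ?_
      have h1 : rs X (f ≫ k) x = i.app (op W) y := by rw [rs_comp, hk, hy]
      rw [hF, P.res_res k f hk hy h1, Q.res_res k f hk hy h1, hF]
    · intro U x p g
      refine hi.relSheaf_sep Q.toRelSheaf fun {W} f y hy => ?_
      rw [hF, P.act_res, Q.act_res, hF]
      exact Hom.app_act φ _ _
    · intro U x p
      refine gsep M.Pi (hi.cover x) _ _ fun {V} f ⟨y, hy⟩ => ?_
      rw [← Q.j_res f hy, ← P.j_res f hy, hF]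
      exact Hom.j_app φ _
    · refine hom_ext fun {U y} p => ?_
      have h1 := hF p (𝟙 U) y (rs_id X _)
      rw [Q.res_id] at h1
      exact h1.trans (congrArg (Hom.app φ (x := y)) (P.res_id _ p))

end IsDense

/-- A section over `x` of the extension along `i : X' ⟶ X` of a sheaf over `X'`: a compatible
family of sections over the local lifts of `x`. -/
@[ext] structure LiftFamily (i : X' ⟶ X) (P : RelSheaf J X') {U : C} (x : X.obj (op U)) where
  val : ∀ {V : C} (f : V ⟶ U) (y : X'.obj (op V)), rs X f x = i.app (op V) y → P.carrier y
  val_res : ∀ {V W : C} (f : V ⟶ U) (g : W ⟶ V) {y : X'.obj (op V)} {z : X'.obj (op W)}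
    (hy : rs X f x = i.app (op V) y) (hg : rs X' g y = z) (hz : rs X (g ≫ f) x = i.app (op W) z),
    P.res g hg (val f y hy) = val (g ≫ f) z hz

namespace LiftFamily
variable {i : X' ⟶ X} {P : RelSheaf J X'} {U V W : C} {x : X.obj (op U)}

theorem val_congr (t : LiftFamily i P x) {f f' : V ⟶ U} (e : f = f') {y : X'.obj (op V)}
    (hy : rs X f x = i.app (op V) y) : t.val f y hy = t.val f' y (e ▸ hy) := by
  subst e
  rfl

theorem res_val (t : LiftFamily i P x) {f : V ⟶ U} {g : W ⟶ V} {k : W ⟶ U} (e : g ≫ f = k)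
    {y : X'.obj (op V)} {z : X'.obj (op W)} (hy : rs X f x = i.app (op V) y) (hg : rs X' g y = z)
    (hz : rs X k x = i.app (op W) z) : P.res g hg (t.val f y hy) = t.val k z hz := by
  subst e
  exact t.val_res f g hy hg hz

/-- Restriction of families. -/
def restrict (t : LiftFamily i P x) (k : V ⟶ U) {z : X.obj (op V)} (h : rs X k x = z) :
    LiftFamily i P z where
  val f y hy := t.val (f ≫ k) y (by rw [rs_comp, h, hy])
  val_res f g y z hy hg hz := t.res_val (Category.assoc g f k).symm _ _ _

end LiftFamily

/-- The extension of a sheaf along a morphism of presheaves. -/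
def pushRelSheaf (i : X' ⟶ X) (P : RelSheaf J X') : RelSheaf J X where
  carrier x := LiftFamily i P x
  res f _ _ h t := t.restrict f h
  res_id {U x} h t := LiftFamily.ext (by
    funext V f y hy
    exact t.val_congr (Category.comp_id f) _)
  res_res f g _ _ _ _ _ _ t := LiftFamily.ext (by
    funext V k y hy
    exact t.val_congr (Category.assoc k g f) _)
  sep {U x} R hR t t' h := LiftFamily.ext (by
    funext V f y hy
    refine P.sep _ (J.pullback_stable f hR) _ _ fun {W} g hg => ?_
    have hz : rs X (g ≫ f) x = i.app (op W) (rs X' g y) := by rw [rs_comp, hy, nat_app i g rfl]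
    have h1 := congrArg (fun s : LiftFamily i P (rs X (g ≫ f) x) =>
      s.val (𝟙 W) (rs X' g y) ((rs_id X _).trans hz)) (h (g ≫ f) hg)
    exact (t.res_val (Category.id_comp _).symm _ _ _).trans
      (h1.trans (t'.res_val (Category.id_comp _).symm _ _ _).symm))
  glue {U x} R hR T hT := by
    have e : ∀ {V W : C} (f : V ⟶ U) (g : W ⟶ V) {y : X'.obj (op V)}
        (hy : rs X f x = i.app (op V) y),
        rs X (𝟙 W) (rs X (g ≫ f) x) = i.app (op W) (rs X' g y) := by
      intro V W f g y hy
      rw [rs_id, rs_comp, hy, nat_app i g rfl]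
    have hT' : ∀ {V W : C} (f : V ⟶ U) (hf : R f) (g : W ⟶ V) {k : W ⟶ U} (hk : g ≫ f = k)
        (hR : R k) {z : X'.obj (op W)} (hz : rs X g (rs X f x) = i.app (op W) z)
        (hz' : rs X (𝟙 W) (rs X k x) = i.app (op W) z),
        (T f hf).val g z hz = (T k hR).val (𝟙 W) z hz' := by
      intro V W f hf g k hk hR z hz hz'
      subst hk
      rw [← hT f hf g]
      exact (T f hf).val_congr (Category.id_comp g).symm _
    have key : ∀ {V : C} (f : V ⟶ U) (y : X'.obj (op V)) (hy : rs X f x = i.app (op V) y),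
        ∃ p : P.carrier y, ∀ {W : C} (g : W ⟶ V) (hg : R (g ≫ f)),
          P.res g rfl p = (T (g ≫ f) hg).val (𝟙 W) (rs X' g y) (e f g hy) := by
      intro V f y hy
      refine P.glue _ (J.pullback_stable f hR)
        (fun {W} g hg => (T (g ≫ f) hg).val (𝟙 W) (rs X' g y) (e f g hy)) fun {W W'} g hg k => ?_
      refine ((T (g ≫ f) hg).res_val (Category.comp_id k) _ _ ?_).trans
        (hT' _ _ _ (Category.assoc k g f).symm _ _ _)
      rw [rs_comp X' g k, ← rs_comp, ← nat_app i k rfl, ← nat_app i g rfl, ← hy, ← rs_comp,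
        ← rs_comp, Category.assoc]
    choose t ht using @key
    refine ⟨⟨fun f y hy => t f y hy, ?_⟩, ?_⟩
    · intro V W f g y z hy hg hz
      refine P.sep _ (J.pullback_stable (g ≫ f) hR) _ _ fun {W'} k hk => ?_
      have hk' : R ((k ≫ g) ≫ f) := by rw [Category.assoc]; exact hk
      rw [ht (g ≫ f) z hz k hk]
      subst hg
      have h1 := ht f y hy (k ≫ g) hk'
      have key' : ∀ {w : X'.obj (op W')} (e₁ : rs X' (k ≫ g) y = w)
          (e₂ : rs X (𝟙 W') (rs X ((k ≫ g) ≫ f) x) = i.app (op W') w),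
          P.res (k ≫ g) e₁ (t f y hy) = (T ((k ≫ g) ≫ f) hk').val (𝟙 W') w e₂ := by
        intro w e₁ e₂
        subst e₁
        exact h1
      refine (P.res_res g k rfl rfl (rs_comp _ _ _ _) _).trans
        ((key' (rs_comp _ _ _ _) ?_).trans ?_)
      · rw [Category.assoc]; exact e (g ≫ f) k hz
      · exact hT' _ _ (𝟙 W') ((Category.id_comp _).trans (Category.assoc k g f)) _ _ _
    · intro V f hf
      refine LiftFamily.ext ?_
      funext W g y hy
      have h0 : rs X (g ≫ f) x = i.app (op W) y := by rw [rs_comp, hy]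
      have hg : R (𝟙 W ≫ g ≫ f) := by rw [Category.id_comp]; exact R.downward_closed hf g
      have h1 := ht (g ≫ f) y h0 (𝟙 W) hg
      have h2 : ∀ {w : X'.obj (op W)} (e₁ : rs X' (𝟙 W) y = w)
          (e₂ : rs X (𝟙 W) (rs X (𝟙 W ≫ g ≫ f) x) = i.app (op W) w),
          P.res (𝟙 W) e₁ (t (g ≫ f) y h0) = (T (𝟙 W ≫ g ≫ f) hg).val (𝟙 W) w e₂ := by
        intro w e₁ e₂
        subst e₁
        exact h1
      refine (P.res_id (rs_id X' y) _).symm.trans ((h2 (rs_id X' y) ?_).trans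
        (hT' f hf g (Category.id_comp _).symm hg _ _).symm)
      rw [rs_id, Category.id_comp, h0]


namespace IsDense
variable {i : X' ⟶ X} (hi : IsDense J i) {P : Torsor M X'} {U V : C} {x : X.obj (op U)}
include hi

theorem exists_pushJ (t : LiftFamily i P.toRelSheaf x) : ∃ a : Sec M.Pi U, ∀ {V : C} (f : V ⟶ U)
    (y : X'.obj (op V)) (hy : rs X f x = i.app (op V) y), gres M.Pi f a = P.j (t.val f y hy) := by
  have key : ∀ {V : C} (f : V ⟶ U) {y z : X'.obj (op V)} (hy : rs X f x = i.app (op V) y)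
      (hz : rs X f x = i.app (op V) z), P.j (t.val f y hy) = P.j (t.val f z hz) := by
    intro V f y z hy hz
    obtain rfl := hi.inj (hy.symm.trans hz)
    rfl
  obtain ⟨a, ha⟩ := gglue M.Pi (hi.cover x) (fun f hf => P.j (t.val f hf.choose hf.choose_spec))
    (fun {V W} f hf g => by
      rw [← P.j_res g rfl, t.val_res f g hf.choose_spec rfl (by
        rw [rs_comp, ← nat_app i g rfl, ← hf.choose_spec])]
      exact key _ _ _)
  exact ⟨a, fun f y hy => (ha f ⟨y, hy⟩).trans (key _ _ _)⟩

/-- The map `j` of the extension of a torsor. -/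
noncomputable def pushJ (t : LiftFamily i P.toRelSheaf x) : Sec M.Pi U := (hi.exists_pushJ t).choose

theorem gres_pushJ (t : LiftFamily i P.toRelSheaf x) (f : V ⟶ U) (y : X'.obj (op V))
    (hy : rs X f x = i.app (op V) y) : gres M.Pi f (hi.pushJ t) = P.j (t.val f y hy) :=
  (hi.exists_pushJ t).choose_spec f y hy

/-- The extension of a torsor along a dense monomorphism. -/
noncomputable def push (P : Torsor M X') : Torsor M X where
  toRelSheaf := pushRelSheaf i P.toRelSheaf
  act {U x} t γ :=
    { val := fun f y hy => P.act (t.val f y hy) (gres M.G f γ)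
      val_res := fun f g y z hy hg hz => by rw [P.act_res, t.val_res f g hy hg hz, gres_comp] }
  act_res k _ _ _ t γ := LiftFamily.ext (by
    funext V f y hy
    exact congrArg (P.act _) (gres_comp M.G k f γ))
  act_one t := LiftFamily.ext (by
    funext V f y hy
    change P.act _ _ = _
    rw [map_one, P.act_one])
  act_mul t γ δ := LiftFamily.ext (by
    funext V f y hy
    change P.act _ _ = P.act (P.act _ _) _
    rw [map_mul, P.act_mul])
  trans {U x} t t' := by
    have key : ∀ {V : C} (f : V ⟶ U) (hf : liftSieve i x f), ∃ γ : Sec M.G V,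
        ∀ (y : X'.obj (op V)) (hy : rs X f x = i.app (op V) y),
          P.act (t.val f y hy) γ = t'.val f y hy := by
      rintro V f ⟨y, hy⟩
      obtain ⟨γ, hγ, -⟩ := P.trans (t.val f y hy) (t'.val f y hy)
      refine ⟨γ, fun z hz => ?_⟩
      obtain rfl := hi.inj (hy.symm.trans hz)
      exact hγ
    choose γ hγ using @key
    obtain ⟨g, hg⟩ := gglue M.G (hi.cover x) (fun f hf => γ f hf) (fun {V W} f hf k => by
      have hz : rs X (k ≫ f) x = i.app (op W) (rs X' k hf.choose) := by
        rw [rs_comp, ← nat_app i k rfl, ← hf.choose_spec]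
      refine act_inj (P := P) (p := t.val (k ≫ f) _ hz) ?_
      rw [hγ, ← t.val_res f k hf.choose_spec rfl, ← P.act_res, hγ]
      exact t'.val_res f k _ _ _)
    refine ⟨g, LiftFamily.ext ?_, fun g' hg' => ?_⟩
    · funext V f y hy
      exact (congrArg (P.act _) (hg f ⟨y, hy⟩)).trans (hγ f ⟨y, hy⟩ y hy)
    · refine gsep M.G (hi.cover x) _ _ fun {V} f hf => ?_
      obtain ⟨y, hy⟩ := id hf
      refine act_inj (P := P) (p := t.val f y hy) ?_
      rw [hg f hf, hγ f hf]
      exact congrArg (fun s : LiftFamily i P.toRelSheaf x => s.val f y hy) hg'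
  inhab {U} x := by
    let T : ∀ {V : C} {f : V ⟶ U}, liftSieve i x f → Sieve V := fun hf => (P.inhab hf.choose).choose
    refine ⟨_, J.transitive (hi.cover x) (Sieve.bind (liftSieve i x).arrows fun V f hf => T hf)
      fun {V} f hf => ?_, ?_⟩
    · exact J.superset_covering (Sieve.le_pullback_bind _ _ f hf) (P.inhab hf.choose).choose_spec.1
    · rintro V _ ⟨W, g, f, hf, hg, rfl⟩
      obtain ⟨p⟩ := (P.inhab hf.choose).choose_spec.2 g hg
      have hz : rs X (g ≫ f) x = i.app (op V) (rs X' g hf.choose) := by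
        rw [rs_comp, ← nat_app i g rfl, ← hf.choose_spec]
      exact ⟨{
        val := fun k y hy => P.res k (hi.rs_eq (f := 𝟙 V) (Category.comp_id k)
          ((rs_id X _).trans hz) hy) p
        val_res := fun k l y z hy hl hz => P.res_res k l _ _ _ p }⟩
  j t := hi.pushJ t
  j_res k x z h t := by
    refine gsep M.Pi (hi.cover z) _ _ fun {V} f ⟨y, hy⟩ => ?_
    refine (hi.gres_pushJ (P := P) (t.restrict k h) f y hy).trans ?_
    rw [← gres_comp, hi.gres_pushJ (P := P) t (f ≫ k) y (by rw [rs_comp, h, hy])]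
    rfl
  j_act {U x} t γ := by
    refine gsep M.Pi (hi.cover x) _ _ fun {V} f ⟨y, hy⟩ => ?_
    refine (hi.gres_pushJ (P := P) _ f y hy).trans ?_
    rw [map_mul, hi.gres_pushJ (P := P) t f y hy, ← M.d_res]
    exact P.j_act _ _

/-- The restriction of the extension of a torsor is the given torsor. -/
noncomputable def counit (P : Torsor M X') : (pull i).obj (hi.push P) ⟶ P :=
  show Torsor.Hom (pullObj i (hi.push P)) P from
  { app := fun {U y} t => LiftFamily.val t (𝟙 U) y (rs_id X _)
    app_res := fun {U V} f x y h t =>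
      (LiftFamily.val_congr (P := P.toRelSheaf) t ((Category.id_comp f).trans
        (Category.comp_id f).symm) _).trans (LiftFamily.val_res t (𝟙 U) f _ h _).symm
    app_act := fun t g => congrArg (P.act _) (gres_id M.G g)
    j_app := fun {U y} t => (hi.gres_pushJ (P := P) t (𝟙 U) y (rs_id X _)).symm.trans
      (gres_id M.Pi _) }

end IsDense

end
end Biext4

namespace Biext4
section
variable {C : Type u} [SmallCategory C] {J : GrothendieckTopology C}
open Biext4.Torsor Functor.LaxMonoidal Functor.OplaxMonoidal

section
variable {X' X : Cᵒᵖ ⥤ Type u} {M : BraidedCrossedModule J}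

/-- A relation on `X` lifts to a relation on `X'` along a monomorphism `X' ⟶ X`. -/
structure LiftsRel (i : X' ⟶ X)
    (r : ∀ {U : C}, X.obj (op U) → X.obj (op U) → X.obj (op U) → Prop)
    (r' : ∀ {U : C}, X'.obj (op U) → X'.obj (op U) → X'.obj (op U) → Prop) : Prop where
  exists_lift : ∀ {U V : C} {x y z : X.obj (op U)}, r x y z → ∀ (f : V ⟶ U) {z' : X'.obj (op V)},
    rs X f z = i.app (op V) z' →
    ∃ x' y', rs X f x = i.app (op V) x' ∧ rs X f y = i.app (op V) y'
  reflect : ∀ {U V : C} {x y z : X.obj (op U)}, r x y z → ∀ (f : V ⟶ U)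
    {x' y' z' : X'.obj (op V)}, rs X f x = i.app (op V) x' → rs X f y = i.app (op V) y' →
    rs X f z = i.app (op V) z' → r' x' y' z'

namespace PartialLaw
variable {i : X' ⟶ X} (hi : IsDense J i) {P : Torsor M X'}
    {r : ∀ {U : C}, X.obj (op U) → X.obj (op U) → X.obj (op U) → Prop}
    {r' : ∀ {U : C}, X'.obj (op U) → X'.obj (op U) → X'.obj (op U) → Prop}
    (L : PartialLaw P r') (hr : LiftsRel i r r')

include hi hr in
theorem exists_pushMul {U : C} {x y z : X.obj (op U)} (m : r x y z)
    (t : LiftFamily i P.toRelSheaf x) (t' : LiftFamily i P.toRelSheaf y) :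
    ∃ s : LiftFamily i P.toRelSheaf z, ∀ {V : C} (f : V ⟶ U) {x' y' z' : X'.obj (op V)}
      (hx : rs X f x = i.app (op V) x') (hy : rs X f y = i.app (op V) y')
      (hz : rs X f z = i.app (op V) z') (m' : r' x' y' z'),
      s.val f z' hz = L.mul m' (t.val f x' hx) (t'.val f y' hy) := by
  have key : ∀ {V : C} (f : V ⟶ U) (z' : X'.obj (op V)) (hz : rs X f z = i.app (op V) z'),
      ∃ p : P.carrier z', ∀ {x' y' : X'.obj (op V)} (hx : rs X f x = i.app (op V) x')
        (hy : rs X f y = i.app (op V) y') (m' : r' x' y' z'),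
        p = L.mul m' (t.val f x' hx) (t'.val f y' hy) := by
    intro V f z' hz
    obtain ⟨x', y', hx, hy⟩ := hr.exists_lift m f hz
    refine ⟨L.mul (hr.reflect m f hx hy hz) (t.val f x' hx) (t'.val f y' hy),
      fun {x₁ y₁} hx₁ hy₁ m' => ?_⟩
    obtain rfl := hi.inj (hx.symm.trans hx₁)
    obtain rfl := hi.inj (hy.symm.trans hy₁)
    rfl
  choose s hs using @key
  refine ⟨⟨fun f z' hz => s f z' hz, fun {V W} f g z' w hz hg hw => ?_⟩,
    fun f x' y' z' hx hy hz m' => hs f z' hz hx hy m'⟩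
  obtain ⟨x', y', hx, hy⟩ := hr.exists_lift m f hz
  have hx₁ : rs X (g ≫ f) x = i.app (op W) (rs X' g x') := by rw [rs_comp, hx, nat_app i g rfl]
  have hy₁ : rs X (g ≫ f) y = i.app (op W) (rs X' g y') := by rw [rs_comp, hy, nat_app i g rfl]
  rw [hs f z' hz hx hy (hr.reflect m f hx hy hz),
    hs (g ≫ f) w hw hx₁ hy₁ (hr.reflect m (g ≫ f) hx₁ hy₁ hw),
    L.res g rfl rfl hg _ (hr.reflect m (g ≫ f) hx₁ hy₁ hw), t.val_res f g hx rfl hx₁,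
    t'.val_res f g hy rfl hy₁]

/-- The extension of a partial law along a dense monomorphism, on families. -/
noncomputable def pushMul {U : C} {x y z : X.obj (op U)} (m : r x y z)
    (t : LiftFamily i P.toRelSheaf x) (t' : LiftFamily i P.toRelSheaf y) :
    LiftFamily i P.toRelSheaf z := (exists_pushMul hi L hr m t t').choose

theorem pushMul_val {U V : C} {x y z : X.obj (op U)} (m : r x y z)
    (t : LiftFamily i P.toRelSheaf x) (t' : LiftFamily i P.toRelSheaf y) (f : V ⟶ U)
    {x' y' z' : X'.obj (op V)} (hx : rs X f x = i.app (op V) x') (hy : rs X f y = i.app (op V) y')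
    (hz : rs X f z = i.app (op V) z') (m' : r' x' y' z') :
    (pushMul hi L hr m t t').val f z' hz = L.mul m' (t.val f x' hx) (t'.val f y' hy) :=
  (exists_pushMul hi L hr m t t').choose_spec f hx hy hz _

/-- The extension of a partial law along a dense monomorphism. -/
noncomputable def push : PartialLaw (hi.push P) r where
  mul m t t' := pushMul hi L hr m t t'
  res {U V} k x y z x₁ y₁ z₁ hx hy hz m m₁ t t' := by
    refine LiftFamily.ext ?_
    funext W f z' hz'
    obtain ⟨x', y', hx', hy'⟩ := hr.exists_lift m₁ f hz'
    exact (pushMul_val hi L hr m t t' (f ≫ k) (by rw [rs_comp, hx, hx'])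
      (by rw [rs_comp, hy, hy']) _ _).trans
      (pushMul_val hi L hr m₁ (LiftFamily.restrict t k hx) (LiftFamily.restrict t' k hy) f hx' hy'
        hz' (hr.reflect m₁ f hx' hy' hz')).symm
  bal {U x y z} m t t' g := by
    refine LiftFamily.ext ?_
    funext W f z' hz'
    obtain ⟨x', y', hx', hy'⟩ := hr.exists_lift m f hz'
    have m' := hr.reflect m f hx' hy' hz'
    refine (pushMul_val hi L hr m _ _ f hx' hy' hz' m').trans ((L.bal m' _ _ _).trans
      (Eq.trans ?_ (pushMul_val hi L hr m _ _ f hx' hy' hz' m').symm))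
    refine congrArg (L.mul m' _) ?_
    refine congrArg (P.act _) ?_
    rw [M.act_res]
    exact congrArg (M.act _) (hi.gres_pushJ (P := P) t' f y' hy').symm
  act {U x y z} m t t' g := by
    refine LiftFamily.ext ?_
    funext W f z' hz'
    obtain ⟨x', y', hx', hy'⟩ := hr.exists_lift m f hz'
    have m' := hr.reflect m f hx' hy' hz'
    refine (pushMul_val hi L hr m _ _ f hx' hy' hz' m').trans ((L.act m' _ _ _).trans
      (congrArg (P.act · _) ?_))
    exact (pushMul_val hi L hr m t t' f hx' hy' hz' m').symm
  j {U x y z} m t t' := by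
    refine gsep M.Pi (hi.cover z) _ _ fun {V} f ⟨z', hz'⟩ => ?_
    obtain ⟨x', y', hx', hy'⟩ := hr.exists_lift m f hz'
    have m' := hr.reflect m f hx' hy' hz'
    refine (hi.gres_pushJ (P := P) _ f z' hz').trans ?_
    refine (congrArg P.j (pushMul_val hi L hr m t t' f hx' hy' hz' m')).trans ?_
    rw [L.j, map_mul]
    exact (congrArg₂ (· * ·) (hi.gres_pushJ (P := P) t f x' hx')
      (hi.gres_pushJ (P := P) t' f y' hy')).symm

end PartialLaw
end

variable {S' S : Cᵒᵖ ⥤ Type u} {H K : Sheaf J GrpCat.{u}} {M : BraidedCrossedModule J}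
  {a : S' ⟶ S}

theorem exists_baseMap_lift {U V : C} {x z : (base S H K).obj (op U)} (e : x.1 = z.1) (f : V ⟶ U)
    {z' : (base S' H K).obj (op V)} (hz : rs _ f z = (baseMap a H K).app (op V) z') :
    ∃ x', rs _ f x = (baseMap a H K).app (op V) x' :=
  ⟨(z'.1, (rs (base S H K) f x).2),
    Prod.ext ((congrArg (S.map f.op) e).trans (congrArg Prod.fst hz)) rfl⟩

theorem IsDense.baseMap (ha : IsDense J a) : IsDense J (Biext4.baseMap a H K) where
  inj {U y y'} h := by
    have h₁ : a.app (op U) y.1 = a.app (op U) y'.1 := congrArg Prod.fst h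
    have h₂ : y.2 = y'.2 := congrArg (fun z : (base S H K).obj (op U) => z.2) h
    exact Prod.ext (ha.inj h₁) h₂
  cover {U} x := J.superset_covering (S := liftSieve a x.1) (by
    rintro V f ⟨s, hs⟩
    exact ⟨(s, (rs (base S H K) f x).2), Prod.ext hs rfl⟩) (ha.cover x.1)

theorem IsDense.liftsRel₁ (ha : IsDense J a) :
    LiftsRel (Biext4.baseMap a H K) BaseMul₁ BaseMul₁ where
  exists_lift m f z' hz := by
    obtain ⟨x', hx⟩ := exists_baseMap_lift m.s'.symm f hz
    obtain ⟨y', hy⟩ := exists_baseMap_lift (m.s.trans m.s'.symm) f hz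
    exact ⟨x', y', hx, hy⟩
  reflect m f x' y' z' hx hy hz := by
    have m' := m.rs f
    rw [hx, hy, hz] at m'
    exact ⟨ha.inj m'.s, ha.inj m'.s', m'.h, m'.k, m'.k'⟩

theorem IsDense.liftsRel₂ (ha : IsDense J a) :
    LiftsRel (Biext4.baseMap a H K) BaseMul₂ BaseMul₂ where
  exists_lift m f z' hz := by
    obtain ⟨x', hx⟩ := exists_baseMap_lift m.s'.symm f hz
    obtain ⟨y', hy⟩ := exists_baseMap_lift (m.s.trans m.s'.symm) f hz
    exact ⟨x', y', hx, hy⟩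
  reflect m f x' y' z' hx hy hz := by
    have m' := m.rs f
    rw [hx, hy, hz] at m'
    exact ⟨ha.inj m'.s, ha.inj m'.s', m'.h, m'.h', m'.k⟩

theorem BaseMul₁.baseMap {U : C} {x y z : (base S' H K).obj (op U)} (m : BaseMul₁ x y z)
    (a : S' ⟶ S) : BaseMul₁ ((Biext4.baseMap a H K).app (op U) x)
      ((Biext4.baseMap a H K).app (op U) y) ((Biext4.baseMap a H K).app (op U) z) :=
  ⟨congrArg (a.app (op U)) m.s, congrArg (a.app (op U)) m.s', m.h, m.k, m.k'⟩

theorem BaseMul₂.baseMap {U : C} {x y z : (base S' H K).obj (op U)} (m : BaseMul₂ x y z)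
    (a : S' ⟶ S) : BaseMul₂ ((Biext4.baseMap a H K).app (op U) x)
      ((Biext4.baseMap a H K).app (op U) y) ((Biext4.baseMap a H K).app (op U) z) :=
  ⟨congrArg (a.app (op U)) m.s, congrArg (a.app (op U)) m.s', m.h, m.h', m.k⟩

namespace Biext

theorem baseChange_secLaw₁ (a : S' ⟶ S) (B : Biext M H K S) {U : C}
    {x y z : (base S' H K).obj (op U)} (m : BaseMul₁ x y z)
    (p : B.data.tor.carrier ((baseMap a H K).app (op U) x))
    (q : B.data.tor.carrier ((baseMap a H K).app (op U) y)) :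
    ((baseChange a).obj B).secLaw₁.mul m p q = B.secLaw₁.mul (m.baseMap a) p q := by
  let A : ∀ _ _ _ : (base S' H K).obj (op U), Prop := fun x y z => ∀ (m : BaseMul₁ x y z)
    (p : B.data.tor.carrier ((baseMap a H K).app (op U) x))
    (q : B.data.tor.carrier ((baseMap a H K).app (op U) y)),
    ((baseChange a).obj B).secLaw₁.mul m p q = B.secLaw₁.mul (m.baseMap a) p q
  have h : A ((Pt.ofBase x).map.app _ (𝟙 U)) ((Pt.ofBase y).map.app _ (𝟙 U))
      ((Pt.ofBase z).map.app _ (𝟙 U)) := fun _ p q =>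
    (fibMul_mul₁ (B := (baseChange a).obj B) m.pt (𝟙 U) p q).symm.trans
      (fibMul_mul₁ (B := B) (m.pt.push a) (𝟙 U) p q)
  simp only [Pt.ofBase_map_app_id] at h
  exact h m p q

theorem baseChange_secLaw₂ (a : S' ⟶ S) (B : Biext M H K S) {U : C}
    {x y z : (base S' H K).obj (op U)} (m : BaseMul₂ x y z)
    (p : B.data.tor.carrier ((baseMap a H K).app (op U) x))
    (q : B.data.tor.carrier ((baseMap a H K).app (op U) y)) :
    ((baseChange a).obj B).secLaw₂.mul m p q = B.secLaw₂.mul (m.baseMap a) p q := by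
  let A : ∀ _ _ _ : (base S' H K).obj (op U), Prop := fun x y z => ∀ (m : BaseMul₂ x y z)
    (p : B.data.tor.carrier ((baseMap a H K).app (op U) x))
    (q : B.data.tor.carrier ((baseMap a H K).app (op U) y)),
    ((baseChange a).obj B).secLaw₂.mul m p q = B.secLaw₂.mul (m.baseMap a) p q
  have h : A ((Pt.ofBase x).map.app _ (𝟙 U)) ((Pt.ofBase y).map.app _ (𝟙 U))
      ((Pt.ofBase z).map.app _ (𝟙 U)) := fun _ p q =>
    (fibMul_mul₂ (B := (baseChange a).obj B) m.pt (𝟙 U) p q).symm.trans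
      (fibMul_mul₂ (B := B) (m.pt.push a) (𝟙 U) p q)
  simp only [Pt.ofBase_map_app_id] at h
  exact h m p q

end Biext

namespace IsDense
variable (ha : IsDense J a)
include ha

theorem baseChange_faithful : (Biext.baseChange (M := M) (H := H) (K := K) a).Faithful where
  map_injective h := Biext.Hom.ext ((ha.baseMap).pull_faithful.map_injective
    (congrArg Biext.Hom.hom h))

theorem baseChange_full : (Biext.baseChange (M := M) (H := H) (K := K) a).Full where
  map_surjective {B B'} φ := by
    obtain ⟨ψ, hψ⟩ := (ha.baseMap (H := H) (K := K)).pull_full.map_surjective (Biext.Hom.hom φ)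
    have hψ' : ∀ {U : C} {x : (base S' H K).obj (op U)}
        (p : B.data.tor.carrier ((Biext4.baseMap a H K).app (op U) x)),
        Hom.app ψ p = Hom.app (Biext.Hom.hom φ) (x := x) p := fun {U x} p =>
      congrArg (fun χ : (pull (Biext4.baseMap a H K)).obj B.data.tor ⟶
        (pull (Biext4.baseMap a H K)).obj B'.data.tor => Hom.app χ (x := x) p) hψ
    refine ⟨(⟨ψ, Biext.isHom_of_sec ?_ ?_⟩ : Biext.Hom B B'), Biext.Hom.ext hψ⟩
    · intro U x y z m p q
      refine (ha.baseMap (H := H) (K := K)).relSheaf_sep B'.data.tor.toRelSheaf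
        fun {V} f z' hz => ?_
      obtain ⟨x', y', hx, hy⟩ := ha.liftsRel₁.exists_lift m f hz
      have m' := ha.liftsRel₁.reflect m f hx hy hz
      rw [← Hom.app_res ψ f hz, B.secLaw₁.res f hx hy hz m (m'.baseMap a),
        B'.secLaw₁.res f hx hy hz m (m'.baseMap a), ← Hom.app_res ψ f hx, ← Hom.app_res ψ f hy,
        hψ', hψ', hψ', ← Biext.baseChange_secLaw₁ a B m']
      exact (Biext.app_secLaw₁ φ.isHom m' _ _).trans (Biext.baseChange_secLaw₁ a B' m' _ _)
    · intro U x y z m p q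
      refine (ha.baseMap (H := H) (K := K)).relSheaf_sep B'.data.tor.toRelSheaf
        fun {V} f z' hz => ?_
      obtain ⟨x', y', hx, hy⟩ := ha.liftsRel₂.exists_lift m f hz
      have m' := ha.liftsRel₂.reflect m f hx hy hz
      rw [← Hom.app_res ψ f hz, B.secLaw₂.res f hx hy hz m (m'.baseMap a),
        B'.secLaw₂.res f hx hy hz m (m'.baseMap a), ← Hom.app_res ψ f hx, ← Hom.app_res ψ f hy,
        hψ', hψ', hψ', ← Biext.baseChange_secLaw₂ a B m']
      exact (Biext.app_secLaw₂ φ.isHom m' _ _).trans (Biext.baseChange_secLaw₂ a B' _ _ _)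

/-- The partial laws of the extension of a biextension along a dense monomorphism. -/
noncomputable def pushLaws (B : Biext M H K S') : SecLaws (ha.baseMap.push B.data.tor) where
  law₁ := PartialLaw.push ha.baseMap B.secLaw₁ ha.liftsRel₁
  law₂ := PartialLaw.push ha.baseMap B.secLaw₂ ha.liftsRel₂
  assoc₁ {U x y z xy yz xyz} m n m' n' p q r := by
    refine LiftFamily.ext ?_
    funext V f w hw
    obtain ⟨xy', z', hxy, hz⟩ := ha.liftsRel₁.exists_lift n f hw
    obtain ⟨x', y', hx, hy⟩ := ha.liftsRel₁.exists_lift m f hxy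
    obtain ⟨yz', hyz⟩ := exists_baseMap_lift m'.s' f hy
    have l := ha.liftsRel₁.reflect m f hx hy hxy
    have l₁ := ha.liftsRel₁.reflect n f hxy hz hw
    have l₂ := ha.liftsRel₁.reflect m' f hy hz hyz
    have l₃ := ha.liftsRel₁.reflect n' f hx hyz hw
    refine (PartialLaw.pushMul_val ha.baseMap _ ha.liftsRel₁ n _ _ f hxy hz hw l₁).trans
      (Eq.trans ?_ (PartialLaw.pushMul_val ha.baseMap _ ha.liftsRel₁ n' _ _ f hx hyz hw l₃).symm)
    refine (congrArg (B.secLaw₁.mul l₁ · _)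
      (PartialLaw.pushMul_val ha.baseMap _ ha.liftsRel₁ m _ _ f hx hy hxy l)).trans
      (Eq.trans ?_ (congrArg (B.secLaw₁.mul l₃ _)
        (PartialLaw.pushMul_val ha.baseMap _ ha.liftsRel₁ m' _ _ f hy hz hyz l₂)).symm)
    exact Biext.sec_assoc₁ _ _ _ _ _ _ _
  assoc₂ {U x y z xy yz xyz} m n m' n' p q r := by
    refine LiftFamily.ext ?_
    funext V f w hw
    obtain ⟨xy', z', hxy, hz⟩ := ha.liftsRel₂.exists_lift n f hw
    obtain ⟨x', y', hx, hy⟩ := ha.liftsRel₂.exists_lift m f hxy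
    obtain ⟨yz', hyz⟩ := exists_baseMap_lift m'.s' f hy
    have l := ha.liftsRel₂.reflect m f hx hy hxy
    have l₁ := ha.liftsRel₂.reflect n f hxy hz hw
    have l₂ := ha.liftsRel₂.reflect m' f hy hz hyz
    have l₃ := ha.liftsRel₂.reflect n' f hx hyz hw
    refine (PartialLaw.pushMul_val ha.baseMap _ ha.liftsRel₂ n _ _ f hxy hz hw l₁).trans
      (Eq.trans ?_ (PartialLaw.pushMul_val ha.baseMap _ ha.liftsRel₂ n' _ _ f hx hyz hw l₃).symm)
    refine (congrArg (B.secLaw₂.mul l₁ · _)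
      (PartialLaw.pushMul_val ha.baseMap _ ha.liftsRel₂ m _ _ f hx hy hxy l)).trans
      (Eq.trans ?_ (congrArg (B.secLaw₂.mul l₃ _)
        (PartialLaw.pushMul_val ha.baseMap _ ha.liftsRel₂ m' _ _ f hy hz hyz l₂)).symm)
    exact Biext.sec_assoc₂ _ _ _ _ _ _ _
  interchange {U x y z w xy zw xz yw t} m n p m' n' p' b c d e := by
    refine LiftFamily.ext ?_
    funext V f v hv
    obtain ⟨xy', zw', hxy, hzw⟩ := ha.liftsRel₂.exists_lift p f hv
    obtain ⟨x', y', hx, hy⟩ := ha.liftsRel₁.exists_lift m f hxy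
    obtain ⟨z', w', hz, hw⟩ := ha.liftsRel₁.exists_lift n f hzw
    obtain ⟨xz', yw', hxz, hyw⟩ := ha.liftsRel₁.exists_lift p' f hv
    have l₁ := ha.liftsRel₁.reflect m f hx hy hxy
    have l₂ := ha.liftsRel₁.reflect n f hz hw hzw
    have l₃ := ha.liftsRel₂.reflect p f hxy hzw hv
    have l₄ := ha.liftsRel₂.reflect m' f hx hz hxz
    have l₅ := ha.liftsRel₂.reflect n' f hy hw hyw
    have l₆ := ha.liftsRel₁.reflect p' f hxz hyw hv
    refine (PartialLaw.pushMul_val ha.baseMap _ ha.liftsRel₂ p _ _ f hxy hzw hv l₃).trans ?_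
    refine (congrArg₂ (B.secLaw₂.mul l₃)
      (PartialLaw.pushMul_val ha.baseMap _ ha.liftsRel₁ m _ _ f hx hy hxy l₁)
      (PartialLaw.pushMul_val ha.baseMap _ ha.liftsRel₁ n _ _ f hz hw hzw l₂)).trans ?_
    refine (Biext.sec_interchange l₁ l₂ l₃ l₄ l₅ l₆ _ _ _ _).trans ?_
    refine congrArg₂ B.data.tor.act (Eq.symm ?_) ?_
    · refine (PartialLaw.pushMul_val ha.baseMap _ ha.liftsRel₁ p' _ _ f hxz hyw hv l₆).trans ?_
      exact congrArg₂ (B.secLaw₁.mul l₆)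
        (PartialLaw.pushMul_val ha.baseMap _ ha.liftsRel₂ m' _ _ f hx hz hxz l₄)
        (PartialLaw.pushMul_val ha.baseMap _ ha.liftsRel₂ n' _ _ f hy hw hyw l₅)
    · rw [M.act_res, map_inv, M.br_res]
      refine congrArg₂ M.act (congrArg Inv.inv (congrArg₂ M.br ?_ ?_)) ?_
      · exact (ha.baseMap.gres_pushJ (P := B.data.tor) c f y' hy).symm
      · exact (ha.baseMap.gres_pushJ (P := B.data.tor) d f z' hz).symm
      · exact (ha.baseMap.gres_pushJ (P := B.data.tor) e f w' hw).symm

theorem baseChange_essSurj : (Biext.baseChange (M := M) (H := H) (K := K) a).EssSurj where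
  mem_essImage B := by
    refine ⟨(ha.pushLaws B).toBiext, ⟨Biext.isoOf (show Biext.Hom
      ((Biext.baseChange a).obj (ha.pushLaws B).toBiext) B from
        ⟨ha.baseMap.counit B.data.tor, Biext.isHom_of_sec ?_ ?_⟩)⟩⟩
    · intro U x y z m p q
      refine (congrArg (Hom.app (ha.baseMap.counit B.data.tor) (x := z))
        ((Biext.baseChange_secLaw₁ a (ha.pushLaws B).toBiext m p q).trans
          ((ha.pushLaws B).toBiext_secLaw₁ (m.baseMap a) p q))).trans ?_
      exact PartialLaw.pushMul_val ha.baseMap _ ha.liftsRel₁ (m.baseMap a) _ _ (𝟙 U) _ _ _ m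
    · intro U x y z m p q
      refine (congrArg (Hom.app (ha.baseMap.counit B.data.tor) (x := z))
        ((Biext.baseChange_secLaw₂ a (ha.pushLaws B).toBiext m p q).trans
          ((ha.pushLaws B).toBiext_secLaw₂ (m.baseMap a) p q))).trans ?_
      exact PartialLaw.pushMul_val ha.baseMap _ ha.liftsRel₂ (m.baseMap a) _ _ (𝟙 U) _ _ _ m

end IsDense

end
end Biext4

namespace Biext4
section
universe v w v' t
variable {C : Type w} [Category.{v} C] (Ψ : Cᵒᵖ ⥤ Cat.{v', t})

theorem toPseudofunctor'_mapComp' {U V W : LocallyDiscrete Cᵒᵖ} (f : U ⟶ V) (g : V ⟶ W) (k : U ⟶ W)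
    (e : f ≫ g = k) (h : Ψ.toPseudofunctor'.map k =
      Ψ.toPseudofunctor'.map f ≫ Ψ.toPseudofunctor'.map g) :
    Ψ.toPseudofunctor'.mapComp' f g k e = eqToIso h := by
  subst e
  rw [Pseudofunctor.mapComp'_eq_mapComp]
  rfl

theorem toPseudofunctor'_mapComp'_hom_app {U V W : LocallyDiscrete Cᵒᵖ} (f : U ⟶ V) (g : V ⟶ W)
    (k : U ⟶ W) (e : f ≫ g = k) (X : Ψ.toPseudofunctor'.obj U)
    (h : (Ψ.toPseudofunctor'.map k).toFunctor.obj X =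
      (Ψ.toPseudofunctor'.map f ≫ Ψ.toPseudofunctor'.map g).toFunctor.obj X) :
    (Ψ.toPseudofunctor'.mapComp' f g k e).hom.toNatTrans.app X = eqToHom h := by
  have h' : Ψ.toPseudofunctor'.map k = Ψ.toPseudofunctor'.map f ≫ Ψ.toPseudofunctor'.map g := by
    subst e
    exact Ψ.map_comp _ _
  rw [toPseudofunctor'_mapComp' Ψ f g k e h']
  exact Cat.eqToHom_app _ _ h' X

theorem toPseudofunctor'_mapComp'_inv_app {U V W : LocallyDiscrete Cᵒᵖ} (f : U ⟶ V) (g : V ⟶ W)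
    (k : U ⟶ W) (e : f ≫ g = k) (X : Ψ.toPseudofunctor'.obj U)
    (h : (Ψ.toPseudofunctor'.map f ≫ Ψ.toPseudofunctor'.map g).toFunctor.obj X =
      (Ψ.toPseudofunctor'.map k).toFunctor.obj X) :
    (Ψ.toPseudofunctor'.mapComp' f g k e).inv.toNatTrans.app X = eqToHom h := by
  have h' : Ψ.toPseudofunctor'.map k = Ψ.toPseudofunctor'.map f ≫ Ψ.toPseudofunctor'.map g := by
    subst e
    exact Ψ.map_comp _ _
  rw [toPseudofunctor'_mapComp' Ψ f g k e h']
  exact Cat.eqToHom_app _ _ h'.symm X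

open Pseudofunctor.LocallyDiscreteOpToCat

theorem pullHom_comp_comp {F : Pseudofunctor (LocallyDiscrete Cᵒᵖ) Cat.{v', t}} {X₁ X₂ Y Y' : C}
    {A₁ B₁ : F.obj (.mk (op X₁))} {A₂ B₂ : F.obj (.mk (op X₂))} {f₁ : Y ⟶ X₁} {f₂ : Y ⟶ X₂}
    (e₁ : A₁ ⟶ B₁) (e₂ : B₂ ⟶ A₂)
    (φ : (F.map f₁.op.toLoc).toFunctor.obj B₁ ⟶ (F.map f₂.op.toLoc).toFunctor.obj B₂)
    (g : Y' ⟶ Y) (gf₁ : Y' ⟶ X₁) (gf₂ : Y' ⟶ X₂) (h₁ : g ≫ f₁ = gf₁) (h₂ : g ≫ f₂ = gf₂) :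
    pullHom ((F.map f₁.op.toLoc).toFunctor.map e₁ ≫ φ ≫ (F.map f₂.op.toLoc).toFunctor.map e₂) g
      gf₁ gf₂ h₁ h₂ = (F.map gf₁.op.toLoc).toFunctor.map e₁ ≫ pullHom φ g gf₁ gf₂ h₁ h₂ ≫
        (F.map gf₂.op.toLoc).toFunctor.map e₂ := by
  unfold pullHom
  rw [Functor.map_comp, Functor.map_comp]
  simp only [Category.assoc]
  rw [Pseudofunctor.mapComp'_inv_naturality, Pseudofunctor.mapComp'_hom_naturality_assoc]

theorem pullHom_toPseudofunctor' {X₁ X₂ Y Y' : C} {A₁ : Ψ.obj (op X₁)} {A₂ : Ψ.obj (op X₂)}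
    {f₁ : Y ⟶ X₁} {f₂ : Y ⟶ X₂}
    (φ : (Ψ.map f₁.op).toFunctor.obj A₁ ⟶ (Ψ.map f₂.op).toFunctor.obj A₂)
    (g : Y' ⟶ Y) (gf₁ : Y' ⟶ X₁) (gf₂ : Y' ⟶ X₂) (h₁ : g ≫ f₁ = gf₁) (h₂ : g ≫ f₂ = gf₂)
    (e₁ : (Ψ.map gf₁.op).toFunctor.obj A₁ =
      (Ψ.map g.op).toFunctor.obj ((Ψ.map f₁.op).toFunctor.obj A₁))
    (e₂ : (Ψ.map g.op).toFunctor.obj ((Ψ.map f₂.op).toFunctor.obj A₂) =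
      (Ψ.map gf₂.op).toFunctor.obj A₂) :
    pullHom (F := Ψ.toPseudofunctor') (M₁ := A₁) (M₂ := A₂) φ g gf₁ gf₂ h₁ h₂ =
      eqToHom e₁ ≫ (Ψ.map g.op).toFunctor.map φ ≫ eqToHom e₂ := by
  unfold pullHom
  rw [toPseudofunctor'_mapComp'_hom_app Ψ f₁.op.toLoc g.op.toLoc gf₁.op.toLoc _ A₁ e₁,
    toPseudofunctor'_mapComp'_inv_app Ψ f₂.op.toLoc g.op.toLoc gf₂.op.toLoc _ A₂ e₂]
  rfl

theorem ofObj_toPseudofunctor'_hom {ι : Type*} {U : C} {X : ι → C} {f : ∀ i, X i ⟶ U}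
    (A : Ψ.obj (op U)) {Y : C} (q : Y ⟶ U) {i j : ι} (a : Y ⟶ X i) (b : Y ⟶ X j)
    (ha : a ≫ f i = q) (hb : b ≫ f j = q)
    (e₁ : (Ψ.map a.op).toFunctor.obj ((Ψ.map (f i).op).toFunctor.obj A) =
      (Ψ.map q.op).toFunctor.obj A)
    (e₂ : (Ψ.map q.op).toFunctor.obj A =
      (Ψ.map b.op).toFunctor.obj ((Ψ.map (f j).op).toFunctor.obj A)) :
    (Pseudofunctor.DescentData.ofObj (F := Ψ.toPseudofunctor') (f := f) A).hom q a b ha hb =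
      eqToHom e₁ ≫ eqToHom e₂ := by
  unfold Pseudofunctor.DescentData.ofObj
  dsimp only
  rw [toPseudofunctor'_mapComp'_inv_app Ψ (f i).op.toLoc a.op.toLoc q.op.toLoc _ A e₁,
    toPseudofunctor'_mapComp'_hom_app Ψ (f j).op.toLoc b.op.toLoc q.op.toLoc _ A e₂]
  rfl

end

section
variable {C : Type u} [SmallCategory C] {J : GrothendieckTopology C}
open Biext4.Torsor Functor.LaxMonoidal Functor.OplaxMonoidal

variable {S' S : Cᵒᵖ ⥤ Type u} {H K : Sheaf J GrpCat.{u}} {M : BraidedCrossedModule J}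

theorem Biext.eqToHom_baseChange_app {a a' : S' ⟶ S} (ha : a = a') (B : Biext M H K S)
    (h : (Biext.baseChange a).obj B = (Biext.baseChange a').obj B) {U : C}
    {x : (base S' H K).obj (op U)} (p : B.data.tor.carrier ((baseMap a H K).app (op U) x))
    (e : rs _ (𝟙 U) ((baseMap a H K).app (op U) x) = (baseMap a' H K).app (op U) x) :
    Torsor.Hom.app (Biext.Hom.hom (eqToHom h)) (x := x) p = B.data.tor.res (𝟙 U) e p := by
  subst ha
  exact (B.data.tor.res_id e p).symm

open Pseudofunctor.LocallyDiscreteOpToCat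

theorem Biext.pullHom_app {X₁ X₂ Y Y' : C} {f₁ : Y ⟶ X₁} {f₂ : Y ⟶ X₂}
    {B₁ : Biext M H K (yoneda.obj X₁)} {B₂ : Biext M H K (yoneda.obj X₂)}
    (φ : (Biext.baseChange (yoneda.map f₁)).obj B₁ ⟶ (Biext.baseChange (yoneda.map f₂)).obj B₂)
    (g : Y' ⟶ Y) (gf₁ : Y' ⟶ X₁) (gf₂ : Y' ⟶ X₂) (h₁ : g ≫ f₁ = gf₁) (h₂ : g ≫ f₂ = gf₂) {V : C}
    (x : (base (yoneda.obj Y') H K).obj (op V))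
    (e₁ : rs _ (𝟙 V) ((baseMap (yoneda.map gf₁) H K).app (op V) x) =
      (baseMap (yoneda.map g ≫ yoneda.map f₁) H K).app (op V) x)
    (e₂ : rs _ (𝟙 V) ((baseMap (yoneda.map g ≫ yoneda.map f₂) H K).app (op V) x) =
      (baseMap (yoneda.map gf₂) H K).app (op V) x)
    (p : B₁.data.tor.carrier ((baseMap (yoneda.map gf₁) H K).app (op V) x)) :
    Torsor.Hom.app (Biext.Hom.hom (pullHom (F := (biextStack M H K).toPseudofunctor')
      (M₁ := B₁) (M₂ := B₂) φ g gf₁ gf₂ h₁ h₂)) (x := x) p =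
      B₂.data.tor.res (𝟙 V) e₂ (Torsor.Hom.app (Biext.Hom.hom φ)
        (x := (baseMap (yoneda.map g) H K).app (op V) x) (B₁.data.tor.res (𝟙 V) e₁ p)) := by
  have k₁ : yoneda.map gf₁ = yoneda.map g ≫ yoneda.map f₁ := by rw [← h₁, Functor.map_comp]
  have k₂ : yoneda.map g ≫ yoneda.map f₂ = yoneda.map gf₂ := by rw [← h₂, Functor.map_comp]
  have m₁ := congrArg (fun a => (Biext.baseChange a).obj B₁) k₁
  have m₂ := congrArg (fun a => (Biext.baseChange a).obj B₂) k₂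
  refine (congrArg (fun χ : (Biext.baseChange (yoneda.map gf₁)).obj B₁ ⟶
    (Biext.baseChange (yoneda.map gf₂)).obj B₂ => Torsor.Hom.app (Biext.Hom.hom χ) (x := x) p)
    (pullHom_toPseudofunctor' (biextStack M H K) (A₁ := B₁) (A₂ := B₂) φ g gf₁ gf₂ h₁ h₂ m₁
      m₂)).trans ?_
  refine (Biext.eqToHom_baseChange_app k₂ B₂ m₂ (x := x) _ e₂).trans ?_
  refine congrArg (fun p => B₂.data.tor.res (𝟙 V) e₂ (Torsor.Hom.app (Biext.Hom.hom φ)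
    (x := (baseMap (yoneda.map g) H K).app (op V) x) p)) ?_
  exact Biext.eqToHom_baseChange_app k₁ B₁ m₁ (x := x) p e₁

namespace Descent
variable {ι : Type*} {U : C} {X : ι → C} {f : ∀ i, X i ⟶ U}
  (D : (biextStack M H K).toPseudofunctor'.DescentData f)

/-- The biextensions of a descent datum. -/
def obj (i : ι) : Biext M H K (yoneda.obj (X i)) := D.obj i

/-- The isomorphisms of a descent datum. -/
def hom {Y : C} (q : Y ⟶ U) {i j : ι} (a : Y ⟶ X i) (b : Y ⟶ X j) (ha : a ≫ f i = q)
    (hb : b ≫ f j = q) : (Biext.baseChange (yoneda.map a)).obj (obj D i) ⟶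
      (Biext.baseChange (yoneda.map b)).obj (obj D j) := D.hom q a b ha hb

variable {i j k : ι} {V W : C}

/-- A section of `T × H × K`. -/
def pt {T : C} (s : V ⟶ T) (c : Sec H V × Sec K V) : (base (yoneda.obj T) H K).obj (op V) := (s, c)

/-- Restriction of sections of `H × K`. -/
def cres (g : W ⟶ V) (c : Sec H V × Sec K V) : Sec H W × Sec K W := (gres H g c.1, gres K g c.2)

theorem cres_id (c : Sec H V × Sec K V) : cres (𝟙 V) c = c :=
  Prod.ext (gres_id H c.1) (gres_id K c.2)

theorem rs_pt {T : C} {s : V ⟶ T} {c : Sec H V × Sec K V} {g : W ⟶ V} {s' : W ⟶ T}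
    {c' : Sec H W × Sec K W} (hs : g ≫ s = s') (hc : cres g c = c') :
    rs _ g (pt s c) = pt s' c' := by
  subst hs hc
  rfl

theorem rs_id_pt {T : C} {s s' : V ⟶ T} (c : Sec H V × Sec K V) (hs : s = s') :
    rs _ (𝟙 V) (pt s c) = pt s' c := rs_pt ((Category.id_comp s).trans hs) (cres_id c)

/-- The isomorphisms of a descent datum, on sections. -/
def homApp {Y : C} (q : Y ⟶ U) {a : Y ⟶ X i} {b : Y ⟶ X j} (ha : a ≫ f i = q) (hb : b ≫ f j = q)
    (w : V ⟶ Y) (c : Sec H V × Sec K V) (p : (obj D i).data.tor.carrier (pt (w ≫ a) c)) :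
    (obj D j).data.tor.carrier (pt (w ≫ b) c) :=
  Torsor.Hom.app (Biext.Hom.hom (hom D q a b ha hb)) (x := pt w c) p

section
variable {Y : C} (q : Y ⟶ U) {a : Y ⟶ X i} {b : Y ⟶ X j} (ha : a ≫ f i = q) (hb : b ≫ f j = q)

theorem homApp_act (w : V ⟶ Y) (c : Sec H V × Sec K V)
    (p : (obj D i).data.tor.carrier (pt (w ≫ a) c)) (g : Sec M.G V) :
    homApp D q ha hb w c ((obj D i).data.tor.act p g) =
      (obj D j).data.tor.act (homApp D q ha hb w c p) g :=
  Torsor.Hom.app_act (Biext.Hom.hom (hom D q a b ha hb)) (x := pt w c) p g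

theorem j_homApp (w : V ⟶ Y) (c : Sec H V × Sec K V)
    (p : (obj D i).data.tor.carrier (pt (w ≫ a) c)) :
    (obj D j).data.tor.j (homApp D q ha hb w c p) = (obj D i).data.tor.j p :=
  Torsor.Hom.j_app (Biext.Hom.hom (hom D q a b ha hb)) (x := pt w c) p

theorem homApp_res {g : W ⟶ V} {w : V ⟶ Y} {w' : W ⟶ Y} (hw : g ≫ w = w') {c : Sec H V × Sec K V}
    {c' : Sec H W × Sec K W} (hc : cres g c = c')
    (h₁ : rs _ g (pt (w ≫ a) c) = pt (w' ≫ a) c') (h₂ : rs _ g (pt (w ≫ b) c) = pt (w' ≫ b) c')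
    (p : (obj D i).data.tor.carrier (pt (w ≫ a) c)) :
    (obj D j).data.tor.res g h₂ (homApp D q ha hb w c p) =
      homApp D q ha hb w' c' ((obj D i).data.tor.res g h₁ p) :=
  (Torsor.Hom.app_res (Biext.Hom.hom (hom D q a b ha hb)) g (x := pt w c) (y := pt w' c')
    (rs_pt hw hc) p).symm

theorem homApp_pull (w : V ⟶ Y) (c : Sec H V × Sec K V) (ha' : (w ≫ a) ≫ f i = w ≫ q)
    (hb' : (w ≫ b) ≫ f j = w ≫ q)
    (e₁ : rs _ (𝟙 V) (pt (𝟙 V ≫ w ≫ a) c) = pt ((𝟙 V ≫ w) ≫ a) c)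
    (e₂ : rs _ (𝟙 V) (pt ((𝟙 V ≫ w) ≫ b) c) = pt (𝟙 V ≫ w ≫ b) c)
    (p : (obj D i).data.tor.carrier (pt (𝟙 V ≫ w ≫ a) c)) :
    homApp D (w ≫ q) ha' hb' (𝟙 V) c p = (obj D j).data.tor.res (𝟙 V) e₂
      (homApp D q ha hb (𝟙 V ≫ w) c ((obj D i).data.tor.res (𝟙 V) e₁ p)) := by
  have h : pullHom (F := (biextStack M H K).toPseudofunctor') (hom D q a b ha hb) w (w ≫ a)
      (w ≫ b) rfl rfl = hom D (w ≫ q) (w ≫ a) (w ≫ b) ha' hb' :=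
    D.pullHom_hom w q _ rfl a b ha hb _ _ rfl rfl
  unfold homApp
  rw [← h]
  exact Biext.pullHom_app (hom D q a b ha hb) w (w ≫ a) (w ≫ b) rfl rfl (pt (𝟙 V) c) e₁ e₂ p

theorem homApp_secLaw₁ (w : V ⟶ Y) {c₁ c₂ c₃ : Sec H V × Sec K V}
    (m : BaseMul₁ (pt w c₁) (pt w c₂) (pt w c₃))
    (m₁ : BaseMul₁ (pt (w ≫ a) c₁) (pt (w ≫ a) c₂) (pt (w ≫ a) c₃))
    (m₂ : BaseMul₁ (pt (w ≫ b) c₁) (pt (w ≫ b) c₂) (pt (w ≫ b) c₃))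
    (p : (obj D i).data.tor.carrier (pt (w ≫ a) c₁))
    (p' : (obj D i).data.tor.carrier (pt (w ≫ a) c₂)) :
    homApp D q ha hb w c₃ ((obj D i).secLaw₁.mul m₁ p p') =
      (obj D j).secLaw₁.mul m₂ (homApp D q ha hb w c₁ p) (homApp D q ha hb w c₂ p') :=
  (congrArg (Torsor.Hom.app (Biext.Hom.hom (hom D q a b ha hb)) (x := pt w c₃))
    (Biext.baseChange_secLaw₁ (yoneda.map a) (obj D i) m p p').symm).trans
    ((Biext.app_secLaw₁ (hom D q a b ha hb).isHom m p p').trans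
      (Biext.baseChange_secLaw₁ (yoneda.map b) (obj D j) m _ _))

theorem homApp_secLaw₂ (w : V ⟶ Y) {c₁ c₂ c₃ : Sec H V × Sec K V}
    (m : BaseMul₂ (pt w c₁) (pt w c₂) (pt w c₃))
    (m₁ : BaseMul₂ (pt (w ≫ a) c₁) (pt (w ≫ a) c₂) (pt (w ≫ a) c₃))
    (m₂ : BaseMul₂ (pt (w ≫ b) c₁) (pt (w ≫ b) c₂) (pt (w ≫ b) c₃))
    (p : (obj D i).data.tor.carrier (pt (w ≫ a) c₁))
    (p' : (obj D i).data.tor.carrier (pt (w ≫ a) c₂)) :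
    homApp D q ha hb w c₃ ((obj D i).secLaw₂.mul m₁ p p') =
      (obj D j).secLaw₂.mul m₂ (homApp D q ha hb w c₁ p) (homApp D q ha hb w c₂ p') :=
  (congrArg (Torsor.Hom.app (Biext.Hom.hom (hom D q a b ha hb)) (x := pt w c₃))
    (Biext.baseChange_secLaw₂ (yoneda.map a) (obj D i) m p p').symm).trans
    ((Biext.app_secLaw₂ (hom D q a b ha hb).isHom m p p').trans
      (Biext.baseChange_secLaw₂ (yoneda.map b) (obj D j) m _ _))

end

/-- The transition maps of a descent datum. -/
def tr {s : V ⟶ X i} {s' : V ⟶ X j} (h : s ≫ f i = s' ≫ f j) {c : Sec H V × Sec K V}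
    (p : (obj D i).data.tor.carrier (pt s c)) : (obj D j).data.tor.carrier (pt s' c) :=
  (obj D j).data.tor.res (𝟙 V) (rs_id_pt c (Category.id_comp s'))
    (homApp D (s ≫ f i) rfl h.symm (𝟙 V) c
      ((obj D i).data.tor.res (𝟙 V) (rs_id_pt c (Category.id_comp s).symm) p))

variable {s : V ⟶ X i} {s' : V ⟶ X j} {s'' : V ⟶ X k} {c : Sec H V × Sec K V}

theorem tr_eq (h : s ≫ f i = s' ≫ f j) (q : V ⟶ U) (hs : s ≫ f i = q) (hs' : s' ≫ f j = q)
    (p : (obj D i).data.tor.carrier (pt s c)) :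
    tr D h p = (obj D j).data.tor.res (𝟙 V) (rs_id_pt c (Category.id_comp s'))
      (homApp D q hs hs' (𝟙 V) c
        ((obj D i).data.tor.res (𝟙 V) (rs_id_pt c (Category.id_comp s).symm) p)) := by
  subst hs
  rfl

theorem homApp_eq_tr {Y : C} (q : Y ⟶ U) {a : Y ⟶ X i} {b : Y ⟶ X j} (ha : a ≫ f i = q)
    (hb : b ≫ f j = q) (w : V ⟶ Y) (c : Sec H V × Sec K V) (h : (w ≫ a) ≫ f i = (w ≫ b) ≫ f j)
    (p : (obj D i).data.tor.carrier (pt (w ≫ a) c)) : homApp D q ha hb w c p = tr D h p := by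
  have e : ∀ {l : ι} (d : Y ⟶ X l), rs (base (yoneda.obj (X l)) H K) (𝟙 V) (pt (𝟙 V ≫ w ≫ d) c) =
      pt ((𝟙 V ≫ w) ≫ d) c := fun d => rs_id_pt c (Category.assoc _ _ _).symm
  have e' : ∀ {l : ι} (d : Y ⟶ X l), rs (base (yoneda.obj (X l)) H K) (𝟙 V)
      (pt ((𝟙 V ≫ w) ≫ d) c) = pt (𝟙 V ≫ w ≫ d) c := fun d => rs_id_pt c (Category.assoc _ _ _)
  have e'' : ∀ {l : ι} (d : Y ⟶ X l), rs (base (yoneda.obj (X l)) H K) (𝟙 V) (pt (w ≫ d) c) =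
      pt ((𝟙 V ≫ w) ≫ d) c := fun d => rs_id_pt c (congrArg (· ≫ d) (Category.id_comp w).symm)
  rw [tr_eq D h (w ≫ q) (by rw [Category.assoc, ha]) (by rw [Category.assoc, hb]),
    homApp_pull D q ha hb w c _ _ (e a) (e' b),
    (obj D i).data.tor.res_eq_res (h := e'' a) (Category.id_comp _),
    ← homApp_res D q ha hb rfl (cres_id c) _ (e'' b),
    (obj D j).data.tor.res_eq_res (h := rs_id_pt c (Category.id_comp _).symm) (Category.id_comp _),
    (obj D j).data.tor.res_eq_res (h := rs_id _ _) (Category.id_comp _),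
    (obj D j).data.tor.res_id]

theorem tr_self (h : s ≫ f i = s ≫ f i) (p : (obj D i).data.tor.carrier (pt s c)) :
    tr D h p = p := by
  have h₁ : ∀ p, homApp D (s ≫ f i) rfl h.symm (𝟙 V) c p = p := fun p =>
    congrArg (fun χ : (Biext.baseChange (yoneda.map s)).obj (obj D i) ⟶
      (Biext.baseChange (yoneda.map s)).obj (obj D i) => Torsor.Hom.app (Biext.Hom.hom χ)
        (x := pt (𝟙 V) c) p) (D.hom_self (s ≫ f i) s rfl)
  rw [tr, h₁, (obj D i).data.tor.res_eq_res (h := rs_id _ _) (Category.id_comp _),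
    (obj D i).data.tor.res_id]

theorem tr_tr (h : s ≫ f i = s' ≫ f j) (h' : s' ≫ f j = s'' ≫ f k)
    (p : (obj D i).data.tor.carrier (pt s c)) : tr D h' (tr D h p) = tr D (h.trans h') p := by
  have h₁ : ∀ p, homApp D (s ≫ f i) h.symm (h.trans h').symm (𝟙 V) c
      (homApp D (s ≫ f i) rfl h.symm (𝟙 V) c p) =
      homApp D (s ≫ f i) rfl (h.trans h').symm (𝟙 V) c p := fun p =>
    congrArg (fun χ : (Biext.baseChange (yoneda.map s)).obj (obj D i) ⟶
      (Biext.baseChange (yoneda.map s'')).obj (obj D k) => Torsor.Hom.app (Biext.Hom.hom χ)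
        (x := pt (𝟙 V) c) p) (D.hom_comp (s ≫ f i) s s' s'' rfl h.symm (h.trans h').symm)
  rw [tr_eq D h' (s ≫ f i) h.symm (h.trans h').symm,
    tr_eq D (h.trans h') (s ≫ f i) rfl (h.trans h').symm, tr_eq D h (s ≫ f i) rfl h.symm, ← h₁,
    (obj D j).data.tor.res_eq_res (h := rs_id _ _) (Category.id_comp _),
    (obj D j).data.tor.res_id]

theorem res_tr (h : s ≫ f i = s' ≫ f j) {g : W ⟶ V} {t : W ⟶ X i} {t' : W ⟶ X j}
    {c' : Sec H W × Sec K W} (hs : g ≫ s = t) (hs' : g ≫ s' = t') (hc : cres g c = c')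
    (e : rs _ g (pt s c) = pt t c') (e' : rs _ g (pt s' c) = pt t' c') (h' : t ≫ f i = t' ≫ f j)
    (p : (obj D i).data.tor.carrier (pt s c)) :
    (obj D j).data.tor.res g e' (tr D h p) = tr D h' ((obj D i).data.tor.res g e p) := by
  subst hs hs' hc
  have k₁ : ∀ {l : ι} (d : V ⟶ X l), rs (base (yoneda.obj (X l)) H K) g (pt (𝟙 V ≫ d) c) =
      pt (g ≫ d) (cres g c) := fun d => rs_pt (by rw [Category.id_comp]) rfl
  have h₁ := homApp_res D (s ≫ f i) rfl h.symm (Category.comp_id g) (c := c) rfl (k₁ s) (k₁ s')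
    ((obj D i).data.tor.res (𝟙 V) (rs_id_pt c (Category.id_comp s).symm) p)
  rw [homApp_eq_tr D _ _ _ g _ h', (obj D i).data.tor.res_eq_res (h := e) (Category.comp_id g)] at h₁
  rw [← h₁, tr, (obj D j).data.tor.res_eq_res (Category.comp_id g)]

theorem tr_act (h : s ≫ f i = s' ≫ f j) (p : (obj D i).data.tor.carrier (pt s c))
    (g : Sec M.G V) : tr D h ((obj D i).data.tor.act p g) =
      (obj D j).data.tor.act (tr D h p) g := by
  rw [tr, (obj D i).data.tor.act_res, gres_id, homApp_act, (obj D j).data.tor.act_res, gres_id, tr]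

theorem j_tr (h : s ≫ f i = s' ≫ f j) (p : (obj D i).data.tor.carrier (pt s c)) :
    (obj D j).data.tor.j (tr D h p) = (obj D i).data.tor.j p := by
  rw [tr, (obj D j).data.tor.j_res, gres_id, j_homApp, (obj D i).data.tor.j_res, gres_id]

theorem tr_lact (h : s ≫ f i = s' ≫ f j) (p : (obj D i).data.tor.carrier (pt s c))
    (g : Sec M.G V) : tr D h ((obj D i).data.tor.lact g p) =
      (obj D j).data.tor.lact g (tr D h p) := by
  rw [lact, lact, tr_act, j_tr]

theorem tr_bijective (h : s ≫ f i = s' ≫ f j) : Function.Bijective (tr D h (c := c)) :=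
  Function.bijective_iff_has_inverse.2 ⟨tr D h.symm,
    fun p => (tr_tr D h h.symm p).trans (tr_self D _ p),
    fun p => (tr_tr D h.symm h p).trans (tr_self D _ p)⟩

theorem tr_secLaw₁ {c₁ c₂ c₃ : Sec H V × Sec K V} (h : s ≫ f i = s' ≫ f j)
    (m : BaseMul₁ (pt s c₁) (pt s c₂) (pt s c₃)) (m' : BaseMul₁ (pt s' c₁) (pt s' c₂) (pt s' c₃))
    (p : (obj D i).data.tor.carrier (pt s c₁)) (q : (obj D i).data.tor.carrier (pt s c₂)) :
    tr D h ((obj D i).secLaw₁.mul m p q) = (obj D j).secLaw₁.mul m' (tr D h p) (tr D h q) := by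
  have n : ∀ {T : C} (d : V ⟶ T), BaseMul₁ (pt d c₁) (pt d c₂) (pt d c₃) := fun d =>
    ⟨rfl, rfl, m.h, m.k, m.k'⟩
  rw [tr, tr, tr, (obj D i).secLaw₁.res (𝟙 V) _ _ _ m (n (𝟙 V ≫ s)),
    homApp_secLaw₁ D _ _ _ (𝟙 V) (n _) (n _) (n (𝟙 V ≫ s')),
    (obj D j).secLaw₁.res (𝟙 V) _ _ _ (n (𝟙 V ≫ s')) m']

theorem tr_secLaw₂ {c₁ c₂ c₃ : Sec H V × Sec K V} (h : s ≫ f i = s' ≫ f j)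
    (m : BaseMul₂ (pt s c₁) (pt s c₂) (pt s c₃)) (m' : BaseMul₂ (pt s' c₁) (pt s' c₂) (pt s' c₃))
    (p : (obj D i).data.tor.carrier (pt s c₁)) (q : (obj D i).data.tor.carrier (pt s c₂)) :
    tr D h ((obj D i).secLaw₂.mul m p q) = (obj D j).secLaw₂.mul m' (tr D h p) (tr D h q) := by
  have n : ∀ {T : C} (d : V ⟶ T), BaseMul₂ (pt d c₁) (pt d c₂) (pt d c₃) := fun d =>
    ⟨rfl, rfl, m.h, m.h', m.k⟩
  rw [tr, tr, tr, (obj D i).secLaw₂.res (𝟙 V) _ _ _ m (n (𝟙 V ≫ s)),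
    homApp_secLaw₂ D _ _ _ (𝟙 V) (n _) (n _) (n (𝟙 V ≫ s')),
    (obj D j).secLaw₂.res (𝟙 V) _ _ _ (n (𝟙 V ≫ s')) m']

end Descent

end
end Biext4

namespace Biext4
section
variable {C : Type u} [SmallCategory C] {J : GrothendieckTopology C}
open Biext4.Torsor

variable {H K : Sheaf J GrpCat.{u}} {M : BraidedCrossedModule J} {U : C}

theorem isDense_functorInclusion {R : Sieve U} (hR : R ∈ J U) : IsDense J R.functorInclusion where
  inj h := Subtype.ext h
  cover {V} a := J.superset_covering (S := R.pullback (show V ⟶ U from a))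
    (fun _ g hg => ⟨⟨g ≫ (show V ⟶ U from a), hg⟩, rfl⟩) (J.pullback_stable _ hR)

namespace Descent

/-- The family `f` generates the sieve `R`. -/
structure Generates {ι : Type*} {X : ι → C} (R : Sieve U) (f : ∀ i, X i ⟶ U) : Prop where
  mem : ∀ i, R (f i)
  factors : ∀ {V : C} (a : V ⟶ U), R a → ∃ (i : ι) (s : V ⟶ X i), s ≫ f i = a

variable {ι : Type*} {X : ι → C} {f : ∀ i, X i ⟶ U} {R : Sieve U} (hf : Generates R f) {V W : C}

/-- The morphism to `U` underlying a section of `R × H × K`. -/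
def arr (y : (base R.functor H K).obj (op V)) : V ⟶ U := Subtype.val (p := fun a : V ⟶ U => R a) y.1

/-- The section of `H × K` underlying a section of `R × H × K`. -/
def coef (y : (base R.functor H K).obj (op V)) : Sec H V × Sec K V := y.2

theorem arr_rs {g : W ⟶ V} {y : (base R.functor H K).obj (op V)}
    {z : (base R.functor H K).obj (op W)} (h : rs _ g y = z) : g ≫ arr y = arr z := by
  subst h
  rfl

theorem coef_rs {g : W ⟶ V} {y : (base R.functor H K).obj (op V)}
    {z : (base R.functor H K).obj (op W)} (h : rs _ g y = z) : cres g (coef y) = coef z := by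
  subst h
  rfl

namespace Generates
include hf

/-- The index of a chosen factorization. -/
noncomputable def ix (y : (base R.functor H K).obj (op V)) : ι := (hf.factors (arr y) y.1.2).choose

/-- The morphism of a chosen factorization. -/
noncomputable def sc (y : (base R.functor H K).obj (op V)) : V ⟶ X (hf.ix y) :=
  (hf.factors (arr y) y.1.2).choose_spec.choose

theorem sc_comp (y : (base R.functor H K).obj (op V)) : hf.sc y ≫ f (hf.ix y) = arr y :=
  (hf.factors (arr y) y.1.2).choose_spec.choose_spec

theorem comp_sc_comp {g : W ⟶ V} {y : (base R.functor H K).obj (op V)}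
    {z : (base R.functor H K).obj (op W)} (h : rs _ g y = z) :
    (g ≫ hf.sc y) ≫ f (hf.ix y) = hf.sc z ≫ f (hf.ix z) := by
  rw [Category.assoc, sc_comp, sc_comp, arr_rs h]

theorem sc_comp_eq {y z : (base R.functor H K).obj (op V)} (h : y.1 = z.1) :
    hf.sc y ≫ f (hf.ix y) = hf.sc z ≫ f (hf.ix z) := by
  rw [sc_comp, sc_comp, arr, arr, h]

end Generates

variable (D : (biextStack M H K).toPseudofunctor'.DescentData f)

/-- The sections of the torsor glued from a descent datum. -/
abbrev GlueSec (y : (base R.functor H K).obj (op V)) : Type u :=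
  (obj D (hf.ix y)).data.tor.carrier (pt (hf.sc y) (coef y))

/-- Restriction of sections of the torsor glued from a descent datum. -/
noncomputable def glueRes (g : W ⟶ V) {y : (base R.functor H K).obj (op V)}
    {z : (base R.functor H K).obj (op W)} (h : rs _ g y = z) (p : GlueSec hf D y) :
    GlueSec hf D z :=
  tr D (hf.comp_sc_comp h) ((obj D (hf.ix y)).data.tor.res g (rs_pt rfl (coef_rs h)) p)

theorem tr_glueRes {i : ι} {g : W ⟶ V} {y : (base R.functor H K).obj (op V)}
    {z : (base R.functor H K).obj (op W)} (h : rs _ g y = z) {s : V ⟶ X i} {s' : W ⟶ X i}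
    (hs : g ≫ s = s') (h₁ : hf.sc y ≫ f (hf.ix y) = s ≫ f i)
    (h₂ : hf.sc z ≫ f (hf.ix z) = s' ≫ f i)
    (e : rs _ g (pt s (coef y)) = pt s' (coef z)) (p : GlueSec hf D y) :
    tr D h₂ (glueRes hf D g h p) = (obj D i).data.tor.res g e (tr D h₁ p) := by
  rw [glueRes, tr_tr, res_tr D h₁ rfl hs (coef_rs h)]

/-- The sheaf glued from a descent datum. -/
noncomputable def gluedSheaf : RelSheaf J (base R.functor H K) where
  carrier y := GlueSec hf D y
  res g _ _ h p := glueRes hf D g h p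
  res_id {V y} h p := by
    rw [glueRes, ← res_tr D rfl rfl (Category.id_comp _) (coef_rs h) _ (rs_id_pt _ rfl), tr_self]
    exact RelSheaf.res_id _ _ _
  res_res {V W Z} g l y z x hg hl h p := by
    have e : (l ≫ g) ≫ hf.sc y = l ≫ g ≫ hf.sc y := Category.assoc _ _ _
    rw [glueRes, glueRes, glueRes, res_tr D (hf.comp_sc_comp hg) e.symm rfl (coef_rs hl)
      (rs_pt e.symm (coef_rs hl)) (rs_pt rfl (coef_rs hl)) (by rw [hf.comp_sc_comp h, hf.comp_sc_comp hl]), tr_tr,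
      (obj D (hf.ix y)).data.tor.res_eq_res rfl]
  sep {V y} T hT p q h := (obj D (hf.ix y)).data.tor.sep T hT p q fun g hg =>
    (tr_bijective D (c := coef (rs _ g y)) (hf.comp_sc_comp rfl)).1 (h g hg)
  glue {V y} T hT t ht := by
    obtain ⟨p, hp⟩ := (obj D (hf.ix y)).data.tor.glue (x := pt (hf.sc y) (coef y)) T hT
      (fun {W} g hg => tr D (s' := g ≫ hf.sc y) (c := coef (rs _ g y)) (hf.comp_sc_comp rfl).symm
        (t g hg)) (fun {W Z} g hg l => by
        have e : (l ≫ g) ≫ hf.sc y = l ≫ g ≫ hf.sc y := Category.assoc _ _ _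
        refine (tr_glueRes hf D (rs_comp _ g l y).symm e.symm (hf.comp_sc_comp rfl).symm
          (hf.comp_sc_comp rfl).symm _ (t g hg)).symm.trans ?_
        exact congrArg (tr D _) (ht g hg l))
    refine ⟨p, fun {W} g hg => ?_⟩
    refine (congrArg (tr D (c := coef (rs _ g y)) (hf.comp_sc_comp rfl)) (hp g hg)).trans ?_
    exact (tr_tr D _ _ _).trans (tr_self D _ _)

/-- The torsor glued from a descent datum. -/
noncomputable def gluedTorsor : Torsor M (base R.functor H K) where
  toRelSheaf := gluedSheaf hf D
  act {V y} p g := (obj D (hf.ix y)).data.tor.act p g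
  act_res g y z h p γ := by
    refine (congrArg (tr D (hf.comp_sc_comp h))
      ((obj D (hf.ix y)).data.tor.act_res g _ p γ)).trans ?_
    exact tr_act D _ _ _
  act_one {V y} p := (obj D (hf.ix y)).data.tor.act_one p
  act_mul {V y} p g h := (obj D (hf.ix y)).data.tor.act_mul p g h
  trans {V y} p q := (obj D (hf.ix y)).data.tor.trans p q
  inhab {V} y := by
    obtain ⟨T, hT, h⟩ := (obj D (hf.ix y)).data.tor.inhab (pt (hf.sc y) (coef y))
    exact ⟨T, hT, fun g hg => (h g hg).map fun p =>
      tr D (c := coef (rs _ g y)) (hf.comp_sc_comp rfl) p⟩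
  j {V y} p := (obj D (hf.ix y)).data.tor.j p
  j_res g y z h p := (j_tr D (hf.comp_sc_comp h) _).trans
    ((obj D (hf.ix y)).data.tor.j_res g _ p)
  j_act {V y} p g := (obj D (hf.ix y)).data.tor.j_act p g

/-- The first partial law of the glued torsor. -/
noncomputable def gluedMul₁ {x y z : (base R.functor H K).obj (op V)} (m : BaseMul₁ x y z)
    (p : GlueSec hf D x) (q : GlueSec hf D y) : GlueSec hf D z :=
  (obj D (hf.ix z)).secLaw₁.mul (x := pt (hf.sc z) (coef x)) (y := pt (hf.sc z) (coef y))
    ⟨rfl, rfl, m.h, m.k, m.k'⟩ (tr D (hf.sc_comp_eq m.s'.symm) p)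
    (tr D (hf.sc_comp_eq (m.s.trans m.s'.symm)) q)

theorem tr_gluedMul₁ {i : ι} {x y z : (base R.functor H K).obj (op V)} (m : BaseMul₁ x y z)
    {s : V ⟶ X i} (hz : hf.sc z ≫ f (hf.ix z) = s ≫ f i)
    (m' : BaseMul₁ (pt s (coef x)) (pt s (coef y)) (pt s (coef z)))
    (p : GlueSec hf D x) (q : GlueSec hf D y) :
    tr D hz (gluedMul₁ hf D m p q) =
      (obj D i).secLaw₁.mul m' (tr D ((hf.sc_comp_eq m.s'.symm).trans hz) p)
        (tr D ((hf.sc_comp_eq (m.s.trans m.s'.symm)).trans hz) q) := by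
  rw [gluedMul₁, tr_secLaw₁ D hz _ m', tr_tr, tr_tr]

/-- The second partial law of the glued torsor. -/
noncomputable def gluedMul₂ {x y z : (base R.functor H K).obj (op V)} (m : BaseMul₂ x y z)
    (p : GlueSec hf D x) (q : GlueSec hf D y) : GlueSec hf D z :=
  (obj D (hf.ix z)).secLaw₂.mul (x := pt (hf.sc z) (coef x)) (y := pt (hf.sc z) (coef y))
    ⟨rfl, rfl, m.h, m.h', m.k⟩ (tr D (hf.sc_comp_eq m.s'.symm) p)
    (tr D (hf.sc_comp_eq (m.s.trans m.s'.symm)) q)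

theorem tr_gluedMul₂ {i : ι} {x y z : (base R.functor H K).obj (op V)} (m : BaseMul₂ x y z)
    {s : V ⟶ X i} (hz : hf.sc z ≫ f (hf.ix z) = s ≫ f i)
    (m' : BaseMul₂ (pt s (coef x)) (pt s (coef y)) (pt s (coef z)))
    (p : GlueSec hf D x) (q : GlueSec hf D y) :
    tr D hz (gluedMul₂ hf D m p q) =
      (obj D i).secLaw₂.mul m' (tr D ((hf.sc_comp_eq m.s'.symm).trans hz) p)
        (tr D ((hf.sc_comp_eq (m.s.trans m.s'.symm)).trans hz) q) := by
  rw [gluedMul₂, tr_secLaw₂ D hz _ m', tr_tr, tr_tr]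

/-- The first partial law of the glued torsor. -/
noncomputable def gluedLaw₁ : PartialLaw (gluedTorsor hf D) BaseMul₁ where
  mul m p q := gluedMul₁ hf D m p q
  res {V W} g x y z x' y' z' hx hy hz m m' p q := by
    have n : BaseMul₁ (pt (g ≫ hf.sc z) (coef x')) (pt (g ≫ hf.sc z) (coef y'))
      (pt (g ≫ hf.sc z) (coef z')) := ⟨rfl, rfl, m'.h, m'.k, m'.k'⟩
    refine (tr_bijective D (hf.comp_sc_comp hz).symm).1 ?_
    refine (tr_glueRes hf D hz rfl rfl _ (rs_pt rfl (coef_rs hz))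
      (gluedMul₁ hf D m p q)).trans ?_
    refine Eq.trans ?_ (tr_gluedMul₁ hf D m' _ n (glueRes hf D g hx p)
      (glueRes hf D g hy q)).symm
    refine (congrArg ((obj D (hf.ix z)).data.tor.res g (rs_pt rfl (coef_rs hz)))
      (tr_self D rfl (gluedMul₁ hf D m p q))).trans ?_
    refine ((obj D (hf.ix z)).secLaw₁.res g (rs_pt rfl (coef_rs hx)) (rs_pt rfl (coef_rs hy)) _ _
      n _ _).trans ?_
    exact congrArg₂ ((obj D (hf.ix z)).secLaw₁.mul n) (tr_glueRes hf D hx rfl _ _ _ p).symm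
      (tr_glueRes hf D hy rfl _ _ _ q).symm
  bal {V x y z} m p q g := by
    refine (congrArg (fun t => (obj D (hf.ix z)).secLaw₁.mul _ t _) (tr_act D _ p g)).trans ?_
    refine ((obj D (hf.ix z)).secLaw₁.bal _ _ _ g).trans ?_
    exact congrArg ((obj D (hf.ix z)).secLaw₁.mul _ _) (tr_lact D _ q g).symm
  act {V x y z} m p q g :=
    (congrArg ((obj D (hf.ix z)).secLaw₁.mul _ _) (tr_act D _ q g)).trans
      ((obj D (hf.ix z)).secLaw₁.act _ _ _ g)
  j {V x y z} m p q := ((obj D (hf.ix z)).secLaw₁.j _ _ _).trans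
    (congrArg₂ (· * ·) (j_tr D _ p) (j_tr D _ q))

/-- The second partial law of the glued torsor. -/
noncomputable def gluedLaw₂ : PartialLaw (gluedTorsor hf D) BaseMul₂ where
  mul m p q := gluedMul₂ hf D m p q
  res {V W} g x y z x' y' z' hx hy hz m m' p q := by
    have n : BaseMul₂ (pt (g ≫ hf.sc z) (coef x')) (pt (g ≫ hf.sc z) (coef y'))
      (pt (g ≫ hf.sc z) (coef z')) := ⟨rfl, rfl, m'.h, m'.h', m'.k⟩
    refine (tr_bijective D (hf.comp_sc_comp hz).symm).1 ?_
    refine (tr_glueRes hf D hz rfl rfl _ (rs_pt rfl (coef_rs hz))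
      (gluedMul₂ hf D m p q)).trans ?_
    refine Eq.trans ?_ (tr_gluedMul₂ hf D m' _ n (glueRes hf D g hx p)
      (glueRes hf D g hy q)).symm
    refine (congrArg ((obj D (hf.ix z)).data.tor.res g (rs_pt rfl (coef_rs hz)))
      (tr_self D rfl (gluedMul₂ hf D m p q))).trans ?_
    refine ((obj D (hf.ix z)).secLaw₂.res g (rs_pt rfl (coef_rs hx)) (rs_pt rfl (coef_rs hy)) _ _
      n _ _).trans ?_
    exact congrArg₂ ((obj D (hf.ix z)).secLaw₂.mul n) (tr_glueRes hf D hx rfl _ _ _ p).symm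
      (tr_glueRes hf D hy rfl _ _ _ q).symm
  bal {V x y z} m p q g := by
    refine (congrArg (fun t => (obj D (hf.ix z)).secLaw₂.mul _ t _) (tr_act D _ p g)).trans ?_
    refine ((obj D (hf.ix z)).secLaw₂.bal _ _ _ g).trans ?_
    exact congrArg ((obj D (hf.ix z)).secLaw₂.mul _ _) (tr_lact D _ q g).symm
  act {V x y z} m p q g :=
    (congrArg ((obj D (hf.ix z)).secLaw₂.mul _ _) (tr_act D _ q g)).trans
      ((obj D (hf.ix z)).secLaw₂.act _ _ _ g)
  j {V x y z} m p q := ((obj D (hf.ix z)).secLaw₂.j _ _ _).trans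
    (congrArg₂ (· * ·) (j_tr D _ p) (j_tr D _ q))

/-- The laws of the glued torsor. -/
noncomputable def gluedLaws : SecLaws (gluedTorsor hf D) where
  law₁ := gluedLaw₁ hf D
  law₂ := gluedLaw₂ hf D
  assoc₁ {V x y z xy yz xyz} m n m' n' p q r := by
    have a : ∀ {x y z : (base R.functor H K).obj (op V)} (m : BaseMul₁ x y z), BaseMul₁
        (pt (hf.sc xyz) (coef x)) (pt (hf.sc xyz) (coef y)) (pt (hf.sc xyz) (coef z)) :=
      fun m => ⟨rfl, rfl, m.h, m.k, m.k'⟩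
    refine (congrArg (fun t => (obj D (hf.ix xyz)).secLaw₁.mul (a n) t (tr D _ r))
      (tr_gluedMul₁ hf D m _ (a m) p q)).trans ?_
    refine (Biext.sec_assoc₁ (a m) (a n) (a m') (a n') _ _ _).trans ?_
    exact congrArg ((obj D (hf.ix xyz)).secLaw₁.mul (a n') (tr D _ p))
      (tr_gluedMul₁ hf D m' _ (a m') q r).symm
  assoc₂ {V x y z xy yz xyz} m n m' n' p q r := by
    have a : ∀ {x y z : (base R.functor H K).obj (op V)} (m : BaseMul₂ x y z), BaseMul₂
        (pt (hf.sc xyz) (coef x)) (pt (hf.sc xyz) (coef y)) (pt (hf.sc xyz) (coef z)) :=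
      fun m => ⟨rfl, rfl, m.h, m.h', m.k⟩
    refine (congrArg (fun t => (obj D (hf.ix xyz)).secLaw₂.mul (a n) t (tr D _ r))
      (tr_gluedMul₂ hf D m _ (a m) p q)).trans ?_
    refine (Biext.sec_assoc₂ (a m) (a n) (a m') (a n') _ _ _).trans ?_
    exact congrArg ((obj D (hf.ix xyz)).secLaw₂.mul (a n') (tr D _ p))
      (tr_gluedMul₂ hf D m' _ (a m') q r).symm
  interchange {V x y z w xy zw xz yw t} m n l m' n' l' a b c d := by
    have e₁ : ∀ {x y z : (base R.functor H K).obj (op V)} (m : BaseMul₁ x y z), BaseMul₁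
        (pt (hf.sc t) (coef x)) (pt (hf.sc t) (coef y)) (pt (hf.sc t) (coef z)) :=
      fun m => ⟨rfl, rfl, m.h, m.k, m.k'⟩
    have e₂ : ∀ {x y z : (base R.functor H K).obj (op V)} (m : BaseMul₂ x y z), BaseMul₂
        (pt (hf.sc t) (coef x)) (pt (hf.sc t) (coef y)) (pt (hf.sc t) (coef z)) :=
      fun m => ⟨rfl, rfl, m.h, m.h', m.k⟩
    refine (congrArg₂ ((obj D (hf.ix t)).secLaw₂.mul (e₂ l)) (tr_gluedMul₁ hf D m _ (e₁ m) a b)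
      (tr_gluedMul₁ hf D n _ (e₁ n) c d)).trans ?_
    refine (Biext.sec_interchange (e₁ m) (e₁ n) (e₂ l) (e₂ m') (e₂ n') (e₁ l') _ _ _ _).trans ?_
    refine (congrArg ((obj D (hf.ix t)).data.tor.act _) (congrArg₂ M.act
      (congrArg₂ (fun x y => (M.br x y)⁻¹) (j_tr D _ b) (j_tr D _ c)) (j_tr D _ d))).trans ?_
    exact congrArg (fun r => (obj D (hf.ix t)).data.tor.act r _)
      (congrArg₂ ((obj D (hf.ix t)).secLaw₁.mul (e₁ l')) (tr_gluedMul₂ hf D m' _ (e₂ m') a c)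
      (tr_gluedMul₂ hf D n' _ (e₂ n') b d)).symm

end Descent
end
end Biext4

namespace Biext4
section
variable {C : Type u} [SmallCategory C] {J : GrothendieckTopology C}
open Biext4.Torsor

variable {H K : Sheaf J GrpCat.{u}} {M : BraidedCrossedModule J} {U : C}

namespace Descent
variable {ι : Type*} {X : ι → C} {f : ∀ i, X i ⟶ U} {R : Sieve U} (hf : Generates R f) {V W : C}

open Pseudofunctor

theorem ofObj_hom_app (B : Biext M H K (yoneda.obj U)) {Y : C} (q : Y ⟶ U) {i j : ι} (a : Y ⟶ X i)
    (b : Y ⟶ X j) (ha : a ≫ f i = q) (hb : b ≫ f j = q) (w : V ⟶ Y) (c : Sec H V × Sec K V)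
    (p : B.data.tor.carrier (pt ((w ≫ a) ≫ f i) c))
    (e : rs _ (𝟙 V) (pt ((w ≫ a) ≫ f i) c) = pt ((w ≫ b) ≫ f j) c) :
    Torsor.Hom.app (Biext.Hom.hom (hom (DescentData.ofObj (F := (biextStack M H K).toPseudofunctor')
      (f := f) B) q a b ha hb)) (x := pt w c) p = B.data.tor.res (𝟙 V) e p := by
  have k₁ : yoneda.map a ≫ yoneda.map (f i) = yoneda.map q := by rw [← ha, Functor.map_comp]
  have k₂ : yoneda.map q = yoneda.map b ≫ yoneda.map (f j) := by rw [← hb, Functor.map_comp]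
  have m₁ := congrArg (fun a => (Biext.baseChange a).obj B) k₁
  have m₂ := congrArg (fun a => (Biext.baseChange a).obj B) k₂
  have e₁ : rs _ (𝟙 V) (pt ((w ≫ a) ≫ f i) c) = pt (w ≫ q) c :=
    rs_id_pt c (by rw [Category.assoc, ha])
  have e₂ : rs _ (𝟙 V) (pt (w ≫ q) c) = pt ((w ≫ b) ≫ f j) c :=
    rs_id_pt c (by rw [Category.assoc, hb])
  refine (congrArg (fun χ : (Biext.baseChange (yoneda.map a)).obj
      ((Biext.baseChange (yoneda.map (f i))).obj B) ⟶ (Biext.baseChange (yoneda.map b)).obj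
        ((Biext.baseChange (yoneda.map (f j))).obj B) =>
      Torsor.Hom.app (Biext.Hom.hom χ) (x := pt w c) p)
    (ofObj_toPseudofunctor'_hom (biextStack M H K) B q a b ha hb m₁ m₂)).trans ?_
  refine (Biext.eqToHom_baseChange_app k₂ B m₂ (x := pt w c) _ e₂).trans ?_
  refine (congrArg (B.data.tor.res (𝟙 V) e₂)
    (Biext.eqToHom_baseChange_app k₁ B m₁ (x := pt w c) p e₁)).trans ?_
  exact B.data.tor.res_eq_res (Category.comp_id _) p

/-- The biextension over a covering sieve glued from a descent datum. -/
noncomputable def glued (D : (biextStack M H K).toPseudofunctor'.DescentData f) :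
    Biext M H K R.functor := (gluedLaws hf D).toBiext

section
variable (D : (biextStack M H K).toPseudofunctor'.DescentData f)

/-- The section of `R × H × K` defined by a section of `X i × H × K`. -/
def sievePt (i : ι) (s : V ⟶ X i) (c : Sec H V × Sec K V) : (base R.functor H K).obj (op V) :=
  (⟨s ≫ f i, R.downward_closed (hf.mem i) s⟩, c)

theorem sc_sievePt (i : ι) (s : V ⟶ X i) (c : Sec H V × Sec K V) :
    hf.sc (sievePt hf i s c) ≫ f (hf.ix (sievePt hf i s c)) = s ≫ f i :=
  hf.sc_comp _

/-- The restriction of the glued biextension to a member of the covering. -/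
noncomputable def gluedHom (i : ι) :
    (Biext.baseChange (R.toFunctor (f i) (hf.mem i))).obj (glued hf D) ⟶ obj D i :=
  show Biext.Hom _ _ from
  { hom := show Torsor.Hom _ _ from
      { app := fun {V x} p => tr D (c := x.2) (sc_sievePt hf i x.1 x.2) p
        app_res := fun g x y h p => by
          subst h
          exact tr_glueRes hf D (z := sievePt hf i (g ≫ x.1) (cres g x.2))
            (nat_app (baseMap (R.toFunctor (f i) (hf.mem i)) H K) g rfl) rfl _ _ _ p
        app_act := fun p g => tr_act D _ p g
        j_app := fun p => j_tr D _ p }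
    isHom := Biext.isHom_of_sec
      (fun {V x y z} m p q => by
        obtain ⟨s, c₁⟩ := x
        obtain ⟨s₂, c₂⟩ := y
        obtain ⟨s₃, c₃⟩ := z
        obtain rfl : s₂ = s := m.s
        obtain rfl : s₃ = s₂ := m.s'
        refine (congrArg (tr D (c := c₃) (sc_sievePt hf i s₃ c₃))
          ((Biext.baseChange_secLaw₁ _ (glued hf D) m p q).trans
            ((gluedLaws hf D).toBiext_secLaw₁ (m.baseMap _) p q))).trans ?_
        exact tr_gluedMul₁ hf D (m.baseMap (R.toFunctor (f i) (hf.mem i))) _ m p q)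
      (fun {V x y z} m p q => by
        obtain ⟨s, c₁⟩ := x
        obtain ⟨s₂, c₂⟩ := y
        obtain ⟨s₃, c₃⟩ := z
        obtain rfl : s₂ = s := m.s
        obtain rfl : s₃ = s₂ := m.s'
        refine (congrArg (tr D (c := c₃) (sc_sievePt hf i s₃ c₃))
          ((Biext.baseChange_secLaw₂ _ (glued hf D) m p q).trans
            ((gluedLaws hf D).toBiext_secLaw₂ (m.baseMap _) p q))).trans ?_
        exact tr_gluedMul₂ hf D (m.baseMap (R.toFunctor (f i) (hf.mem i))) _ m p q) }

/-- A morphism of biextensions over a covering sieve, extended to a member of the covering. -/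
noncomputable def gluedObjHom {E : Biext M H K (yoneda.obj U)}
    (e : (Biext.baseChange R.functorInclusion).obj E ⟶ glued hf D) (i : ι) :
    (Biext.baseChange (yoneda.map (f i))).obj E ⟶ obj D i :=
  (show (Biext.baseChange (yoneda.map (f i))).obj E ⟶
    (Biext.baseChange (R.toFunctor (f i) (hf.mem i))).obj (glued hf D) from
      (Biext.baseChange (R.toFunctor (f i) (hf.mem i))).map e) ≫ gluedHom hf D i

theorem gluedObjHom_app {E : Biext M H K (yoneda.obj U)}
    (e : (Biext.baseChange R.functorInclusion).obj E ⟶ glued hf D) (i : ι) (s : V ⟶ X i)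
    (c : Sec H V × Sec K V) (p : E.data.tor.carrier (pt (s ≫ f i) c)) :
    Torsor.Hom.app (Biext.Hom.hom (gluedObjHom hf D e i)) (x := pt s c) p =
      tr D (sc_sievePt hf i s c)
        (Torsor.Hom.app (Biext.Hom.hom e) (x := sievePt hf i s c) p) := rfl

end

theorem toDescentData_essSurj (hf : Generates R f) (hR : R ∈ J U) :
    ((biextStack M H K).toPseudofunctor'.toDescentData f).EssSurj where
  mem_essImage D := by
    obtain ⟨E, ⟨e⟩⟩ := (isDense_functorInclusion hR).baseChange_essSurj.mem_essImage (glued hf D)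
    refine ⟨E, ⟨DescentData.isoMk (fun i => Biext.isoOf (gluedObjHom hf D e.hom i)) ?_⟩⟩
    intro Y q i j a b ha hb
    refine Biext.Hom.ext (Torsor.hom_ext fun {V x} p => ?_)
    obtain ⟨w, c⟩ := x
    have h : (w ≫ a) ≫ f i = (w ≫ b) ≫ f j := by rw [Category.assoc, Category.assoc, ha, hb]
    have h' : rs _ (𝟙 V) (sievePt hf i (w ≫ a) c) = sievePt hf j (w ≫ b) c :=
      (rs_id _ _).trans (Prod.ext (Subtype.ext h) rfl)
    refine (homApp_eq_tr D q ha hb w c h _).trans ?_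
    refine (congrArg (tr D h) (gluedObjHom_app hf D e.hom i (w ≫ a) c p)).trans ?_
    refine (tr_tr D _ h _).trans ?_
    refine Eq.trans ?_ (congrArg
      (Torsor.Hom.app (Biext.Hom.hom (gluedObjHom hf D e.hom j)) (x := pt (w ≫ b) c))
      (ofObj_hom_app E q a b ha hb w c p (rs_id_pt c h)).symm)
    refine Eq.trans ?_ (gluedObjHom_app hf D e.hom j (w ≫ b) c _).symm
    refine Eq.trans ?_ (congrArg (tr D (sc_sievePt hf j (w ≫ b) c))
      (Torsor.Hom.app_res (Biext.Hom.hom e.hom) (𝟙 V) (x := sievePt hf i (w ≫ a) c)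
        (y := sievePt hf j (w ≫ b) c) h' p)).symm
    refine Eq.trans ?_ (tr_glueRes hf D h' (Category.id_comp _)
      ((sc_sievePt hf i (w ≫ a) c).trans h) _ (rs_id_pt c rfl) _).symm
    exact ((obj D j).data.tor.res_id _ _).symm

section
variable {E F : Biext M H K (yoneda.obj U)}
  (φ : ((biextStack M H K).toPseudofunctor'.toDescentData f).obj E ⟶
    ((biextStack M H K).toPseudofunctor'.toDescentData f).obj F)

/-- The components of a morphism of descent data. -/
def comp (i : ι) : (Biext.baseChange (yoneda.map (f i))).obj E ⟶
    (Biext.baseChange (yoneda.map (f i))).obj F := DescentData.Hom.hom φ i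

/-- The components of a morphism of descent data, on sections. -/
def compApp {i : ι} (s : V ⟶ X i) {a : V ⟶ U} (h : s ≫ f i = a) {c : Sec H V × Sec K V}
    (p : E.data.tor.carrier (pt a c)) : F.data.tor.carrier (pt a c) :=
  F.data.tor.res (𝟙 V) (rs_id_pt c h) (Torsor.Hom.app (Biext.Hom.hom (comp φ i)) (x := pt s c)
    (E.data.tor.res (𝟙 V) (rs_id_pt c h.symm) p))

theorem compApp_rfl {i : ι} (s : V ⟶ X i) {c : Sec H V × Sec K V}
    (p : E.data.tor.carrier (pt (s ≫ f i) c)) :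
    compApp φ s rfl p = Torsor.Hom.app (Biext.Hom.hom (comp φ i)) (x := pt s c) p :=
  (F.data.tor.res_id _ _).trans (congrArg (Torsor.Hom.app (Biext.Hom.hom (comp φ i)) (x := pt s c))
    (E.data.tor.res_id _ _))

theorem compApp_eq {i j : ι} (s : V ⟶ X i) (s' : V ⟶ X j) {a : V ⟶ U} (h : s ≫ f i = a)
    (h' : s' ≫ f j = a) {c : Sec H V × Sec K V} (p : E.data.tor.carrier (pt a c)) :
    compApp φ s h p = compApp φ s' h' p := by
  have key : ∀ (t : V ⟶ X i) (t' : V ⟶ X j) (_ : 𝟙 V ≫ s = t) (_ : 𝟙 V ≫ s' = t')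
      (ht : t ≫ f i = a) (ht' : t' ≫ f j = a), compApp φ t ht p = compApp φ t' ht' p := by
    rintro _ _ rfl rfl ht ht'
    have h₁ : ∀ p₀, _ := fun p₀ => congrArg (fun χ :
      (Biext.baseChange (yoneda.map s)).obj ((Biext.baseChange (yoneda.map (f i))).obj E) ⟶
      (Biext.baseChange (yoneda.map s')).obj ((Biext.baseChange (yoneda.map (f j))).obj F) =>
        Torsor.Hom.app (Biext.Hom.hom χ) (x := pt (𝟙 V) c) p₀) (DescentData.Hom.comm φ a s s' h h')
    have e : rs (base (yoneda.obj U) H K) (𝟙 V) (pt ((𝟙 V ≫ s) ≫ f i) c) =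
      pt ((𝟙 V ≫ s') ≫ f j) c := rs_id_pt c (ht.trans ht'.symm)
    have h₂ : ∀ p₀, F.data.tor.res (𝟙 V) e
        (Torsor.Hom.app (Biext.Hom.hom (comp φ i)) (x := pt (𝟙 V ≫ s) c) p₀) =
        Torsor.Hom.app (Biext.Hom.hom (comp φ j)) (x := pt (𝟙 V ≫ s') c)
          (E.data.tor.res (𝟙 V) e p₀) := fun p₀ =>
      (ofObj_hom_app F a s s' h h' (𝟙 V) c _ e).symm.trans ((h₁ p₀).trans
        (congrArg (Torsor.Hom.app (Biext.Hom.hom (comp φ j)) (x := pt (𝟙 V ≫ s') c))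
          (ofObj_hom_app E a s s' h h' (𝟙 V) c p₀ e)))
    have h₃ := (h₂ (E.data.tor.res (𝟙 V) (rs_id_pt c ht.symm) p)).trans
      (congrArg (Torsor.Hom.app (Biext.Hom.hom (comp φ j)) (x := pt (𝟙 V ≫ s') c))
        (E.data.tor.res_eq_res (h := rs_id_pt c ht'.symm) (Category.id_comp _) p))
    exact (F.data.tor.res_eq_res (h := rs_id_pt c ht) (Category.id_comp _) _).symm.trans
      (congrArg (F.data.tor.res (𝟙 V) (rs_id_pt c ht')) h₃)
  exact key s s' (Category.id_comp s) (Category.id_comp s') h h'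

theorem res_compApp {i : ι} (s : V ⟶ X i) {a : V ⟶ U} (h : s ≫ f i = a) {g : W ⟶ V} {b : W ⟶ U}
    {t : W ⟶ X i} (h' : t ≫ f i = b) (hg : g ≫ s = t) {c : Sec H V × Sec K V} {d : Sec H W × Sec K W}
    (hc : cres g c = d) (e : rs _ g (pt a c) = pt b d)
    (p : E.data.tor.carrier (pt a c)) :
    F.data.tor.res g e (compApp φ s h p) = compApp φ t h' (E.data.tor.res g e p) := by
  subst h h' hg hc
  rw [compApp_rfl, compApp_rfl]
  exact (Torsor.Hom.app_res (Biext.Hom.hom (comp φ i)) g (x := pt s c) (y := pt (g ≫ s) (cres g c))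
    rfl p).symm

theorem compApp_act {i : ι} (s : V ⟶ X i) {a : V ⟶ U} (h : s ≫ f i = a) {c : Sec H V × Sec K V}
    (p : E.data.tor.carrier (pt a c)) (g : Sec M.G V) :
    compApp φ s h (E.data.tor.act p g) = F.data.tor.act (compApp φ s h p) g := by
  subst h
  rw [compApp_rfl, compApp_rfl]
  exact Torsor.Hom.app_act (Biext.Hom.hom (comp φ i)) (x := pt s c) p g

theorem j_compApp {i : ι} (s : V ⟶ X i) {a : V ⟶ U} (h : s ≫ f i = a) {c : Sec H V × Sec K V}
    (p : E.data.tor.carrier (pt a c)) :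
    F.data.tor.j (compApp φ s h p) = E.data.tor.j p := by
  subst h
  rw [compApp_rfl]
  exact Torsor.Hom.j_app (Biext.Hom.hom (comp φ i)) (x := pt s c) p

theorem compApp_secLaw₁ {i : ι} (s : V ⟶ X i) {a : V ⟶ U} (h : s ≫ f i = a)
    {c₁ c₂ c₃ : Sec H V × Sec K V} (m : BaseMul₁ (pt a c₁) (pt a c₂) (pt a c₃))
    (p : E.data.tor.carrier (pt a c₁)) (q : E.data.tor.carrier (pt a c₂)) :
    compApp φ s h (E.secLaw₁.mul m p q) =
      F.secLaw₁.mul m (compApp φ s h p) (compApp φ s h q) := by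
  subst h
  rw [compApp_rfl, compApp_rfl, compApp_rfl]
  have n : BaseMul₁ (pt s c₁) (pt s c₂) (pt s c₃) := ⟨rfl, rfl, m.h, m.k, m.k'⟩
  exact (congrArg (Torsor.Hom.app (Biext.Hom.hom (comp φ i)) (x := pt s c₃))
    (Biext.baseChange_secLaw₁ (yoneda.map (f i)) E n p q).symm).trans
    ((Biext.app_secLaw₁ (comp φ i).isHom n p q).trans
      (Biext.baseChange_secLaw₁ (yoneda.map (f i)) F n _ _))

theorem compApp_secLaw₂ {i : ι} (s : V ⟶ X i) {a : V ⟶ U} (h : s ≫ f i = a)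
    {c₁ c₂ c₃ : Sec H V × Sec K V} (m : BaseMul₂ (pt a c₁) (pt a c₂) (pt a c₃))
    (p : E.data.tor.carrier (pt a c₁)) (q : E.data.tor.carrier (pt a c₂)) :
    compApp φ s h (E.secLaw₂.mul m p q) =
      F.secLaw₂.mul m (compApp φ s h p) (compApp φ s h q) := by
  subst h
  rw [compApp_rfl, compApp_rfl, compApp_rfl]
  have n : BaseMul₂ (pt s c₁) (pt s c₂) (pt s c₃) := ⟨rfl, rfl, m.h, m.h', m.k⟩
  exact (congrArg (Torsor.Hom.app (Biext.Hom.hom (comp φ i)) (x := pt s c₃))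
    (Biext.baseChange_secLaw₂ (yoneda.map (f i)) E n p q).symm).trans
    ((Biext.app_secLaw₂ (comp φ i).isHom n p q).trans
      (Biext.baseChange_secLaw₂ (yoneda.map (f i)) F n _ _))

/-- The morphism over a covering sieve defined by a morphism of descent data. -/
noncomputable def sieveHom : (Biext.baseChange R.functorInclusion).obj E ⟶
    (Biext.baseChange R.functorInclusion).obj F :=
  show Biext.Hom _ _ from
  { hom := show Torsor.Hom _ _ from
      { app := fun {V x} p => compApp φ (c := x.2) (hf.sc x) (hf.sc_comp x) p
        app_res := fun g x y h p => by
          refine Eq.trans ?_ (res_compApp φ (hf.sc x) (hf.sc_comp x)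
            ((hf.comp_sc_comp h).trans (hf.sc_comp y)) rfl (coef_rs h) _ p).symm
          exact compApp_eq φ _ _ _ _ _
        app_act := fun p g => compApp_act φ _ _ p g
        j_app := fun p => j_compApp φ _ _ p }
    isHom := Biext.isHom_of_sec
      (fun {V x y z} m p q => by
        obtain ⟨s, c₁⟩ := x
        obtain ⟨s₂, c₂⟩ := y
        obtain ⟨s₃, c₃⟩ := z
        obtain rfl : s₂ = s := m.s
        obtain rfl : s₃ = s₂ := m.s'
        refine (congrArg (compApp φ (c := c₃) _ (hf.sc_comp _))
          (Biext.baseChange_secLaw₁ R.functorInclusion E m p q)).trans ?_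
        refine (compApp_secLaw₁ φ _ _ _ _ _).trans ?_
        refine Eq.trans ?_ (Biext.baseChange_secLaw₁ R.functorInclusion F m _ _).symm
        exact congrArg₂ (F.secLaw₁.mul _) (compApp_eq φ _ _ _ (hf.sc_comp _) _)
          (compApp_eq φ _ _ _ (hf.sc_comp _) _))
      (fun {V x y z} m p q => by
        obtain ⟨s, c₁⟩ := x
        obtain ⟨s₂, c₂⟩ := y
        obtain ⟨s₃, c₃⟩ := z
        obtain rfl : s₂ = s := m.s
        obtain rfl : s₃ = s₂ := m.s'
        refine (congrArg (compApp φ (c := c₃) _ (hf.sc_comp _))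
          (Biext.baseChange_secLaw₂ R.functorInclusion E m p q)).trans ?_
        refine (compApp_secLaw₂ φ _ _ _ _ _).trans ?_
        refine Eq.trans ?_ (Biext.baseChange_secLaw₂ R.functorInclusion F m _ _).symm
        exact congrArg₂ (F.secLaw₂.mul _) (compApp_eq φ _ _ _ (hf.sc_comp _) _)
          (compApp_eq φ _ _ _ (hf.sc_comp _) _)) }

end

theorem toDescentData_full (hf : Generates R f) (hR : R ∈ J U) :
    ((biextStack M H K).toPseudofunctor'.toDescentData f).Full where
  map_surjective {E F} φ := by
    obtain ⟨χ, hχ⟩ := (isDense_functorInclusion hR).baseChange_full.map_surjective (sieveHom hf φ)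
    refine ⟨χ, DescentData.hom_ext fun i => Biext.Hom.ext (Torsor.hom_ext fun {V x} p => ?_)⟩
    obtain ⟨s, c⟩ := x
    refine (congrArg (fun ψ : (Biext.baseChange R.functorInclusion).obj E ⟶
      (Biext.baseChange R.functorInclusion).obj F => Torsor.Hom.app (Biext.Hom.hom ψ)
        (x := sievePt hf i s c) p) hχ).trans ?_
    exact (compApp_eq φ _ s (sc_sievePt hf i s c) rfl _).trans (compApp_rfl φ s p)

theorem toDescentData_faithful (hf : Generates R f) (hR : R ∈ J U) :
    ((biextStack M H K).toPseudofunctor'.toDescentData f).Faithful where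
  map_injective {E F χ χ'} h := by
    refine (isDense_functorInclusion hR).baseChange_faithful.map_injective
      (Biext.Hom.ext (Torsor.hom_ext fun {V x} p => ?_))
    obtain ⟨⟨a, ha⟩, c⟩ := x
    obtain ⟨i, s, rfl⟩ := hf.factors a ha
    exact congrArg (fun ψ => Torsor.Hom.app (Biext.Hom.hom (comp ψ i)) (x := pt s c) p) h

end Descent

theorem biextStack_isStack (M : BraidedCrossedModule J) (H K : Sheaf J GrpCat.{u}) :
    (biextStack M H K).toPseudofunctor'.IsStack J :=
  .of_isStackFor fun U R hR => by
    have hf : Descent.Generates R (fun i : R.arrows.category => i.obj.hom) :=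
      ⟨fun i => i.property, fun {V} a ha => ⟨⟨Over.mk a, ha⟩, 𝟙 V, Category.id_comp a⟩⟩
    exact ⟨{ faithful := Descent.toDescentData_faithful hf hR
             full := Descent.toDescentData_full hf hR
             essSurj := Descent.toDescentData_essSurj hf hR }⟩

end
end Biext4

namespace Biext4
namespace StackTransfer
universe v w v' t
variable {C : Type w} [Category.{v} C] {Ψ Φ : Cᵒᵖ ⥤ Cat.{v', t}}
open Pseudofunctor Pseudofunctor.LocallyDiscreteOpToCat

section
variable (Ψ)

/-- The restriction functors of a presheaf of categories. -/
abbrev pb {X Y : C} (f : Y ⟶ X) : Ψ.obj (op X) ⥤ Ψ.obj (op Y) := (Ψ.map f.op).toFunctor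

theorem pb_obj_comp {X Y Y' : C} {f : Y ⟶ X} {g : Y' ⟶ Y} {k : Y' ⟶ X} (h : g ≫ f = k)
    (A : Ψ.obj (op X)) : (pb Ψ k).obj A = (pb Ψ g).obj ((pb Ψ f).obj A) := by
  subst h
  exact congrArg (fun F : Ψ.obj (op X) ⟶ Ψ.obj (op Y') => F.toFunctor.obj A)
    (Ψ.map_comp f.op g.op)

end

variable (α : Ψ ⟶ Φ)

/-- The components of a morphism of presheaves of categories. -/
abbrev fn (X : C) : Ψ.obj (op X) ⥤ Φ.obj (op X) := (α.app (op X)).toFunctor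

/-- A morphism of presheaves of categories commutes with restriction. -/
def nat {X Y : C} (f : Y ⟶ X) (A : Ψ.obj (op X)) :
    (fn α Y).obj ((pb Ψ f).obj A) ≅ (pb Φ f).obj ((fn α X).obj A) :=
  eqToIso (congrArg (fun F : Ψ.obj (op X) ⟶ Φ.obj (op Y) => F.toFunctor.obj A)
    (α.naturality f.op))

theorem fn_map_pb_map {X Y : C} (f : Y ⟶ X) {A B : Ψ.obj (op X)} (φ : A ⟶ B) :
    (fn α Y).map ((pb Ψ f).map φ) =
      (nat α f A).hom ≫ (pb Φ f).map ((fn α X).map φ) ≫ (nat α f B).inv :=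
  Functor.congr_hom (congrArg Cat.Hom.toFunctor (α.naturality f.op)) φ

theorem fn_map_pullHom {X₁ X₂ Y Y' : C} {A₁ : Ψ.obj (op X₁)} {A₂ : Ψ.obj (op X₂)} {f₁ : Y ⟶ X₁}
    {f₂ : Y ⟶ X₂} (φ : (pb Ψ f₁).obj A₁ ⟶ (pb Ψ f₂).obj A₂) (g : Y' ⟶ Y) (gf₁ : Y' ⟶ X₁)
    (gf₂ : Y' ⟶ X₂) (h₁ : g ≫ f₁ = gf₁) (h₂ : g ≫ f₂ = gf₂) :
    (fn α Y').map (pullHom (F := Ψ.toPseudofunctor') (M₁ := A₁) (M₂ := A₂) φ g gf₁ gf₂ h₁ h₂) =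
      (nat α gf₁ A₁).hom ≫ pullHom (F := Φ.toPseudofunctor') (M₁ := (fn α X₁).obj A₁)
        (M₂ := (fn α X₂).obj A₂) ((nat α f₁ A₁).inv ≫ (fn α Y).map φ ≫ (nat α f₂ A₂).hom) g gf₁ gf₂
        h₁ h₂ ≫ (nat α gf₂ A₂).inv := by
  refine (congrArg (fn α Y').map (pullHom_toPseudofunctor' Ψ φ g gf₁ gf₂ h₁ h₂ (pb_obj_comp Ψ h₁ A₁)
    (pb_obj_comp Ψ h₂ A₂).symm)).trans ?_
  refine Eq.trans ?_ (congrArg (fun χ => (nat α gf₁ A₁).hom ≫ χ ≫ (nat α gf₂ A₂).inv)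
    (pullHom_toPseudofunctor' Φ ((nat α f₁ A₁).inv ≫ (fn α Y).map φ ≫ (nat α f₂ A₂).hom) g gf₁ gf₂
      h₁ h₂ (pb_obj_comp Φ h₁ _) (pb_obj_comp Φ h₂ _).symm).symm)
  refine ((fn α Y').map_comp _ _).trans ?_
  refine (congrArg₂ (· ≫ ·) (eqToHom_map (fn α Y') _) (((fn α Y').map_comp _ _).trans
    (congrArg₂ (· ≫ ·) (fn_map_pb_map α g φ) (eqToHom_map (fn α Y') _)))).trans ?_
  simp only [nat, eqToIso.hom, eqToIso.inv, Functor.map_comp, eqToHom_map, Category.assoc,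
    eqToHom_trans, eqToHom_trans_assoc]
  rfl

variable {ι : Type*} {U : C} {X : ι → C} {f : ∀ i, X i ⟶ U}

section
variable (f) (A : Ψ.obj (op U)) {Y : C} (q : Y ⟶ U) {i j : ι} (a : Y ⟶ X i) (b : Y ⟶ X j)
    (ha : a ≫ f i = q) (hb : b ≫ f j = q)

/-- The isomorphisms of the descent datum defined by an object over `U`. -/
def ofObjHom : (pb Ψ a).obj ((pb Ψ (f i)).obj A) ⟶ (pb Ψ b).obj ((pb Ψ (f j)).obj A) :=
  (DescentData.ofObj (F := Ψ.toPseudofunctor') (f := f) A).hom q a b ha hb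

theorem fn_map_ofObjHom : (fn α Y).map (ofObjHom f A q a b ha hb) =
    (nat α a _).hom ≫ (pb Φ a).map (nat α (f i) A).hom ≫
      ofObjHom f ((fn α U).obj A) q a b ha hb ≫ (pb Φ b).map (nat α (f j) A).inv ≫
        (nat α b _).inv := by
  rw [ofObjHom, ofObjHom, ofObj_toPseudofunctor'_hom Ψ A q a b ha hb (pb_obj_comp Ψ ha A).symm
    (pb_obj_comp Ψ hb A), ofObj_toPseudofunctor'_hom Φ ((fn α U).obj A) q a b ha hb
    (pb_obj_comp Φ ha _).symm (pb_obj_comp Φ hb _)]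
  simp only [nat, eqToIso.hom, eqToIso.inv, eqToHom_map, eqToHom_trans]

end

/-- The components of a morphism between the descent data defined by two objects over `U`. -/
def compHom {A B : Ψ.obj (op U)} (φ : (Ψ.toPseudofunctor'.toDescentData f).obj A ⟶
    (Ψ.toPseudofunctor'.toDescentData f).obj B) (i : ι) :
    (pb Ψ (f i)).obj A ⟶ (pb Ψ (f i)).obj B := DescentData.Hom.hom φ i

theorem compHom_comm {A B : Ψ.obj (op U)} (φ : (Ψ.toPseudofunctor'.toDescentData f).obj A ⟶
    (Ψ.toPseudofunctor'.toDescentData f).obj B) {Y : C} (q : Y ⟶ U) {i j : ι} (a : Y ⟶ X i)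
    (b : Y ⟶ X j) (ha : a ≫ f i = q) (hb : b ≫ f j = q) :
    (pb Ψ a).map (compHom φ i) ≫ ofObjHom f B q a b ha hb =
      ofObjHom f A q a b ha hb ≫ (pb Ψ b).map (compHom φ j) :=
  DescentData.Hom.comm φ q a b ha hb

variable [hα : ∀ X : C, (fn α X).IsEquivalence]

theorem toDescentData_full [hF : (Ψ.toPseudofunctor'.toDescentData f).Full] :
    (fn α U ⋙ Φ.toPseudofunctor'.toDescentData f).Full where
  map_surjective {E F} φ := by
    let ψ (i : ι) : (pb Ψ (f i)).obj E ⟶ (pb Ψ (f i)).obj F :=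
      (fn α (X i)).preimage ((nat α (f i) E).hom ≫ compHom φ i ≫ (nat α (f i) F).inv)
    have hψ : ∀ i, (fn α (X i)).map (ψ i) =
        (nat α (f i) E).hom ≫ compHom φ i ≫ (nat α (f i) F).inv := fun i =>
      (fn α (X i)).map_preimage _
    have hc : ∀ ⦃Y : C⦄ (q : Y ⟶ U) ⦃i j : ι⦄ (a : Y ⟶ X i) (b : Y ⟶ X j) (ha : a ≫ f i = q)
        (hb : b ≫ f j = q), (pb Ψ a).map (ψ i) ≫ ofObjHom f F q a b ha hb =
          ofObjHom f E q a b ha hb ≫ (pb Ψ b).map (ψ j) := by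
      intro Y q i j a b ha hb
      refine (fn α Y).map_injective ?_
      have h := compHom_comm φ q a b ha hb
      rw [Functor.map_comp, Functor.map_comp, fn_map_ofObjHom, fn_map_ofObjHom, fn_map_pb_map,
        fn_map_pb_map, hψ, hψ]
      simp only [Functor.map_comp, Category.assoc, Iso.inv_hom_id_assoc, Iso.map_inv_hom_id_assoc]
      rw [reassoc_of% h]
    obtain ⟨χ, hχ⟩ := hF.map_surjective (X := E) (Y := F) ⟨ψ, hc⟩
    refine ⟨χ, DescentData.hom_ext fun i => ?_⟩
    have h : (pb Ψ (f i)).map χ = ψ i := congrArg (fun θ => DescentData.Hom.hom θ i) hχ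
    have h' := (fn_map_pb_map α (f i) χ).symm.trans ((congrArg (fn α (X i)).map h).trans (hψ i))
    exact (Iso.cancel_iso_inv_right _ _ _).1 ((Iso.cancel_iso_hom_left _ _ _).1 h')

theorem toDescentData_faithful [(Ψ.toPseudofunctor'.toDescentData f).Faithful] :
    (fn α U ⋙ Φ.toPseudofunctor'.toDescentData f).Faithful where
  map_injective {E F χ χ'} h := by
    refine (Ψ.toPseudofunctor'.toDescentData f).map_injective
      (DescentData.hom_ext fun i => (fn α (X i)).map_injective ?_)
    have h' : (pb Φ (f i)).map ((fn α U).map χ) = (pb Φ (f i)).map ((fn α U).map χ') :=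
      congrArg (fun θ => DescentData.Hom.hom θ i) h
    exact (fn_map_pb_map α (f i) χ).trans ((congrArg (fun θ => (nat α (f i) E).hom ≫ θ ≫ _) h').trans
      (fn_map_pb_map α (f i) χ').symm)

section
variable (D : Φ.toPseudofunctor'.DescentData f)

/-- The objects of a descent datum. -/
def obj (i : ι) : Φ.obj (op (X i)) := D.obj i

/-- The isomorphisms of a descent datum. -/
def hom {Y : C} (q : Y ⟶ U) {i j : ι} (a : Y ⟶ X i) (b : Y ⟶ X j) (ha : a ≫ f i = q)
    (hb : b ≫ f j = q) : (pb Φ a).obj (obj D i) ⟶ (pb Φ b).obj (obj D j) := D.hom q a b ha hb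

/-- Preimages of the objects of a descent datum. -/
noncomputable def preObj (i : ι) : Ψ.obj (op (X i)) := (fn α (X i)).objPreimage (obj D i)

/-- The image of `preObj α D i` is isomorphic to the given object. -/
noncomputable def preIso (i : ι) : (fn α (X i)).obj (preObj α D i) ≅ obj D i :=
  (fn α (X i)).objObjPreimageIso (obj D i)

variable {Y : C} (q : Y ⟶ U) {i j : ι} (a : Y ⟶ X i) (b : Y ⟶ X j) (ha : a ≫ f i = q)
  (hb : b ≫ f j = q)

/-- Preimages of the isomorphisms of a descent datum. -/
noncomputable def preHom : (pb Ψ a).obj (preObj α D i) ⟶ (pb Ψ b).obj (preObj α D j) :=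
  (fn α Y).preimage ((nat α a _).hom ≫ ((pb Φ a).map (preIso α D i).hom ≫ hom D q a b ha hb ≫
    (pb Φ b).map (preIso α D j).inv) ≫ (nat α b _).inv)

theorem fn_map_preHom : (fn α Y).map (preHom α D q a b ha hb) =
    (nat α a _).hom ≫ ((pb Φ a).map (preIso α D i).hom ≫ hom D q a b ha hb ≫
      (pb Φ b).map (preIso α D j).inv) ≫ (nat α b _).inv :=
  (fn α Y).map_preimage _

theorem nat_inv_fn_map_preHom_nat_hom :
    (nat α a _).inv ≫ (fn α Y).map (preHom α D q a b ha hb) ≫ (nat α b _).hom =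
      (pb Φ a).map (preIso α D i).hom ≫ hom D q a b ha hb ≫ (pb Φ b).map (preIso α D j).inv := by
  rw [fn_map_preHom]
  simp only [Category.assoc, Iso.inv_hom_id, Iso.inv_hom_id_assoc, Category.comp_id]

end

/-- A descent datum transported along an equivalence of presheaves of categories. -/
noncomputable def pre (D : Φ.toPseudofunctor'.DescentData f) :
    Ψ.toPseudofunctor'.DescentData f where
  obj i := preObj α D i
  hom Y q i j a b ha hb := preHom α D q a b ha hb
  pullHom_hom Y' Y g q q' hq i j a b ha hb ga gb hga hgb := by
    refine (fn α Y').map_injective ?_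
    refine (fn_map_pullHom α (preHom α D q a b ha hb) g ga gb hga hgb).trans ?_
    refine Eq.trans ?_ (fn_map_preHom α D q' ga gb _ _).symm
    refine congrArg (fun φ => (nat α ga (preObj α D i)).hom ≫ φ ≫ (nat α gb (preObj α D j)).inv) ?_
    refine (congrArg (fun φ => pullHom (F := Φ.toPseudofunctor')
      (M₁ := (fn α (X i)).obj (preObj α D i)) (M₂ := (fn α (X j)).obj (preObj α D j)) φ g ga gb
        hga hgb) (nat_inv_fn_map_preHom_nat_hom α D q a b ha hb)).trans ?_
    refine (pullHom_comp_comp (F := Φ.toPseudofunctor') (preIso α D i).hom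
      (preIso α D j).inv (hom D q a b ha hb) g ga gb hga hgb).trans ?_
    exact congrArg (fun φ => (pb Φ ga).map (preIso α D i).hom ≫ φ ≫
        (pb Φ gb).map (preIso α D j).inv)
      (D.pullHom_hom g q q' hq a b ha hb ga gb hga hgb)
  hom_self Y q i a ha := by
    refine (fn α Y).map_injective ((fn_map_preHom α D q a a ha ha).trans ?_)
    have h : hom D q a a ha ha = 𝟙 _ := D.hom_self q a ha
    rw [h, Category.id_comp, ← Functor.map_comp, Iso.hom_inv_id, CategoryTheory.Functor.map_id,
      Category.id_comp, Iso.hom_inv_id]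
    exact ((fn α Y).map_id ((pb Ψ a).obj (preObj α D i))).symm
  hom_comp Y q i j k a b c ha hb hc := by
    refine (fn α Y).map_injective (((fn α Y).map_comp _ _).trans ?_)
    refine (congrArg₂ (· ≫ ·) (fn_map_preHom α D q a b ha hb)
      (fn_map_preHom α D q b c hb hc)).trans ?_
    refine Eq.trans ?_ (fn_map_preHom α D q a c ha hc).symm
    have h : hom D q a b ha hb ≫ hom D q b c hb hc = hom D q a c ha hc :=
      D.hom_comp q a b c ha hb hc
    rw [← h]
    simp only [Category.assoc, Iso.inv_hom_id_assoc, Iso.map_inv_hom_id_assoc]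

theorem toDescentData_essSurj [(Ψ.toPseudofunctor'.toDescentData f).EssSurj] :
    (fn α U ⋙ Φ.toPseudofunctor'.toDescentData f).EssSurj where
  mem_essImage D := by
    obtain ⟨(E : Ψ.obj (op U)), ⟨θ⟩⟩ := Functor.EssSurj.mem_essImage
      (F := Ψ.toPseudofunctor'.toDescentData f) (pre α D)
    let β (i : ι) : (pb Ψ (f i)).obj E ≅ preObj α D i :=
      ⟨θ.hom.hom i, θ.inv.hom i, congrArg (fun χ => DescentData.Hom.hom χ i) θ.hom_inv_id,
        congrArg (fun χ => DescentData.Hom.hom χ i) θ.inv_hom_id⟩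
    let δ (i : ι) : (pb Φ (f i)).obj ((fn α U).obj E) ≅ obj D i :=
      (nat α (f i) E).symm ≪≫ (fn α (X i)).mapIso (β i) ≪≫ preIso α D i
    refine ⟨E, ⟨DescentData.isoMk δ ?_⟩⟩
    intro Y q i j a b ha hb
    have h : (pb Ψ a).map (β i).hom ≫ preHom α D q a b ha hb =
        ofObjHom f E q a b ha hb ≫ (pb Ψ b).map (β j).hom := θ.hom.comm q a b ha hb
    have h' := congrArg (fn α Y).map h
    rw [Functor.map_comp, Functor.map_comp, fn_map_preHom, fn_map_ofObjHom, fn_map_pb_map,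
      fn_map_pb_map] at h'
    simp only [Category.assoc, Iso.inv_hom_id_assoc] at h'
    have h'' : (pb Φ a).map (δ i).hom ≫ hom D q a b ha hb =
        ofObjHom f ((fn α U).obj E) q a b ha hb ≫ (pb Φ b).map (δ j).hom := by
      rw [Iso.cancel_iso_hom_left] at h'
      simp only [← Category.assoc] at h'
      rw [Iso.cancel_iso_inv_right] at h'
      simp only [δ, Iso.trans_hom, Iso.symm_hom, Functor.mapIso_hom, Functor.map_comp]
      rw [← cancel_mono ((pb Φ b).map (preIso α D j).inv),
        ← cancel_epi ((pb Φ a).map (nat α (f i) E).hom)]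
      simp only [Category.assoc, Iso.map_hom_inv_id, Category.comp_id, Iso.map_hom_inv_id_assoc] at h' ⊢
      exact h'
    exact h''

theorem toDescentData_isEquivalence (α : Ψ ⟶ Φ) [∀ X : C, (fn α X).IsEquivalence]
    [(Ψ.toPseudofunctor'.toDescentData f).IsEquivalence] :
    (Φ.toPseudofunctor'.toDescentData f).IsEquivalence :=
  have : (fn α U ⋙ Φ.toPseudofunctor'.toDescentData f).IsEquivalence :=
    { faithful := toDescentData_faithful α
      full := toDescentData_full α
      essSurj := toDescentData_essSurj α }
  Functor.isEquivalence_of_comp_left (fn α U) _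

theorem isStack (α : Ψ ⟶ Φ) [∀ X : C, (fn α X).IsEquivalence] {J : GrothendieckTopology C}
    (h : Ψ.toPseudofunctor'.IsStack J) : Φ.toPseudofunctor'.IsStack J :=
  .of_isStackFor fun _ R hR => by
    have := (Ψ.toPseudofunctor'.isStackFor' R hR).isEquivalence
    exact ⟨toDescentData_isEquivalence α⟩

end StackTransfer

section
variable {C : Type u} [SmallCategory C] {J : GrothendieckTopology C}

theorem biaddStack_isStack (M : BraidedCrossedModule J) (H K : Sheaf J GrpCat.{u}) :
    (biaddStack M H K).toPseudofunctor'.IsStack J :=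
  have (X : C) : (StackTransfer.fn (uStack M H K) X).IsEquivalence :=
    Biext.u_isEquivalence
  StackTransfer.isStack (uStack M H K) (biextStack_isStack M H K)

end
end Biext4

theorem proposition4 {C : Type u} [SmallCategory C] (J : GrothendieckTopology C)
    (M : BraidedCrossedModule J) :
    -- the crossed module is symmetric iff the stack of its torsors is
    (M.IsSymmetric ↔ ∀ (U : C) (P Q : Biext4.Torsor M (yoneda.obj U)),
      (β_ P Q).hom ≫ (β_ Q P).hom = 𝟙 (P ⊗ Q)) ∧
    -- for two given biextensions, which instances of symmetry are equivalent to `E ∧ F` being one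
    (∀ (H K : Sheaf J GrpCat.{u}) (S : Cᵒᵖ ⥤ Type u) (E F : Biext M H K S),
      (E.data.prod F.data).IsBiext ↔ ∀ (U : C) (x y : Pt S H K U), x.s = y.s →
        (β_ (fib E.data.tor x) (fib F.data.tor y)).hom ≫
          (β_ (fib F.data.tor y) (fib E.data.tor x)).hom =
            𝟙 (fib E.data.tor x ⊗ fib F.data.tor y)) ∧
    -- contracted products of biextensions are biextensions iff the braiding is symmetric
    ((∀ (H K : Sheaf J GrpCat.{u}) (E F : Biext M H K (final C)), (E.data.prod F.data).IsBiext) ↔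
      M.IsSymmetric) ∧
    -- biextensions form a symmetric group-like groupoid, resp. stack, iff the braiding is symmetric
    ((∀ H K : Sheaf J GrpCat.{u}, ∃ s : SymGr (Biext M H K (final C)), Nonempty (IsContracted s)) ↔
      M.IsSymmetric) ∧
    ((∀ H K : Sheaf J GrpCat.{u}, Nonempty (ContractedStack M H K)) ↔ M.IsSymmetric) ∧
    -- the same for biadditive morphisms
    ((∀ H K : Sheaf J GrpCat.{u}, ∃ t : SymGr (Biadd M H K (final C)), Nonempty (IsPointwise t)) ↔
      M.IsSymmetric) ∧
    ((∀ H K : Sheaf J GrpCat.{u}, Nonempty (PointwiseStack M H K)) ↔ M.IsSymmetric) ∧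
    -- `u` is then an equivalence of symmetric group-like groupoids, resp. stacks
    (M.IsSymmetric → ∀ H K : Sheaf J GrpCat.{u},
      (∃ (s : SymGr (Biext M H K (final C))) (t : SymGr (Biadd M H K (final C)))
        (c : IsContracted s) (p : IsPointwise t) (b : s.Fun t.toBrStr (Biext.u M H K (final C))),
        IsCanonical c p b ∧ (Biext.u M H K (final C)).IsEquivalence) ∧
      ∃ (s : ContractedStack M H K) (t : PointwiseStack M H K)
        (e : s.toSymGrStack.Equivalence t.toSymGrStack (uStack M H K)),
        ∀ U : C, IsCanonical (s.contracted U) (t.pointwise U) (e.braided (op U))) :=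
  ⟨Torsor.isSymmetric_iff M, fun _ _ _ E F => Biext.prod_isBiext_iff E F, isSymmetric_iff_prod_isBiext M,
    ⟨fun h => by
        obtain ⟨s, ⟨c⟩⟩ := h M.Pi (Cochain.sheaf M)
        exact isSymmetric_of_evalBiext_final (c.prod_isBiext _ _),
      fun hM H K => by
        have := Fact.mk hM
        exact ⟨biextSymGr M H K (final C), ⟨biextIsContracted M H K (final C)⟩⟩⟩,
    ⟨fun h => by
        obtain ⟨t⟩ := h M.Pi (Cochain.sheaf M)
        exact isSymmetric_of_evalBiext_yoneda fun U => (t.contracted U).prod_isBiext _ _,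
      fun hM H K => by
        have := Fact.mk hM
        exact ⟨contractedStack M H K (biextStack_isStack M H K)⟩⟩,
    ⟨fun h => by
        obtain ⟨s, ⟨c⟩⟩ := h M.Pi (Cochain.sheaf M)
        exact isSymmetric_of_evalBiext_final (c.prod_isBiext _ _),
      fun hM H K => by
        have := Fact.mk hM
        exact ⟨biaddSymGr M H K (final C), ⟨biaddIsPointwise M H K (final C)⟩⟩⟩,
    ⟨fun h => by
        obtain ⟨t⟩ := h M.Pi (Cochain.sheaf M)
        exact isSymmetric_of_evalBiext_yoneda fun U => (t.pointwise U).prod_isBiext _ _,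
      fun hM H K => by
        have := Fact.mk hM
        exact ⟨pointwiseStack M H K (biaddStack_isStack M H K)⟩⟩,
    fun hM H K => by
      have := Fact.mk hM
      exact ⟨⟨biextSymGr M H K (final C), biaddSymGr M H K (final C),
          biextIsContracted M H K (final C), biaddIsPointwise M H K (final C),
          uFun M H K (final C), uFun_isCanonical M H K (final C), inferInstance⟩,
        contractedStack M H K (biextStack_isStack M H K),
        pointwiseStack M H K (biaddStack_isStack M H K),
        uStackEquivalence M H K (biextStack_isStack M H K) (biaddStack_isStack M H K),
        fun U => uFun_isCanonical M H K (yoneda.obj U)⟩⟩
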